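/- **Setting.** Let $P$ be a finite set of processes, $\Sigma$ a finite set of messages and $C=\{pq : p\ne q\in P\}$ the set of channels. Actions are sends $pq!m$ (active process $p$), receives $pq?m$ (active process $q$) and internal actions (of one process). A FIFO system $S$ consists of a finite automaton (states, initial state, transitions labelled by actions) for each process; its size $n$ is the sum over all processes of the number of states plus the number of transitions. Fix a non-empty set $F$ of failures among lossiness, corruption and out-of-order, and let $\succeq$ be the least preorder on $\Sigma^*$ that is compatible with concatenation and contains, for all $a,b\in\Sigma$: $a\succeq\varepsilon$ if $F$ contains lossiness, $a\succeq b$ if $F$ contains corruption, $ab\succeq ba$ if $F$ contains out-of-order. A configuration is a global state with a word $w_c$ for each channel $c$. Firing a transition of the active process with label $c!m$ (resp. $c?m$, resp. internal) changes only the state of that process, and turns the channel contents $w$ into any $w'$ such that $w_d\succeq w'_d$ for every channel $d$, except that for $d=c$ the requirement is $w_c\cdot m\succeq w'_c$ (resp. $w_c\succeq m\cdot w'_c$). The executions of $S$ under $F$ are the words $e=a_1\cdots a_k$ of actions that can be fired from the initial states with empty channels. For a word $e$ of actions, an *$i$-matching pair* is a set $\{j,j'\}$ with $j<j'$, $a_j=pq!m$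 and $a_{j'}=pq?m'$ for some channel $pq$; the messages $m,m'$ may differ, and so may the rank of $a_j$ among the sends and that of $a_{j'}$ among the receives of the channel. A *valid communication* of $e$ is a set $\mathcal M$ of $i$-matching pairs, singletons $\{j\}$ with $a_j$ a send, and singletons $\{j\}$ with $a_j$ internal, such that every position of $e$ lies in exactly one member. The *conflict graph* of $(e,\mathcal M)$ has vertex set $\mathcal M$ and an edge $X\to Y$ whenever there are $j\in X$, $j'\in Y$ with $j<j'$ such that $a_j,a_{j'}$ have the same active process or $\{j,j'\}\in\mathcal M$. The pair $(e,\mathcal M)$ is an *$i$-RSC execution* if every matching pair in $\mathcal M$ has the form $\{j,j+1\}$. The system $S$ is *$i$-RSC* (under $F$) if for every execution $e$ of $S$ under $F$ and every valid communication $\mathcal M$ of $e$, the conflict graph of $(e,\mathcal M)$ is isomorphic to that of some $i$-RSC execution $(e',\mathcal M')$, where $e'$ is an arbitrary word of actions and $\mathcal M'$ a valid communication of $e'$. **Theorem.** For every non-empty $F\subseteq\{\text{lossiness},\text{corruption},\text{out-of-order}\}$ it is decidable whether a given FIFO system $S$ is $i$-RSC under $F$. More precisely, there is an algorithm (a random access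 machine program with unit-cost addition and subtraction, the same for all $P$, $\Sigma$ and $S$) that decides this question, and whenever $|P|\ge 2$ and $\Sigma\neq\emptyset$ it does so in time $$O\bigl(n^{|P|+2}\,|C|^5\cdot 2^{|C|}\cdot|\Sigma|^2\bigr),$$ with an implied constant that does not depend on $P$, $\Sigma$ or $S$. -/

import Mathlib

/-! ### Actions and FIFO systems -/

/-- Peer-to-peer channels: ordered pairs of distinct processes (sender, receiver). -/
abbrev Channel (P : Type) : Type := {c : P × P // c.1 ≠ c.2}

/-- Actions over processes `P` and messages `M`: sending on a channel, receiving from a channel,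
and internal actions of a process (named by natural numbers). -/
inductive Act (P M : Type) : Type where
  | send (c : Channel P) (m : M)
  | recv (c : Channel P) (m : M)
  | internal (p : P) (x : ℕ)

/-- The active process of an action. -/
def Act.proc {P M : Type} : Act P M → P
  | .send c _ => c.1.1
  | .recv c _ => c.1.2
  | .internal p _ => p

/-- A FIFO system: for each process a finite automaton (control states `Fin (numStates p)`,
an initial control state, a finite transition relation labelled by actions; no final states). -/
structure FIFOSystem (P M : Type) where
  numStates : P → ℕ
  init : ∀ p, Fin (numStates p)
  trans : ∀ p, Finset (Fin (numStates p) × Act P M × Fin (numStates p))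

/-- The size of a system: the sum over all processes of number of states plus number of
transitions. -/
def FIFOSystem.size {P M : Type} [Fintype P] (S : FIFOSystem P M) : ℕ :=
  ∑ p, (S.numStates p + (S.trans p).card)

/-! ### Interference -/

/-- An interference model: `rel w w'` says that channel content `w` may evolve into `w'`. -/
structure InterferenceModel (M : Type) where
  rel : List M → List M → Prop
  refl : ∀ w, rel w w
  trans : ∀ {w w' w''}, rel w w' → rel w' w'' → rel w w''
  additive : ∀ {w₁ w₁' w₂ w₂'}, rel w₁ w₁' → rel w₂ w₂' → rel (w₁ ++ w₂) (w₁' ++ w₂')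
  integrity : ∀ {w}, rel [] w → w = []
  nonexpansion : ∀ {w w'}, rel w w' → w'.length ≤ w.length

/-- The three kinds of failures. -/
inductive Failure : Type where
  | lossiness
  | corruption
  | outOfOrder

/-- The least preorder on words that is compatible with concatenation and contains the axioms
of the failures in `F`. -/
inductive Interferes {M : Type} (F : Set Failure) : List M → List M → Prop
  | refl (w : List M) : Interferes F w w
  | trans {w w' w'' : List M} : Interferes F w w' → Interferes F w' w'' → Interferes F w w''
  | append {w₁ w₁' w₂ w₂' : List M} : Interferes F w₁ w₁' → Interferes F w₂ w₂' →
      Interferes F (w₁ ++ w₂) (w₁' ++ w₂')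
  | lose (h : Failure.lossiness ∈ F) (a : M) : Interferes F [a] []
  | corrupt (h : Failure.corruption ∈ F) (a b : M) : Interferes F [a] [b]
  | swap (h : Failure.outOfOrder ∈ F) (a b : M) : Interferes F [a, b] [b, a]

theorem Interferes.length_le {M : Type} {F : Set Failure} {w w' : List M}
    (h : Interferes F w w') : w'.length ≤ w.length := by
  induction h with
  | refl => exact le_rfl
  | trans _ _ h₁ h₂ => exact h₂.trans h₁
  | append _ _ h₁ h₂ => simpa using Nat.add_le_add h₁ h₂
  | lose => simp
  | corrupt => simp
  | swap => simp

/-- The interference model generated by a set of failures. -/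
def failureModel (M : Type) (F : Set Failure) : InterferenceModel M where
  rel := Interferes F
  refl := Interferes.refl
  trans := Interferes.trans
  additive := Interferes.append
  integrity := fun h => List.length_eq_zero_iff.mp (Nat.le_zero.mp h.length_le)
  nonexpansion := Interferes.length_le

/-! ### Semantics -/

/-- Configurations: a global state and a content for each channel. -/
structure Config {P M : Type} (S : FIFOSystem P M) where
  state : ∀ p, Fin (S.numStates p)
  chan : Channel P → List M

/-- The initial configuration: initial control states, empty channels. -/
def FIFOSystem.initConfig {P M : Type} (S : FIFOSystem P M) : Config S where
  state := S.init
  chan := fun _ => []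

/-- Successor configurations under interference.  Only the active process of the action moves;
the content of every channel may suffer interference. -/
inductive Step {P M : Type} (I : InterferenceModel M) (S : FIFOSystem P M) :
    Config S → Act P M → Config S → Prop
  | send {γ γ' : Config S} (c : Channel P) (m : M)
      (htrans : (γ.state c.1.1, Act.send c m, γ'.state c.1.1) ∈ S.trans c.1.1)
      (hstate : ∀ r, r ≠ c.1.1 → γ'.state r = γ.state r)
      (hchan : I.rel (γ.chan c ++ [m]) (γ'.chan c))
      (hother : ∀ d, d ≠ c → I.rel (γ.chan d) (γ'.chan d)) :
      Step I S γ (Act.send c m) γ'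
  | recv {γ γ' : Config S} (c : Channel P) (m : M)
      (htrans : (γ.state c.1.2, Act.recv c m, γ'.state c.1.2) ∈ S.trans c.1.2)
      (hstate : ∀ r, r ≠ c.1.2 → γ'.state r = γ.state r)
      (hchan : I.rel (γ.chan c) (m :: γ'.chan c))
      (hother : ∀ d, d ≠ c → I.rel (γ.chan d) (γ'.chan d)) :
      Step I S γ (Act.recv c m) γ'
  | internal {γ γ' : Config S} (p : P) (x : ℕ)
      (htrans : (γ.state p, Act.internal p x, γ'.state p) ∈ S.trans p)
      (hstate : ∀ r, r ≠ p → γ'.state r = γ.state r)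
      (hchan : ∀ d, I.rel (γ.chan d) (γ'.chan d)) :
      Step I S γ (Act.internal p x) γ'

/-- Firing a finite sequence of actions. -/
inductive Steps {P M : Type} (I : InterferenceModel M) (S : FIFOSystem P M) :
    Config S → List (Act P M) → Config S → Prop
  | nil (γ : Config S) : Steps I S γ [] γ
  | cons {γ γ' γ'' : Config S} {a : Act P M} {e : List (Act P M)} :
      Step I S γ a γ' → Steps I S γ' e γ'' → Steps I S γ (a :: e) γ''

/-- The executions of a system under interference. -/
def IsExecutionOf {P M : Type} (I : InterferenceModel M) (S : FIFOSystem P M)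
    (e : List (Act P M)) : Prop :=
  ∃ γ, Steps I S S.initConfig e γ

/-! ### Communications and conflict graphs.  Positions in a word are counted from 0. -/

/-- Matching pairs with interference: a send and a later receive on the same channel.
The two messages, and the ranks of the send among the sends and of the receive among the
receives of the channel, are unconstrained. -/
def IsMatchingPair {P M : Type} (e : List (Act P M)) (X : Finset ℕ) : Prop :=
  ∃ (c : Channel P) (m m' : M) (j j' : ℕ), j < j' ∧
    e[j]? = some (Act.send c m) ∧ e[j']? = some (Act.recv c m') ∧ X = {j, j'}

/-- Interactions: matching pairs, single (unmatched) sends, and single internal actions. -/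
def IsInteraction {P M : Type} (e : List (Act P M)) (X : Finset ℕ) : Prop :=
  IsMatchingPair e X ∨
  (∃ (j : ℕ) (c : Channel P) (m : M), e[j]? = some (Act.send c m) ∧ X = {j}) ∨
  (∃ (j : ℕ) (p : P) (x : ℕ), e[j]? = some (Act.internal p x) ∧ X = {j})

/-- Valid communications of `e`: sets of interactions such that every position of `e` lies in
exactly one of them (so a singleton send is one that is in no matching pair of the set). -/
def IsValidComm {P M : Type} (e : List (Act P M)) (C : Set (Finset ℕ)) : Prop :=
  (∀ X ∈ C, IsInteraction e X) ∧ ∀ j < e.length, ∃! X, X ∈ C ∧ j ∈ X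

/-- `j` strictly precedes `j'` and the two actions do not commute: they have the same active
process or form a matching pair of the communication. -/
def Precedes {P M : Type} (e : List (Act P M)) (C : Set (Finset ℕ)) (j j' : ℕ) : Prop :=
  j < j' ∧ ∃ a a' : Act P M, e[j]? = some a ∧ e[j']? = some a' ∧
    ¬ (a.proc ≠ a'.proc ∧ ({j, j'} : Finset ℕ) ∉ C)

/-- The edge relation of the conflict graph, whose vertices are the interactions in `C`. -/
def ConflictEdge {P M : Type} (e : List (Act P M)) (C : Set (Finset ℕ)) (X Y : C) : Prop :=
  ∃ j ∈ X.1, ∃ j' ∈ Y.1, Precedes e C j j'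

/-- Causal equivalence: isomorphism of conflict graphs. -/
def CausallyEquivalent {P M : Type} (e : List (Act P M)) (C : Set (Finset ℕ))
    (e' : List (Act P M)) (C' : Set (Finset ℕ)) : Prop :=
  Nonempty (ConflictEdge e C ≃r ConflictEdge e' C')

/-- `i`-RSC executions: a word with a valid communication all of whose matching pairs are
adjacent. -/
def IsIRSCExecution {P M : Type} (e : List (Act P M)) (C : Set (Finset ℕ)) : Prop :=
  IsValidComm e C ∧ ∀ X ∈ C, IsMatchingPair e X → ∃ j, X = {j, j + 1}

/-- `i`-RSC systems: every execution with every valid communication is causally equivalent to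
an `i`-RSC execution. -/
def IsIRSC {P M : Type} (I : InterferenceModel M) (S : FIFOSystem P M) : Prop :=
  ∀ e, IsExecutionOf I S e → ∀ C, IsValidComm e C →
    ∃ e' C', IsIRSCExecution e' C' ∧ CausallyEquivalent e C e' C'

/-! ### Random access machines with unit costs, as structured programs -/

namespace RAM

/-- Expressions: constants, registers, indirect reads from an array, sum, truncated
difference. -/
inductive Term : Type where
  | lit (k : ℕ)
  | reg (x : ℕ)
  | read (a : ℕ) (i : Term)
  | add (s t : Term)
  | sub (s t : Term)

/-- Programs.  `cond` and `loop` test whether a value is nonzero. -/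
inductive Prog : Type where
  | skip
  | assign (x : ℕ) (t : Term)
  | write (a : ℕ) (i t : Term)
  | seq (c d : Prog)
  | cond (t : Term) (c d : Prog)
  | loop (t : Term) (c : Prog)

/-- Memory: registers and arrays, all cells hold natural numbers.  A program names its registers
and arrays statically, so it uses finitely many of them. -/
structure Memory where
  reg : ℕ → ℕ
  arr : ℕ → ℕ → ℕ

/-- The value of an expression. -/
def Term.eval (σ : Memory) : Term → ℕ
  | .lit k => k
  | .reg x => σ.reg x
  | .read a i => σ.arr a (i.eval σ)
  | .add s t => s.eval σ + t.eval σ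
  | .sub s t => s.eval σ - t.eval σ

/-- The cost of evaluating an expression: one step for each operation and operand. -/
def Term.cost : Term → ℕ
  | .lit _ => 1
  | .reg _ => 1
  | .read _ i => i.cost + 1
  | .add s t => s.cost + t.cost + 1
  | .sub s t => s.cost + t.cost + 1

/-- `Runs c σ t σ'`: started in memory `σ`, program `c` halts after exactly `t` steps in
memory `σ'`. -/
inductive Runs : Prog → Memory → ℕ → Memory → Prop
  | skip (σ : Memory) : Runs .skip σ 1 σ
  | assign (x : ℕ) (t : Term) (σ : Memory) :
      Runs (.assign x t) σ (t.cost + 1) { σ with reg := Function.update σ.reg x (t.eval σ) }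
  | write (a : ℕ) (i t : Term) (σ : Memory) :
      Runs (.write a i t) σ (i.cost + t.cost + 1)
        { σ with arr :=
            Function.update σ.arr a (Function.update (σ.arr a) (i.eval σ) (t.eval σ)) }
  | seq {c d : Prog} {σ σ' σ'' : Memory} {k l : ℕ} :
      Runs c σ k σ' → Runs d σ' l σ'' → Runs (.seq c d) σ (k + l) σ''
  | cond_true {t : Term} {c d : Prog} {σ σ' : Memory} {k : ℕ} :
      t.eval σ ≠ 0 → Runs c σ k σ' → Runs (.cond t c d) σ (t.cost + 1 + k) σ'
  | cond_false {t : Term} {c d : Prog} {σ σ' : Memory} {k : ℕ} :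
      t.eval σ = 0 → Runs d σ k σ' → Runs (.cond t c d) σ (t.cost + 1 + k) σ'
  | loop_done {t : Term} {c : Prog} {σ : Memory} :
      t.eval σ = 0 → Runs (.loop t c) σ (t.cost + 1) σ
  | loop_step {t : Term} {c : Prog} {σ σ' σ'' : Memory} {k l : ℕ} :
      t.eval σ ≠ 0 → Runs c σ k σ' → Runs (.loop t c) σ' l σ'' →
      Runs (.loop t c) σ (t.cost + 1 + k + l) σ''

/-- The start memory for an input word: array 0 holds the word, register 0 its length, every
other cell is 0. -/
def start (w : List ℕ) : Memory where
  reg := fun x => if x = 0 then w.length else 0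
  arr := fun a i => if a = 0 then w.getD i 0 else 0

end RAM

/-! ### Systems as inputs -/

/-- The code of an action: kind, sender, receiver, message (or kind, process, 0, name). -/
def Act.code {N s : ℕ} : Act (Fin N) (Fin s) → List ℕ
  | .send c m => [0, c.1.1, c.1.2, m]
  | .recv c m => [1, c.1.1, c.1.2, m]
  | .internal p x => [2, p, 0, x]

/-- The code of an automaton with `k` states, initial state `q₀` and list of transitions `L`. -/
def automatonCode {N s k : ℕ} (q₀ : Fin k)
    (L : List (Fin k × Act (Fin N) (Fin s) × Fin k)) : List ℕ :=
  [k, (q₀ : ℕ), L.length] ++ L.flatMap fun t => (t.1 : ℕ) :: (t.2.1.code ++ [(t.2.2 : ℕ)])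

/-- `w` encodes the system `S`: number of processes, number of messages, and the codes of the
automata in order, where the transitions of each automaton are listed without repetition in
some arbitrary order. -/
def FIFOSystem.IsEncodedBy {N s : ℕ} (S : FIFOSystem (Fin N) (Fin s)) (w : List ℕ) : Prop :=
  ∃ L : ∀ p, List (Fin (S.numStates p) × Act (Fin N) (Fin s) × Fin (S.numStates p)),
    (∀ p, (L p).Nodup ∧ ∀ t, t ∈ L p ↔ t ∈ S.trans p) ∧
    w = [N, s] ++ (List.finRange N).flatMap fun p => automatonCode (S.init p) (L p)

/-! A valid communication is the same thing as a matching `μ` that sends every receive injectively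
to an earlier send on its channel. A word with a communication is equivalent to an `i`-RSC execution
exactly if its conflict graph is acyclic: a topological order of the nodes makes matched pairs
adjacent, and in an `i`-RSC execution the edges between different nodes go strictly upwards. So a
system fails to be `i`-RSC if and only if some execution has, for some matching, a cycle in its
conflict graph (`isIRSC_iff`).

Such executions are detected by reachability in a finite graph (`SearchNode`, `Move`), one for each
channel `c` and message `m₀`. Its nodes hold a global state, a mode for each process and one bit,
but no channel contents. Two facts make this possible. First, a shortest cyclic execution has the
form `e · r`, where all conflict graphs of `e` are acyclic and `r` is a receive on some `c`; the
cycle is then a path in the conflict graph of `e` from an unmatched send `j` on `c` to an action of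
the receiver of `c`. Second, `e` also has an honest matching `ν`, by which messages really travel
(`exists_isHonest`); reordering `e` along `ν` turns matched pairs into handshakes. One only has to
remember whether a message for `r` is available. That message comes from the send with which `ν`
matches `r`, which need not be `j`.

Completeness (`not_hasCycle_of_not_accepting`) has to reconcile the matching `μ` that carries the
path with `ν`. As every conflict graph of `e` is acyclic, matched pairs on one channel never overlap
(`AlwaysAcyclic.lt_send`). Hence any mixture of `μ` and `ν` is a matching (`AlwaysAcyclic.mix`), and
one graph may even contain edges for both choices at once without becoming cyclic
(`AlwaysAcyclic.mixedEdge`). A numbering `L` of that graph is a schedule. The two matchings matter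
only where a process first comes causally after `j`. If it does so by a receive `r` with `ν r < μ
r`, it is frozen between these two sends; if the sender does so by `μ r < ν r`, the receiver waits
between them. Thus a mode out of 2N+2, where N is the number of processes, is enough. `Layout`
collects the properties of the schedule and `Layout.exists_nodeAt` follows it in the search graph.

Soundness (`exists_hasCycle_of_accepting`) turns a search path into an execution in which the
receive of a frozen process is delayed until its parent sends again, and is then matched with the
new send, while the receive of a waiting process is matched with the old send. A handshake is
possible whatever the channel holds (`Interferes.exists_sync`): the new message gets to the front by
corruption, by reordering, or by loss of everything else. Only the last way destroys the available
message, whence the role of `IsFifo`.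

The algorithm is a breadth-first search. There are at most |C|·|Σ|·n^N·(2N+2)^N·2 keys; each is
expanded by trying all pairs of transitions with all pairs of new modes, in time O(n²N³). For N ≥ 2
one has N ≤ |C| and (2N+2)^N ≤ 9·2^|C| (`pow_modes_le`), which gives the bound. The program is
verified with `Ends`, total correctness with a time bound. -/

open Relation


/-! ### Matchings and their conflict graphs -/

/-- Position `i` of `e` holds a receive. -/
def IsRecv {P M : Type} (e : List (Act P M)) (i : ℕ) : Prop :=
  ∃ c m, e[i]? = some (Act.recv c m)

/-- Positions `i` and `i'` of `e` have the same active process. -/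
def SameProc {P M : Type} (e : List (Act P M)) (i i' : ℕ) : Prop :=
  ∃ x x', e[i]? = some x ∧ e[i']? = some x' ∧ x.proc = x'.proc

/-- `μ` maps the receives of `e` injectively to earlier sends on the same channel. -/
structure IsMatching {P M : Type} (e : List (Act P M)) (μ : ℕ → ℕ) : Prop where
  send : ∀ {r c m}, e[r]? = some (Act.recv c m) →
    μ r < r ∧ ∃ m', e[μ r]? = some (Act.send c m')
  inj : ∀ {r r'}, IsRecv e r → IsRecv e r' → μ r = μ r' → r = r'

open Classical in
/-- The node of a position: receives are merged with their matched sends. -/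
noncomputable def nodeOf {P M : Type} (e : List (Act P M)) (μ : ℕ → ℕ) (i : ℕ) : ℕ :=
  if IsRecv e i then μ i else i

/-- Edges of the conflict graph on nodes. -/
def NodeEdge {P M : Type} (e : List (Act P M)) (μ : ℕ → ℕ) (a b : ℕ) : Prop :=
  ∃ i i', i < i' ∧ SameProc e i i' ∧ nodeOf e μ i = a ∧ nodeOf e μ i' = b

/-- The conflict graph has a cycle. -/
def HasCycle {P M : Type} (e : List (Act P M)) (μ : ℕ → ℕ) : Prop :=
  ∃ a, TransGen (NodeEdge e μ) a a

theorem lt_length_of_getElem? {α : Type} {l : List α} {i : ℕ} {a : α} (h : l[i]? = some a) :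
    i < l.length := by
  by_contra hc
  rw [List.getElem?_eq_none (by omega)] at h
  simp at h

section Matching

variable {P M : Type} {e : List (Act P M)} {μ : ℕ → ℕ}

theorem SameProc.symm {i i' : ℕ} (h : SameProc e i i') : SameProc e i' i := by
  obtain ⟨x, x', h1, h2, h3⟩ := h
  exact ⟨x', x, h2, h1, h3.symm⟩

theorem SameProc.trans {i j k : ℕ} (h : SameProc e i j) (h' : SameProc e j k) :
    SameProc e i k := by
  obtain ⟨x, x', h1, h2, h3⟩ := h
  obtain ⟨y, y', h4, h5, h6⟩ := h'
  rw [h2] at h4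
  cases h4
  exact ⟨x, y', h1, h5, h3.trans h6⟩

theorem SameProc.lt_left {i i' : ℕ} (h : SameProc e i i') : i < e.length := by
  obtain ⟨x, x', h1, -, -⟩ := h
  exact lt_length_of_getElem? h1

theorem SameProc.lt_right {i i' : ℕ} (h : SameProc e i i') : i' < e.length := h.symm.lt_left

theorem nodeOf_recv {i : ℕ} (h : IsRecv e i) : nodeOf e μ i = μ i := if_pos h

theorem nodeOf_not_recv {i : ℕ} (h : ¬ IsRecv e i) : nodeOf e μ i = i := if_neg h

theorem not_isRecv_of_send {i : ℕ} {c : Channel P} {m : M} (h : e[i]? = some (Act.send c m)) :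
    ¬ IsRecv e i := by
  rintro ⟨c', m', h'⟩
  rw [h] at h'
  cases h'

theorem not_isRecv_of_internal {i : ℕ} {p : P} {x : ℕ} (h : e[i]? = some (Act.internal p x)) :
    ¬ IsRecv e i := by
  rintro ⟨c', m', h'⟩
  rw [h] at h'
  cases h'

theorem IsRecv.lt {i : ℕ} (h : IsRecv e i) : i < e.length := by
  obtain ⟨c, m, h⟩ := h
  exact lt_length_of_getElem? h

theorem IsMatching.lt (h : IsMatching e μ) {r : ℕ} (hr : IsRecv e r) : μ r < r := by
  obtain ⟨c, m, hr⟩ := hr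
  exact (h.send hr).1

theorem IsMatching.not_recv (h : IsMatching e μ) {r : ℕ} (hr : IsRecv e r) :
    ¬ IsRecv e (μ r) := by
  obtain ⟨c, m, hr⟩ := hr
  obtain ⟨m', h'⟩ := (h.send hr).2
  exact not_isRecv_of_send h'

theorem IsMatching.nodeOf_le (h : IsMatching e μ) (i : ℕ) : nodeOf e μ i ≤ i := by
  by_cases hi : IsRecv e i
  · rw [nodeOf_recv hi]; exact (h.lt hi).le
  · rw [nodeOf_not_recv hi]

theorem IsMatching.nodeOf_not_recv (h : IsMatching e μ) (i : ℕ) : ¬ IsRecv e (nodeOf e μ i) := by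
  by_cases hi : IsRecv e i
  · rw [nodeOf_recv hi]; exact h.not_recv hi
  · rwa [_root_.nodeOf_not_recv hi]

theorem IsMatching.not_sameProc (h : IsMatching e μ) {r : ℕ} (hr : IsRecv e r) :
    ¬ SameProc e (μ r) r := by
  obtain ⟨c, m, hr⟩ := hr
  obtain ⟨m', h'⟩ := (h.send hr).2
  rintro ⟨x, x', h1, h2, h3⟩
  rw [h'] at h1
  rw [hr] at h2
  cases h1
  cases h2
  exact c.2 h3

theorem IsMatching.nodeOf_ne (h : IsMatching e μ) {i i' : ℕ} (hlt : i < i')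
    (hs : SameProc e i i') : nodeOf e μ i ≠ nodeOf e μ i' := by
  intro heq
  by_cases hi : IsRecv e i
  · by_cases hi' : IsRecv e i'
    · rw [nodeOf_recv hi, nodeOf_recv hi'] at heq
      exact hlt.ne (h.inj hi hi' heq)
    · rw [nodeOf_recv hi, _root_.nodeOf_not_recv hi'] at heq
      have := h.lt hi
      omega
  · by_cases hi' : IsRecv e i'
    · rw [_root_.nodeOf_not_recv hi, nodeOf_recv hi'] at heq
      rw [heq] at hs
      exact h.not_sameProc hi' hs
    · rw [_root_.nodeOf_not_recv hi, _root_.nodeOf_not_recv hi'] at heq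
      omega

theorem IsMatching.edge_lt (h : IsMatching e μ) {a b : ℕ} (he : NodeEdge e μ a b) :
    a < e.length ∧ b < e.length := by
  obtain ⟨i, i', -, hs, rfl, rfl⟩ := he
  exact ⟨(h.nodeOf_le i).trans_lt hs.lt_left, (h.nodeOf_le i').trans_lt hs.lt_right⟩

end Matching

/-! ### Numberings of acyclic relations -/

/-- The number of strict ancestors grows along an edge, since in an acyclic relation a node is not
its own ancestor. Multiplying it by `n` and adding the node separates ties. -/
theorem exists_numbering (R : ℕ → ℕ → Prop) (n : ℕ) (hR : ∀ a b, R a b → a < n ∧ b < n)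
    (hac : ∀ a, ¬ TransGen R a a) :
    ∃ L : ℕ → ℕ, (∀ a b, a < n → b < n → L a = L b → a = b) ∧ ∀ a b, R a b → L a < L b := by
  classical
  let D : ℕ → Finset ℕ := fun a => (Finset.range n).filter fun x => TransGen R x a
  have hD : ∀ a b, R a b → (D a).card < (D b).card := by
    intro a b hab
    apply Finset.card_lt_card
    rw [Finset.ssubset_iff_of_subset]
    · exact ⟨a, by simp [D, (hR a b hab).1, TransGen.single hab], by simp [D, hac a]⟩
    · intro x hx
      simp only [D, Finset.mem_filter, Finset.mem_range] at hx ⊢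
      exact ⟨hx.1, hx.2.tail hab⟩
  refine ⟨fun a => (D a).card * n + a, ?_, ?_⟩
  · intro a b ha hb h
    have h1 : ((D a).card * n + a) % n = ((D b).card * n + b) % n := by
      simp only at h
      rw [h]
    rwa [Nat.mul_add_mod_of_lt ha, Nat.mul_add_mod_of_lt hb] at h1
  · intro a b hab
    have h1 := hD a b hab
    have h2 := (hR a b hab).1
    have h3 : ((D a).card + 1) * n ≤ (D b).card * n := Nat.mul_le_mul_right _ h1
    simp only
    nlinarith

/-- The rank of a position is the number of smaller keys. Extending it by the identity to a
permutation of `ℕ` spares a separate treatment of positions outside the word. -/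
theorem exists_ranking (key : ℕ → ℕ) (n : ℕ)
    (hkey : ∀ a b, a < n → b < n → key a = key b → a = b) :
    ∃ σ : Equiv.Perm ℕ, (∀ i, σ i < n ↔ i < n) ∧
      ∀ i i', i < n → i' < n → (σ i < σ i' ↔ key i < key i') := by
  classical
  let idx : ℕ → ℕ := fun i => ((Finset.range n).filter fun x => key x < key i).card
  have hmono : ∀ i i', i < n → i' < n → key i < key i' → idx i < idx i' := by
    intro i i' hi _ h
    apply Finset.card_lt_card
    rw [Finset.ssubset_iff_of_subset]
    · exact ⟨i, by simp [hi, h], by simp⟩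
    · intro x hx
      simp only [Finset.mem_filter, Finset.mem_range] at hx ⊢
      exact ⟨hx.1, hx.2.trans h⟩
  have hiff : ∀ i i', i < n → i' < n → (idx i < idx i' ↔ key i < key i') := by
    intro i i' hi hi'
    refine ⟨fun h => ?_, hmono i i' hi hi'⟩
    by_contra hc
    rcases (not_lt.mp hc).lt_or_eq with h2 | h2
    · have := hmono i' i hi' hi h2
      omega
    · rw [hkey i' i hi' hi h2] at h
      omega
  have hlt : ∀ i, i < n → idx i < n := by
    intro i hi
    have : idx i < (Finset.range n).card := by
      apply Finset.card_lt_card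
      rw [Finset.ssubset_iff_of_subset (Finset.filter_subset _ _)]
      exact ⟨i, by simp [hi], by simp⟩
    simpa using this
  have hinj : ∀ i i', i < n → i' < n → idx i = idx i' → i = i' := by
    intro i i' hi hi' h
    apply hkey i i' hi hi'
    have h1 := hiff i i' hi hi'
    have h2 := hiff i' i hi' hi
    omega
  have hsurj : ∀ k, k < n → ∃ i, i < n ∧ idx i = k := by
    have h1 : (Finset.range n).image idx = Finset.range n := by
      apply Finset.eq_of_subset_of_card_le
      · intro k hk
        simp only [Finset.mem_image, Finset.mem_range] at hk ⊢
        obtain ⟨i, hi, rfl⟩ := hk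
        exact hlt i hi
      · rw [Finset.card_image_of_injOn]
        intro a ha b hb
        exact hinj a b (by simpa using ha) (by simpa using hb)
    intro k hk
    have : k ∈ (Finset.range n).image idx := by simpa [h1] using hk
    simpa using this
  let f : ℕ → ℕ := fun i => if i < n then idx i else i
  have hf : ∀ i, i < n → f i = idx i := fun i hi => if_pos hi
  have hf' : ∀ i, ¬ i < n → f i = i := fun i hi => if_neg hi
  have hfn : ∀ i, f i < n ↔ i < n := by
    intro i
    by_cases hi : i < n
    · simp [hf i hi, hi, hlt i hi]
    · simp [hf' i hi, hi]
  have hbij : Function.Bijective f := by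
    constructor
    · intro a b h
      have ha := hfn a
      have hb := hfn b
      by_cases h1 : a < n
      · have h2 : b < n := by rw [← hb, ← h, ha]; exact h1
        rw [hf a h1, hf b h2] at h
        exact hinj a b h1 h2 h
      · have h2 : ¬ b < n := by rw [← hb, ← h, ha]; exact h1
        rwa [hf' a h1, hf' b h2] at h
    · intro k
      by_cases hk : k < n
      · obtain ⟨i, hi, h⟩ := hsurj k hk
        exact ⟨i, by rw [hf i hi, h]⟩
      · exact ⟨k, hf' k hk⟩
  refine ⟨Equiv.ofBijective f hbij, hfn, fun i i' hi hi' => ?_⟩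
  simp only [Equiv.ofBijective_apply, hf i hi, hf i' hi']
  exact hiff i i' hi hi'

/-! ### Communications versus matchings -/

/-- `C` is the communication whose members are the fibres of the nodes of `μ`. -/
structure Represents {P M : Type} (e : List (Act P M)) (μ : ℕ → ℕ) (C : Set (Finset ℕ)) :
    Prop where
  matching : IsMatching e μ
  valid : IsValidComm e C
  iff : ∀ {i i'}, i < e.length → i' < e.length →
    (nodeOf e μ i = nodeOf e μ i' ↔ ∃ X ∈ C, i ∈ X ∧ i' ∈ X)

section Represent

variable {P M : Type} {e : List (Act P M)} {μ : ℕ → ℕ} {C : Set (Finset ℕ)}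

theorem IsInteraction.lt {X : Finset ℕ} (h : IsInteraction e X) {i : ℕ} (hi : i ∈ X) :
    i < e.length := by
  rcases h with ⟨c, m, m', j, j', hj, h1, h2, rfl⟩ | ⟨j, c, m, h1, rfl⟩ | ⟨j, p, x, h1, rfl⟩
  · simp only [Finset.mem_insert, Finset.mem_singleton] at hi
    rcases hi with rfl | rfl
    · exact lt_length_of_getElem? h1
    · exact lt_length_of_getElem? h2
  · simp only [Finset.mem_singleton] at hi
    rw [hi]; exact lt_length_of_getElem? h1
  · simp only [Finset.mem_singleton] at hi
    rw [hi]; exact lt_length_of_getElem? h1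

theorem IsValidComm.unique (h : IsValidComm e C) {X Y : Finset ℕ} (hX : X ∈ C) (hY : Y ∈ C)
    {i : ℕ} (hi : i ∈ X) (hi' : i ∈ Y) : X = Y := by
  obtain ⟨Z, -, hZ⟩ := h.2 i ((h.1 X hX).lt hi)
  rw [hZ X ⟨hX, hi⟩, hZ Y ⟨hY, hi'⟩]

theorem IsInteraction.recv_mem {X : Finset ℕ} (h : IsInteraction e X) {r : ℕ} {c : Channel P}
    {m : M} (hr : r ∈ X) (hrecv : e[r]? = some (Act.recv c m)) :
    ∃ j m', j < r ∧ e[j]? = some (Act.send c m') ∧ X = {j, r} := by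
  rcases h with ⟨c', m1, m2, j, j', hj, h1, h2, rfl⟩ | ⟨j, c', m', h1, rfl⟩ | ⟨j, p, x, h1, rfl⟩
  · simp only [Finset.mem_insert, Finset.mem_singleton] at hr
    rcases hr with rfl | rfl
    · rw [h1] at hrecv; cases hrecv
    · rw [h2] at hrecv
      cases hrecv
      exact ⟨j, m1, hj, h1, rfl⟩
  · simp only [Finset.mem_singleton] at hr
    rw [hr, h1] at hrecv; cases hrecv
  · simp only [Finset.mem_singleton] at hr
    rw [hr, h1] at hrecv; cases hrecv

/-- A receive can only be covered by a pair, so its member names its send. Members with a common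
position coincide, so two receives cannot share a send. -/
theorem exists_represents_of_valid (h : IsValidComm e C) : ∃ μ, Represents e μ C := by
  have h0 : ∀ r, ∃ j, IsRecv e r → j < r ∧ ({j, r} : Finset ℕ) ∈ C ∧
      ∀ c m, e[r]? = some (Act.recv c m) → ∃ m', e[j]? = some (Act.send c m') := by
    intro r
    by_cases hr : IsRecv e r
    · obtain ⟨c, m, hr'⟩ := hr
      obtain ⟨X, ⟨hX, hrX⟩, -⟩ := h.2 r (lt_length_of_getElem? hr')
      obtain ⟨j, m', hj, hs, rfl⟩ := (h.1 X hX).recv_mem hrX hr'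
      refine ⟨j, fun _ => ⟨hj, hX, fun c' m'' h' => ?_⟩⟩
      rw [hr'] at h'
      cases h'
      exact ⟨m', hs⟩
    · exact ⟨0, fun h => absurd h hr⟩
  choose μ hμ using h0
  have hm : IsMatching e μ := by
    refine ⟨fun {r c m} hr => ?_, fun {r r'} hr hr' heq => ?_⟩
    · have := hμ r ⟨c, m, hr⟩
      exact ⟨this.1, this.2.2 c m hr⟩
    · have h1 := hμ r hr
      have h2 := hμ r' hr'
      have h3 : ({μ r, r} : Finset ℕ) = {μ r', r'} :=
        h.unique h1.2.1 h2.2.1 (i := μ r) (by simp) (by simp [heq])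
      have h4 : r ∈ ({μ r', r'} : Finset ℕ) := by rw [← h3]; simp
      simp only [Finset.mem_insert, Finset.mem_singleton] at h4
      rcases h4 with h4 | h4
      · have := h1.1
        omega
      · exact h4
  have hmem : ∀ i, i < e.length → ∃ X ∈ C, i ∈ X ∧ nodeOf e μ i ∈ X := by
    intro i hi
    by_cases hr : IsRecv e i
    · exact ⟨_, (hμ i hr).2.1, by simp, by rw [nodeOf_recv hr]; simp⟩
    · obtain ⟨X, hX, -⟩ := h.2 i hi
      exact ⟨X, hX.1, hX.2, by rw [nodeOf_not_recv hr]; exact hX.2⟩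
  refine ⟨μ, hm, h, fun {i i'} hi hi' => ⟨fun heq => ?_, ?_⟩⟩
  · obtain ⟨X, hX, h1, h2⟩ := hmem i hi
    obtain ⟨Y, hY, h3, h4⟩ := hmem i' hi'
    rw [heq] at h2
    have := h.unique hX hY h2 h4
    subst this
    exact ⟨X, hX, h1, h3⟩
  · have key : ∀ i i', i ∈ ({i, i'} : Finset ℕ) → IsRecv e i → ∀ X ∈ C, i ∈ X → i' ∈ X →
        nodeOf e μ i' = nodeOf e μ i := by
      intro i i' _ hr X hX h1 h2
      have h3 := hμ i hr
      have h4 := h.unique hX h3.2.1 h1 (by simp)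
      rw [h4] at h2
      simp only [Finset.mem_insert, Finset.mem_singleton] at h2
      rcases h2 with h2 | h2
      · rw [h2, nodeOf_recv hr, nodeOf_not_recv (hm.not_recv hr)]
      · rw [h2]
    rintro ⟨X, hX, h1, h2⟩
    by_cases hr : IsRecv e i
    · exact (key i i' (by simp) hr X hX h1 h2).symm
    by_cases hr' : IsRecv e i'
    · exact key i' i (by simp) hr' X hX h2 h1
    rcases h.1 X hX with ⟨c, m, m', j, j', hj, h3, h4, rfl⟩ | ⟨j, c, m, h3, rfl⟩ |
      ⟨j, p, x, h3, rfl⟩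
    · simp only [Finset.mem_insert, Finset.mem_singleton] at h1 h2
      have hj' : IsRecv e j' := ⟨_, _, h4⟩
      have e1 : i = j := by
        rcases h1 with h1 | h1
        · exact h1
        · rw [h1] at hr; exact absurd hj' hr
      have e2 : i' = j := by
        rcases h2 with h2 | h2
        · exact h2
        · rw [h2] at hr'; exact absurd hj' hr'
      rw [e1, e2]
    · simp only [Finset.mem_singleton] at h1 h2
      rw [h1, h2]
    · simp only [Finset.mem_singleton] at h1 h2
      rw [h1, h2]

-- The fibre of a receive is the pair that it forms with its send; a fibre without receives is a
-- singleton.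
open Classical in
theorem exists_represents_of_matching (h : IsMatching e μ) : ∃ C, Represents e μ C := by
  let fib : ℕ → Finset ℕ := fun i =>
    (Finset.range e.length).filter fun i' => nodeOf e μ i' = nodeOf e μ i
  have hfib : ∀ i i', i' ∈ fib i ↔ i' < e.length ∧ nodeOf e μ i' = nodeOf e μ i := by
    simp [fib]
  have hpair : ∀ r, IsRecv e r → fib r = {μ r, r} := by
    intro r hr
    ext i
    rw [hfib, nodeOf_recv hr]
    simp only [Finset.mem_insert, Finset.mem_singleton]
    constructor
    · rintro ⟨-, h2⟩
      by_cases hi : IsRecv e i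
      · rw [nodeOf_recv hi] at h2
        exact Or.inr (h.inj hi hr h2)
      · rw [nodeOf_not_recv hi] at h2
        exact Or.inl h2
    · rintro (rfl | rfl)
      · exact ⟨(h.lt hr).trans hr.lt, nodeOf_not_recv (h.not_recv hr)⟩
      · exact ⟨hr.lt, nodeOf_recv hr⟩
  have hcongr : ∀ i i', nodeOf e μ i = nodeOf e μ i' → fib i = fib i' := by
    intro i i' hii
    ext k
    rw [hfib, hfib, hii]
  refine ⟨{X | ∃ i < e.length, X = fib i}, h, ⟨?_, ?_⟩, ?_⟩
  · rintro X ⟨i, hi, rfl⟩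
    by_cases hex : ∃ r, IsRecv e r ∧ nodeOf e μ r = nodeOf e μ i
    · obtain ⟨r, hr, hri⟩ := hex
      rw [← hcongr r i hri, hpair r hr]
      obtain ⟨c, m, hr'⟩ := hr
      obtain ⟨h1, m', h2⟩ := h.send hr'
      exact Or.inl ⟨c, m', m, μ r, r, h1, h2, hr', rfl⟩
    · have hi' : ¬ IsRecv e i := fun hr => hex ⟨i, hr, rfl⟩
      have hsing : fib i = {i} := by
        ext k
        rw [hfib]
        simp only [Finset.mem_singleton]
        constructor
        · rintro ⟨-, h2⟩
          have hk : ¬ IsRecv e k := fun hr => hex ⟨k, hr, h2⟩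
          rwa [nodeOf_not_recv hk, nodeOf_not_recv hi'] at h2
        · rintro rfl
          exact ⟨hi, rfl⟩
      rw [hsing]
      rcases hact : e[i] with ⟨c, m⟩ | ⟨c, m⟩ | ⟨p, x⟩
      · exact Or.inr (Or.inl ⟨i, c, m, by rw [List.getElem?_eq_getElem hi, hact], rfl⟩)
      · exact absurd ⟨c, m, by rw [List.getElem?_eq_getElem hi, hact]⟩ hi'
      · exact Or.inr (Or.inr ⟨i, p, x, by rw [List.getElem?_eq_getElem hi, hact], rfl⟩)
  · intro j hj
    refine ⟨fib j, ⟨⟨j, hj, rfl⟩, by rw [hfib]; exact ⟨hj, rfl⟩⟩, ?_⟩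
    rintro X ⟨⟨i, hi, rfl⟩, hX⟩
    rw [hfib] at hX
    exact (hcongr _ _ hX.2).symm
  · intro i i' hi hi'
    constructor
    · intro heq
      exact ⟨fib i, ⟨i, hi, rfl⟩, by rw [hfib]; exact ⟨hi, rfl⟩, by rw [hfib]; exact ⟨hi', heq.symm⟩⟩
    · rintro ⟨X, ⟨k, hk, rfl⟩, h1, h2⟩
      rw [hfib] at h1 h2
      rw [h1.2, h2.2]

/-! ### A word is equivalent to an `i`-RSC execution iff its conflict graph is acyclic -/

/-- In an `i`-RSC execution the members are disjoint intervals of length one or two, so the largest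
position strictly increases along an edge between different members. An isomorphism would carry a
cycle into this order. -/
theorem Represents.not_equivalent_of_cyclic (h : Represents e μ C) (hc : HasCycle e μ)
    {e' : List (Act P M)} {C' : Set (Finset ℕ)} (h' : IsIRSCExecution e' C') :
    ¬ CausallyEquivalent e C e' C' := by
  rintro ⟨f⟩
  have hshape : ∀ X ∈ C', ∃ x, X = {x} ∨ X = {x, x + 1} := by
    intro X hX
    rcases h'.1.1 X hX with h1 | ⟨j, c, m, -, h1⟩ | ⟨j, p, x, -, h1⟩
    · obtain ⟨j, hj⟩ := h'.2 X hX h1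
      exact ⟨j, Or.inr hj⟩
    · exact ⟨j, Or.inl h1⟩
    · exact ⟨j, Or.inl h1⟩
  have hsup : ∀ X Y : C', ConflictEdge e' C' X Y → X ≠ Y → X.1.sup id < Y.1.sup id := by
    rintro ⟨X, hX⟩ ⟨Y, hY⟩ ⟨j, hj, j', hj', hlt, -⟩ hne
    have hne' : X ≠ Y := fun h => hne (Subtype.ext h)
    have h1 : j' ≤ Y.sup id := Finset.le_sup (f := id) hj'
    have h2 : j' ∉ X := fun hc => hne' (h'.1.unique hX hY hc hj')
    obtain ⟨x, hx | hx⟩ := hshape X hX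
    · simp only [hx, Finset.mem_singleton] at hj
      simp only [hx, Finset.sup_singleton, id]
      omega
    · simp only [hx, Finset.mem_insert, Finset.mem_singleton, not_or] at hj h2
      have h3 : X.sup id = x + 1 := by
        rw [hx, Finset.sup_insert, Finset.sup_singleton]
        simp
      simp only [h3]
      omega
  -- A matching pair always has a loop in the conflict graph, because its send precedes its receive.
  -- Only edges between different members count.
  let R : C → C → Prop := fun X Y => ConflictEdge e C X Y ∧ X ≠ Y
  have hR : ∀ a b, NodeEdge e μ a b → ∀ (i i' : ℕ), i < e.length → i' < e.length →
      nodeOf e μ i = a → nodeOf e μ i' = b → ∀ X Y : C, i ∈ X.1 → i' ∈ Y.1 → R X Y := by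
    rintro a b ⟨k, k', hlt, hs, hk, hk'⟩ i i' hi hi' hia hib X Y hX hY
    have mem : ∀ (i k : ℕ) (X : C), i < e.length → k < e.length → i ∈ X.1 →
        nodeOf e μ i = nodeOf e μ k → k ∈ X.1 := by
      intro i k X hi hk hiX heq
      obtain ⟨Z, hZ, h1, h2⟩ := (h.iff hi hk).1 heq
      rwa [← h.valid.unique hZ X.2 h1 hiX]
    have m1 := mem i k X hi hs.lt_left hX (by rw [hia, hk])
    have m2 := mem i' k' Y hi' hs.lt_right hY (by rw [hib, hk'])
    refine ⟨⟨k, m1, k', m2, hlt, ?_⟩, ?_⟩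
    · obtain ⟨x, x', h1, h2, h3⟩ := hs
      exact ⟨x, x', h1, h2, fun hcon => hcon.1 h3⟩
    · rintro rfl
      exact h.matching.nodeOf_ne hlt hs ((h.iff hs.lt_left hs.lt_right).2 ⟨X.1, X.2, m1, m2⟩)
  have hcov : ∀ i, i < e.length → ∃ X : C, i ∈ X.1 := by
    intro i hi
    obtain ⟨X, hX, -⟩ := h.valid.2 i hi
    exact ⟨⟨X, hX.1⟩, hX.2⟩
  have hT : ∀ a b, TransGen (NodeEdge e μ) a b → ∀ (i i' : ℕ), i < e.length → i' < e.length →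
      nodeOf e μ i = a → nodeOf e μ i' = b → ∀ X Y : C, i ∈ X.1 → i' ∈ Y.1 → TransGen R X Y := by
    intro a b hab
    induction hab with
    | single h1 =>
      intro i i' hi hi' hia hib X Y hX hY
      exact .single (hR _ _ h1 i i' hi hi' hia hib X Y hX hY)
    | tail h1 h2 ih =>
      intro i i' hi hi' hia hib X Y hX hY
      obtain ⟨k, k', hlt, hs, hk, hk'⟩ := id h2
      obtain ⟨Z, hZ⟩ := hcov k hs.lt_left
      exact (ih i k hi hs.lt_left hia hk X Z hX hZ).tail
        (hR _ _ h2 k i' hs.lt_left hi' hk hib Z Y hZ hY)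
  obtain ⟨a, ha⟩ := hc
  obtain ⟨b, hab, -⟩ := TransGen.head'_iff.1 ha
  obtain ⟨k, k', hlt, hs, hk, hk'⟩ := hab
  obtain ⟨X, hX⟩ := hcov k hs.lt_left
  have hXX := hT a a ha k k hs.lt_left hs.lt_left hk hk X X hX hX
  have hfin : ∀ X Y : C, TransGen R X Y → (f X).1.sup id < (f Y).1.sup id := by
    intro X Y hXY
    have hstep : ∀ X Y : C, R X Y → (f X).1.sup id < (f Y).1.sup id := fun X Y h1 =>
      hsup (f X) (f Y) (f.map_rel_iff.2 h1.1) (fun hc => h1.2 (f.injective hc))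
    induction hXY with
    | single h1 => exact hstep _ _ h1
    | tail _ h1 ih => exact ih.trans (hstep _ _ h1)
  exact lt_irrefl _ (hfin X X hXX)

/-- The word is sorted by a topological numbering of the nodes. The members of a pair have the same
number and nothing else has it, so they become adjacent; no two dependent actions are exchanged, so
the conflict graph is kept. -/
theorem Represents.exists_equivalent_of_acyclic (h : Represents e μ C) (hc : ¬ HasCycle e μ) :
    ∃ e' C', IsIRSCExecution e' C' ∧ CausallyEquivalent e C e' C' := by
  classical
  obtain ⟨L, hLinj, hL⟩ := exists_numbering (NodeEdge e μ) e.length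
    (fun a b hab => h.matching.edge_lt hab) (fun a ha => hc ⟨a, ha⟩)
  have hnode : ∀ i, i < e.length → nodeOf e μ i < e.length := fun i hi =>
    (h.matching.nodeOf_le i).trans_lt hi
  -- Lexicographic order: first the number of the node, then the position, which keeps a send before
  -- its receive.
  let key : ℕ → ℕ := fun i => L (nodeOf e μ i) * e.length + i
  have hkeylt : ∀ i i', i < e.length → i' < e.length → key i < key i' →
      L (nodeOf e μ i) ≤ L (nodeOf e μ i') := by
    intro i i' hi hi' hlt
    by_contra hcon
    have : (L (nodeOf e μ i') + 1) * e.length ≤ L (nodeOf e μ i) * e.length :=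
      Nat.mul_le_mul_right _ (by omega)
    simp only [key] at hlt
    nlinarith
  have hkeylt' : ∀ i i', i < e.length → L (nodeOf e μ i) < L (nodeOf e μ i') →
      key i < key i' := by
    intro i i' hi hlt
    have : (L (nodeOf e μ i) + 1) * e.length ≤ L (nodeOf e μ i') * e.length :=
      Nat.mul_le_mul_right _ (by omega)
    simp only [key]
    nlinarith
  obtain ⟨σ, hσ, hσkey⟩ := exists_ranking key e.length (by
    intro a b ha hb heq
    have h1 : (key a) % e.length = (key b) % e.length := by rw [heq]
    simp only [key] at h1
    rwa [Nat.mul_add_mod_of_lt ha, Nat.mul_add_mod_of_lt hb] at h1)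
  let e' : List (Act P M) := List.ofFn fun k : Fin e.length =>
    e[σ.symm k]'(by rw [← hσ]; simp)
  have hlen : e'.length = e.length := by simp [e']
  have he' : ∀ i, e'[σ i]? = e[i]? := by
    intro i
    by_cases hi : i < e.length
    · have hi' := (hσ i).2 hi
      rw [List.getElem?_eq_getElem hi, List.getElem?_eq_getElem (by rw [hlen]; exact hi')]
      simp [e']
    · have hi' : ¬ σ i < e.length := fun hc => hi ((hσ i).1 hc)
      rw [List.getElem?_eq_none (by omega : e'.length ≤ _), List.getElem?_eq_none (by omega)]
  let mp : Finset ℕ → Finset ℕ := fun X => X.map σ.toEmbedding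
  have hmp : Function.Injective mp := Finset.map_injective _
  have hmpair : ∀ j j', mp {j, j'} = {σ j, σ j'} := by
    intro j j'
    simp [mp, Finset.map_insert]
  let C' : Set (Finset ℕ) := mp '' C
  have hCpair : ∀ j j', ({σ j, σ j'} : Finset ℕ) ∈ C' ↔ ({j, j'} : Finset ℕ) ∈ C := by
    intro j j'
    rw [← hmpair]
    exact hmp.mem_set_image
  have horder : ∀ j j', Precedes e C j j' → σ j < σ j' := by
    rintro j j' ⟨hlt, a, a', h1, h2, h3⟩
    have hj := lt_length_of_getElem? h1
    have hj' := lt_length_of_getElem? h2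
    rw [hσkey j j' hj hj']
    by_cases hp : a.proc = a'.proc
    · exact hkeylt' j j' hj (hL _ _ ⟨j, j', hlt, ⟨a, a', h1, h2, hp⟩, rfl, rfl⟩)
    · have hmem : ({j, j'} : Finset ℕ) ∈ C := by
        by_contra hcon
        exact h3 ⟨hp, hcon⟩
      have := (h.iff hj hj').2 ⟨_, hmem, by simp, by simp⟩
      simp only [key, this]
      omega
  have hprec : ∀ j j', Precedes e C j j' ↔ Precedes e' C' (σ j) (σ j') := by
    intro j j'
    constructor
    · intro hp
      obtain ⟨-, a, a', h1, h2, h3⟩ := id hp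
      refine ⟨horder j j' hp, a, a', by rw [he', h1], by rw [he', h2], ?_⟩
      rwa [hCpair]
    · rintro ⟨hlt, a, a', h1, h2, h3⟩
      rw [he'] at h1 h2
      rw [hCpair] at h3
      refine ⟨?_, a, a', h1, h2, h3⟩
      by_contra hcon
      rcases (not_lt.mp hcon).lt_or_eq with hlt' | heq
      · have := horder j' j ⟨hlt', a', a, h2, h1, fun hc =>
          h3 ⟨fun h => hc.1 h.symm, by rw [Finset.pair_comm]; exact hc.2⟩⟩
        omega
      · rw [heq] at hlt
        omega
  have hvalid' : IsValidComm e' C' := by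
    constructor
    · rintro _ ⟨X, hX, rfl⟩
      rcases h.valid.1 X hX with ⟨c, m, m', j, j', hj, h1, h2, rfl⟩ | ⟨j, c, m, h1, rfl⟩ |
        ⟨j, p, x, h1, rfl⟩
      · refine Or.inl ⟨c, m, m', σ j, σ j', ?_, by rw [he', h1], by rw [he', h2], hmpair j j'⟩
        exact horder j j' ⟨hj, _, _, h1, h2, fun hc => hc.2 hX⟩
      · exact Or.inr (Or.inl ⟨σ j, c, m, by rw [he', h1], by simp [mp]⟩)
      · exact Or.inr (Or.inr ⟨σ j, p, x, by rw [he', h1], by simp [mp]⟩)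
    · intro k hk
      obtain ⟨i, rfl⟩ := σ.surjective k
      rw [hlen, hσ] at hk
      obtain ⟨X, ⟨hX, hiX⟩, huniq⟩ := h.valid.2 i hk
      refine ⟨mp X, ⟨⟨X, hX, rfl⟩, by simp [mp, hiX]⟩, ?_⟩
      rintro _ ⟨⟨Y, hY, rfl⟩, hmem⟩
      rw [huniq Y ⟨hY, by simpa [mp] using hmem⟩]
  refine ⟨e', C', ⟨hvalid', ?_⟩, ⟨?_⟩⟩
  · rintro _ ⟨X, hX, rfl⟩ ⟨c, m, m', k, k', hlt, h1, h2, hXk⟩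
    obtain ⟨i, rfl⟩ := σ.surjective k
    obtain ⟨i', rfl⟩ := σ.surjective k'
    refine ⟨σ i, ?_⟩
    rw [hXk]
    congr 1
    rw [he'] at h1 h2
    have hi := lt_length_of_getElem? h1
    have hi' := lt_length_of_getElem? h2
    -- Otherwise some `t` is placed between the two. Its key lies between theirs, so it has the same
    -- node and belongs to the pair.
    by_contra hne
    have hne' : σ i' ≠ σ i + 1 := fun hc => hne (by rw [hc])
    obtain ⟨t, ht⟩ := σ.surjective (σ i + 1)
    have hti' : σ t < σ i' := by omega
    have ht' : t < e.length := by
      rw [← hσ]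
      exact hti'.trans ((hσ i').2 hi')
    rw [← hmpair] at hXk
    have hXk' := hmp hXk
    have hii' := (h.iff hi hi').2 ⟨X, hX, by simp [hXk'], by simp [hXk']⟩
    have l1 := hkeylt i t hi ht' ((hσkey i t hi ht').1 (by omega))
    have l2 := hkeylt t i' ht' hi' ((hσkey t i' ht' hi').1 hti')
    rw [← hii'] at l2
    have hti := hLinj _ _ (hnode t ht') (hnode i hi) (le_antisymm l2 l1)
    obtain ⟨Y, hY, m1, m2⟩ := (h.iff ht' hi).1 hti
    have hYX := h.valid.unique hY hX m2 (by simp [hXk'])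
    rw [hYX, hXk'] at m1
    simp only [Finset.mem_insert, Finset.mem_singleton] at m1
    rcases m1 with rfl | rfl
    · omega
    · omega
  · let f : C ≃ C' := Equiv.Set.image mp C hmp
    refine ⟨f, ?_⟩
    intro X Y
    constructor
    · rintro ⟨j, hj, j', hj', hp⟩
      have hX : (f X).1 = mp X.1 := rfl
      have hY : (f Y).1 = mp Y.1 := rfl
      rw [hX] at hj
      rw [hY] at hj'
      simp only [mp, Finset.mem_map, Equiv.coe_toEmbedding] at hj hj'
      obtain ⟨i, hi, rfl⟩ := hj
      obtain ⟨i', hi', rfl⟩ := hj'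
      exact ⟨i, hi, i', hi', (hprec i i').2 hp⟩
    · rintro ⟨j, hj, j', hj', hp⟩
      exact ⟨σ j, Finset.mem_map_of_mem _ hj, σ j', Finset.mem_map_of_mem _ hj',
        (hprec j j').1 hp⟩

end Represent

/-- This removes the quantification over equivalent words: only executions of the system and their
matchings remain. -/
theorem isIRSC_iff {P M : Type} (I : InterferenceModel M) (S : FIFOSystem P M) :
    IsIRSC I S ↔ ∀ e, IsExecutionOf I S e → ∀ μ, IsMatching e μ → ¬ HasCycle e μ := by
  constructor
  · intro h e he μ hμ hc
    obtain ⟨C, hC⟩ := exists_represents_of_matching hμ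
    obtain ⟨e', C', h1, h2⟩ := h e he C hC.valid
    exact hC.not_equivalent_of_cyclic hc h1 h2
  · intro h e he C hC
    obtain ⟨μ, hμ⟩ := exists_represents_of_valid hC
    exact hμ.exists_equivalent_of_acyclic (h e he μ hμ.matching)


/-! ### Interference -/

/-- Messages that may be sent and received in an adjacent pair. -/
def MsgOk {M : Type} (F : Set Failure) (m m' : M) : Prop := Failure.corruption ∈ F ∨ m = m'

/-- Neither corruption nor reordering: channels are lossy queues. -/
def IsFifo (F : Set Failure) : Prop := Failure.corruption ∉ F ∧ Failure.outOfOrder ∉ F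

section Interference

variable {M : Type} {F : Set Failure}

theorem lossy_of_isFifo (hF : F.Nonempty) (h : IsFifo F) : Failure.lossiness ∈ F := by
  obtain ⟨f, hf⟩ := hF
  cases f with
  | lossiness => exact hf
  | corruption => exact absurd hf h.1
  | outOfOrder => exact absurd hf h.2

theorem Interferes.lose_all (h : Failure.lossiness ∈ F) (w : List M) : Interferes F w [] := by
  induction w with
  | nil => exact .refl _
  | cons a w ih => exact Interferes.append (.lose h a) ih

theorem Interferes.cons (a : M) {w w' : List M} (h : Interferes F w w') :
    Interferes F (a :: w) (a :: w') :=
  Interferes.append (.refl [a]) h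

theorem Interferes.move_front (h : Failure.outOfOrder ∈ F) (w : List M) (m : M) :
    Interferes F (w ++ [m]) (m :: w) := by
  induction w with
  | nil => exact .refl _
  | cons a w ih =>
    exact (Interferes.cons a ih).trans (Interferes.append (.swap h a m) (.refl w))

theorem Interferes.corrupt_all (h : Failure.corruption ∈ F) :
    ∀ {w w' : List M}, w.length = w'.length → Interferes F w w'
  | [], [], _ => .refl _
  | a :: w, b :: w', hl =>
    Interferes.append (.corrupt h a b) (corrupt_all h (by simpa using hl))

/-- A newly sent message can be received next. -/
theorem Interferes.exists_sync (hF : F.Nonempty) {m m' : M} (hm : MsgOk F m m')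
    {need : List M} (hneed : IsFifo F → need = []) (junk : List M) :
    ∃ junk', Interferes F (need ++ junk ++ [m]) (m' :: (need ++ junk')) := by
  by_cases hc : Failure.corruption ∈ F
  · exact ⟨junk, .corrupt_all hc (by simp; omega)⟩
  have hmm : m = m' := hm.resolve_left hc
  subst hmm
  by_cases ho : Failure.outOfOrder ∈ F
  · exact ⟨junk, .move_front ho _ m⟩
  · rw [hneed ⟨hc, ho⟩]
    exact ⟨[], Interferes.append (.lose_all (lossy_of_isFifo hF ⟨hc, ho⟩) _) (.refl [m])⟩

/-- Without corruption, interference permutes and deletes the occurrences of messages. -/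
theorem Interferes.lift {R : ℕ → M → Prop} {w w' : List M} (h : Interferes F w w')
    (hc : Failure.corruption ∉ F) :
    ∀ l, List.Forall₂ R l w → ∃ l', List.Forall₂ R l' w' ∧ List.Subperm l' l ∧
      (Failure.outOfOrder ∉ F → List.Sublist l' l) := by
  induction h with
  | refl w => exact fun l hl => ⟨l, hl, List.Subperm.refl l, fun _ => List.Sublist.refl l⟩
  | trans _ _ ih1 ih2 =>
    intro l hl
    obtain ⟨l1, h1, h2, h3⟩ := ih1 l hl
    obtain ⟨l2, h4, h5, h6⟩ := ih2 l1 h1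
    exact ⟨l2, h4, h5.trans h2, fun ho => (h6 ho).trans (h3 ho)⟩
  | @append w₁ w₁' w₂ w₂' _ _ ih1 ih2 =>
    intro l hl
    obtain ⟨l1, l2, h1, h2, rfl⟩ : ∃ l1 l2, List.Forall₂ R l1 w₁ ∧ List.Forall₂ R l2 w₂ ∧
        l = l1 ++ l2 := by
      refine ⟨l.take w₁.length, l.drop w₁.length, List.forall₂_take_append _ _ _ hl,
        List.forall₂_drop_append _ _ _ hl, (List.take_append_drop _ _).symm⟩
    obtain ⟨l1', h3, h4, h5⟩ := ih1 l1 h1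
    obtain ⟨l2', h6, h7, h8⟩ := ih2 l2 h2
    exact ⟨l1' ++ l2', List.rel_append h3 h6, h4.append h7, fun ho => (h5 ho).append (h8 ho)⟩
  | lose _ a =>
    intro l hl
    exact ⟨[], .nil, List.nil_subperm, fun _ => List.nil_sublist l⟩
  | corrupt h a b => exact absurd h hc
  | swap h a b =>
    intro l hl
    cases hl with | cons h1 hl => ?_
    cases hl with | cons h2 hl => ?_
    cases hl
    exact ⟨[_, _], .cons h2 (.cons h1 .nil), (List.Perm.swap _ _ []).subperm,
      fun ho => absurd h ho⟩

end Interference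

/-! ### Executions -/

section Steps

variable {P M : Type} {I : InterferenceModel M} {S : FIFOSystem P M}

theorem Steps.snoc {γ γ' γ'' : Config S} {e : List (Act P M)} {a : Act P M}
    (h : Steps I S γ e γ') (h' : Step I S γ' a γ'') : Steps I S γ (e ++ [a]) γ'' := by
  induction h with
  | nil γ => exact .cons h' (.nil _)
  | cons h1 _ ih => exact .cons h1 (ih h')

theorem Steps.split {γ γ'' : Config S} {e : List (Act P M)} {a : Act P M}
    (h : Steps I S γ (e ++ [a]) γ'') : ∃ γ', Steps I S γ e γ' ∧ Step I S γ' a γ'' := by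
  induction e generalizing γ with
  | nil =>
    cases h with
    | cons h1 h2 =>
      cases h2
      exact ⟨γ, .nil _, h1⟩
  | cons b e ih =>
    cases h with
    | cons h1 h2 =>
      obtain ⟨γ', h3, h4⟩ := ih h2
      exact ⟨γ', .cons h1 h3, h4⟩

theorem Step.trans_mem {γ γ' : Config S} {a : Act P M} (h : Step I S γ a γ') :
    (γ.state a.proc, a, γ'.state a.proc) ∈ S.trans a.proc := by
  cases h <;> assumption

theorem Step.state_eq {γ γ' : Config S} {a : Act P M} (h : Step I S γ a γ') {r : P}
    (hr : r ≠ a.proc) : γ'.state r = γ.state r := by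
  cases h with
  | send c m _ h1 _ _ => exact h1 r hr
  | recv c m _ h1 _ _ => exact h1 r hr
  | internal p x _ h1 _ => exact h1 r hr

/-- The control states along an execution. -/
theorem Steps.exists_states {γ γ' : Config S} {e : List (Act P M)} (h : Steps I S γ e γ') :
    ∃ st : ℕ → ∀ p, Fin (S.numStates p), st 0 = γ.state ∧ st e.length = γ'.state ∧
      ∀ i a, e[i]? = some a → (st i a.proc, a, st (i + 1) a.proc) ∈ S.trans a.proc ∧
        ∀ r, r ≠ a.proc → st (i + 1) r = st i r := by
  induction h with
  | nil γ => exact ⟨fun _ => γ.state, rfl, rfl, fun i a h => by simp at h⟩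
  | @cons γ γ₁ γ₂ a e h1 _ ih =>
    obtain ⟨st, h2, h3, h4⟩ := ih
    refine ⟨fun i => Nat.casesOn i γ.state st, rfl, h3, fun i b hb => ?_⟩
    cases i with
    | zero =>
      simp only [List.getElem?_cons_zero, Option.some.injEq] at hb
      subst hb
      simp only [h2]
      exact ⟨h1.trans_mem, fun r hr => h1.state_eq hr⟩
    | succ i =>
      simp only [List.getElem?_cons_succ] at hb
      exact h4 i b hb

end Steps

/-! ### Matchings that respect messages -/

/-- A matching in which receives get acceptable messages and, on lossy queues, in the order of
the sends. -/
structure IsHonest {P M : Type} (F : Set Failure) (e : List (Act P M)) (μ : ℕ → ℕ) : Prop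
    extends IsMatching e μ where
  msg : ∀ {r c m}, e[r]? = some (Act.recv c m) →
    ∃ m', e[μ r]? = some (Act.send c m') ∧ MsgOk F m' m
  mono : IsFifo F → ∀ {r r' c m m'}, r < r' → e[r]? = some (Act.recv c m) →
    e[r']? = some (Act.recv c m') → μ r < μ r'

section Honest

variable {P M : Type} {F : Set Failure} {e : List (Act P M)} {μ : ℕ → ℕ}

theorem IsMatching.isHonest_of_corruption (h : IsMatching e μ) (hc : Failure.corruption ∈ F) :
    IsHonest F e μ where
  toIsMatching := h
  msg hr := by
    obtain ⟨m', hm⟩ := (h.send hr).2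
    exact ⟨m', hm, Or.inl hc⟩
  mono hf := absurd hc hf.1

theorem getElem?_snoc_iff {α : Type} {l : List α} {a b : α} {i : ℕ} :
    (l ++ [a])[i]? = some b ↔ l[i]? = some b ∨ (i = l.length ∧ a = b) := by
  rcases lt_trichotomy i l.length with h | h | h
  · rw [List.getElem?_append_left h]
    simp [h.ne]
  · subst h
    simp
  · rw [List.getElem?_eq_none (by simp; omega), List.getElem?_eq_none (by omega)]
    simp [h.ne']

theorem isMatching_snoc {a : Act P M} (h : IsMatching e μ) (ha : ∀ c m, a ≠ .recv c m) :
    IsMatching (e ++ [a]) μ := by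
  have hr : ∀ r, IsRecv (e ++ [a]) r → IsRecv e r := by
    rintro r ⟨c, m, hr⟩
    rcases getElem?_snoc_iff.1 hr with h1 | ⟨-, h1⟩
    · exact ⟨c, m, h1⟩
    · exact absurd h1 (ha c m)
  refine ⟨fun {r c m} h1 => ?_, fun h1 h2 h3 => h.inj (hr _ h1) (hr _ h2) h3⟩
  rcases getElem?_snoc_iff.1 h1 with h2 | ⟨-, h2⟩
  · obtain ⟨h3, m', h4⟩ := h.send h2
    exact ⟨h3, m', getElem?_snoc_iff.2 (Or.inl h4)⟩
  · exact absurd h2 (ha c m)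

theorem isMatching_snoc_recv {c : Channel P} {m m' : M} {i : ℕ} (h : IsMatching e μ)
    (hi : e[i]? = some (.send c m')) (hfree : ∀ r, IsRecv e r → μ r ≠ i) :
    IsMatching (e ++ [.recv c m]) (Function.update μ e.length i) := by
  have hr : ∀ r, IsRecv (e ++ [.recv c m]) r → IsRecv e r ∨ r = e.length := by
    rintro r ⟨c, m, hr⟩
    rcases getElem?_snoc_iff.1 hr with h1 | ⟨h1, -⟩
    · exact Or.inl ⟨_, _, h1⟩
    · exact Or.inr h1
  refine ⟨fun {r c' m''} h1 => ?_, fun {r r'} h1 h2 h3 => ?_⟩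
  · rcases getElem?_snoc_iff.1 h1 with h2 | ⟨rfl, h2⟩
    · obtain ⟨h3, m', h4⟩ := h.send h2
      rw [Function.update_of_ne (lt_length_of_getElem? h2).ne]
      exact ⟨h3, m', getElem?_snoc_iff.2 (Or.inl h4)⟩
    · cases h2
      rw [Function.update_self]
      exact ⟨lt_length_of_getElem? hi, m', getElem?_snoc_iff.2 (Or.inl hi)⟩
  · rcases hr r h1 with h4 | rfl <;> rcases hr r' h2 with h5 | rfl
    · rw [Function.update_of_ne h4.lt.ne, Function.update_of_ne h5.lt.ne] at h3
      exact h.inj h4 h5 h3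
    · rw [Function.update_of_ne h4.lt.ne, Function.update_self] at h3
      exact absurd h3 (hfree r h4)
    · rw [Function.update_of_ne h5.lt.ne, Function.update_self] at h3
      exact absurd h3.symm (hfree r' h5)
    · rfl

/-- The pending sends of an honest matching account for the channel contents. -/
structure Pending {S : FIFOSystem P M} (F : Set Failure) (e : List (Act P M)) (μ : ℕ → ℕ)
    (γ : Config S) (q : Channel P → List ℕ) : Prop where
  honest : IsHonest F e μ
  content : ∀ d, List.Forall₂ (fun i m => e[i]? = some (Act.send d m)) (q d) (γ.chan d)
  nodup : ∀ d, (q d).Nodup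
  free : ∀ d, ∀ i ∈ q d, ∀ r, IsRecv e r → μ r ≠ i
  sorted : IsFifo F → ∀ d, (q d).Pairwise (· < ·)
  after : IsFifo F → ∀ d, ∀ i ∈ q d, ∀ r m, e[r]? = some (Act.recv d m) → μ r < i

theorem forall₂_mem_left {α β : Type} {R : α → β → Prop} {l : List α} {w : List β}
    (h : List.Forall₂ R l w) : ∀ i ∈ l, ∃ m, R i m := by
  induction h with
  | nil => simp
  | cons h1 _ ih =>
    intro i hi
    rcases List.mem_cons.1 hi with rfl | hi
    · exact ⟨_, h1⟩
    · exact ih i hi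

/-- Interference is applied to the positions of the sends instead of their messages. By
`Interferes.lift` the new list of positions consists of some of the old ones, and keeps their order
if nothing is reordered; all the listed properties are inherited. -/
theorem exists_lift_pending (hc : Failure.corruption ∉ F) {d : Channel P} {w w' : List M} {l : List ℕ}
    (hl : List.Forall₂ (fun i m => e[i]? = some (Act.send d m)) l w) (hw : Interferes F w w')
    (hn : l.Nodup) (hfree : ∀ i ∈ l, ∀ r, IsRecv e r → μ r ≠ i)
    (hs : IsFifo F → l.Pairwise (· < ·))
    (ha : IsFifo F → ∀ i ∈ l, ∀ r m, e[r]? = some (Act.recv d m) → μ r < i) :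
    ∃ l', List.Forall₂ (fun i m => e[i]? = some (Act.send d m)) l' w' ∧ l'.Nodup ∧
      (∀ i ∈ l', ∀ r, IsRecv e r → μ r ≠ i) ∧ (IsFifo F → l'.Pairwise (· < ·)) ∧
      (IsFifo F → ∀ i ∈ l', ∀ r m, e[r]? = some (Act.recv d m) → μ r < i) := by
  obtain ⟨l', h1, h2, h3⟩ := hw.lift hc l hl
  have hsub : ∀ i ∈ l', i ∈ l := fun i hi => h2.subset hi
  have hn' : l'.Nodup := by
    obtain ⟨l'', h4, h5⟩ := h2
    exact h4.nodup_iff.1 (hn.sublist h5)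
  exact ⟨l', h1, hn', fun i hi => hfree i (hsub i hi), fun hf => (hs hf).sublist (h3 hf.2),
    fun hf i hi => ha hf i (hsub i hi)⟩

/-- One follows, for each channel, the positions of the sends whose messages are in it. A receive is
matched with the position at the head. On lossy queues these positions increase and exceed those of
all sends received from, so receives get their sends in order. -/
theorem exists_pending {S : FIFOSystem P M} {γ : Config S} (hc : Failure.corruption ∉ F)
    (h : Steps (failureModel M F) S S.initConfig e γ) : ∃ μ q, Pending F e μ γ q := by
  classical
  induction e using List.reverseRecOn generalizing γ with
  | nil =>
    cases h
    refine ⟨id, fun _ => [], ⟨⟨⟨?_, ?_⟩, ?_, ?_⟩, ?_, ?_, ?_, ?_, ?_⟩⟩ <;>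
      simp [IsRecv, FIFOSystem.initConfig]
  | append_singleton e a ih =>
    obtain ⟨γ₀, h0, hstep⟩ := h.split
    obtain ⟨μ, q, hq⟩ := ih h0
    by_cases ha : ∃ c m, a = .recv c m
    · obtain ⟨c, m, rfl⟩ := ha
      cases hstep with
      | recv _ _ _ _ hchan hother =>
      obtain ⟨l, h1, h2, h3, h4, h5⟩ := exists_lift_pending hc (hq.content c)
        hchan (hq.nodup c) (hq.free c) (fun hf => hq.sorted hf c) (fun hf => hq.after hf c)
      have hoth : ∀ d, ∃ l', d ≠ c →
          List.Forall₂ (fun i m => e[i]? = some (Act.send d m)) l' (γ.chan d) ∧ l'.Nodup ∧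
          (∀ i ∈ l', ∀ r, IsRecv e r → μ r ≠ i) ∧ (IsFifo F → l'.Pairwise (· < ·)) ∧
          (IsFifo F → ∀ i ∈ l', ∀ r m, e[r]? = some (Act.recv d m) → μ r < i) := by
        intro d
        by_cases hd : d = c
        · exact ⟨[], fun h => absurd hd h⟩
        · obtain ⟨l', hl'⟩ := exists_lift_pending hc (hq.content d)
            (hother d hd) (hq.nodup d) (hq.free d) (fun hf => hq.sorted hf d)
            (fun hf => hq.after hf d)
          exact ⟨l', fun _ => hl'⟩
      choose q' hq' using hoth
      -- The head of the list that survives the interference is the send that the new receive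
      -- consumes.
      obtain ⟨i, l, hi, hl, rfl⟩ : ∃ i l'', e[i]? = some (Act.send c m) ∧
          List.Forall₂ (fun i m => e[i]? = some (Act.send c m)) l'' (γ.chan c) ∧ l = i :: l'' := by
        cases h1 with
        | cons h6 h7 => exact ⟨_, _, h6, h7, rfl⟩
      have hold : ∀ d m, ∀ i, e[i]? = some (Act.send d m) →
          (e ++ [Act.recv c m])[i]? = some (Act.send d m) := fun d m i hi =>
        getElem?_snoc_iff.2 (Or.inl hi)
      have hnewr : ∀ {r c' m'}, (e ++ [Act.recv c m])[r]? = some (Act.recv c' m') →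
          e[r]? = some (Act.recv c' m') ∨ (r = e.length ∧ c = c' ∧ m = m') := by
        intro r c' m' hr
        rcases getElem?_snoc_iff.1 hr with h6 | ⟨h6, h7⟩
        · exact Or.inl h6
        · cases h7
          exact Or.inr ⟨h6, rfl, rfl⟩
      have hother_ne : ∀ d, d ≠ c → ∀ k ∈ q' d, k ≠ i := by
        rintro d hd k hk rfl
        obtain ⟨m', hm'⟩ := forall₂_mem_left (hq' d hd).1 k hk
        rw [hi] at hm'
        cases hm'
        exact hd rfl
      refine ⟨Function.update μ e.length i, fun d => if d = c then l else q' d,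
        ⟨⟨isMatching_snoc_recv hq.honest.toIsMatching hi (h3 i (by simp)), ?_, ?_⟩,
          ?_, ?_, ?_, ?_, ?_⟩⟩
      · intro r c' m' hr
        rcases hnewr hr with h6 | ⟨rfl, rfl, rfl⟩
        · obtain ⟨m'', h7, h8⟩ := hq.honest.msg h6
          rw [Function.update_of_ne (lt_length_of_getElem? h6).ne]
          exact ⟨m'', getElem?_snoc_iff.2 (Or.inl h7), h8⟩
        · rw [Function.update_self]
          exact ⟨m, getElem?_snoc_iff.2 (Or.inl hi), Or.inr rfl⟩
      · intro hf r r' c' m1 m2 hlt hr hr'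
        have hrl : r < e.length := by
          have := lt_length_of_getElem? hr'
          simp at this
          omega
        rcases hnewr hr with h6 | ⟨h6, -, -⟩
        swap
        · omega
        rw [Function.update_of_ne (lt_length_of_getElem? h6).ne]
        rcases hnewr hr' with h7 | ⟨rfl, rfl, rfl⟩
        · rw [Function.update_of_ne (lt_length_of_getElem? h7).ne]
          exact hq.honest.mono hf hlt h6 h7
        · rw [Function.update_self]
          exact h5 hf i (by simp) r _ h6
      · intro d
        by_cases hd : d = c
        · subst hd
          simp only [if_true]
          exact hl.imp fun _ _ h => getElem?_snoc_iff.2 (Or.inl h)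
        · simp only [if_neg hd]
          exact (hq' d hd).1.imp fun _ _ h => getElem?_snoc_iff.2 (Or.inl h)
      · intro d
        by_cases hd : d = c
        · simp only [if_pos hd]
          exact (List.nodup_cons.1 h2).2
        · simp only [if_neg hd]
          exact (hq' d hd).2.1
      · intro d k hk r hr
        have hr' : IsRecv e r ∨ r = e.length := by
          obtain ⟨c', m', hr⟩ := hr
          rcases hnewr hr with h6 | ⟨h6, -, -⟩
          · exact Or.inl ⟨_, _, h6⟩
          · exact Or.inr h6
        by_cases hd : d = c
        · simp only [if_pos hd] at hk
          rcases hr' with hr' | rfl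
          · rw [Function.update_of_ne hr'.lt.ne]
            exact h3 k (by simp [hk]) r hr'
          · rw [Function.update_self]
            rintro rfl
            exact (List.nodup_cons.1 h2).1 hk
        · simp only [if_neg hd] at hk
          rcases hr' with hr' | rfl
          · rw [Function.update_of_ne hr'.lt.ne]
            exact (hq' d hd).2.2.1 k hk r hr'
          · rw [Function.update_self]
            exact (hother_ne d hd k hk).symm
      · intro hf d
        by_cases hd : d = c
        · simp only [if_pos hd]
          exact (List.pairwise_cons.1 (h4 hf)).2
        · simp only [if_neg hd]
          exact (hq' d hd).2.2.2.1 hf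
      · intro hf d k hk r m' hr
        by_cases hd : d = c
        · simp only [if_pos hd] at hk
          rcases hnewr hr with h6 | ⟨rfl, rfl, rfl⟩
          · rw [Function.update_of_ne (lt_length_of_getElem? h6).ne]
            subst hd
            exact h5 hf k (by simp [hk]) r m' h6
          · rw [Function.update_self]
            exact (List.pairwise_cons.1 (h4 hf)).1 k hk
        · simp only [if_neg hd] at hk
          rcases hnewr hr with h6 | ⟨rfl, rfl, rfl⟩
          · rw [Function.update_of_ne (lt_length_of_getElem? h6).ne]
            exact (hq' d hd).2.2.2.2 hf k hk r m' h6
          · exact absurd rfl hd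
    · push Not at ha
      have hnewr : ∀ {r : ℕ} {c' : Channel P} {m' : M}, (e ++ [a])[r]? = some (Act.recv c' m') →
          e[r]? = some (Act.recv c' m') := by
        intro r c' m' hr
        rcases getElem?_snoc_iff.1 hr with h6 | ⟨h6, h7⟩
        · exact h6
        · exact absurd h7 (ha _ _)
      have hnewr' : ∀ r, IsRecv (e ++ [a]) r → IsRecv e r := by
        rintro r ⟨c, m, hr⟩
        exact ⟨c, m, hnewr hr⟩
      -- Before interference acts, the only change is that a send appends its own position to the
      -- list of its channel.
      have hlist : ∀ d, ∃ w l, List.Forall₂ (fun i m => (e ++ [a])[i]? = some (Act.send d m)) l w ∧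
          Interferes F w (γ.chan d) ∧ (l = q d ∨ l = q d ++ [e.length]) := by
        intro d
        have hold : List.Forall₂ (fun i m => (e ++ [a])[i]? = some (Act.send d m)) (q d)
            (γ₀.chan d) := (hq.content d).imp fun i m h => getElem?_snoc_iff.2 (Or.inl h)
        cases hstep with
        | send c m _ _ hchan hother =>
          by_cases hd : d = c
          · subst hd
            exact ⟨_, _, List.rel_append hold
              (.cons (getElem?_snoc_iff.2 (Or.inr ⟨rfl, rfl⟩)) .nil), hchan, Or.inr rfl⟩
          · exact ⟨_, _, hold, hother d hd, Or.inl rfl⟩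
        | recv c m _ _ _ _ => exact absurd rfl (ha c m)
        | internal p x _ _ hchan => exact ⟨_, _, hold, hchan d, Or.inl rfl⟩
      have hlt : ∀ d, ∀ i ∈ q d, i < e.length := by
        intro d i hi
        obtain ⟨m, hm⟩ := forall₂_mem_left (hq.content d) i hi
        exact lt_length_of_getElem? hm
      have hmain : ∀ d, ∃ l', List.Forall₂ (fun i m => (e ++ [a])[i]? = some (Act.send d m)) l'
          (γ.chan d) ∧ l'.Nodup ∧
          (∀ i ∈ l', ∀ r, IsRecv (e ++ [a]) r → μ r ≠ i) ∧ (IsFifo F → l'.Pairwise (· < ·)) ∧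
          (IsFifo F → ∀ i ∈ l', ∀ r m, (e ++ [a])[r]? = some (Act.recv d m) → μ r < i) := by
        intro d
        obtain ⟨w, l, h1, h2, h3⟩ := hlist d
        have hmem : ∀ i ∈ l, i ∈ q d ∨ i = e.length := by
          intro i hi
          rcases h3 with rfl | rfl
          · exact Or.inl hi
          · simpa using hi
        refine exists_lift_pending hc h1 h2 ?_ ?_ ?_ ?_
        · rcases h3 with rfl | rfl
          · exact hq.nodup d
          · rw [List.nodup_append]
            refine ⟨hq.nodup d, by simp, ?_⟩
            intro x hx y hy
            have := hlt d x hx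
            simp only [List.mem_singleton] at hy
            omega
        · intro i hi r hr
          rcases hmem i hi with h4 | rfl
          · exact hq.free d i h4 r (hnewr' r hr)
          · have h5 := hnewr' r hr
            have := hq.honest.lt h5
            have := h5.lt
            omega
        · intro hf
          rcases h3 with rfl | rfl
          · exact hq.sorted hf d
          · rw [List.pairwise_append]
            refine ⟨hq.sorted hf d, by simp, ?_⟩
            intro x hx y hy
            have := hlt d x hx
            simp only [List.mem_singleton] at hy
            omega
        · intro hf i hi r m hr
          rcases hmem i hi with h4 | rfl
          · exact hq.after hf d i h4 r m (hnewr hr)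
          · have h5 : IsRecv e r := ⟨_, _, hnewr hr⟩
            have := hq.honest.lt h5
            have := h5.lt
            omega
      choose q' hq' using hmain
      refine ⟨μ, q', ⟨⟨isMatching_snoc hq.honest.toIsMatching ha, ?_, ?_⟩,
        fun d => (hq' d).1, fun d => (hq' d).2.1, fun d => (hq' d).2.2.1,
        fun hf d => (hq' d).2.2.2.1 hf, fun hf d => (hq' d).2.2.2.2 hf⟩⟩
      · intro r c m hr
        obtain ⟨m', h1, h2⟩ := hq.honest.msg (hnewr hr)
        exact ⟨m', getElem?_snoc_iff.2 (Or.inl h1), h2⟩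
      · intro hf r r' c m m' hrr hr hr'
        exact hq.honest.mono hf hrr (hnewr hr) (hnewr hr')

/-- Every matching of an execution can be replaced by one that respects messages. -/
theorem exists_isHonest {S : FIFOSystem P M} (hμ : IsMatching e μ)
    (h : IsExecutionOf (failureModel M F) S e) : ∃ ν, IsHonest F e ν := by
  by_cases hc : Failure.corruption ∈ F
  -- With corruption any message is acceptable and the condition on the order is void.
  · exact ⟨μ, hμ.isHonest_of_corruption hc⟩
  · obtain ⟨γ, hγ⟩ := h
    obtain ⟨ν, q, hν⟩ := exists_pending hc hγ
    exact ⟨ν, hν.honest⟩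

end Honest


/-! ### The search graph -/

/-- Causal status of a process: not (known to be) causally after the chosen send, causally after
it, suspended after a receive until its parent sends again, or suspended before a receive until
its parent sends again. -/
inductive Mode (P : Type) : Type where
  | idle
  | active
  | frozen (f : P)
  | waiting (f : P)

/-- The process may act. -/
def Mode.Free {P : Type} (a : Mode P) : Prop := a = .idle ∨ a = .active

/-- The process is causally after the chosen send. -/
def Mode.Hot {P : Type} (a : Mode P) : Prop := a = .active ∨ ∃ f, a = .waiting f

/-- Nodes of the search graph: control states, modes, and whether the chosen message is
available on the chosen channel. -/
structure SearchNode {P M : Type} (S : FIFOSystem P M) where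
  state : ∀ p, Fin (S.numStates p)
  mode : P → Mode P
  flag : Bool

/-- Change of the modes of sender and receiver when a send on `d` stays unreceived. -/
inductive SendModes {P : Type} (c d : Channel P) : Mode P → Mode P → Mode P → Mode P → Prop
  | plain {a b : Mode P} : a.Free → SendModes c d a b a b
  | start {b : Mode P} : d = c → SendModes c d .idle b .active b
  | thaw : SendModes c d .active (.frozen d.1.1) .active .active
  | invite : SendModes c d .idle .active .active (.waiting d.1.1)

/-- Change of the modes of sender and receiver when a message on `d` is received at once. -/
inductive SyncModes {P : Type} (c d : Channel P) : Mode P → Mode P → Mode P → Mode P → Prop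
  | plain {a b : Mode P} : a.Free → b.Free → SyncModes c d a b a b
  | spread {a b : Mode P} : a.Free → b.Free → a = .active ∨ b = .active →
      SyncModes c d a b .active .active
  | freeze {a : Mode P} : a.Free → SyncModes c d a .idle a (.frozen d.1.1)
  | startFreeze : d = c → SyncModes c d .idle .idle .active (.frozen d.1.1)
  | release {a : Mode P} : a.Free → SyncModes c d a (.waiting d.1.1) a .active

/-- Moves of the search graph for channel `c` and message `m₀`. -/
inductive Move {P M : Type} (F : Set Failure) {S : FIFOSystem P M} (c : Channel P) (m₀ : M) :
    SearchNode S → SearchNode S → Prop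
  | internal {n n' : SearchNode S} (p : P) (x : ℕ)
      (htrans : (n.state p, Act.internal p x, n'.state p) ∈ S.trans p)
      (hstate : ∀ r, r ≠ p → n'.state r = n.state r)
      (hfree : (n.mode p).Free)
      (hmode : n'.mode = n.mode)
      (hflag : n'.flag = n.flag) : Move F c m₀ n n'
  | send {n n' : SearchNode S} (d : Channel P) (m : M)
      (htrans : (n.state d.1.1, Act.send d m, n'.state d.1.1) ∈ S.trans d.1.1)
      (hstate : ∀ r, r ≠ d.1.1 → n'.state r = n.state r)
      (hmodes : SendModes c d (n.mode d.1.1) (n.mode d.1.2) (n'.mode d.1.1) (n'.mode d.1.2))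
      (hmode : ∀ r, r ≠ d.1.1 → r ≠ d.1.2 → n'.mode r = n.mode r)
      (hflag : n'.flag = true ↔ n.flag = true ∨ (d = c ∧ MsgOk F m m₀)) : Move F c m₀ n n'
  | sync {n n' : SearchNode S} (d : Channel P) (m m' : M) (hok : MsgOk F m m')
      (htrans : (n.state d.1.1, Act.send d m, n'.state d.1.1) ∈ S.trans d.1.1)
      (htrans' : (n.state d.1.2, Act.recv d m', n'.state d.1.2) ∈ S.trans d.1.2)
      (hstate : ∀ r, r ≠ d.1.1 → r ≠ d.1.2 → n'.state r = n.state r)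
      (hmodes : SyncModes c d (n.mode d.1.1) (n.mode d.1.2) (n'.mode d.1.1) (n'.mode d.1.2))
      (hmode : ∀ r, r ≠ d.1.1 → r ≠ d.1.2 → n'.mode r = n.mode r)
      (hflag : n'.flag = true ↔ n.flag = true ∧ ¬ (IsFifo F ∧ d = c)) : Move F c m₀ n n'

/-- The initial node. -/
def SearchNode.init {P M : Type} (S : FIFOSystem P M) : SearchNode S where
  state := S.init
  mode := fun _ => .idle
  flag := false

/-- At an accepting node, the receiver of `c` is causally after the chosen send and can receive
on `c`. -/
def SearchNode.Accepting {P M : Type} (F : Set Failure) {S : FIFOSystem P M} (c : Channel P)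
    (m₀ : M) (n : SearchNode S) : Prop :=
  n.flag = true ∧ n.mode c.1.2 = .active ∧ (∀ p f, n.mode p ≠ .waiting f) ∧
    ∃ m' q', MsgOk F m₀ m' ∧ (n.state c.1.2, Act.recv c m', q') ∈ S.trans c.1.2

/-! ### Every accepting search yields a cyclic execution -/

section Sound

variable {P M : Type} {F : Set Failure} {S : FIFOSystem P M} {c : Channel P} {m₀ : M}

theorem Mode.Free.not_frozen {a : Mode P} (h : a.Free) (f : P) : a ≠ .frozen f := by
  rintro rfl
  rcases h with h | h <;> cases h

theorem Mode.not_hot_idle : ¬ (Mode.idle : Mode P).Hot := by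
  rintro (h | ⟨g, h⟩) <;> cases h

theorem Mode.not_hot_frozen (f : P) : ¬ (Mode.frozen f : Mode P).Hot := by
  rintro (h | ⟨g, h⟩) <;> cases h

theorem Mode.hot_active : (Mode.active : Mode P).Hot := Or.inl rfl

theorem Mode.hot_waiting (f : P) : (Mode.waiting f : Mode P).Hot := Or.inr ⟨f, rfl⟩

/-- Up to the last receive of the cycle, the delayed execution needs interference only on the
channel of a send, at the moment of that send. All other channels stay as they are. -/
theorem Steps.exists_send {e : List (Act P M)} {γ₀ γ : Config S}
    (h : Steps (failureModel M F) S γ₀ e γ) {d : Channel P} {m : M}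
    {q' : Fin (S.numStates d.1.1)} (ht : (γ.state d.1.1, Act.send d m, q') ∈ S.trans d.1.1)
    {w : List M} (hw : Interferes F (γ.chan d ++ [m]) w) :
    ∃ γ', Steps (failureModel M F) S γ₀ (e ++ [.send d m]) γ' ∧ γ'.state d.1.1 = q' ∧
      (∀ r, r ≠ d.1.1 → γ'.state r = γ.state r) ∧ γ'.chan d = w ∧
      ∀ d', d' ≠ d → γ'.chan d' = γ.chan d' := by
  classical
  refine ⟨⟨Function.update γ.state d.1.1 q', Function.update γ.chan d w⟩,
    h.snoc (.send d m ?_ ?_ ?_ ?_), ?_, ?_, ?_, ?_⟩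
  · simpa using ht
  · exact fun r hr => Function.update_of_ne hr _ _
  · simp only [Function.update_self]
    exact hw
  · intro d' hd'
    simp only [Function.update_of_ne hd']
    exact .refl _
  · simp
  · exact fun r hr => Function.update_of_ne hr _ _
  · simp
  · exact fun d' hd' => Function.update_of_ne hd' _ _

theorem Steps.exists_recv {e : List (Act P M)} {γ₀ γ : Config S}
    (h : Steps (failureModel M F) S γ₀ e γ) {d : Channel P} {m : M}
    {q' : Fin (S.numStates d.1.2)} (ht : (γ.state d.1.2, Act.recv d m, q') ∈ S.trans d.1.2)
    {w : List M} (hw : γ.chan d = m :: w) :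
    ∃ γ', Steps (failureModel M F) S γ₀ (e ++ [.recv d m]) γ' ∧ γ'.state d.1.2 = q' ∧
      (∀ r, r ≠ d.1.2 → γ'.state r = γ.state r) ∧ γ'.chan d = w ∧
      ∀ d', d' ≠ d → γ'.chan d' = γ.chan d' := by
  classical
  refine ⟨⟨Function.update γ.state d.1.2 q', Function.update γ.chan d w⟩,
    h.snoc (.recv d m ?_ ?_ ?_ ?_), ?_, ?_, ?_, ?_⟩
  · simpa using ht
  · exact fun r hr => Function.update_of_ne hr _ _
  · simp only [hw, Function.update_self]
    exact .refl _
  · intro d' hd'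
    simp only [Function.update_of_ne hd']
    exact .refl _
  · simp
  · exact fun r hr => Function.update_of_ne hr _ _
  · simp
  · exact fun d' hd' => Function.update_of_ne hd' _ _

theorem Steps.exists_internal {e : List (Act P M)} {γ₀ γ : Config S}
    (h : Steps (failureModel M F) S γ₀ e γ) {p : P} {x : ℕ}
    {q' : Fin (S.numStates p)} (ht : (γ.state p, Act.internal p x, q') ∈ S.trans p) :
    ∃ γ', Steps (failureModel M F) S γ₀ (e ++ [.internal p x]) γ' ∧ γ'.state p = q' ∧
      (∀ r, r ≠ p → γ'.state r = γ.state r) ∧ γ'.chan = γ.chan := by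
  classical
  refine ⟨⟨Function.update γ.state p q', γ.chan⟩, h.snoc (.internal p x ?_ ?_ ?_), ?_, ?_, rfl⟩
  · simpa using ht
  · exact fun r hr => Function.update_of_ne hr _ _
  · exact fun d => .refl _
  · simp
  · exact fun r hr => Function.update_of_ne hr _ _

open Classical in
/-- The chosen message, on the chosen channel, if it is available. -/
noncomputable def flagPart (c : Channel P) (m₀ : M) (n : SearchNode S) (d : Channel P) : List M :=
  if d = c ∧ n.flag = true then [m₀] else []

/-- The configuration `γ` of the delayed execution agrees with the search node `n`. -/
structure Agrees (c : Channel P) (m₀ : M) (n : SearchNode S) (γ : Config S) : Prop where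
  state : ∀ p, (∀ f, n.mode p ≠ .frozen f) → γ.state p = n.state p
  frozen : ∀ d : Channel P, n.mode d.1.2 = .frozen d.1.1 → ∃ m junk,
    γ.chan d = m :: (flagPart c m₀ n d ++ junk) ∧
    (γ.state d.1.2, Act.recv d m, n.state d.1.2) ∈ S.trans d.1.2
  chan : ∀ d : Channel P, n.mode d.1.2 ≠ .frozen d.1.1 → ∃ junk,
    γ.chan d = flagPart c m₀ n d ++ junk

theorem flagPart_congr {n n' : SearchNode S} {d : Channel P}
    (h : d = c → (n'.flag = true ↔ n.flag = true)) : flagPart c m₀ n' d = flagPart c m₀ n d := by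
  unfold flagPart
  by_cases hd : d = c
  · have h' : n'.flag = n.flag := by rw [Bool.eq_iff_iff]; exact h hd
    rw [h']
  · rw [if_neg (fun hc => hd hc.1), if_neg (fun hc => hd hc.1)]

/-- A send or handshake on `d` concerns the two ends of `d`, the content of `d` and, if `d = c`, the
flag, so agreement need only be checked there. The hypotheses `hr` and `hrs` cover the case that the
receiver is frozen towards another process: its delayed receive from there must be left alone. -/
theorem Agrees.of_eq {n n' : SearchNode S} {γ γ' : Config S} (h : Agrees c m₀ n γ) (d : Channel P)
    (hp : ∀ f, n.mode d.1.1 ≠ .frozen f) (hp' : ∀ f, n'.mode d.1.1 ≠ .frozen f)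
    (hr : ∀ f, f ≠ d.1.1 → (n'.mode d.1.2 = .frozen f ↔ n.mode d.1.2 = .frozen f))
    (hrs : ∀ f, f ≠ d.1.1 → n.mode d.1.2 = .frozen f →
      γ'.state d.1.2 = γ.state d.1.2 ∧ n'.state d.1.2 = n.state d.1.2)
    (hmode : ∀ r, r ≠ d.1.1 → r ≠ d.1.2 → n'.mode r = n.mode r)
    (hn : ∀ r, r ≠ d.1.1 → r ≠ d.1.2 → n'.state r = n.state r)
    (hγ : ∀ r, r ≠ d.1.1 → r ≠ d.1.2 → γ'.state r = γ.state r)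
    (h1 : γ'.state d.1.1 = n'.state d.1.1)
    (h2 : (∀ f, n'.mode d.1.2 ≠ .frozen f) → γ'.state d.1.2 = n'.state d.1.2)
    (hchan : ∀ d', d' ≠ d → γ'.chan d' = γ.chan d')
    (hflag : d ≠ c → (n'.flag = true ↔ n.flag = true))
    (hd : n'.mode d.1.2 = .frozen d.1.1 → ∃ m junk,
      γ'.chan d = m :: (flagPart c m₀ n' d ++ junk) ∧
      (γ'.state d.1.2, Act.recv d m, n'.state d.1.2) ∈ S.trans d.1.2)
    (hd' : n'.mode d.1.2 ≠ .frozen d.1.1 → ∃ junk, γ'.chan d = flagPart c m₀ n' d ++ junk) :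
    Agrees c m₀ n' γ' := by
  have hfl : ∀ d', d' ≠ d → flagPart c m₀ n' d' = flagPart c m₀ n d' := by
    intro d' hne
    refine flagPart_congr fun hc => hflag ?_
    rintro rfl
    exact hne hc
  have hiff : ∀ d' : Channel P, d' ≠ d →
      (n'.mode d'.1.2 = .frozen d'.1.1 ↔ n.mode d'.1.2 = .frozen d'.1.1) := by
    intro d' hne
    by_cases e1 : d'.1.2 = d.1.1
    · rw [e1]
      exact ⟨fun h => absurd h (hp' _), fun h => absurd h (hp _)⟩
    by_cases e2 : d'.1.2 = d.1.2
    · rw [e2]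
      apply hr
      intro e3
      exact hne (Subtype.ext (Prod.ext e3 e2))
    · rw [hmode _ e1 e2]
  constructor
  · intro p hpf
    by_cases e1 : p = d.1.1
    · rw [e1]; exact h1
    by_cases e2 : p = d.1.2
    · subst e2; exact h2 hpf
    · rw [hγ p e1 e2, hn p e1 e2]
      refine h.state p ?_
      rwa [← hmode p e1 e2]
  · intro d' hfr
    by_cases hne : d' = d
    · subst hne
      exact hd hfr
    · have hfr' := (hiff d' hne).1 hfr
      obtain ⟨m, junk, h3, h4⟩ := h.frozen d' hfr'
      refine ⟨m, junk, by rw [hchan d' hne, hfl d' hne, h3], ?_⟩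
      by_cases e1 : d'.1.2 = d.1.1
      · rw [e1] at hfr'
        exact absurd hfr' (hp _)
      by_cases e2 : d'.1.2 = d.1.2
      · have hne1 : d'.1.1 ≠ d.1.1 := fun e3 => hne (Subtype.ext (Prod.ext e3 e2))
        have h5 := hrs d'.1.1 hne1 (by rw [← e2]; exact hfr')
        obtain ⟨⟨p', r'⟩, hpr⟩ := d'
        simp only at e2 h4 ⊢
        subst e2
        rw [h5.1, h5.2]
        exact h4
      · rw [hγ _ e1 e2, hn _ e1 e2]
        exact h4
  · intro d' hfr
    by_cases hne : d' = d
    · subst hne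
      exact hd' hfr
    · obtain ⟨junk, h3⟩ := h.chan d' (fun hc => hfr ((hiff d' hne).2 hc))
      exact ⟨junk, by rw [hchan d' hne, hfl d' hne, h3]⟩

/-- Sending a message, possibly making the chosen message available. -/
theorem exists_flagPart_send (hF : F.Nonempty) {n n' : SearchNode S} {d : Channel P} {m : M}
    (hflag : n'.flag = true ↔ n.flag = true ∨ (d = c ∧ MsgOk F m m₀)) (junk : List M) :
    ∃ junk', Interferes F (flagPart c m₀ n d ++ junk ++ [m]) (flagPart c m₀ n' d ++ junk') := by
  by_cases h : flagPart c m₀ n' d = flagPart c m₀ n d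
  · rw [h, List.append_assoc]
    exact ⟨_, .refl _⟩
  · have hd : d = c := by
      by_contra hd
      exact h (flagPart_congr fun hc => absurd hc hd)
    have hn : n.flag ≠ true := by
      intro hn
      exact h (flagPart_congr fun _ => by rw [hflag]; simp [hn])
    have hn' : n'.flag = true := by
      by_contra hn'
      exact h (flagPart_congr fun _ => ⟨fun h => absurd h hn', fun h => absurd h hn⟩)
    have hm := ((hflag.1 hn').resolve_left hn).2
    have e1 : flagPart c m₀ n d = [] := by simp [flagPart, hn]
    have e2 : flagPart c m₀ n' d = [m₀] := by simp [flagPart, hn', hd]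
    rw [e1, e2]
    exact Interferes.exists_sync hF hm (need := []) (fun _ => rfl) junk

/-- Sending a message that can be received next. -/
theorem exists_flagPart_sync (hF : F.Nonempty) {n n' : SearchNode S} {d : Channel P} {m m' : M}
    (hok : MsgOk F m m') (hflag : n'.flag = true ↔ n.flag = true ∧ ¬ (IsFifo F ∧ d = c))
    (junk : List M) : ∃ junk',
      Interferes F (flagPart c m₀ n d ++ junk ++ [m]) (m' :: (flagPart c m₀ n' d ++ junk')) := by
  by_cases hf : IsFifo F
  · have e2 : flagPart c m₀ n' d = [] := by
      unfold flagPart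
      rw [if_neg]
      rintro ⟨h1, h2⟩
      exact (hflag.1 h2).2 ⟨hf, h1⟩
    rw [e2]
    exact Interferes.exists_sync hF hok (need := []) (fun _ => rfl) _
  · have e2 : flagPart c m₀ n' d = flagPart c m₀ n d := flagPart_congr fun _ => by
      rw [hflag]; simp [hf]
    rw [e2]
    exact Interferes.exists_sync hF hok (fun h => absurd h hf) _

/-- A position is not matched by any receive. -/
def IsUnmatched (e : List (Act P M)) (μ : ℕ → ℕ) (i : ℕ) : Prop := ∀ r, IsRecv e r → μ r ≠ i

/-- Conflict graph edges, and edges that will be present once waiting processes receive. -/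
def VirtualEdge (e : List (Act P M)) (μ : ℕ → ℕ) (n : SearchNode S) (wt : P → ℕ) (a b : ℕ) :
    Prop :=
  NodeEdge e μ a b ∨ ∃ i x f, e[i]? = some x ∧ n.mode x.proc = .waiting f ∧
    nodeOf e μ i = a ∧ wt x.proc = b

/-- Some action of `p` is causally after the send at position `j`. -/
def Reached (e : List (Act P M)) (μ : ℕ → ℕ) (n : SearchNode S) (wt : P → ℕ) (j : ℕ) (p : P) :
    Prop :=
  ∃ i x, e[i]? = some x ∧ x.proc = p ∧ ReflTransGen (VirtualEdge e μ n wt) j (nodeOf e μ i)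

/-- The modes of `n` reflect causality in the delayed execution. -/
structure Causal (c : Channel P) (n : SearchNode S) (e : List (Act P M)) (μ : ℕ → ℕ)
    (wt : P → ℕ) : Prop where
  matching : IsMatching e μ
  waiting : ∀ p f, n.mode p = .waiting f → ∃ (d : Channel P) (m : M), d.1 = (f, p) ∧ d ≠ c ∧
    e[wt p]? = some (.send d m) ∧ IsUnmatched e μ (wt p)
  hot : ∀ p, (n.mode p).Hot → (n.mode c.1.1).Hot
  start : (n.mode c.1.1).Hot → ∃ j m, e[j]? = some (.send c m) ∧ IsUnmatched e μ j ∧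
    ∀ p, (n.mode p).Hot → Reached e μ n wt j p

theorem isRecv_append {e l : List (Act P M)} {i : ℕ} (hi : i < e.length) :
    IsRecv (e ++ l) i ↔ IsRecv e i := by
  unfold IsRecv
  rw [List.getElem?_append_left hi]

theorem nodeOf_append {e l : List (Act P M)} {μ μ' : ℕ → ℕ} (hμ : ∀ r < e.length, μ' r = μ r)
    {i : ℕ} (hi : i < e.length) : nodeOf (e ++ l) μ' i = nodeOf e μ i := by
  unfold nodeOf
  rw [isRecv_append hi, hμ i hi]

theorem getElem?_append_of_some {α : Type} {e l : List α} {i : ℕ} {x : α} (h : e[i]? = some x) :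
    (e ++ l)[i]? = some x := by
  rw [List.getElem?_append_left (lt_length_of_getElem? h), h]

theorem NodeEdge.append {e l : List (Act P M)} {μ μ' : ℕ → ℕ} (hμ : ∀ r < e.length, μ' r = μ r)
    {a b : ℕ} (h : NodeEdge e μ a b) : NodeEdge (e ++ l) μ' a b := by
  obtain ⟨i, i', hlt, hs, h1, h2⟩ := h
  refine ⟨i, i', hlt, ?_, by rw [nodeOf_append hμ hs.lt_left, h1],
    by rw [nodeOf_append hμ hs.lt_right, h2]⟩
  obtain ⟨x, x', h3, h4, h5⟩ := hs
  exact ⟨x, x', getElem?_append_of_some h3, getElem?_append_of_some h4, h5⟩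

theorem Reached.append {e l : List (Act P M)} {μ μ' : ℕ → ℕ} {n n' : SearchNode S}
    {wt wt' : P → ℕ} {j : ℕ} {p : P} (hμ : ∀ r < e.length, μ' r = μ r)
    (hv : ∀ a b, VirtualEdge e μ n wt a b → VirtualEdge (e ++ l) μ' n' wt' a b)
    (h : Reached e μ n wt j p) : Reached (e ++ l) μ' n' wt' j p := by
  obtain ⟨i, x, h1, h2, h3⟩ := h
  refine ⟨i, x, getElem?_append_of_some h1, h2, ?_⟩
  rw [nodeOf_append hμ (lt_length_of_getElem? h1)]
  exact ReflTransGen.mono hv _ _ h3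

theorem VirtualEdge.append {e l : List (Act P M)} {μ μ' : ℕ → ℕ} {n n' : SearchNode S}
    {wt wt' : P → ℕ} (hμ : ∀ r < e.length, μ' r = μ r)
    (hw : ∀ p f, n.mode p = .waiting f → ∃ f', n'.mode p = .waiting f' ∧ wt' p = wt p)
    (a b : ℕ) (h : VirtualEdge e μ n wt a b) : VirtualEdge (e ++ l) μ' n' wt' a b := by
  rcases h with h | ⟨i, x, f, h1, h2, h3, h4⟩
  · exact Or.inl (h.append hμ)
  · obtain ⟨f', h5, h6⟩ := hw _ _ h2
    exact Or.inr ⟨i, x, f', getElem?_append_of_some h1, h5,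
      by rw [nodeOf_append hμ (lt_length_of_getElem? h1), h3], by rw [h6, h4]⟩

theorem IsUnmatched.snoc {e : List (Act P M)} {μ : ℕ → ℕ} {i : ℕ} {a : Act P M}
    (h : IsUnmatched e μ i) (ha : ∀ c m, a ≠ .recv c m) : IsUnmatched (e ++ [a]) μ i := by
  rintro r ⟨c, m, hr⟩
  rcases getElem?_snoc_iff.1 hr with h1 | ⟨-, h1⟩
  · exact h r ⟨c, m, h1⟩
  · exact absurd h1 (ha c m)

theorem IsUnmatched.snoc_recv {e : List (Act P M)} {μ : ℕ → ℕ} {i k : ℕ} {a : Act P M}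
    (h : IsUnmatched e μ i) (hk : k ≠ i) :
    IsUnmatched (e ++ [a]) (Function.update μ e.length k) i := by
  rintro r ⟨c, m, hr⟩
  rcases getElem?_snoc_iff.1 hr with h1 | ⟨rfl, h1⟩
  · rw [Function.update_of_ne (lt_length_of_getElem? h1).ne]
    exact h r ⟨c, m, h1⟩
  · rwa [Function.update_self]

theorem IsMatching.isUnmatched_length {e : List (Act P M)} {μ : ℕ → ℕ} (h : IsMatching e μ) :
    IsUnmatched e μ e.length := by
  intro r hr hc
  have := h.lt hr
  have := hr.lt
  omega

/-- An unmatched action that changes no hot modes, except that it may make its process hot. -/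
theorem Causal.snoc {n n' : SearchNode S} {e : List (Act P M)} {μ : ℕ → ℕ} {wt : P → ℕ}
    (h : Causal c n e μ wt) {a : Act P M} (ha : ∀ c m, a ≠ .recv c m)
    (hw : ∀ p f, n'.mode p = .waiting f ↔ n.mode p = .waiting f)
    (hhot : ∀ p, (n'.mode p).Hot ↔ (n.mode p).Hot) : Causal c n' (e ++ [a]) μ wt where
  matching := isMatching_snoc h.matching ha
  waiting p f hp := by
    obtain ⟨d, m, h1, h2, h3, h4⟩ := h.waiting p f ((hw p f).1 hp)
    exact ⟨d, m, h1, h2, getElem?_append_of_some h3, h4.snoc ha⟩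
  hot p hp := (hhot _).2 (h.hot p ((hhot p).1 hp))
  start hc := by
    obtain ⟨j, m, h1, h2, h3⟩ := h.start ((hhot _).1 hc)
    refine ⟨j, m, getElem?_append_of_some h1, h2.snoc ha, fun p hp => ?_⟩
    exact (h3 p ((hhot p).1 hp)).append (fun _ _ => rfl)
      (VirtualEdge.append (fun _ _ => rfl) fun p f hpf => ⟨f, (hw p f).2 hpf, rfl⟩)

/-- The chosen send happens. -/
theorem Causal.start_send {n n' : SearchNode S} {e : List (Act P M)} {μ : ℕ → ℕ} {wt : P → ℕ}
    (h : Causal c n e μ wt) {m : M} (hc : n.mode c.1.1 = .idle)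
    (hhot : ∀ p, (n'.mode p).Hot ↔ (n.mode p).Hot ∨ p = c.1.1)
    (hw : ∀ p f, n'.mode p = .waiting f → n.mode p = .waiting f) :
    Causal c n' (e ++ [.send c m]) μ wt where
  matching := isMatching_snoc h.matching (by simp)
  waiting p f hp := by
    have := h.hot p (by rw [hw p f hp]; exact Mode.hot_waiting f)
    rw [hc] at this
    exact absurd this Mode.not_hot_idle
  hot p hp := (hhot _).2 (Or.inr rfl)
  start _ := by
    refine ⟨e.length, m, by simp, h.matching.isUnmatched_length.snoc (by simp), fun p hp => ?_⟩
    rcases (hhot p).1 hp with h1 | rfl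
    · have := h.hot p h1
      rw [hc] at this
      exact absurd this Mode.not_hot_idle
    · refine ⟨e.length, .send c m, by simp, rfl, ?_⟩
      rw [nodeOf_not_recv (not_isRecv_of_send (c := c) (m := m) (by simp))]

/-- An idle process sends to a process that is causally after the chosen send and will receive
later. -/
theorem Causal.invite {n n' : SearchNode S} {e : List (Act P M)} {μ : ℕ → ℕ} {wt : P → ℕ}
    (h : Causal c n e μ wt) {d : Channel P} {m : M} (hp : n.mode d.1.1 = .idle)
    (hr : n.mode d.1.2 = .active) (hp' : n'.mode d.1.1 = .active)
    (hr' : n'.mode d.1.2 = .waiting d.1.1)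
    (hmode : ∀ r, r ≠ d.1.1 → r ≠ d.1.2 → n'.mode r = n.mode r) :
    ∃ wt', Causal c n' (e ++ [.send d m]) μ wt' := by
  classical
  have hwhot : (n.mode c.1.1).Hot := h.hot d.1.2 (by rw [hr]; exact Mode.hot_active)
  -- The sender of `c` is hot as soon as any process is, whereas the inviting process is idle. Hence
  -- an invitation is never the chosen send.
  have hdc : d ≠ c := by
    rintro rfl
    rw [hp] at hwhot
    exact Mode.not_hot_idle hwhot
  have hne : d.1.2 ≠ d.1.1 := d.2.symm
  have hold : ∀ p f, n.mode p = .waiting f → p ≠ d.1.1 ∧ p ≠ d.1.2 := by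
    intro p f hpf
    constructor
    · rintro rfl; rw [hp] at hpf; cases hpf
    · rintro rfl; rw [hr] at hpf; cases hpf
  have hhot : ∀ p, (n.mode p).Hot → (n'.mode p).Hot := by
    intro p h1
    by_cases e1 : p = d.1.1
    · rw [e1, hp']; exact Mode.hot_active
    by_cases e2 : p = d.1.2
    · rw [e2, hr']; exact Mode.hot_waiting _
    · rwa [hmode p e1 e2]
  refine ⟨Function.update wt d.1.2 e.length, isMatching_snoc h.matching (by simp), ?_,
    fun p _ => hhot _ hwhot, fun _ => ?_⟩
  · intro p f hpf
    by_cases e2 : p = d.1.2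
    · subst e2
      rw [hr'] at hpf
      cases hpf
      refine ⟨d, m, rfl, hdc, by simp, ?_⟩
      rw [Function.update_self]
      exact h.matching.isUnmatched_length.snoc (by simp)
    · have e1 : p ≠ d.1.1 := by rintro rfl; rw [hp'] at hpf; cases hpf
      rw [hmode p e1 e2] at hpf
      obtain ⟨d', m', h1, h2, h3, h4⟩ := h.waiting p f hpf
      rw [Function.update_of_ne e2]
      exact ⟨d', m', h1, h2, getElem?_append_of_some h3, h4.snoc (by simp)⟩
  · obtain ⟨j, m', h1, h2, h3⟩ := h.start hwhot
    have hv : ∀ a b, VirtualEdge e μ n wt a b → VirtualEdge (e ++ [.send d m]) μ n'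
        (Function.update wt d.1.2 e.length) a b := by
      refine VirtualEdge.append (fun _ _ => rfl) fun p f hpf => ⟨f, ?_, ?_⟩
      · rw [hmode p (hold p f hpf).1 (hold p f hpf).2, hpf]
      · rw [Function.update_of_ne (hold p f hpf).2]
    refine ⟨j, m', getElem?_append_of_some h1, h2.snoc (by simp), fun p hph => ?_⟩
    by_cases e1 : p = d.1.1
    · obtain ⟨i, x, h4, h5, h6⟩ := h3 d.1.2 (by rw [hr]; exact Mode.hot_active)
      refine ⟨e.length, .send d m, by simp, e1.symm, ?_⟩
      rw [nodeOf_not_recv (not_isRecv_of_send (c := d) (m := m) (by simp))]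
      -- The sender is reached through the edge from an action of the receiver to the new send,
      -- which becomes genuine once the receiver receives.
      refine (ReflTransGen.mono hv _ _ h6).tail (Or.inr ⟨i, x, d.1.1, getElem?_append_of_some h4, ?_, ?_, ?_⟩)
      · rw [h5, hr']
      · exact nodeOf_append (fun _ _ => rfl) (lt_length_of_getElem? h4)
      · rw [h5, Function.update_self]
    · refine (h3 p ?_).append (fun _ _ => rfl) hv
      by_cases e2 : p = d.1.2
      · rw [e2, hr]; exact Mode.hot_active
      · rwa [← hmode p e1 e2]

/-- A send that is received at once. -/
theorem Causal.sync {n n' : SearchNode S} {e : List (Act P M)} {μ : ℕ → ℕ} {wt : P → ℕ}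
    (h : Causal c n e μ wt) {d : Channel P} {m m' : M}
    (hw : ∀ p f, n'.mode p = .waiting f ↔ n.mode p = .waiting f)
    (hhot : ∀ p, (n'.mode p).Hot → (n.mode p).Hot ∨
      (((n.mode d.1.1).Hot ∨ (n.mode d.1.2).Hot) ∧ (p = d.1.1 ∨ p = d.1.2)))
    (hhot' : ∀ p, (n.mode p).Hot → (n'.mode p).Hot) :
    ∃ μ', Causal c n' (e ++ [.send d m] ++ [.recv d m']) μ' wt := by
  have hm1 : IsMatching (e ++ [.send d m]) μ := isMatching_snoc h.matching (by simp)
  have hlen : (e ++ [Act.send d m]).length = e.length + 1 := by simp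
  have hfree : IsUnmatched (e ++ [.send d m]) μ e.length :=
    h.matching.isUnmatched_length.snoc (by simp)
  set μ' := Function.update μ (e ++ [Act.send d m]).length e.length with hμ'
  have hm2 : IsMatching (e ++ [.send d m] ++ [.recv d m']) μ' :=
    isMatching_snoc_recv hm1 (m' := m) (by simp) hfree
  have hagree : ∀ r < e.length, μ' r = μ r := by
    intro r hr
    rw [hμ', Function.update_of_ne (by omega)]
  have hsend : (e ++ [Act.send d m] ++ [.recv d m'])[e.length]? = some (.send d m) := by simp
  have hrecv : (e ++ [Act.send d m] ++ [.recv d m'])[e.length + 1]? = some (.recv d m') := by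
    simp
  have hn1 : nodeOf (e ++ [Act.send d m] ++ [.recv d m']) μ' e.length = e.length :=
    nodeOf_not_recv (not_isRecv_of_send hsend)
  have hn2 : nodeOf (e ++ [Act.send d m] ++ [.recv d m']) μ' (e.length + 1) = e.length := by
    rw [nodeOf_recv ⟨_, _, hrecv⟩, hμ', hlen, Function.update_self]
  have hun : ∀ i, i < e.length → IsUnmatched e μ i →
      IsUnmatched (e ++ [.send d m] ++ [.recv d m']) μ' i := fun i hi hu =>
    (hu.snoc (by simp)).snoc_recv (by omega)
  have hwhot : ∀ p, (n'.mode p).Hot → (n.mode c.1.1).Hot := by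
    intro p hp
    rcases hhot p hp with h1 | ⟨h1 | h1, -⟩
    · exact h.hot p h1
    · exact h.hot _ h1
    · exact h.hot _ h1
  refine ⟨μ', hm2, ?_, fun p hp => hhot' _ (hwhot p hp), fun hc => ?_⟩
  · intro p f hpf
    obtain ⟨d', m'', h1, h2, h3, h4⟩ := h.waiting p f ((hw p f).1 hpf)
    rw [List.append_assoc] at hun ⊢
    exact ⟨d', m'', h1, h2, getElem?_append_of_some h3, hun _ (lt_length_of_getElem? h3) h4⟩
  · obtain ⟨j, m'', h1, h2, h3⟩ := h.start (hwhot _ hc)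
    rw [List.append_assoc] at *
    have hv : ∀ a b, VirtualEdge e μ n wt a b →
        VirtualEdge (e ++ ([.send d m] ++ [.recv d m'])) μ' n' wt a b :=
      VirtualEdge.append hagree fun p f hpf => ⟨f, (hw p f).2 hpf, rfl⟩
    refine ⟨j, m'', getElem?_append_of_some h1, hun j (lt_length_of_getElem? h1) h2,
      fun p hp => ?_⟩
    rcases hhot p hp with h4 | ⟨h4, h5⟩
    · exact (h3 p h4).append hagree hv
    -- Whichever end was hot, an action of it precedes the new pair on the same process, so the node
    -- of the pair is reached, and with it both ends.
    · have hreach : ReflTransGen (VirtualEdge (e ++ ([.send d m] ++ [.recv d m'])) μ' n' wt) j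
          e.length := by
        rcases h4 with h4 | h4
        · obtain ⟨i, x, h6, h7, h8⟩ := h3 _ h4
          have hi := lt_length_of_getElem? h6
          refine (ReflTransGen.mono hv _ _ h8).tail (Or.inl ⟨i, e.length, hi,
            ⟨x, _, getElem?_append_of_some h6, hsend, h7⟩, nodeOf_append hagree hi, hn1⟩)
        · obtain ⟨i, x, h6, h7, h8⟩ := h3 _ h4
          have hi := lt_length_of_getElem? h6
          refine (ReflTransGen.mono hv _ _ h8).tail (Or.inl ⟨i, e.length + 1, by omega,
            ⟨x, _, getElem?_append_of_some h6, hrecv, h7⟩, nodeOf_append hagree hi, hn2⟩)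
      rcases h5 with rfl | rfl
      · exact ⟨e.length, _, hsend, rfl, by rwa [hn1]⟩
      · exact ⟨e.length + 1, _, hrecv, rfl, by rwa [hn2]⟩

/-- A waiting process receives. -/
theorem Causal.release {n n' : SearchNode S} {e : List (Act P M)} {μ : ℕ → ℕ} {wt : P → ℕ}
    (h : Causal c n e μ wt) {d : Channel P} {m m' : M}
    (hr : n.mode d.1.2 = .waiting d.1.1) (hr' : n'.mode d.1.2 = .active)
    (hmode : ∀ r, r ≠ d.1.2 → n'.mode r = n.mode r) :
    ∃ μ', Causal c n' (e ++ [.send d m] ++ [.recv d m']) μ' wt := by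
  obtain ⟨d', m₁, hd', hdc, hwt, hun⟩ := h.waiting _ _ hr
  have hdd : d' = d := Subtype.ext hd'
  subst hdd
  have hm1 : IsMatching (e ++ [.send d' m]) μ := isMatching_snoc h.matching (by simp)
  have hlen : (e ++ [Act.send d' m]).length = e.length + 1 := by simp
  -- The receive is matched with the old send of the invitation; the send just performed stays
  -- unmatched.
  set μ' := Function.update μ (e ++ [Act.send d' m]).length (wt d'.1.2) with hμ'
  have hm2 : IsMatching (e ++ [.send d' m] ++ [.recv d' m']) μ' :=
    isMatching_snoc_recv hm1 (getElem?_append_of_some hwt) (hun.snoc (by simp))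
  have hagree : ∀ r < e.length, μ' r = μ r := by
    intro r hr
    rw [hμ', Function.update_of_ne (by omega)]
  have hrecv : (e ++ [Act.send d' m] ++ [.recv d' m'])[e.length + 1]? = some (.recv d' m') := by
    simp
  have hn2 : nodeOf (e ++ [Act.send d' m] ++ [.recv d' m']) μ' (e.length + 1) = wt d'.1.2 := by
    rw [nodeOf_recv ⟨_, _, hrecv⟩, hμ', hlen, Function.update_self]
  have hhot : ∀ p, (n'.mode p).Hot ↔ (n.mode p).Hot := by
    intro p
    by_cases e2 : p = d'.1.2
    · subst e2
      rw [hr, hr']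
      exact ⟨fun _ => Mode.hot_waiting _, fun _ => Mode.hot_active⟩
    · rw [hmode p e2]
  refine ⟨μ', hm2, ?_, fun p hp => (hhot _).2 (h.hot p ((hhot p).1 hp)), fun hc => ?_⟩
  · intro p f hpf
    have e2 : p ≠ d'.1.2 := by rintro rfl; rw [hr'] at hpf; cases hpf
    rw [hmode p e2] at hpf
    obtain ⟨d₂, m₂, h1, h2, h3, h4⟩ := h.waiting p f hpf
    refine ⟨d₂, m₂, h1, h2, getElem?_append_of_some (getElem?_append_of_some h3),
      (h4.snoc (by simp)).snoc_recv ?_⟩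
    intro heq
    rw [heq, h3] at hwt
    cases hwt
    rw [h1] at e2
    exact e2 rfl
  · obtain ⟨j, m₂, h1, h2, h3⟩ := h.start ((hhot _).1 hc)
    refine ⟨j, m₂, getElem?_append_of_some (getElem?_append_of_some h1),
      (h2.snoc (by simp)).snoc_recv ?_, fun p hp => ?_⟩
    · intro heq
      rw [heq, h1] at hwt
      cases hwt
      exact hdc rfl
    rw [List.append_assoc] at *
    refine (h3 p ((hhot p).1 hp)).append hagree fun a b hab => ?_
    rcases hab with hab | ⟨i, x, f, h4, h5, h6, h7⟩
    · exact Or.inl (hab.append hagree)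
    · have hi := lt_length_of_getElem? h4
      -- The anticipated edges of the waiting process become real: its receive comes after all its
      -- actions and its node is the invitation.
      by_cases e2 : x.proc = d'.1.2
      · refine Or.inl ⟨i, e.length + 1, by omega, ⟨x, _, getElem?_append_of_some h4, hrecv, e2⟩,
          ?_, ?_⟩
        · rw [nodeOf_append hagree hi, h6]
        · rw [hn2, ← h7, e2]
      · exact Or.inr ⟨i, x, f, getElem?_append_of_some h4, by rw [hmode _ e2, h5],
          by rw [nodeOf_append hagree hi, h6], h7⟩

theorem sendModes_iff {c d : Channel P} {a b a' b' : Mode P} : SendModes c d a b a' b' ↔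
    (a.Free ∧ a' = a ∧ b' = b) ∨ (d = c ∧ a = .idle ∧ a' = .active ∧ b' = b) ∨
    (a = .active ∧ b = .frozen d.1.1 ∧ a' = .active ∧ b' = .active) ∨
    (a = .idle ∧ b = .active ∧ a' = .active ∧ b' = .waiting d.1.1) := by
  constructor
  · rintro (h | h | _ | _)
    · exact Or.inl ⟨h, rfl, rfl⟩
    · exact Or.inr (Or.inl ⟨h, rfl, rfl, rfl⟩)
    · exact Or.inr (Or.inr (Or.inl ⟨rfl, rfl, rfl, rfl⟩))
    · exact Or.inr (Or.inr (Or.inr ⟨rfl, rfl, rfl, rfl⟩))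
  · rintro (⟨h, rfl, rfl⟩ | ⟨h, rfl, rfl, rfl⟩ | ⟨rfl, rfl, rfl, rfl⟩ | ⟨rfl, rfl, rfl, rfl⟩)
    · exact .plain h
    · exact .start h
    · exact .thaw
    · exact .invite

theorem syncModes_iff {c d : Channel P} {a b a' b' : Mode P} : SyncModes c d a b a' b' ↔
    (a.Free ∧ b.Free ∧ a' = a ∧ b' = b) ∨
    (a.Free ∧ b.Free ∧ (a = .active ∨ b = .active) ∧ a' = .active ∧ b' = .active) ∨
    (a.Free ∧ b = .idle ∧ a' = a ∧ b' = .frozen d.1.1) ∨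
    (d = c ∧ a = .idle ∧ b = .idle ∧ a' = .active ∧ b' = .frozen d.1.1) ∨
    (a.Free ∧ b = .waiting d.1.1 ∧ a' = a ∧ b' = .active) := by
  constructor
  · rintro (⟨h1, h2⟩ | ⟨h1, h2, h3⟩ | h1 | h1 | h1)
    · exact Or.inl ⟨h1, h2, rfl, rfl⟩
    · exact Or.inr (Or.inl ⟨h1, h2, h3, rfl, rfl⟩)
    · exact Or.inr (Or.inr (Or.inl ⟨h1, rfl, rfl, rfl⟩))
    · exact Or.inr (Or.inr (Or.inr (Or.inl ⟨h1, rfl, rfl, rfl, rfl⟩)))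
    · exact Or.inr (Or.inr (Or.inr (Or.inr ⟨h1, rfl, rfl, rfl⟩)))
  · rintro (⟨h1, h2, rfl, rfl⟩ | ⟨h1, h2, h3, rfl, rfl⟩ | ⟨h1, rfl, rfl, rfl⟩ |
      ⟨h1, rfl, rfl, rfl, rfl⟩ | ⟨h1, rfl, rfl, rfl⟩)
    · exact .plain h1 h2
    · exact .spread h1 h2 h3
    · exact .freeze h1
    · exact .startFreeze h1
    · exact .release h1

/-- The delayed execution of a search node. -/
def IsRealized (F : Set Failure) (c : Channel P) (m₀ : M) (n : SearchNode S) : Prop :=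
  ∃ e γ μ wt, Steps (failureModel M F) S S.initConfig e γ ∧ Agrees c m₀ n γ ∧ Causal c n e μ wt

theorem isRealized_init : IsRealized F c m₀ (SearchNode.init S) := by
  refine ⟨[], S.initConfig, id, fun _ => 0, .nil _, ⟨fun p _ => rfl, ?_, ?_⟩, ⟨⟨?_, ?_⟩, ?_, ?_, ?_⟩⟩
  · intro d hd; cases hd
  · intro d _
    exact ⟨[], by simp [flagPart, SearchNode.init, FIFOSystem.initConfig]⟩
  · simp
  · rintro r r' ⟨c, m, hr⟩
    simp at hr
  · intro p f hp; cases hp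
  · intro p hp; exact absurd hp Mode.not_hot_idle
  · intro hp; exact absurd hp Mode.not_hot_idle

/-- A handshake is executed as a send and a receive, except that a freezing one executes only the
send and leaves the message at the front of the channel. Thawing executes a send and then the
delayed receive, which reads the old message but is matched with the new send, so that the active
parent precedes it. Releasing matches the receive with the invitation. Modes only promise causality:
an idle process may well be causally after the chosen send, so that moves may leave modes unchanged.
-/
theorem IsRealized.move (hF : F.Nonempty) {n n' : SearchNode S} (hn : IsRealized F c m₀ n)
    (hmove : Move F c m₀ n n') : IsRealized F c m₀ n' := by
  obtain ⟨e, γ, μ, wt, hsteps, hag, hca⟩ := hn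
  cases hmove with
  | internal p x htrans hstate hfree hmode hflag =>
    rw [← hag.state p hfree.not_frozen] at htrans
    obtain ⟨γ', h1, h2, h3, h4⟩ := hsteps.exists_internal htrans
    have hfl : ∀ d, flagPart c m₀ n' d = flagPart c m₀ n d := fun d =>
      flagPart_congr fun _ => by rw [hflag]
    refine ⟨_, γ', μ, wt, h1, ⟨fun r hr => ?_, fun d hd => ?_, fun d hd => ?_⟩,
      hca.snoc (by simp) (by simp [hmode]) (by simp [hmode])⟩
    · by_cases e1 : r = p
      · rw [e1, h2]
      · rw [h3 r e1, hstate r e1]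
        exact hag.state r (by rwa [hmode] at hr)
    · rw [hmode] at hd
      have e1 : d.1.2 ≠ p := by
        rintro rfl
        exact hfree.not_frozen _ hd
      obtain ⟨m, junk, h5, h6⟩ := hag.frozen d hd
      exact ⟨m, junk, by rw [h4, hfl, h5], by rw [h3 _ e1, hstate _ e1]; exact h6⟩
    · rw [hmode] at hd
      rw [h4, hfl]
      exact hag.chan d hd
  | send d m htrans hstate hmodes hmode hflag =>
    have hne : d.1.2 ≠ d.1.1 := d.2.symm
    have hfree : (n.mode d.1.1).Free := by
      rcases sendModes_iff.1 hmodes with ⟨h, -⟩ | ⟨-, h, -⟩ | ⟨h, -⟩ | ⟨h, -⟩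
      · exact h
      · exact Or.inl h
      · exact Or.inr h
      · exact Or.inl h
    have hfree' : (n'.mode d.1.1).Free := by
      rcases sendModes_iff.1 hmodes with ⟨h, h', -⟩ | ⟨-, -, h, -⟩ | ⟨-, -, h, -⟩ | ⟨-, -, h, -⟩
      · rwa [h']
      · exact Or.inr h
      · exact Or.inr h
      · exact Or.inr h
    rw [← hag.state _ hfree.not_frozen] at htrans
    have hflag' : d ≠ c → (n'.flag = true ↔ n.flag = true) := by
      intro hd
      rw [hflag]
      simp [hd]
    -- When thawing, the delayed receive follows this send at once. For causality the two are a
    -- matched pair, although the message read is an older one.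
    by_cases hthaw : n.mode d.1.2 = .frozen d.1.1 ∧ n'.mode d.1.2 = .active
    · obtain ⟨m', junk, h1, h2⟩ := hag.frozen d hthaw.1
      obtain ⟨junk', h3⟩ := exists_flagPart_send hF hflag junk
      obtain ⟨γ', h4, h5, h6, h7, h8⟩ := hsteps.exists_send (w := m' :: (flagPart c m₀ n' d ++ junk'))
        htrans (by rw [h1]; exact h3.cons m')
      rw [← h6 _ hne] at h2
      obtain ⟨γ₂, h9, h10, h11, h12, h13⟩ := h4.exists_recv h2 h7
      have hact : n.mode d.1.1 = .active ∧ n'.mode d.1.1 = .active := by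
        rcases sendModes_iff.1 hmodes with ⟨-, -, h⟩ | ⟨-, -, -, h⟩ | ⟨h, -, h', -⟩ | ⟨-, h, -⟩
        · rw [hthaw.1, hthaw.2] at h; cases h
        · rw [hthaw.1, hthaw.2] at h; cases h
        · exact ⟨h, h'⟩
        · rw [hthaw.1] at h; cases h
      have hag' : Agrees c m₀ n' γ₂ := by
        refine hag.of_eq d hfree.not_frozen hfree'.not_frozen ?_ ?_ hmode
          (fun r e1 _ => hstate r e1) (fun r e1 e2 => by rw [h11 r e2, h6 r e1]) ?_ ?_ ?_ hflag' ?_ ?_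
        · intro f hf
          rw [hthaw.1, hthaw.2]
          simp [hf.symm]
        · intro f hf h
          rw [hthaw.1] at h
          cases h
          exact absurd rfl hf
        · rw [h11 _ hne.symm, h5]
        · intro _
          rw [h10, hstate _ hne]
        · intro d' hd'
          rw [h13 d' hd', h8 d' hd']
        · intro h
          rw [hthaw.2] at h; cases h
        · intro _
          exact ⟨junk', h12⟩
      obtain ⟨μ', hμ'⟩ := hca.sync (n' := n') (d := d) (m := m) (m' := m') (by
        intro p f
        by_cases e1 : p = d.1.1
        · rw [e1, hact.1, hact.2]
        by_cases e2 : p = d.1.2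
        · rw [e2, hthaw.1, hthaw.2]; simp
        · rw [hmode p e1 e2]) (by
        intro p hp
        by_cases e1 : p = d.1.1
        · exact Or.inl (by rw [e1, hact.1]; exact Mode.hot_active)
        by_cases e2 : p = d.1.2
        · exact Or.inr ⟨Or.inl (by rw [hact.1]; exact Mode.hot_active), Or.inr e2⟩
        · rw [hmode p e1 e2] at hp
          exact Or.inl hp) (by
        intro p hp
        by_cases e1 : p = d.1.1
        · rw [e1, hact.2]; exact Mode.hot_active
        by_cases e2 : p = d.1.2
        · rw [e2, hthaw.2]; exact Mode.hot_active
        · rwa [hmode p e1 e2])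
      exact ⟨_, γ₂, μ', wt, h9, hag', hμ'⟩
    · have hfz : ∀ f, n'.mode d.1.2 = .frozen f ↔ n.mode d.1.2 = .frozen f := by
        intro f
        rcases sendModes_iff.1 hmodes with ⟨-, -, h⟩ | ⟨-, -, -, h⟩ | ⟨-, h, -, h'⟩ | ⟨-, h, -, h'⟩
        · rw [h]
        · rw [h]
        · exact absurd ⟨h, h'⟩ hthaw
        · rw [h, h']; simp
      obtain ⟨w, hw, hw1, hw2⟩ : ∃ w, Interferes F (γ.chan d ++ [m]) w ∧
          (n'.mode d.1.2 = .frozen d.1.1 → ∃ m junk, w = m :: (flagPart c m₀ n' d ++ junk) ∧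
            (γ.state d.1.2, Act.recv d m, n'.state d.1.2) ∈ S.trans d.1.2) ∧
          (n'.mode d.1.2 ≠ .frozen d.1.1 → ∃ junk, w = flagPart c m₀ n' d ++ junk) := by
        by_cases hfr : n.mode d.1.2 = .frozen d.1.1
        · obtain ⟨m', junk, h1, h2⟩ := hag.frozen d hfr
          obtain ⟨junk', h3⟩ := exists_flagPart_send hF hflag junk
          refine ⟨m' :: (flagPart c m₀ n' d ++ junk'), by rw [h1]; exact h3.cons m', fun _ =>
            ⟨m', junk', rfl, by rw [hstate _ hne]; exact h2⟩, fun h => absurd ((hfz _).2 hfr) h⟩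
        · obtain ⟨junk, h1⟩ := hag.chan d hfr
          obtain ⟨junk', h3⟩ := exists_flagPart_send hF hflag junk
          exact ⟨_, by rw [h1]; exact h3, fun h => absurd ((hfz _).1 h) hfr, fun _ => ⟨junk', rfl⟩⟩
      obtain ⟨γ', h4, h5, h6, h7, h8⟩ := hsteps.exists_send htrans hw
      have hag' : Agrees c m₀ n' γ' := by
        refine hag.of_eq d hfree.not_frozen hfree'.not_frozen (fun f _ => hfz f)
          (fun f _ _ => ⟨h6 _ hne, hstate _ hne⟩) hmode
          (fun r e1 _ => hstate r e1) (fun r e1 e2 => h6 r e1) h5 ?_ h8 hflag' ?_ ?_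
        · intro h
          rw [h6 _ hne, hstate _ hne]
          exact hag.state _ fun f hf => h f ((hfz f).2 hf)
        · intro h
          rw [h7, h6 _ hne]
          exact hw1 h
        · intro h
          rw [h7]
          exact hw2 h
      rcases sendModes_iff.1 hmodes with ⟨-, ha, hb⟩ | ⟨rfl, ha, ha', hb⟩ | ⟨-, ha, -, ha'⟩ |
        ⟨ha, hb, ha', hb'⟩
      · have hm : n'.mode = n.mode := by
          funext p
          by_cases e1 : p = d.1.1
          · rw [e1, ha]
          by_cases e2 : p = d.1.2
          · rw [e2, hb]
          · exact hmode p e1 e2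
        exact ⟨_, γ', μ, wt, h4, hag', hca.snoc (by simp) (by simp [hm]) (by simp [hm])⟩
      · have hm : ∀ p, p ≠ d.1.1 → n'.mode p = n.mode p := by
          intro p e1
          by_cases e2 : p = d.1.2
          · rw [e2, hb]
          · exact hmode p e1 e2
        refine ⟨_, γ', μ, wt, h4, hag', hca.start_send ha (fun p => ?_) fun p f hp => ?_⟩
        · by_cases e1 : p = d.1.1
          · simp [e1, ha', Mode.hot_active]
          · simp [hm p e1, e1]
        · by_cases e1 : p = d.1.1
          · rw [e1, ha'] at hp; cases hp
          · rwa [hm p e1] at hp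
      · exact absurd ⟨ha, ha'⟩ hthaw
      · obtain ⟨wt', hwt'⟩ := hca.invite (m := m) ha hb ha' hb' hmode
        exact ⟨_, γ', μ, wt', h4, hag', hwt'⟩
  | sync d m m' hok htrans htrans' hstate hmodes hmode hflag =>
    have hne : d.1.2 ≠ d.1.1 := d.2.symm
    have hfree : (n.mode d.1.1).Free := by
      rcases syncModes_iff.1 hmodes with ⟨h, -⟩ | ⟨h, -⟩ | ⟨h, -⟩ | ⟨-, h, -⟩ | ⟨h, -⟩
      · exact h
      · exact h
      · exact h
      · exact Or.inl h
      · exact h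
    have hfree' : (n'.mode d.1.1).Free := by
      rcases syncModes_iff.1 hmodes with ⟨h, -, h', -⟩ | ⟨-, -, -, h', -⟩ | ⟨h, -, h', -⟩ |
        ⟨-, -, -, h', -⟩ | ⟨h, -, h', -⟩
      · rwa [h']
      · exact Or.inr h'
      · rwa [h']
      · exact Or.inr h'
      · rwa [h']
    have hnf : ∀ f, n.mode d.1.2 ≠ .frozen f := by
      intro f
      rcases syncModes_iff.1 hmodes with ⟨-, h, -⟩ | ⟨-, h, -⟩ | ⟨-, h, -⟩ | ⟨-, -, h, -⟩ | ⟨-, h, -⟩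
      · exact h.not_frozen f
      · exact h.not_frozen f
      · rw [h]; simp
      · rw [h]; simp
      · rw [h]; simp
    rw [← hag.state _ hfree.not_frozen] at htrans
    rw [← hag.state _ hnf] at htrans'
    have hflag' : d ≠ c → (n'.flag = true ↔ n.flag = true) := by
      intro hd
      rw [hflag]
      simp [hd]
    obtain ⟨junk, h1⟩ := hag.chan d (hnf _)
    obtain ⟨junk', h3⟩ := exists_flagPart_sync hF hok hflag junk
    obtain ⟨γ', h4, h5, h6, h7, h8⟩ := hsteps.exists_send (w := m' :: (flagPart c m₀ n' d ++ junk'))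
        htrans (by rw [h1]; exact h3)
    -- When freezing, only the send is performed. If it is the chosen send, it thereby remains
    -- unmatched even though its message is reserved for the frozen receiver.
    by_cases hfz : n'.mode d.1.2 = .frozen d.1.1
    · have hag' : Agrees c m₀ n' γ' := by
        refine hag.of_eq d hfree.not_frozen hfree'.not_frozen ?_
          (fun f _ h => absurd h (hnf f)) hmode hstate
          (fun r e1 e2 => h6 r e1) h5 (fun h => absurd hfz (h _)) h8 hflag' ?_
          (fun h => absurd hfz h)
        · intro f hf
          rw [hfz]
          simp [hf.symm, hnf f]
        · intro _
          exact ⟨m', junk', h7, by rw [h6 _ hne]; exact htrans'⟩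
      have hkeep : n'.mode d.1.1 = n.mode d.1.1 ∧ n.mode d.1.2 = .idle ∨
          (d = c ∧ n.mode d.1.1 = .idle ∧ n.mode d.1.2 = .idle ∧ n'.mode d.1.1 = .active) := by
        rcases syncModes_iff.1 hmodes with ⟨-, -, -, h⟩ | ⟨-, -, -, -, h⟩ | ⟨-, h, h', -⟩ |
          ⟨h, h2, h3, h4, -⟩ | ⟨-, -, -, h'⟩
        · rw [h] at hfz
          exact absurd hfz (hnf _)
        · rw [h] at hfz; cases hfz
        · exact Or.inl ⟨h', h⟩
        · exact Or.inr ⟨h, h2, h3, h4⟩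
        · rw [h'] at hfz; cases hfz
      rcases hkeep with ⟨ha, hb⟩ | ⟨rfl, ha, hb, ha'⟩
      · refine ⟨_, γ', μ, wt, h4, hag', hca.snoc (by simp) (fun p f => ?_) fun p => ?_⟩
        · by_cases e1 : p = d.1.1
          · rw [e1, ha]
          by_cases e2 : p = d.1.2
          · rw [e2, hb, hfz]; simp
          · rw [hmode p e1 e2]
        · by_cases e1 : p = d.1.1
          · rw [e1, ha]
          by_cases e2 : p = d.1.2
          · rw [e2, hb, hfz]; simp [Mode.not_hot_idle, Mode.not_hot_frozen]
          · rw [hmode p e1 e2]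
      · refine ⟨_, γ', μ, wt, h4, hag', hca.start_send ha (fun p => ?_) fun p f hp => ?_⟩
        · by_cases e1 : p = d.1.1
          · simp [e1, ha', Mode.hot_active]
          by_cases e2 : p = d.1.2
          · rw [e2, hb, hfz]; simp [Mode.not_hot_idle, Mode.not_hot_frozen, hne]
          · rw [hmode p e1 e2]; simp [e1]
        · by_cases e1 : p = d.1.1
          · rw [e1, ha'] at hp; cases hp
          by_cases e2 : p = d.1.2
          · rw [e2, hfz] at hp; cases hp
          · rwa [hmode p e1 e2] at hp
    · have hnf' : ∀ f, n'.mode d.1.2 ≠ .frozen f := by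
        intro f
        rcases syncModes_iff.1 hmodes with ⟨-, -, -, h⟩ | ⟨-, -, -, -, h⟩ | ⟨-, -, -, h⟩ |
          ⟨-, -, -, -, h⟩ | ⟨-, -, -, h⟩
        · rw [h]; exact hnf f
        · rw [h]; simp
        · exact absurd h hfz
        · exact absurd h hfz
        · rw [h]; simp
      have h2 := htrans'
      rw [← h6 _ hne] at h2
      obtain ⟨γ₂, h9, h10, h11, h12, h13⟩ := h4.exists_recv h2 h7
      have hag' : Agrees c m₀ n' γ₂ := by
        refine hag.of_eq d hfree.not_frozen hfree'.not_frozen ?_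
          (fun f _ h => absurd h (hnf f)) hmode hstate
          (fun r e1 e2 => by rw [h11 r e2, h6 r e1]) ?_ (fun _ => h10)
          (fun d' hd' => by rw [h13 d' hd', h8 d' hd']) hflag' (fun h => absurd h (hnf' _))
          (fun _ => ⟨junk', h12⟩)
        · intro f _
          exact ⟨fun h => absurd h (hnf' f), fun h => absurd h (hnf f)⟩
        · rw [h11 _ hne.symm, h5]
      have hplain : ((n.mode d.1.1).Free ∧ (n.mode d.1.2).Free) ∧
          (n'.mode d.1.1 = n.mode d.1.1 ∧ n'.mode d.1.2 = n.mode d.1.2 ∨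
          ((n.mode d.1.1 = .active ∨ n.mode d.1.2 = .active) ∧ n'.mode d.1.1 = .active ∧
            n'.mode d.1.2 = .active)) ∨ (n.mode d.1.2 = .waiting d.1.1 ∧
            n'.mode d.1.2 = .active ∧ n'.mode d.1.1 = n.mode d.1.1) := by
        rcases syncModes_iff.1 hmodes with ⟨h, h', h2, h3⟩ | ⟨h, h', h2, h3, h4⟩ | ⟨-, -, -, h⟩ |
          ⟨-, -, -, -, h⟩ | ⟨-, h, h', h2⟩
        · exact Or.inl ⟨⟨h, h'⟩, Or.inl ⟨h2, h3⟩⟩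
        · exact Or.inl ⟨⟨h, h'⟩, Or.inr ⟨h2, h3, h4⟩⟩
        · exact absurd h hfz
        · exact absurd h hfz
        · exact Or.inr ⟨h, h2, h'⟩
      rcases hplain with ⟨⟨hf1, hf2⟩, hpl⟩ | ⟨hr, hr', hs⟩
      · have hnw : ∀ {a : Mode P}, a.Free → ∀ f, a ≠ .waiting f := by
          rintro a h f rfl
          rcases h with h | h <;> cases h
        have hf1' : (n'.mode d.1.1).Free := hfree'
        have hf2' : (n'.mode d.1.2).Free := by
          rcases hpl with ⟨-, h⟩ | ⟨-, -, h⟩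
          · rwa [h]
          · exact Or.inr h
        obtain ⟨μ', hμ'⟩ := hca.sync (n' := n') (d := d) (m := m) (m' := m') (by
          intro p f
          by_cases e1 : p = d.1.1
          · rw [e1]
            exact ⟨fun h => absurd h (hnw hf1' f), fun h => absurd h (hnw hf1 f)⟩
          by_cases e2 : p = d.1.2
          · rw [e2]
            exact ⟨fun h => absurd h (hnw hf2' f), fun h => absurd h (hnw hf2 f)⟩
          · rw [hmode p e1 e2]) (by
          intro p hp
          by_cases e1 : p = d.1.1
          · rcases hpl with ⟨h, -⟩ | ⟨h, -⟩
            · rw [e1, h] at hp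
              rw [e1]
              exact Or.inl hp
            · refine Or.inr ⟨h.imp (fun h => ?_) fun h => ?_, Or.inl e1⟩ <;>
                (rw [h]; exact Mode.hot_active)
          by_cases e2 : p = d.1.2
          · rcases hpl with ⟨-, h⟩ | ⟨h, -⟩
            · rw [e2, h] at hp
              rw [e2]
              exact Or.inl hp
            · refine Or.inr ⟨h.imp (fun h => ?_) fun h => ?_, Or.inr e2⟩ <;>
                (rw [h]; exact Mode.hot_active)
          · rw [hmode p e1 e2] at hp
            exact Or.inl hp) (by
          intro p hp
          by_cases e1 : p = d.1.1
          · rcases hpl with ⟨h, -⟩ | ⟨-, h, -⟩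
            · rw [e1] at hp ⊢
              rwa [h]
            · rw [e1, h]; exact Mode.hot_active
          by_cases e2 : p = d.1.2
          · rcases hpl with ⟨-, h⟩ | ⟨-, -, h⟩
            · rw [e2] at hp ⊢
              rwa [h]
            · rw [e2, h]; exact Mode.hot_active
          · rwa [hmode p e1 e2])
        exact ⟨_, γ₂, μ', wt, h9, hag', hμ'⟩
      · obtain ⟨μ', hμ'⟩ := hca.release (n' := n') (m := m) (m' := m') hr hr' (by
          intro p e2
          by_cases e1 : p = d.1.1
          · rw [e1, hs]
          · exact hmode p e1 e2)
        exact ⟨_, γ₂, μ', wt, h9, hag', hμ'⟩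

theorem isRealized_of_reachable (hF : F.Nonempty) {n : SearchNode S}
    (hn : ReflTransGen (Move F c m₀) (SearchNode.init S) n) : IsRealized F c m₀ n := by
  induction hn with
  | refl => exact isRealized_init
  | tail _ h ih => exact ih.move hF h

/-- An accepting search node yields an execution with a cyclic conflict graph. -/
theorem exists_hasCycle_of_accepting (hF : F.Nonempty) {n : SearchNode S}
    (hn : ReflTransGen (Move F c m₀) (SearchNode.init S) n) (hacc : n.Accepting F c m₀) :
    ∃ e, IsExecutionOf (failureModel M F) S e ∧ ∃ μ, IsMatching e μ ∧ HasCycle e μ := by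
  classical
  obtain ⟨e, γ, μ, wt, hsteps, hag, hca⟩ := isRealized_of_reachable hF hn
  obtain ⟨hflag, hact, hnw, m', q', hok, htr⟩ := hacc
  obtain ⟨junk, hchan⟩ := hag.chan c (by rw [hact]; simp)
  have hfl : flagPart c m₀ n c = [m₀] := by simp [flagPart, hflag]
  rw [← hag.state _ (by rw [hact]; simp)] at htr
  obtain ⟨j, m, hj, hun, hreach⟩ := hca.start (hca.hot c.1.2 (by rw [hact]; exact Mode.hot_active))
  obtain ⟨i, x, hi, hx, hpath⟩ := hreach c.1.2 (by rw [hact]; exact Mode.hot_active)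
  have hilt := lt_length_of_getElem? hi
  refine ⟨e ++ [.recv c m'], ⟨⟨Function.update γ.state c.1.2 q', Function.update γ.chan c junk⟩,
    hsteps.snoc (.recv c m' ?_ ?_ ?_ ?_)⟩, Function.update μ e.length j,
    isMatching_snoc_recv hca.matching hj hun, j, ?_⟩
  · simpa using htr
  · exact fun r hr => Function.update_of_ne hr _ _
  · simp only [Function.update_self, hchan, hfl]
    rcases hok with h | h
    · exact .corrupt_all h (by simp)
    · rw [h]; exact .refl _
  · intro d hd
    simp only [Function.update_of_ne hd]
    exact .refl _
  · have hagree : ∀ r < e.length, Function.update μ e.length j r = μ r := fun r hr =>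
      Function.update_of_ne hr.ne _ _
    have hlast : (e ++ [Act.recv c m'])[e.length]? = some (.recv c m') := by simp
    refine TransGen.tail' (b := nodeOf e μ i) (ReflTransGen.mono ?_ _ _ hpath)
      ⟨i, e.length, hilt, ⟨x, _, getElem?_append_of_some hi, hlast, hx⟩,
        nodeOf_append hagree hilt, ?_⟩
    -- No process waits at an accepting node, so all anticipated edges have become real ones.
    · rintro a b (hab | ⟨k, y, f, -, h2, -, -⟩)
      · exact hab.append hagree
      · exact absurd h2 (hnw _ _)
    · rw [nodeOf_recv ⟨_, _, hlast⟩, Function.update_self]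

end Sound


/-! ### Cycles in unions of relations -/

/-- All additional edges leave the same node `s`. A path that uses them splits into an old path to
`s` and an old path from the target of its last additional edge; for a cycle the two fit together.
-/
theorem exists_cycle_or_path_of_union {X : ℕ → ℕ → Prop} {s : ℕ} {T : ℕ → Prop} {a : ℕ}
    (h : TransGen (fun a b => X a b ∨ (a = s ∧ T b)) a a) :
    (∃ a, TransGen X a a) ∨ ∃ b, T b ∧ ReflTransGen X b s := by
  have key : ∀ b, TransGen (fun a b => X a b ∨ (a = s ∧ T b)) a b →
      TransGen X a b ∨ (ReflTransGen X a s ∧ ∃ t, T t ∧ ReflTransGen X t b) := by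
    intro b hb
    induction hb with
    | single h1 =>
      rcases h1 with h1 | ⟨rfl, h1⟩
      · exact Or.inl (.single h1)
      · exact Or.inr ⟨.refl, _, h1, .refl⟩
    | tail _ h1 ih =>
      rcases h1 with h1 | ⟨rfl, h1⟩
      · rcases ih with ih | ⟨h2, t, h3, h4⟩
        · exact Or.inl (ih.tail h1)
        · exact Or.inr ⟨h2, t, h3, h4.tail h1⟩
      · rcases ih with ih | ⟨h2, -⟩
        · exact Or.inr ⟨ih.to_reflTransGen, _, h1, .refl⟩
        · exact Or.inr ⟨h2, _, h1, .refl⟩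
  rcases key a h with h1 | ⟨h1, t, h2, h3⟩
  · exact Or.inl ⟨a, h1⟩
  · exact Or.inr ⟨t, h2, h3.trans h1⟩

theorem exists_cycle_or_path_of_union' {X : ℕ → ℕ → Prop} {s : ℕ} {T : ℕ → Prop} {a : ℕ}
    (h : TransGen (fun a b => X a b ∨ (b = s ∧ T a)) a a) :
    (∃ a, TransGen X a a) ∨ ∃ b, T b ∧ ReflTransGen X s b := by
  rcases exists_cycle_or_path_of_union (X := Function.swap X) (s := s) (T := T) (a := a)
    (transGen_swap.1 h) with ⟨b, hb⟩ | ⟨b, hb, hb'⟩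
  · exact Or.inl ⟨b, transGen_swap.1 hb⟩
  · exact Or.inr ⟨b, hb, reflTransGen_swap.1 hb'⟩

theorem reflTransGen_of_avoid {X X' : ℕ → ℕ → Prop} {u b s : ℕ}
    (hs : ∀ v, ReflTransGen X v b → v ≠ s) (hX : ∀ v v', X v v' → v ≠ s → v' ≠ s → X' v v')
    (h : ReflTransGen X u b) : ReflTransGen X' u b := by
  induction h using ReflTransGen.head_induction_on with
  | refl => exact .refl
  | head h1 h2 ih => exact .head (hX _ _ h1 (hs _ (.head h1 h2)) (hs _ h2)) ih

theorem reflTransGen_of_avoid' {X X' : ℕ → ℕ → Prop} {u b s : ℕ}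
    (hs : ∀ v, ReflTransGen X u v → v ≠ s) (hX : ∀ v v', X v v' → v ≠ s → v' ≠ s → X' v v')
    (h : ReflTransGen X u b) : ReflTransGen X' u b := by
  induction h with
  | refl => exact .refl
  | tail h1 h2 ih => exact .tail ih (hX _ _ h2 (hs _ h1) (hs _ (h1.tail h2)))

/-! ### Mixing matchings of words all of whose conflict graphs are acyclic -/

section Mix

variable {P M : Type} {e : List (Act P M)} {κ μ ν : ℕ → ℕ}

/-- All conflict graphs of the word are acyclic. -/
def AlwaysAcyclic (e : List (Act P M)) : Prop := ∀ κ, IsMatching e κ → ¬ HasCycle e κ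

theorem sameProc_of_send {i i' : ℕ} {c : Channel P} {m m' : M} (h : e[i]? = some (.send c m))
    (h' : e[i']? = some (.send c m')) : SameProc e i i' := ⟨_, _, h, h', rfl⟩

theorem sameProc_of_recv {i i' : ℕ} {c : Channel P} {m m' : M} (h : e[i]? = some (.recv c m))
    (h' : e[i']? = some (.recv c m')) : SameProc e i i' := ⟨_, _, h, h', rfl⟩

theorem hasCycle_of_edges {a b : ℕ} (h : NodeEdge e κ a b) (h' : NodeEdge e κ b a) :
    HasCycle e κ := ⟨a, (TransGen.single h).tail h'⟩

/-- Matched pairs on a channel do not overlap. -/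
theorem AlwaysAcyclic.lt_send (hac : AlwaysAcyclic e) (hκ : IsMatching e κ) {r r' : ℕ}
    {c : Channel P} {m m' : M} (hlt : r < r') (hr : e[r]? = some (.recv c m))
    (hr' : e[r']? = some (.recv c m')) : r < κ r' := by
  obtain ⟨h1, m1, h2⟩ := hκ.send hr
  obtain ⟨h3, m2, h4⟩ := hκ.send hr'
  have hrr : IsRecv e r := ⟨_, _, hr⟩
  have hrr' : IsRecv e r' := ⟨_, _, hr'⟩
  have hss := sameProc_of_send h2 h4
  have hsr := sameProc_of_recv hr hr'
  have hn1 : ¬ IsRecv e (κ r) := not_isRecv_of_send h2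
  have hn2 : ¬ IsRecv e (κ r') := not_isRecv_of_send h4
  by_contra hcon
  have hne : κ r' ≠ r := by
    intro h
    rw [h] at hn2
    exact hn2 hrr
  have hne' : κ r ≠ κ r' := fun h => hlt.ne (hκ.inj hrr hrr' h)
  rcases lt_or_gt_of_ne hne' with h | h
  -- Both sends precede both receives, so the partners may be exchanged. Then the sends come in one
  -- order and their receives in the other, a cycle of length two.
  · let κ' := Function.update (Function.update κ r (κ r')) r' (κ r)
    have e1 : κ' r = κ r' := by
      simp only [κ']
      rw [Function.update_of_ne hlt.ne, Function.update_self]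
    have e2 : κ' r' = κ r := by simp [κ']
    have e3 : ∀ i, i ≠ r → i ≠ r' → κ' i = κ i := by
      intro i hi hi'
      simp only [κ']
      rw [Function.update_of_ne hi', Function.update_of_ne hi]
    have hκ' : IsMatching e κ' := by
      constructor
      · intro i d m3 hi
        by_cases e4 : i = r
        · subst e4
          rw [hr] at hi
          cases hi
          rw [e1]
          exact ⟨by omega, m2, h4⟩
        by_cases e5 : i = r'
        · subst e5
          rw [hr'] at hi
          cases hi
          rw [e2]
          exact ⟨by omega, m1, h2⟩
        · rw [e3 i e4 e5]
          exact hκ.send hi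
      · have hσ : ∀ i, κ' i = κ (Equiv.swap r r' i) := by
          intro i
          by_cases e4 : i = r
          · rw [e4, e1, Equiv.swap_apply_left]
          by_cases e5 : i = r'
          · rw [e5, e2, Equiv.swap_apply_right]
          · rw [e3 i e4 e5, Equiv.swap_apply_of_ne_of_ne e4 e5]
        have hσr : ∀ i, IsRecv e i → IsRecv e (Equiv.swap r r' i) := by
          intro i hi
          by_cases e4 : i = r
          · rwa [e4, Equiv.swap_apply_left]
          by_cases e5 : i = r'
          · rwa [e5, Equiv.swap_apply_right]
          · rwa [Equiv.swap_apply_of_ne_of_ne e4 e5]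
        intro i i' hi hi' heq
        rw [hσ, hσ] at heq
        exact (Equiv.swap r r').injective (hκ.inj (hσr i hi) (hσr i' hi') heq)
    refine hac κ' hκ' (hasCycle_of_edges (a := κ r) (b := κ r')
      ⟨κ r, κ r', h, hss, nodeOf_not_recv hn1, nodeOf_not_recv hn2⟩
      ⟨r, r', hlt, hsr, by rw [nodeOf_recv hrr, e1], by rw [nodeOf_recv hrr', e2]⟩)
  · exact hac κ hκ (hasCycle_of_edges (a := κ r') (b := κ r)
      ⟨κ r', κ r, h, hss.symm, nodeOf_not_recv hn2, nodeOf_not_recv hn1⟩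
      ⟨r, r', hlt, hsr, nodeOf_recv hrr, nodeOf_recv hrr'⟩)

/-- If `r < r'`, then `r < μ r' = ν r < r`, because matched pairs on a channel do not overlap; the
other case is symmetric. -/
theorem AlwaysAcyclic.eq_of_send_eq (hac : AlwaysAcyclic e) (hμ : IsMatching e μ)
    (hν : IsMatching e ν) {r r' : ℕ} (hr : IsRecv e r) (hr' : IsRecv e r') (h : ν r = μ r') :
    r = r' := by
  obtain ⟨c, m, h1⟩ := hr
  obtain ⟨c', m', h2⟩ := hr'
  obtain ⟨h3, m1, h4⟩ := hν.send h1
  obtain ⟨h5, m2, h6⟩ := hμ.send h2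
  rw [h, h6] at h4
  cases h4
  rcases lt_trichotomy r r' with hlt | heq | hlt
  · have := hac.lt_send hμ hlt h1 h2
    omega
  · exact heq
  · have := hac.lt_send hν hlt h2 h1
    omega

/-- A send that both matchings use is used by the same receive in both. Hence choosing between them
receive by receive never makes two receives share a send. -/
theorem AlwaysAcyclic.mix (hac : AlwaysAcyclic e) (hμ : IsMatching e μ)
    (hν : IsMatching e ν) (hκ : ∀ r, κ r = μ r ∨ κ r = ν r) : IsMatching e κ := by
  constructor
  · intro r c m hr
    rcases hκ r with h | h <;> rw [h]
    · exact hμ.send hr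
    · exact hν.send hr
  · intro r r' hr hr' heq
    rcases hκ r with h | h <;> rcases hκ r' with h' | h' <;> rw [h, h'] at heq
    · exact hμ.inj hr hr' heq
    · exact (hac.eq_of_send_eq hμ hν hr' hr heq.symm).symm
    · exact hac.eq_of_send_eq hμ hν hr hr' heq
    · exact hν.inj hr hr' heq

/-- The nodes that precede what follows position `i`. -/
def OutNode (e : List (Act P M)) (κ μ : ℕ → ℕ) (Z : Finset ℕ) (i a : ℕ) : Prop :=
  a = nodeOf e κ i ∨ (i ∈ Z ∧ IsRecv e i ∧ a = μ i)

/-- The conflict graph of `κ` in which, moreover, nodes `μ r` precede what follows `r` for `r` in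
`Z`, and follow what precedes `r` for `r` in `Z'`. -/
def MixedEdge (e : List (Act P M)) (κ μ : ℕ → ℕ) (Z Z' : Finset ℕ) (a b : ℕ) : Prop :=
  ∃ i i', i < i' ∧ SameProc e i i' ∧ OutNode e κ μ Z i a ∧ OutNode e κ μ Z' i' b

theorem nodeOf_update {r s i : ℕ} (h : i ≠ r) :
    nodeOf e (Function.update κ r s) i = nodeOf e κ i := by
  unfold nodeOf
  rw [Function.update_of_ne h]

theorem OutNode.update {Z : Finset ℕ} {r i a : ℕ} (h : OutNode e κ μ Z i a) (hi : i ≠ r) :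
    OutNode e (Function.update κ r (μ r)) μ Z i a := by
  rcases h with h | h
  · exact Or.inl (by rw [nodeOf_update hi, h])
  · exact Or.inr h

theorem OutNode.update_of_ne {Z : Finset ℕ} {r i a : ℕ} (hr : IsRecv e r)
    (h : OutNode e κ μ Z i a) (ha : a ≠ κ r) : OutNode e (Function.update κ r (μ r)) μ Z i a := by
  by_cases hi : i = r
  · subst hi
    rcases h with h | h
    · rw [nodeOf_recv hr] at h
      exact absurd h ha
    · exact Or.inr h
  · exact h.update hi

theorem OutNode.of_insert {Z : Finset ℕ} {r i a : ℕ} (h : OutNode e κ μ (insert r Z) i a) :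
    OutNode e κ μ Z i a ∨ (i = r ∧ IsRecv e r ∧ a = μ r) := by
  rcases h with h | ⟨h1, h2, h3⟩
  · exact Or.inl (Or.inl h)
  · rcases Finset.mem_insert.1 h1 with rfl | h1
    · exact Or.inr ⟨rfl, h2, h3⟩
    · exact Or.inl (Or.inr ⟨h1, h2, h3⟩)

theorem mixedEdge_empty {a b : ℕ} : MixedEdge e κ μ ∅ ∅ a b ↔ NodeEdge e κ a b := by
  simp only [MixedEdge, NodeEdge, OutNode, Finset.notMem_empty, false_and, or_false]
  refine exists_congr fun i => exists_congr fun i' => and_congr_right fun _ =>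
    and_congr_right fun _ => and_congr eq_comm eq_comm

theorem mixedEdge_update {Z Z' : Finset ℕ} {r a b : ℕ} (hr : IsRecv e r)
    (h : MixedEdge e κ μ Z Z' a b) (ha : a ≠ κ r) (hb : b ≠ κ r) :
    MixedEdge e (Function.update κ r (μ r)) μ Z Z' a b := by
  obtain ⟨i, i', h1, h2, h3, h4⟩ := h
  exact ⟨i, i', h1, h2, h3.update_of_ne hr ha, h4.update_of_ne hr hb⟩

theorem update_mix {r : ℕ} (hκ : ∀ r, κ r = μ r ∨ κ r = ν r) (r' : ℕ) :
    Function.update κ r (μ r) r' = μ r' ∨ Function.update κ r (μ r) r' = ν r' := by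
  by_cases h : r' = r
  · subst h
    exact Or.inl (Function.update_self _ _ _)
  · rw [Function.update_of_ne h]
    exact hκ r'

/-- The extra edges are added for one receive `r` at a time, for all mixtures `κ` simultaneously. A
cycle through an extra edge at `μ r` yields an old path between `μ r` and a neighbour of `r`. This
path avoids `κ r`, so it survives when `r` is rematched with `μ r`; there the extra edge is an
ordinary one, and the mixture with this rematching would be cyclic. -/
theorem AlwaysAcyclic.mixedEdge (hac : AlwaysAcyclic e) (hμ : IsMatching e μ)
    (hν : IsMatching e ν) (Z Z' : Finset ℕ) :
    ∀ κ : ℕ → ℕ, (∀ r, κ r = μ r ∨ κ r = ν r) → ∀ a, ¬ TransGen (MixedEdge e κ μ Z Z') a a := by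
  induction Z using Finset.induction_on with
  | empty =>
    induction Z' using Finset.induction_on with
    | empty =>
      intro κ hκ a ha
      exact hac κ (hac.mix hμ hν hκ) ⟨a, TransGen.mono (fun _ _ => mixedEdge_empty.1) _ _ ha⟩
    | insert r Z' _ ih =>
      intro κ hκ a ha
      by_cases hr : IsRecv e r
      · have hun : TransGen (fun a b => MixedEdge e κ μ ∅ Z' a b ∨
            (b = μ r ∧ ∃ i, i < r ∧ SameProc e i r ∧ OutNode e κ μ ∅ i a)) a a := by
          refine TransGen.mono (fun a b hab => ?_) _ _ ha
          obtain ⟨i, i', h1, h2, h3, h4⟩ := hab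
          rcases h4.of_insert with h4 | ⟨rfl, -, h4⟩
          · exact Or.inl ⟨i, i', h1, h2, h3, h4⟩
          · exact Or.inr ⟨h4, i, h1, h2, h3⟩
        rcases exists_cycle_or_path_of_union' hun with ⟨b, hb⟩ | ⟨b, ⟨i, hi, his, hib⟩, hb⟩
        · exact ih κ hκ b hb
        · have hin : MixedEdge e κ μ ∅ Z' b (κ r) :=
            ⟨i, r, hi, his, hib, Or.inl (nodeOf_recv hr).symm⟩
          -- A visit to `κ r` would close a cycle with the edge from `b` to `κ r`, which is excluded
          -- by induction.
          have havoid : ∀ v, ReflTransGen (MixedEdge e κ μ ∅ Z') v b → v ≠ κ r := by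
            rintro v hv rfl
            exact ih κ hκ _ (TransGen.tail' hv hin)
          have hpath : ReflTransGen (MixedEdge e (Function.update κ r (μ r)) μ ∅ Z') (μ r) b := by
            exact reflTransGen_of_avoid havoid (fun _ _ h h1 h2 => mixedEdge_update hr h h1 h2) hb
          refine ih _ (update_mix hκ) _ (TransGen.tail' hpath ⟨i, r, hi, his, hib.update hi.ne, ?_⟩)
          exact Or.inl (by rw [nodeOf_recv hr, Function.update_self])
      · refine ih κ hκ a (TransGen.mono (fun a b hab => ?_) _ _ ha)
        obtain ⟨i, i', h1, h2, h3, h4⟩ := hab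
        exact ⟨i, i', h1, h2, h3, h4.of_insert.resolve_right fun h => hr h.2.1⟩
  | insert r Z _ ih =>
    intro κ hκ a ha
    by_cases hr : IsRecv e r
    · have hun : TransGen (fun a b => MixedEdge e κ μ Z Z' a b ∨
          (a = μ r ∧ ∃ i, r < i ∧ SameProc e r i ∧ OutNode e κ μ Z' i b)) a a := by
        refine TransGen.mono (fun a b hab => ?_) _ _ ha
        obtain ⟨i, i', h1, h2, h3, h4⟩ := hab
        rcases h3.of_insert with h3 | ⟨rfl, -, h3⟩
        · exact Or.inl ⟨i, i', h1, h2, h3, h4⟩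
        · exact Or.inr ⟨h3, i', h1, h2, h4⟩
      rcases exists_cycle_or_path_of_union hun with ⟨b, hb⟩ | ⟨b, ⟨i, hi, his, hib⟩, hb⟩
      · exact ih κ hκ b hb
      · have hin : MixedEdge e κ μ Z Z' (κ r) b :=
          ⟨r, i, hi, his, Or.inl (nodeOf_recv hr).symm, hib⟩
        have havoid : ∀ v, ReflTransGen (MixedEdge e κ μ Z Z') b v → v ≠ κ r := by
          rintro v hv rfl
          exact ih κ hκ _ (TransGen.head' hin hv)
        have hpath : ReflTransGen (MixedEdge e (Function.update κ r (μ r)) μ Z Z') b (μ r) := by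
          exact reflTransGen_of_avoid' havoid (fun _ _ h h1 h2 => mixedEdge_update hr h h1 h2) hb
        -- After the rematching, `r` itself provides the edge from `μ r` to `b`.
        refine ih _ (update_mix hκ) _ (TransGen.head' ⟨r, i, hi, his, ?_, hib.update hi.ne'⟩ hpath)
        exact Or.inl (by rw [nodeOf_recv hr, Function.update_self])
    · refine ih κ hκ a (TransGen.mono (fun a b hab => ?_) _ _ ha)
      obtain ⟨i, i', h1, h2, h3, h4⟩ := hab
      exact ⟨i, i', h1, h2, h3.of_insert.resolve_right fun h => hr h.2.1, h4⟩

end Mix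


/-! ### Scheduling a cyclic execution with adjacent matched pairs -/

section Schedule

variable {P M : Type} {F : Set Failure} {e : List (Act P M)} {μ ν L : ℕ → ℕ} {c : Channel P}
  {m₀ : M} {j j₀ t : ℕ} {p : P}

/-- Position `i` of `e` holds an action of process `p`. -/
def IsOn (e : List (Act P M)) (i : ℕ) (p : P) : Prop := ∃ a, e[i]? = some a ∧ a.proc = p

theorem IsOn.lt {i : ℕ} (h : IsOn e i p) : i < e.length := by
  obtain ⟨a, h, -⟩ := h
  exact lt_length_of_getElem? h

theorem IsOn.sameProc {i i' : ℕ} (h : IsOn e i p) (h' : IsOn e i' p) : SameProc e i i' := by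
  obtain ⟨a, h1, h2⟩ := h
  obtain ⟨b, h3, h4⟩ := h'
  exact ⟨a, b, h1, h3, h2.trans h4.symm⟩

theorem SameProc.isOn_iff {i i' : ℕ} (h : SameProc e i i') : IsOn e i p ↔ IsOn e i' p := by
  obtain ⟨a, b, h1, h2, h3⟩ := h
  simp [IsOn, h1, h2, h3]

theorem IsOn.unique {i : ℕ} {q : P} (h : IsOn e i p) (h' : IsOn e i q) : p = q := by
  obtain ⟨a, h1, h2⟩ := h
  obtain ⟨b, h3, h4⟩ := h'
  rw [h1] at h3
  cases h3
  exact h2.symm.trans h4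

/-- Position `i` is causally after the send `j`. -/
def IsHot (e : List (Act P M)) (μ : ℕ → ℕ) (j i : ℕ) : Prop :=
  i < e.length ∧ ReflTransGen (NodeEdge e μ) j (nodeOf e μ i)

/-- Position `i` is the first one of its process that is causally after the send `j`. -/
def IsFirst (e : List (Act P M)) (μ : ℕ → ℕ) (j i : ℕ) : Prop :=
  IsHot e μ j i ∧ ∀ i' < i, SameProc e i' i → ¬ IsHot e μ j i'

/-- The receive `r` comes causally after `j` through a send that is later than its honest one. -/
def IsFwd (e : List (Act P M)) (μ ν : ℕ → ℕ) (j r : ℕ) : Prop :=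
  IsRecv e r ∧ IsFirst e μ j r ∧ ν r < μ r

/-- The send matched with `r` comes causally after `j` through `r`, whose honest send is later. -/
def IsBwd (e : List (Act P M)) (μ ν : ℕ → ℕ) (j r : ℕ) : Prop :=
  IsRecv e r ∧ IsFirst e μ j (μ r) ∧ μ r < ν r

/-- A process that comes causally after `j` at `f` becomes active in the search at node `b`. -/
def ActAt (e : List (Act P M)) (μ ν : ℕ → ℕ) (j f b : ℕ) : Prop :=
  (f = j ∧ b = j) ∨ (IsRecv e f ∧ b = max (ν f) (μ f)) ∨
    ∃ r, IsRecv e r ∧ μ r = f ∧ b = min (ν r) (μ r)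

/-- The hypotheses for scheduling: all conflict graphs of `e` are acyclic, the send `j` on `c` is
unmatched in `μ`, the send `j₀` of `m₀` on `c` is available at the end in the honest matching `ν`,
and `L` is a schedule. -/
structure Layout (F : Set Failure) (e : List (Act P M)) (μ ν : ℕ → ℕ) (c : Channel P) (m₀ : M)
    (j j₀ : ℕ) (L : ℕ → ℕ) : Prop where
  acyclic : AlwaysAcyclic e
  matching : IsMatching e μ
  honest : IsHonest F e ν
  start : ∃ m, e[j]? = some (.send c m)
  unmatched : ∀ r, IsRecv e r → μ r ≠ j
  start_cases : (∀ r, IsRecv e r → ν r ≠ j) ∨ ∃ r, IsFwd e μ ν j r ∧ ν r = j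
  avail : e[j₀]? = some (.send c m₀)
  avail_unmatched : ∀ r, IsRecv e r → ν r ≠ j₀
  avail_fifo : IsFifo F → ∀ r m, e[r]? = some (.recv c m) → ν r < j₀
  inj : ∀ a b, a < e.length → b < e.length → L a = L b → a = b
  edge : ∀ {i i' a b}, i < i' → SameProc e i i' →
    (a = nodeOf e ν i ∨ (IsFwd e μ ν j i ∧ a = μ i)) →
    (b = nodeOf e ν i' ∨ (IsBwd e μ ν j i' ∧ b = μ i')) → L a < L b

theorem exists_isFirst {i : ℕ} (h : IsHot e μ j i) :
    ∃ f ≤ i, SameProc e f i ∧ IsFirst e μ j f := by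
  induction i using Nat.strong_induction_on with
  | _ i ih =>
    by_cases hc : ∃ i' < i, SameProc e i' i ∧ IsHot e μ j i'
    · obtain ⟨i', h1, h2, h3⟩ := hc
      obtain ⟨f, h4, h5, h6⟩ := ih i' h1 h3
      exact ⟨f, h4.trans h1.le, h5.trans h2, h6⟩
    · push Not at hc
      exact ⟨i, le_rfl, ⟨e[i]'h.1, e[i]'h.1, by simp, by simp, rfl⟩, h, hc⟩

theorem IsFirst.unique {f f' : ℕ} (h : IsFirst e μ j f) (h' : IsFirst e μ j f')
    (hs : SameProc e f f') : f = f' := by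
  rcases lt_trichotomy f f' with hlt | heq | hlt
  · exact absurd h.1 (h'.2 f hlt hs)
  · exact heq
  · exact absurd h'.1 (h.2 f' hlt hs.symm)

namespace Layout

theorem lt_of_lt (h : Layout F e μ ν c m₀ j j₀ L) {i i' : ℕ} (hlt : i < i')
    (hs : SameProc e i i') : L (nodeOf e ν i) < L (nodeOf e ν i') :=
  h.edge hlt hs (Or.inl rfl) (Or.inl rfl)

theorem start_not_recv (h : Layout F e μ ν c m₀ j j₀ L) : ¬ IsRecv e j := by
  obtain ⟨m, hm⟩ := h.start
  exact not_isRecv_of_send hm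

theorem isFirst_start (h : Layout F e μ ν c m₀ j j₀ L) : IsFirst e μ j j := by
  obtain ⟨m, hm⟩ := h.start
  refine ⟨⟨lt_length_of_getElem? hm, ?_⟩, fun i' hi' hs hh => ?_⟩
  · rw [nodeOf_not_recv h.start_not_recv]
  · refine h.acyclic μ h.matching ⟨j, TransGen.tail' hh.2 ⟨i', j, hi', hs, rfl, ?_⟩⟩
    exact nodeOf_not_recv h.start_not_recv

/-- No earlier position of the process of `f` is hot, so the path from `j` cannot enter the node of
`f` at `f`; it enters at the other member of the matched pair. -/
theorem partner (h : Layout F e μ ν c m₀ j j₀ L) {f : ℕ} (hf : IsFirst e μ j f) (hne : f ≠ j) :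
    (IsRecv e f ∧ ∃ i < μ f, SameProc e i (μ f) ∧ IsHot e μ j i) ∨
      ∃ r, IsRecv e r ∧ μ r = f ∧ ∃ i < r, SameProc e i r ∧ IsHot e μ j i := by
  have hne' : nodeOf e μ f ≠ j := by
    by_cases hr : IsRecv e f
    · rw [nodeOf_recv hr]
      exact h.unmatched f hr
    · rwa [nodeOf_not_recv hr]
  rcases (ReflTransGen.cases_tail hf.1.2) with heq | ⟨a, h1, i, i', h2, h3, h4, h5⟩
  · exact absurd heq hne'
  · have hi : IsHot e μ j i := ⟨h3.lt_left, by rw [h4]; exact h1⟩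
    have hne2 : i' ≠ f := by
      rintro rfl
      exact hf.2 i h2 h3 hi
    by_cases hr : IsRecv e f
    · by_cases hr' : IsRecv e i'
      · rw [nodeOf_recv hr, nodeOf_recv hr'] at h5
        exact absurd (h.matching.inj hr' hr h5) hne2
      · rw [nodeOf_recv hr, nodeOf_not_recv hr'] at h5
        subst h5
        exact Or.inl ⟨hr, i, h2, h3, hi⟩
    · by_cases hr' : IsRecv e i'
      · rw [nodeOf_not_recv hr, nodeOf_recv hr'] at h5
        exact Or.inr ⟨i', hr', h5, i, h2, h3, hi⟩
      · rw [nodeOf_not_recv hr, nodeOf_not_recv hr'] at h5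
        exact absurd h5 hne2

/-- If `r` is first on its process, the path entered the pair at the send, so an earlier action of
the sender is already hot. -/
theorem not_isFirst_send (h : Layout F e μ ν c m₀ j j₀ L) {r : ℕ} (hr : IsRecv e r)
    (hf : IsFirst e μ j r) : ¬ IsFirst e μ j (μ r) := by
  intro hf'
  have hne : r ≠ j := by
    rintro rfl
    exact h.start_not_recv hr
  rcases h.partner hf hne with ⟨-, i, h1, h2, h3⟩ | ⟨r', hr', h1, -⟩
  · exact hf'.2 i h1 h2 h3
  · exact h.matching.not_recv hr' (h1 ▸ hr)

theorem exists_actAt (h : Layout F e μ ν c m₀ j j₀ L) {f : ℕ} (hf : IsFirst e μ j f) :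
    ∃ b, ActAt e μ ν j f b := by
  by_cases hne : f = j
  · exact ⟨j, Or.inl ⟨hne, rfl⟩⟩
  · rcases h.partner hf hne with ⟨hr, -⟩ | ⟨r, hr, h1, -⟩
    · exact ⟨_, Or.inr (Or.inl ⟨hr, rfl⟩)⟩
    · exact ⟨_, Or.inr (Or.inr ⟨r, hr, h1, rfl⟩)⟩

theorem actAt_unique (h : Layout F e μ ν c m₀ j j₀ L) {f b b' : ℕ} (hb : ActAt e μ ν j f b)
    (hb' : ActAt e μ ν j f b') : b = b' := by
  rcases hb with ⟨h1, h2⟩ | ⟨h1, h2⟩ | ⟨r, h1, h2, h3⟩ <;>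
    rcases hb' with ⟨h4, h5⟩ | ⟨h4, h5⟩ | ⟨r', h4, h5, h6⟩
  · rw [h2, h5]
  · exact absurd (h1 ▸ h4) h.start_not_recv
  · exact absurd (h5.trans h1) (h.unmatched r' h4)
  · exact absurd (h4 ▸ h1) h.start_not_recv
  · rw [h2, h5]
  · exact absurd (h5 ▸ h1) (h.matching.not_recv h4)
  · exact absurd (h2.trans h4) (h.unmatched r h1)
  · exact absurd (h2 ▸ h4) (h.matching.not_recv h1)
  · have := h.matching.inj h1 h4 (h2.trans h5.symm)
    subst this
    rw [h3, h6]

/-- Both sends of a receive are on its channel. -/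
theorem sends (h : Layout F e μ ν c m₀ j j₀ L) {r : ℕ} {d : Channel P} {m : M}
    (hr : e[r]? = some (.recv d m)) :
    (∃ m', e[μ r]? = some (.send d m')) ∧ ∃ m', e[ν r]? = some (.send d m') :=
  ⟨(h.matching.send hr).2, (h.honest.send hr).2⟩

theorem sameProc_sends (h : Layout F e μ ν c m₀ j j₀ L) {r : ℕ} (hr : IsRecv e r) :
    SameProc e (μ r) (ν r) := by
  obtain ⟨d, m, hr⟩ := hr
  obtain ⟨⟨m1, h1⟩, m2, h2⟩ := h.sends hr
  exact sameProc_of_send h1 h2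

theorem nodeOf_send (h : Layout F e μ ν c m₀ j j₀ L) {r : ℕ} (hr : IsRecv e r) :
    nodeOf e ν (μ r) = μ r ∧ nodeOf e ν (ν r) = ν r :=
  ⟨nodeOf_not_recv (h.matching.not_recv hr), nodeOf_not_recv (h.honest.not_recv hr)⟩

theorem le_of_min (h : Layout F e μ ν c m₀ j j₀ L) {r : ℕ} (hr : IsRecv e r) :
    L (min (ν r) (μ r)) ≤ L (μ r) := by
  rcases le_or_gt (μ r) (ν r) with hle | hlt
  · rw [min_eq_right hle]
  · rw [min_eq_left hlt.le]
    have := h.lt_of_lt hlt (h.sameProc_sends hr).symm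
    rw [(h.nodeOf_send hr).1, (h.nodeOf_send hr).2] at this
    exact this.le

theorem le_max (h : Layout F e μ ν c m₀ j j₀ L) {r : ℕ} (hr : IsRecv e r) :
    L (μ r) ≤ L (max (ν r) (μ r)) := by
  rcases lt_or_ge (μ r) (ν r) with hlt | hle
  · rw [max_eq_left hlt.le]
    have := h.lt_of_lt hlt (h.sameProc_sends hr)
    rw [(h.nodeOf_send hr).1, (h.nodeOf_send hr).2] at this
    exact this.le
  · rw [max_eq_right hle]

/-- The process of `f` is active before anything that follows `f` is scheduled. When `f` is a
receive whose honest send is the earlier one, this rests on the additional edges out of `μ f`. -/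
theorem exists_out (h : Layout F e μ ν c m₀ j j₀ L) {f b : ℕ} (hf : IsFirst e μ j f)
    (hb : ActAt e μ ν j f b) :
    ∃ x, (x = nodeOf e ν f ∨ (IsFwd e μ ν j f ∧ x = μ f)) ∧ L b ≤ L x := by
  rcases hb with ⟨rfl, h2⟩ | ⟨h1, h2⟩ | ⟨r, h1, h2, h3⟩
  · exact ⟨f, Or.inl (nodeOf_not_recv h.start_not_recv).symm, by rw [h2]⟩
  · rcases lt_or_ge (ν f) (μ f) with hlt | hle
    · exact ⟨μ f, Or.inr ⟨⟨h1, hf, hlt⟩, rfl⟩, by rw [h2, max_eq_right hlt.le]⟩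
    · exact ⟨ν f, Or.inl (nodeOf_recv h1).symm, by rw [h2, max_eq_left hle]⟩
  · refine ⟨f, Or.inl ?_, ?_⟩
    · rw [nodeOf_not_recv (h2 ▸ h.matching.not_recv h1)]
    · rw [h3, ← h2]
      exact h.le_of_min h1

/-- The process through which `f` comes causally after `j` becomes active earlier. -/
theorem exists_earlier (h : Layout F e μ ν c m₀ j j₀ L) {f b : ℕ} (hf : IsFirst e μ j f)
    (hne : f ≠ j) (hb : ActAt e μ ν j f b) :
    (IsRecv e f ∧ ∃ f' b', SameProc e f' (μ f) ∧ IsFirst e μ j f' ∧ ActAt e μ ν j f' b' ∧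
      L b' < L b) ∨
    ∃ r, IsRecv e r ∧ μ r = f ∧ ∃ f' b', SameProc e f' r ∧ IsFirst e μ j f' ∧
      ActAt e μ ν j f' b' ∧ L b' < L b := by
  have key : ∀ i i' y, i < i' → SameProc e i i' → IsHot e μ j i →
      (y = nodeOf e ν i' ∨ (IsBwd e μ ν j i' ∧ y = μ i')) → L y ≤ L b →
      ∃ f' b', SameProc e f' i' ∧ IsFirst e μ j f' ∧ ActAt e μ ν j f' b' ∧ L b' < L b := by
    intro i i' y h1 h2 h3 h4 h5
    obtain ⟨f', h6, h7, h8⟩ := exists_isFirst h3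
    obtain ⟨b', hb'⟩ := h.exists_actAt h8
    obtain ⟨x, hx, hx'⟩ := h.exists_out h8 hb'
    have := h.edge (by omega) (h7.trans h2) hx h4
    exact ⟨f', b', h7.trans h2, h8, hb', by omega⟩
  rcases h.partner hf hne with ⟨hr, i, h1, h2, h3⟩ | ⟨r, hr, h0, i, h1, h2, h3⟩
  · refine Or.inl ⟨hr, key i _ (μ f) h1 h2 h3 (Or.inl (h.nodeOf_send hr).1.symm) ?_⟩
    have : b = max (ν f) (μ f) := h.actAt_unique hb (Or.inr (Or.inl ⟨hr, rfl⟩))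
    rw [this]
    exact h.le_max hr
  · refine Or.inr ⟨r, hr, h0, ?_⟩
    have hb' : b = min (ν r) (μ r) := h.actAt_unique hb (Or.inr (Or.inr ⟨r, hr, h0, rfl⟩))
    rcases lt_or_ge (μ r) (ν r) with hlt | hle
    -- The receive happens only at `ν r`, after `μ r`; that the earlier actions of the receiver
    -- nevertheless precede `μ r` is due to the additional edges into `μ r`.
    · exact key i r (μ r) h1 h2 h3 (Or.inr ⟨⟨hr, h0 ▸ hf, hlt⟩, rfl⟩)
        (by rw [hb', min_eq_right hlt.le])
    · exact key i r (ν r) h1 h2 h3 (Or.inl (nodeOf_recv hr).symm)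
        (by rw [hb', min_eq_left hle])

end Layout

/-! ### Modes along the schedule -/

/-- Node `b` makes process `p` active. -/
def Activates (e : List (Act P M)) (μ ν : ℕ → ℕ) (j : ℕ) (p : P) (b : ℕ) : Prop :=
  ∃ f, IsOn e f p ∧ IsFirst e μ j f ∧ ActAt e μ ν j f b

/-- Process `p` has become active before time `t`. -/
def ActiveAt (e : List (Act P M)) (μ ν : ℕ → ℕ) (j : ℕ) (L : ℕ → ℕ) (t : ℕ) (p : P) : Prop :=
  ∃ b, Activates e μ ν j p b ∧ L b < t

/-- At time `t`, process `p` is suspended after a receive from `f`. -/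
def FrozenAt (e : List (Act P M)) (μ ν : ℕ → ℕ) (j : ℕ) (L : ℕ → ℕ) (t : ℕ) (p f : P) : Prop :=
  ∃ (d : Channel P) (r : ℕ) (m : M), d.1.1 = f ∧ d.1.2 = p ∧ e[r]? = some (.recv d m) ∧
    IsFwd e μ ν j r ∧ L (ν r) < t ∧ t ≤ L (μ r)

/-- At time `t`, process `p` is suspended before a receive from `f`. -/
def WaitingAt (e : List (Act P M)) (μ ν : ℕ → ℕ) (j : ℕ) (L : ℕ → ℕ) (t : ℕ) (p f : P) : Prop :=
  ∃ (d : Channel P) (r : ℕ) (m : M), d.1.1 = f ∧ d.1.2 = p ∧ e[r]? = some (.recv d m) ∧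
    IsBwd e μ ν j r ∧ L (μ r) < t ∧ t ≤ L (ν r)

/-- The mode of process `p` at time `t`. -/
inductive IsMode (e : List (Act P M)) (μ ν : ℕ → ℕ) (j : ℕ) (L : ℕ → ℕ) (t : ℕ) (p : P) :
    Mode P → Prop
  | idle : ¬ ActiveAt e μ ν j L t p → (∀ f, ¬ FrozenAt e μ ν j L t p f) →
      IsMode e μ ν j L t p .idle
  | active : ActiveAt e μ ν j L t p → (∀ f, ¬ WaitingAt e μ ν j L t p f) →
      IsMode e μ ν j L t p .active
  | frozen {f : P} : FrozenAt e μ ν j L t p f → IsMode e μ ν j L t p (.frozen f)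
  | waiting {f : P} : WaitingAt e μ ν j L t p f → IsMode e μ ν j L t p (.waiting f)

theorem isOn_of_recv {r : ℕ} {d : Channel P} {m : M} (h : e[r]? = some (.recv d m)) :
    IsOn e r d.1.2 := ⟨_, h, rfl⟩

theorem isOn_of_send {r : ℕ} {d : Channel P} {m : M} (h : e[r]? = some (.send d m)) :
    IsOn e r d.1.1 := ⟨_, h, rfl⟩

theorem ActiveAt.mono {t' : ℕ} (h : ActiveAt e μ ν j L t p) (ht : t ≤ t') :
    ActiveAt e μ ν j L t' p := by
  obtain ⟨b, h1, h2⟩ := h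
  exact ⟨b, h1, by omega⟩

namespace Layout

theorem activates_unique (h : Layout F e μ ν c m₀ j j₀ L) {b b' : ℕ}
    (hb : Activates e μ ν j p b) (hb' : Activates e μ ν j p b') : b = b' := by
  obtain ⟨f, h1, h2, h3⟩ := hb
  obtain ⟨f', h4, h5, h6⟩ := hb'
  have := h2.unique h5 (h1.sameProc h4)
  subst this
  exact h.actAt_unique h3 h6

theorem not_activeAt (h : Layout F e μ ν c m₀ j j₀ L) {b : ℕ} (hb : Activates e μ ν j p b)
    (ht : t ≤ L b) : ¬ ActiveAt e μ ν j L t p := by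
  rintro ⟨b', h1, h2⟩
  rw [h.activates_unique h1 hb] at h2
  omega

theorem activates_of_isFwd {r : ℕ} {d : Channel P} {m : M} (hr : e[r]? = some (.recv d m))
    (hd : IsFwd e μ ν j r) : Activates e μ ν j d.1.2 (μ r) :=
  ⟨r, isOn_of_recv hr, hd.2.1, Or.inr (Or.inl ⟨hd.1, (max_eq_right hd.2.2.le).symm⟩)⟩

theorem activates_of_isBwd (h : Layout F e μ ν c m₀ j j₀ L) {r : ℕ} {d : Channel P} {m : M}
    (hr : e[r]? = some (.recv d m)) (hd : IsBwd e μ ν j r) : Activates e μ ν j d.1.1 (μ r) := by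
  obtain ⟨⟨m', h1⟩, -⟩ := h.sends hr
  exact ⟨μ r, isOn_of_send h1, hd.2.1, Or.inr (Or.inr ⟨r, hd.1, rfl, (min_eq_right hd.2.2.le).symm⟩)⟩

/-- The sender is active before a receive makes the receiver active. -/
theorem activeAt_sender (h : Layout F e μ ν c m₀ j j₀ L) {r b : ℕ} {d : Channel P} {m : M}
    (hr : e[r]? = some (.recv d m)) (hf : IsFirst e μ j r) (hb : ActAt e μ ν j r b)
    (ht : L b ≤ t) : ActiveAt e μ ν j L t d.1.1 := by
  have hne : r ≠ j := by
    rintro rfl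
    exact h.start_not_recv ⟨_, _, hr⟩
  obtain ⟨⟨m', h1⟩, -⟩ := h.sends hr
  rcases h.exists_earlier hf hne hb with ⟨-, f', b', h2, h3, h4, h5⟩ | ⟨r', hr', h2, -⟩
  · exact ⟨b', ⟨f', (h2.isOn_iff).2 (isOn_of_send h1), h3, h4⟩, by omega⟩
  · exact absurd (h2 ▸ ⟨_, _, hr⟩) (h.matching.not_recv hr')

/-- The receiver is active before its matched send makes the sender active. -/
theorem activeAt_receiver (h : Layout F e μ ν c m₀ j j₀ L) {r b : ℕ} {d : Channel P} {m : M}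
    (hr : e[r]? = some (.recv d m)) (hf : IsFirst e μ j (μ r)) (hb : ActAt e μ ν j (μ r) b)
    (ht : L b ≤ t) : ActiveAt e μ ν j L t d.1.2 := by
  have hr' : IsRecv e r := ⟨_, _, hr⟩
  rcases h.exists_earlier hf (h.unmatched r hr') hb with ⟨h1, -⟩ | ⟨r', h1, h2, f', b', h3, h4, h5, h6⟩
  · exact absurd h1 (h.matching.not_recv hr')
  · have := h.matching.inj h1 hr' h2
    subst this
    exact ⟨b', ⟨f', (h3.isOn_iff).2 (isOn_of_recv hr), h4, h5⟩, by omega⟩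

theorem not_active_of_frozen (h : Layout F e μ ν c m₀ j j₀ L) {f : P}
    (hf : FrozenAt e μ ν j L t p f) : ¬ ActiveAt e μ ν j L t p := by
  obtain ⟨d, r, m, -, rfl, hr, h1, h2, h3⟩ := hf
  exact h.not_activeAt (activates_of_isFwd hr h1) h3

theorem active_of_waiting (h : Layout F e μ ν c m₀ j j₀ L) {f : P}
    (hf : WaitingAt e μ ν j L t p f) : ActiveAt e μ ν j L t p := by
  obtain ⟨d, r, m, -, rfl, hr, h1, h2, h3⟩ := hf
  exact h.activeAt_receiver hr h1.2.1
    (Or.inr (Or.inr ⟨r, h1.1, rfl, (min_eq_right h1.2.2.le).symm⟩)) h2.le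

theorem bwd_unique (h : Layout F e μ ν c m₀ j j₀ L) {r r' : ℕ} (hr : IsBwd e μ ν j r)
    (hr' : IsBwd e μ ν j r') (hs : SameProc e r r') (h1 : L (μ r) ≤ t) (h2 : t ≤ L (ν r))
    (h1' : L (μ r') ≤ t) (h2' : t ≤ L (ν r')) : r = r' := by
  rcases lt_trichotomy r r' with hlt | heq | hlt
  · have := h.edge hlt hs (Or.inl (nodeOf_recv hr.1).symm) (Or.inr ⟨hr', rfl⟩)
    omega
  · exact heq
  · have := h.edge hlt hs.symm (Or.inl (nodeOf_recv hr'.1).symm) (Or.inr ⟨hr, rfl⟩)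
    omega

theorem isMode_unique (h : Layout F e μ ν c m₀ j j₀ L) {a a' : Mode P}
    (ha : IsMode e μ ν j L t p a) (ha' : IsMode e μ ν j L t p a') : a = a' := by
  cases ha <;> cases ha' <;> try rfl
  all_goals first
    | exact absurd ‹ActiveAt e μ ν j L t p› ‹_›
    | exact absurd (h.active_of_waiting ‹_›) ‹¬ ActiveAt e μ ν j L t p›
    | exact absurd ‹FrozenAt e μ ν j L t p _› (‹∀ f, ¬ FrozenAt e μ ν j L t p f› _)
    | exact absurd ‹WaitingAt e μ ν j L t p _› (‹∀ f, ¬ WaitingAt e μ ν j L t p f› _)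
    | exact absurd ‹ActiveAt e μ ν j L t p› (h.not_active_of_frozen ‹_›)
    | exact absurd (h.active_of_waiting ‹_›) (h.not_active_of_frozen ‹_›)
    | skip
  · rename_i f h1 f' h2
    obtain ⟨d, r, m, rfl, h3, hr, h4, -⟩ := h1
    obtain ⟨d', r', m', rfl, h3', hr', h4', -⟩ := h2
    have hon : IsOn e r p := h3 ▸ isOn_of_recv hr
    have hon' : IsOn e r' p := h3' ▸ isOn_of_recv hr'
    have := h4.2.1.unique h4'.2.1 (hon.sameProc hon')
    subst this
    rw [hr] at hr'
    cases hr'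
    rfl
  · rename_i f h1 f' h2
    obtain ⟨d, r, m, rfl, h3, hr, h4, h5, h6⟩ := h1
    obtain ⟨d', r', m', rfl, h3', hr', h4', h5', h6'⟩ := h2
    have hon : IsOn e r p := h3 ▸ isOn_of_recv hr
    have hon' : IsOn e r' p := h3' ▸ isOn_of_recv hr'
    have := h.bwd_unique h4 h4' (hon.sameProc hon') h5.le h6 h5'.le h6'
    subst this
    rw [hr] at hr'
    cases hr'
    rfl

/-- A process that acts at time `t` is free, unless it acts by a receive it was waiting for. -/
theorem free_or_bwd (h : Layout F e μ ν c m₀ j j₀ L) {i : ℕ} {a : Mode P} (hi : IsOn e i p)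
    (ht : L (nodeOf e ν i) = t) (ha : IsMode e μ ν j L t p a) : a.Free ∨ IsBwd e μ ν j i := by
  cases ha with
  | idle => exact Or.inl (Or.inl rfl)
  | active => exact Or.inl (Or.inr rfl)
  | frozen h1 =>
    obtain ⟨d, r, m, -, rfl, hr, h4, h5, h6⟩ := h1
    have hs := hi.sameProc (isOn_of_recv hr)
    rcases lt_trichotomy i r with hlt | heq | hlt
    · have := h.lt_of_lt hlt hs
      rw [nodeOf_recv h4.1] at this
      omega
    · subst heq
      rw [nodeOf_recv h4.1] at ht
      omega
    -- What follows the receive of a frozen process is scheduled after `μ r`, that is, after it has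
    -- thawed.
    · have := h.edge hlt hs.symm (Or.inr ⟨h4, rfl⟩) (Or.inl rfl)
      omega
  | waiting h1 =>
    obtain ⟨d, r, m, -, rfl, hr, h4, h5, h6⟩ := h1
    have hs := hi.sameProc (isOn_of_recv hr)
    rcases lt_trichotomy i r with hlt | heq | hlt
    · have := h.edge hlt hs (Or.inl rfl) (Or.inr ⟨h4, rfl⟩)
      omega
    · subst heq
      exact Or.inr h4
    · have := h.lt_of_lt hlt hs.symm
      rw [nodeOf_recv h4.1] at this
      omega

end Layout

end Schedule


/-! ### One time step of the schedule: modes, control states and the flag -/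

section ScheduleStep

variable {P M : Type} {F : Set Failure} {e : List (Act P M)} {μ ν L : ℕ → ℕ} {c : Channel P}
  {m₀ : M} {j j₀ t : ℕ} {p : P} {S : FIFOSystem P M} {st : ℕ → ∀ p, Fin (S.numStates p)}

/-- What happens at time `t` does not concern the mode of `p`. -/
def Unaffected (e : List (Act P M)) (μ ν : ℕ → ℕ) (j : ℕ) (p : P) (b : ℕ) : Prop :=
  ¬ Activates e μ ν j p b ∧ ∀ (d : Channel P) (r : ℕ) (m : M), e[r]? = some (.recv d m) →
    d.1.2 = p → (IsFwd e μ ν j r → ν r ≠ b) ∧ (IsBwd e μ ν j r → μ r ≠ b ∧ ν r ≠ b)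

theorem Activates.lt (hm : IsMatching e μ) (hm' : IsMatching e ν) {b : ℕ}
    (hb : Activates e μ ν j p b) : b < e.length := by
  obtain ⟨f, h1, h2, ⟨h3, h4⟩ | ⟨h3, h4⟩ | ⟨r, h3, h4, h5⟩⟩ := hb
  · rw [h4, ← h3]
    exact h1.lt
  · have := hm.lt h3
    have := hm'.lt h3
    have := h3.lt
    rw [h4]
    exact max_lt (by omega) (by omega)
  · have := hm.lt h3
    have := h3.lt
    rw [h5]
    exact lt_of_le_of_lt (min_le_right _ _) (by omega)

namespace Layout

/-- The mode of `p` depends on the time only through comparisons with the numbers of the node that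
activates `p` and of the two sends of its receives; none of these is the current time. -/
theorem isMode_succ (h : Layout F e μ ν c m₀ j j₀ L) {a : Mode P}
    (hu : ∀ b < e.length, L b = t → Unaffected e μ ν j p b) (ha : IsMode e μ ν j L t p a) :
    IsMode e μ ν j L (t + 1) p a := by
  have hlt : ∀ {r : ℕ} {d : Channel P} {m : M}, e[r]? = some (.recv d m) →
      μ r < e.length ∧ ν r < e.length := fun {r d m} hr => by
    have hr' : IsRecv e r := ⟨_, _, hr⟩
    have h1 := h.matching.lt hr'
    have h2 := h.honest.lt hr'
    have := hr'.lt
    omega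
  cases ha with
  | idle h1 h2 =>
    refine .idle ?_ ?_
    · rintro ⟨b, h3, h4⟩
      have hb := h3.lt h.matching h.honest.toIsMatching
      rcases Nat.lt_succ_iff_lt_or_eq.1 h4 with h5 | h5
      · exact h1 ⟨b, h3, h5⟩
      · exact (hu b hb h5).1 h3
    · rintro f ⟨d, r, m, h3, h4, hr, h5, h6, h7⟩
      rcases Nat.lt_succ_iff_lt_or_eq.1 h6 with h8 | h8
      · exact h2 f ⟨d, r, m, h3, h4, hr, h5, h8, by omega⟩
      · exact ((hu _ (hlt hr).2 h8).2 d r m hr h4).1 h5 rfl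
  | active h1 h2 =>
    refine .active (h1.mono (by omega)) ?_
    rintro f ⟨d, r, m, h3, h4, hr, h5, h6, h7⟩
    rcases Nat.lt_succ_iff_lt_or_eq.1 h6 with h8 | h8
    · exact h2 f ⟨d, r, m, h3, h4, hr, h5, h8, by omega⟩
    · exact (((hu _ (hlt hr).1 h8).2 d r m hr h4).2 h5).1 rfl
  | frozen h1 =>
    obtain ⟨d, r, m, h3, h4, hr, h5, h6, h7⟩ := h1
    refine .frozen ⟨d, r, m, h3, h4, hr, h5, by omega, ?_⟩
    rcases Nat.lt_or_eq_of_le h7 with h8 | h8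
    · exact h8
    · exact absurd (h4 ▸ activates_of_isFwd hr h5) (hu _ (hlt hr).1 h8.symm).1
  | waiting h1 =>
    obtain ⟨d, r, m, h3, h4, hr, h5, h6, h7⟩ := h1
    refine .waiting ⟨d, r, m, h3, h4, hr, h5, by omega, ?_⟩
    rcases Nat.lt_or_eq_of_le h7 with h8 | h8
    · exact h8
    · exact absurd rfl (((hu _ (hlt hr).2 h8.symm).2 d r m hr h4).2 h5).2

/-- Waiting at time `t + 1` would mean that a waiting period begins at `b`, which `h3` excludes, or
continues. By `h2` one that is running ends at `b`, and periods do not overlap. -/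
theorem isMode_active_succ (h : Layout F e μ ν c m₀ j j₀ L) {b : ℕ} (hb : b < e.length)
    (ht : L b = t) (h1 : ActiveAt e μ ν j L (t + 1) p)
    (h2 : ∀ f, ¬ WaitingAt e μ ν j L t p f ∨ ∃ d r m, e[r]? = some (.recv d m) ∧ d.1.2 = p ∧
      IsBwd e μ ν j r ∧ ν r = b)
    (h3 : ∀ (d : Channel P) (r : ℕ) (m : M), e[r]? = some (.recv d m) → d.1.2 = p →
      IsBwd e μ ν j r → μ r ≠ b) : IsMode e μ ν j L (t + 1) p .active := by
  refine .active h1 ?_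
  rintro f ⟨d, r, m, h4, h5, hr, h6, h7, h8⟩
  have hlt : μ r < e.length := (h.matching.lt h6.1).trans h6.1.lt
  rcases Nat.lt_succ_iff_lt_or_eq.1 h7 with h9 | h9
  · rcases h2 f with h2 | ⟨d', r', m', hr', h10, h11, h12⟩
    · exact h2 ⟨d, r, m, h4, h5, hr, h6, h9, by omega⟩
    · have hon : IsOn e r p := h5 ▸ isOn_of_recv hr
      have hon' : IsOn e r' p := h10 ▸ isOn_of_recv hr'
      subst h12
      have hs := hon.sameProc hon'
      have h13 := h.lt_of_lt (i := μ r') (i' := ν r') h11.2.2 (h.sameProc_sends h11.1)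
      rw [(h.nodeOf_send h11.1).1, (h.nodeOf_send h11.1).2] at h13
      have := h.bwd_unique (t := t) h6 h11 hs (by omega) (by omega) (by omega) (by omega)
      subst this
      omega
  · exact h3 d r m hr h5 h6 (h.inj _ _ hlt hb (h9.trans ht.symm))

/-- How a send can make a process active. -/
theorem activates_send (h : Layout F e μ ν c m₀ j j₀ L) {b : ℕ} {d : Channel P} {m : M}
    (hb : e[b]? = some (.send d m)) (ha : Activates e μ ν j p b) :
    (p = d.1.1 ∧ (b = j ∨ ∃ r m', e[r]? = some (.recv d m') ∧ IsFirst e μ j (μ r) ∧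
      b = min (ν r) (μ r))) ∨
    (p = d.1.2 ∧ ∃ r m', e[r]? = some (.recv d m') ∧ IsFirst e μ j r ∧ b = max (ν r) (μ r)) := by
  have hon := isOn_of_send hb
  have key : ∀ {r d' m'}, e[r]? = some (.recv d' m') → b = ν r ∨ b = μ r → d' = d := by
    intro r d' m' hr h1
    obtain ⟨⟨m1, h2⟩, m2, h3⟩ := h.sends hr
    rcases h1 with rfl | rfl
    · rw [h3] at hb
      cases hb
      rfl
    · rw [h2] at hb
      cases hb
      rfl
  obtain ⟨f, h1, h2, ⟨h3, h4⟩ | ⟨⟨d', m', h3⟩, h4⟩ | ⟨r, ⟨d', m', h3⟩, h4, h5⟩⟩ := ha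
  · subst h4
    subst h3
    exact Or.inl ⟨h1.unique hon, Or.inl rfl⟩
  · have := key h3 (h4 ▸ max_choice _ _)
    subst this
    exact Or.inr ⟨h1.unique (isOn_of_recv h3), f, m', h3, h2, h4⟩
  · have := key h3 (h5 ▸ min_choice _ _)
    subst this
    subst h4
    obtain ⟨⟨m1, h6⟩, -⟩ := h.sends h3
    exact Or.inl ⟨h1.unique (isOn_of_send h6), Or.inr ⟨r, m', h3, h2, h5⟩⟩

theorem channel_eq (h : Layout F e μ ν c m₀ j j₀ L) {b r : ℕ} {d d' : Channel P} {m m' : M}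
    (hb : e[b]? = some (.send d m)) (hr : e[r]? = some (.recv d' m')) (heq : μ r = b ∨ ν r = b) :
    d' = d := by
  obtain ⟨⟨m1, h2⟩, m2, h3⟩ := h.sends hr
  rcases heq with rfl | rfl
  · rw [h2] at hb
    cases hb
    rfl
  · rw [h3] at hb
    cases hb
    rfl

/-- The mode of a sender is only affected by its becoming active. -/
theorem unaffected_of_ne (h : Layout F e μ ν c m₀ j j₀ L) {b : ℕ} {d : Channel P} {m : M}
    (hb : e[b]? = some (.send d m)) (hp : p ≠ d.1.2) (ha : ¬ Activates e μ ν j p b) :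
    Unaffected e μ ν j p b := by
  refine ⟨ha, fun d' r m' hr hd => ⟨fun _ heq => ?_, fun _ => ⟨fun heq => ?_, fun heq => ?_⟩⟩⟩
  · exact hp (hd ▸ h.channel_eq hb hr (Or.inr heq) ▸ rfl)
  · exact hp (hd ▸ h.channel_eq hb hr (Or.inl heq) ▸ rfl)
  · exact hp (hd ▸ h.channel_eq hb hr (Or.inr heq) ▸ rfl)

theorem unaffected_of_other (h : Layout F e μ ν c m₀ j j₀ L) {b : ℕ} {d : Channel P} {m : M}
    (hb : e[b]? = some (.send d m)) (hp : p ≠ d.1.1) (hp' : p ≠ d.1.2) :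
    Unaffected e μ ν j p b := by
  refine h.unaffected_of_ne hb hp' fun ha => ?_
  rcases h.activates_send hb ha with ⟨h1, -⟩ | ⟨h1, -⟩
  · exact hp h1
  · exact hp' h1

/-- A receiver whose matched sends are not this one is not affected. -/
theorem unaffected_receiver (h : Layout F e μ ν c m₀ j j₀ L) {b : ℕ} {d : Channel P} {m : M}
    (hb : e[b]? = some (.send d m))
    (hr : ∀ r m', e[r]? = some (.recv d m') →
      (μ r = b → ¬ IsBwd e μ ν j r) ∧ (ν r = b → ¬ IsBwd e μ ν j r ∧ ¬ IsFwd e μ ν j r) ∧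
      (b = max (ν r) (μ r) → ¬ IsFirst e μ j r)) :
    Unaffected e μ ν j d.1.2 b := by
  refine ⟨fun ha => ?_, fun d' r m' hr' hd => ⟨fun h1 heq => ?_, fun h1 => ⟨fun heq => ?_, fun heq => ?_⟩⟩⟩
  · rcases h.activates_send hb ha with ⟨h1, -⟩ | ⟨-, r, m', h1, h2, h3⟩
    · exact d.2 h1.symm
    · exact (hr r m' h1).2.2 h3 h2
  · have := h.channel_eq hb hr' (Or.inr heq)
    subst this
    exact ((hr r m' hr').2.1 heq).2 h1
  · have := h.channel_eq hb hr' (Or.inl heq)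
    subst this
    exact (hr r m' hr').1 heq h1
  · have := h.channel_eq hb hr' (Or.inr heq)
    subst this
    exact ((hr r m' hr').2.1 heq).1 h1

end Layout

/-! ### States along the schedule -/

/-- The transitions along `e`, with the states `st`. -/
def IsRun (S : FIFOSystem P M) (e : List (Act P M)) (st : ℕ → ∀ p, Fin (S.numStates p)) : Prop :=
  ∀ i a, e[i]? = some a → (st i a.proc, a, st (i + 1) a.proc) ∈ S.trans a.proc ∧
    ∀ r, r ≠ a.proc → st (i + 1) r = st i r

theorem IsRun.eq_of_forall (hst : IsRun S e st) {x y : ℕ} (hxy : x ≤ y) (hy : y ≤ e.length)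
    (hno : ∀ i, x ≤ i → i < y → ¬ IsOn e i p) : st x p = st y p := by
  induction y, hxy using Nat.le_induction with
  | base => rfl
  | succ y hxy ih =>
    rw [ih (by omega) fun i h1 h2 => hno i h1 (by omega)]
    have hy' : e[y]? = some (e[y]'(by omega)) := by simp
    refine ((hst y _ hy').2 p fun hp => hno y hxy (by omega) ⟨_, hy', hp.symm⟩).symm

/-- The state `q` of process `p` is the one before its first action that is not scheduled before
time `t`. -/
def StateAt (e : List (Act P M)) (ν L : ℕ → ℕ) (st : ℕ → ∀ p, Fin (S.numStates p)) (t : ℕ) (p : P)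
    (q : Fin (S.numStates p)) : Prop :=
  ∃ x ≤ e.length, q = st x p ∧ ∀ i, IsOn e i p → (L (nodeOf e ν i) < t ↔ i < x)

theorem StateAt.keep {q : Fin (S.numStates p)} (hq : StateAt e ν L st t p q)
    (hno : ∀ i, IsOn e i p → L (nodeOf e ν i) ≠ t) : StateAt e ν L st (t + 1) p q := by
  obtain ⟨x, h1, h2, h3⟩ := hq
  refine ⟨x, h1, h2, fun i hi => ?_⟩
  rw [← h3 i hi]
  have := hno i hi
  omega

/-- The schedule respects the order of the actions of each process, so those already scheduled form
an initial segment and position `i` is the next one. -/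
theorem Layout.state_advance (h : Layout F e μ ν c m₀ j j₀ L) (hst : IsRun S e st)
    {q : Fin (S.numStates p)} (hq : StateAt e ν L st t p q) {i : ℕ} (hi : IsOn e i p)
    (ht : L (nodeOf e ν i) = t) : q = st i p ∧ StateAt e ν L st (t + 1) p (st (i + 1) p) := by
  obtain ⟨x, h1, rfl, h3⟩ := hq
  refine ⟨hst.eq_of_forall ?_ hi.lt.le ?_, i + 1, hi.lt, rfl, fun i' hi' => ?_⟩
  · have := (h3 i hi).not.1 (by omega)
    omega
  · intro i' h4 h5 h6
    have := (h3 i' h6).not.2 (by omega)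
    have := h.lt_of_lt h5 (h6.sameProc hi)
    omega
  · rcases lt_trichotomy i i' with hlt | heq | hlt
    · have := h.lt_of_lt hlt (hi.sameProc hi')
      omega
    · subst heq
      omega
    · have := h.lt_of_lt hlt (hi'.sameProc hi)
      omega

/-- The search node `n` is the one at time `t` of the schedule. -/
structure NodeAt (e : List (Act P M)) (μ ν : ℕ → ℕ) (j j₀ : ℕ) (L : ℕ → ℕ)
    (st : ℕ → ∀ p, Fin (S.numStates p)) (t : ℕ) (n : SearchNode S) : Prop where
  state : ∀ p, StateAt e ν L st t p (n.state p)
  mode : ∀ p, IsMode e μ ν j L t p (n.mode p)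
  flag : L j₀ < t → n.flag = true

namespace Layout

theorem start_lt (h : Layout F e μ ν c m₀ j j₀ L) : j₀ < e.length := lt_length_of_getElem? h.avail

theorem nodeAt_zero (h0 : st 0 = S.init) :
    NodeAt e μ ν j j₀ L st 0 (SearchNode.init S) where
  state p := ⟨0, Nat.zero_le _, by rw [h0]; rfl, by simp⟩
  mode p := .idle (by simp [ActiveAt]) (by simp [FrozenAt])
  flag := by simp

/-- Nothing happens at numbers that are not taken, nor at the number of a receive: a receive is not
a node and takes place at the number of its honest send. -/
theorem nodeAt_skip (h : Layout F e μ ν c m₀ j j₀ L) {n : SearchNode S}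
    (hn : NodeAt e μ ν j j₀ L st t n) (hno : ∀ b < e.length, ¬ IsRecv e b → L b ≠ t) :
    NodeAt e μ ν j j₀ L st (t + 1) n where
  state p := (hn.state p).keep fun i hi =>
    hno _ ((h.honest.toIsMatching.nodeOf_le i).trans_lt hi.lt) (h.honest.nodeOf_not_recv i)
  mode p := by
    refine h.isMode_succ (fun b hb hb' => ?_) (hn.mode p)
    have hir : IsRecv e b := by
      by_contra hc
      exact hno b hb hc hb'
    have hμ : ∀ r, IsRecv e r → μ r ≠ b := fun r hr heq => h.matching.not_recv hr (heq ▸ hir)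
    have hν : ∀ r, IsRecv e r → ν r ≠ b := fun r hr heq => h.honest.not_recv hr (heq ▸ hir)
    refine ⟨?_, fun d r m hd _ => ⟨fun _ => hν r ⟨_, _, hd⟩, fun _ => ⟨hμ r ⟨_, _, hd⟩, hν r ⟨_, _, hd⟩⟩⟩⟩
    rintro ⟨f, -, -, ⟨-, h4⟩ | ⟨hd, h4⟩ | ⟨r, hd, -, h4⟩⟩
    · exact h.start_not_recv (h4 ▸ hir)
    · rcases max_choice (ν f) (μ f) with h5 | h5
      · exact hν f hd (h5.symm.trans h4.symm)
      · exact hμ f hd (h5.symm.trans h4.symm)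
    · rcases min_choice (ν r) (μ r) with h5 | h5
      · exact hν r hd (h5.symm.trans h4.symm)
      · exact hμ r hd (h5.symm.trans h4.symm)
  flag hlt := hn.flag (by
    have := hno _ h.start_lt (not_isRecv_of_send h.avail)
    omega)

theorem nodeAt_internal (h : Layout F e μ ν c m₀ j j₀ L) (hst : IsRun S e st) {n : SearchNode S}
    (hn : NodeAt e μ ν j j₀ L st t n) {b x : ℕ} (hb : e[b]? = some (.internal p x))
    (ht : L b = t) : ∃ n', Move F c m₀ n n' ∧ NodeAt e μ ν j j₀ L st (t + 1) n' := by
  classical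
  have hlt := lt_length_of_getElem? hb
  have hnr := not_isRecv_of_internal hb
  have hon : IsOn e b p := ⟨_, hb, rfl⟩
  have hN : nodeOf e ν b = b := nodeOf_not_recv hnr
  obtain ⟨h1, h2⟩ := h.state_advance hst (hn.state p) hon (by rw [hN]; exact ht)
  refine ⟨⟨Function.update n.state p (st (b + 1) p), n.mode, n.flag⟩,
    .internal p x ?_ ?_ ?_ rfl rfl, ?_, ?_, ?_⟩
  · simp only [Function.update_self]
    rw [h1]
    exact (hst b _ hb).1
  · exact fun r hr => Function.update_of_ne hr _ _
  · exact (h.free_or_bwd hon (by rw [hN]; exact ht) (hn.mode p)).resolve_right fun hd => hnr hd.1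
  · intro r
    by_cases hr : r = p
    · subst hr
      simpa using h2
    · simp only [Function.update_of_ne hr]
      refine (hn.state r).keep fun i hi heq => hr ?_
      have h3 : nodeOf e ν i = b :=
        h.inj _ _ ((h.honest.toIsMatching.nodeOf_le i).trans_lt hi.lt) hlt (heq.trans ht.symm)
      by_cases hir : IsRecv e i
      · rw [nodeOf_recv hir] at h3
        obtain ⟨d, m, hd⟩ := hir
        obtain ⟨-, m', h4⟩ := h.sends hd
        rw [h3, hb] at h4
        cases h4
      · rw [nodeOf_not_recv hir] at h3
        subst h3
        exact hi.unique hon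
  · intro r
    refine h.isMode_succ (fun b' hb' ht' => ?_) (hn.mode r)
    have := h.inj _ _ hb' hlt (ht'.trans ht.symm)
    subst this
    have key : ∀ {r d m}, e[r]? = some (.recv d m) → μ r ≠ b' ∧ ν r ≠ b' := by
      intro r d m hd
      obtain ⟨⟨m1, h4⟩, m2, h5⟩ := h.sends hd
      constructor
      · rintro rfl
        rw [hb] at h4
        cases h4
      · rintro rfl
        rw [hb] at h5
        cases h5
    refine ⟨?_, fun d r m hd _ => ⟨fun _ => (key hd).2, fun _ => key hd⟩⟩
    rintro ⟨f, -, -, ⟨-, h4⟩ | ⟨⟨d, m, hd⟩, h4⟩ | ⟨r, ⟨d, m, hd⟩, -, h4⟩⟩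
    · obtain ⟨m, hm⟩ := h.start
      rw [h4, hm] at hb
      cases hb
    · rcases max_choice (ν f) (μ f) with h5 | h5
      · exact (key hd).2 (h5.symm.trans h4.symm)
      · exact (key hd).1 (h5.symm.trans h4.symm)
    · rcases min_choice (ν r) (μ r) with h5 | h5
      · exact (key hd).2 (h5.symm.trans h4.symm)
      · exact (key hd).1 (h5.symm.trans h4.symm)
  · intro h3
    refine hn.flag ?_
    rcases Nat.lt_succ_iff_lt_or_eq.1 h3 with h4 | h4
    · exact h4
    · have := h.inj _ _ h.start_lt hlt (h4.trans ht.symm)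
      have h5 := h.avail
      rw [this, hb] at h5
      cases h5

/-- An unmatched send is performed. -/
theorem nodeAt_send (h : Layout F e μ ν c m₀ j j₀ L) (hst : IsRun S e st) {n : SearchNode S}
    (hn : NodeAt e μ ν j j₀ L st t n) {b : ℕ} {d : Channel P} {m : M}
    (hb : e[b]? = some (.send d m)) (ht : L b = t) (hun : ∀ r, IsRecv e r → ν r ≠ b)
    {a a' : Mode P} (hm : SendModes c d (n.mode d.1.1) (n.mode d.1.2) a a')
    (ha : IsMode e μ ν j L (t + 1) d.1.1 a) (ha' : IsMode e μ ν j L (t + 1) d.1.2 a') :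
    ∃ n', Move F c m₀ n n' ∧ NodeAt e μ ν j j₀ L st (t + 1) n' := by
  classical
  have hlt := lt_length_of_getElem? hb
  have hnr := not_isRecv_of_send hb
  have hon := isOn_of_send hb
  have hN : nodeOf e ν b = b := nodeOf_not_recv hnr
  obtain ⟨h1, h2⟩ := h.state_advance hst (hn.state _) hon (by rw [hN]; exact ht)
  refine ⟨⟨Function.update n.state d.1.1 (st (b + 1) d.1.1),
    Function.update (Function.update n.mode d.1.1 a) d.1.2 a',
    decide (n.flag = true ∨ (d = c ∧ MsgOk F m m₀))⟩, .send d m ?_ ?_ ?_ ?_ ?_, ?_, ?_, ?_⟩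
  · simp only [Function.update_self]
    rw [h1]
    exact (hst b _ hb).1
  · exact fun r hr => Function.update_of_ne hr _ _
  · simpa [Function.update_of_ne d.2] using hm
  · intro r hr hr'
    simp only
    rw [Function.update_of_ne hr', Function.update_of_ne hr]
  · simp
  · intro r
    by_cases hr : r = d.1.1
    · subst hr
      simpa using h2
    · simp only [Function.update_of_ne hr]
      refine (hn.state r).keep fun i hi heq => hr ?_
      have h3 : nodeOf e ν i = b :=
        h.inj _ _ ((h.honest.toIsMatching.nodeOf_le i).trans_lt hi.lt) hlt (heq.trans ht.symm)
      by_cases hir : IsRecv e i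
      · rw [nodeOf_recv hir] at h3
        exact absurd h3 (hun i hir)
      · rw [nodeOf_not_recv hir] at h3
        subst h3
        exact hi.unique hon
  · intro r
    by_cases hr' : r = d.1.2
    · subst hr'
      simpa using ha'
    by_cases hr : r = d.1.1
    · subst hr
      simpa [Function.update_of_ne d.2] using ha
    simp only [Function.update_of_ne hr, Function.update_of_ne hr']
    refine h.isMode_succ (fun b' hb' ht' => ?_) (hn.mode r)
    have := h.inj _ _ hb' hlt (ht'.trans ht.symm)
    subst this
    exact h.unaffected_of_other hb hr hr'
  · intro h3
    simp only [decide_eq_true_eq]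
    rcases Nat.lt_succ_iff_lt_or_eq.1 h3 with h4 | h4
    · exact Or.inl (hn.flag h4)
    · have := h.inj _ _ h.start_lt hlt (h4.trans ht.symm)
      have h5 := h.avail
      rw [this, hb] at h5
      cases h5
      exact Or.inr ⟨rfl, Or.inr rfl⟩

/-- A matched pair is performed. -/
theorem nodeAt_sync (h : Layout F e μ ν c m₀ j j₀ L) (hst : IsRun S e st) {n : SearchNode S}
    (hn : NodeAt e μ ν j j₀ L st t n) {b r : ℕ} {d : Channel P} {m' : M}
    (hr : e[r]? = some (.recv d m')) (hb : ν r = b) (ht : L b = t)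
    {a a' : Mode P} (hm : SyncModes c d (n.mode d.1.1) (n.mode d.1.2) a a')
    (ha : IsMode e μ ν j L (t + 1) d.1.1 a) (ha' : IsMode e μ ν j L (t + 1) d.1.2 a') :
    ∃ n', Move F c m₀ n n' ∧ NodeAt e μ ν j j₀ L st (t + 1) n' := by
  classical
  obtain ⟨m, hbm, hok⟩ := h.honest.msg hr
  rw [hb] at hbm
  have hir : IsRecv e r := ⟨_, _, hr⟩
  have hlt := lt_length_of_getElem? hbm
  have hon := isOn_of_send hbm
  have hon' := isOn_of_recv hr
  have hN : nodeOf e ν b = b := nodeOf_not_recv (not_isRecv_of_send hbm)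
  have hN' : nodeOf e ν r = b := by rw [nodeOf_recv hir, hb]
  obtain ⟨h1, h2⟩ := h.state_advance hst (hn.state _) hon (by rw [hN]; exact ht)
  obtain ⟨h1', h2'⟩ := h.state_advance hst (hn.state _) hon' (by rw [hN']; exact ht)
  refine ⟨⟨Function.update (Function.update n.state d.1.1 (st (b + 1) d.1.1)) d.1.2
      (st (r + 1) d.1.2),
    Function.update (Function.update n.mode d.1.1 a) d.1.2 a',
    decide (n.flag = true ∧ ¬ (IsFifo F ∧ d = c))⟩, .sync d m m' hok ?_ ?_ ?_ ?_ ?_ ?_, ?_, ?_, ?_⟩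
  · simp only [Function.update_of_ne d.2, Function.update_self]
    rw [h1]
    exact (hst b _ hbm).1
  · simp only [Function.update_self]
    rw [h1']
    exact (hst r _ hr).1
  · intro r hr hr'
    simp only
    rw [Function.update_of_ne hr', Function.update_of_ne hr]
  · simpa [Function.update_of_ne d.2] using hm
  · intro r hr hr'
    simp only
    rw [Function.update_of_ne hr', Function.update_of_ne hr]
  · simp only [decide_eq_true_eq]
  · intro q
    by_cases hq' : q = d.1.2
    · subst hq'
      simpa using h2'
    by_cases hq : q = d.1.1
    · subst hq
      simpa [Function.update_of_ne d.2] using h2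
    simp only [Function.update_of_ne hq, Function.update_of_ne hq']
    refine (hn.state q).keep fun i hi heq => ?_
    have h3 : nodeOf e ν i = b :=
      h.inj _ _ ((h.honest.toIsMatching.nodeOf_le i).trans_lt hi.lt) hlt (heq.trans ht.symm)
    by_cases hir' : IsRecv e i
    · rw [nodeOf_recv hir', ← hb] at h3
      have := h.honest.inj hir' hir h3
      subst this
      exact hq' (hi.unique hon')
    · rw [nodeOf_not_recv hir'] at h3
      subst h3
      exact hq (hi.unique hon)
  · intro q
    by_cases hq' : q = d.1.2
    · subst hq'
      simpa using ha'
    by_cases hq : q = d.1.1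
    · subst hq
      simpa [Function.update_of_ne d.2] using ha
    simp only [Function.update_of_ne hq, Function.update_of_ne hq']
    refine h.isMode_succ (fun b' hb' ht' => ?_) (hn.mode q)
    have := h.inj _ _ hb' hlt (ht'.trans ht.symm)
    subst this
    exact h.unaffected_of_other hbm hq hq'
  · intro h3
    simp only [decide_eq_true_eq]
    rcases Nat.lt_succ_iff_lt_or_eq.1 h3 with h4 | h4
    · refine ⟨hn.flag h4, ?_⟩
      -- On lossy queues, a handshake on `c` destroys the available message. But all receives of `e`
      -- on `c` have honest sends before `j₀`, so no such handshake is scheduled after `j₀`.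
      rintro ⟨h5, rfl⟩
      have h6 := h.avail_fifo h5 r m' hr
      have h7 := h.lt_of_lt h6 (sameProc_of_send (hb ▸ hbm) h.avail)
      rw [(h.nodeOf_send hir).2, nodeOf_not_recv (not_isRecv_of_send h.avail), hb] at h7
      omega
    · have := h.inj _ _ h.start_lt hlt (h4.trans ht.symm)
      exact absurd (hb.trans this.symm) (h.avail_unmatched r hir)

end Layout

end ScheduleStep


/-! ### Every step of the schedule is a move of the search -/

section ScheduleCases

variable {P M : Type} {F : Set Failure} {e : List (Act P M)} {μ ν L : ℕ → ℕ} {c : Channel P}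
  {m₀ : M} {j j₀ t : ℕ} {p : P} {S : FIFOSystem P M} {st : ℕ → ∀ p, Fin (S.numStates p)}

namespace Layout

theorem isMode_idle {a : Mode P} (ha : IsMode e μ ν j L t p a)
    (hf : a.Free) (hn : ¬ ActiveAt e μ ν j L t p) : a = .idle := by
  rcases hf with rfl | rfl
  · rfl
  · cases ha with
    | active h1 _ => exact absurd h1 hn

theorem isMode_active {a : Mode P} (ha : IsMode e μ ν j L t p a)
    (hf : a.Free) (hn : ActiveAt e μ ν j L t p) : a = .active := by
  rcases hf with rfl | rfl
  · cases ha with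
    | idle h1 _ => exact absurd hn h1
  · rfl

theorem not_waiting_of_free (h : Layout F e μ ν c m₀ j j₀ L) {a : Mode P}
    (ha : IsMode e μ ν j L t p a) (hf : a.Free) (f : P) : ¬ WaitingAt e μ ν j L t p f := by
  intro hw
  have := h.isMode_unique ha (.waiting hw)
  subst this
  rcases hf with h1 | h1 <;> cases h1

theorem sender_active_succ (h : Layout F e μ ν c m₀ j j₀ L) {b : ℕ} {d : Channel P} {m : M}
    (hb : e[b]? = some (.send d m)) (ht : L b = t) {a : Mode P}
    (ha : IsMode e μ ν j L t d.1.1 a) (hf : a.Free)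
    (hact : ActiveAt e μ ν j L (t + 1) d.1.1) : IsMode e μ ν j L (t + 1) d.1.1 .active := by
  refine h.isMode_active_succ (lt_length_of_getElem? hb) ht hact
    (fun f => Or.inl (h.not_waiting_of_free ha hf f)) fun d' r m' hr hd _ heq => ?_
  have := h.channel_eq hb hr (Or.inl heq)
  subst this
  exact d'.2 hd.symm

theorem isMode_succ_of_send (h : Layout F e μ ν c m₀ j j₀ L) {b : ℕ} (hb : b < e.length)
    (ht : L b = t) {a : Mode P} (hu : Unaffected e μ ν j p b) (ha : IsMode e μ ν j L t p a) :
    IsMode e μ ν j L (t + 1) p a := by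
  refine h.isMode_succ (fun b' hb' ht' => ?_) ha
  have := h.inj _ _ hb' hb (ht'.trans ht.symm)
  subst this
  exact hu

theorem free_sender (h : Layout F e μ ν c m₀ j j₀ L) {b : ℕ} {d : Channel P} {m : M}
    (hb : e[b]? = some (.send d m)) (ht : L b = t) {a : Mode P}
    (ha : IsMode e μ ν j L t d.1.1 a) : a.Free := by
  have hnr := not_isRecv_of_send hb
  exact (h.free_or_bwd (isOn_of_send hb) (by rw [nodeOf_not_recv hnr]; exact ht) ha).resolve_right
    fun hd => hnr hd.1

/-- Every unmatched send is a move of the search. -/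
theorem exists_send_move (h : Layout F e μ ν c m₀ j j₀ L) (hst : IsRun S e st) {n : SearchNode S}
    (hn : NodeAt e μ ν j j₀ L st t n) {b : ℕ} {d : Channel P} {m : M}
    (hb : e[b]? = some (.send d m)) (ht : L b = t) (hun : ∀ r, IsRecv e r → ν r ≠ b) :
    ∃ n', Move F c m₀ n n' ∧ NodeAt e μ ν j j₀ L st (t + 1) n' := by
  have hlt := lt_length_of_getElem? hb
  have hfree := h.free_sender hb ht (hn.mode d.1.1)
  by_cases hbj : b = j
  · -- the chosen send
    subst hbj
    obtain ⟨m1, h1⟩ := h.start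
    have hdc : d = c := by
      rw [hb] at h1
      cases h1
      rfl
    have hact : Activates e μ ν b d.1.1 b := ⟨b, isOn_of_send hb, h.isFirst_start, Or.inl ⟨rfl, rfl⟩⟩
    have hidle := isMode_idle (hn.mode d.1.1) hfree (h.not_activeAt hact ht.ge)
    refine h.nodeAt_send hst hn hb ht hun (a := .active) (a' := n.mode d.1.2) ?_
      (h.sender_active_succ hb ht (hn.mode _) hfree ⟨b, hact, by omega⟩)
      (h.isMode_succ_of_send hlt ht (h.unaffected_receiver hb fun r m' hr => ?_) (hn.mode _))
    · rw [hidle]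
      exact .start hdc
    · have hir : IsRecv e r := ⟨_, _, hr⟩
      refine ⟨fun heq => absurd heq (h.unmatched r hir), fun heq => absurd heq (hun r hir),
        fun heq => ?_⟩
      rcases max_choice (ν r) (μ r) with h5 | h5
      · exact absurd (h5.symm.trans heq.symm) (hun r hir)
      · exact absurd (h5.symm.trans heq.symm) (h.unmatched r hir)
  by_cases hfwd : ∃ r m', e[r]? = some (.recv d m') ∧ μ r = b ∧ IsFwd e μ ν j r
  · -- the receiver resumes
    obtain ⟨r, m', hr, rfl, hd⟩ := hfwd
    have hact := activates_of_isFwd hr hd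
    have hactt : ActiveAt e μ ν j L t d.1.1 := h.activeAt_sender hr hd.2.1
      (Or.inr (Or.inl ⟨hd.1, (max_eq_right hd.2.2.le).symm⟩)) ht.le
    have h1 := isMode_active (hn.mode d.1.1) hfree hactt
    have h2 : L (ν r) < L (μ r) := by
      have := h.lt_of_lt hd.2.2 (h.sameProc_sends hd.1).symm
      rwa [(h.nodeOf_send hd.1).1, (h.nodeOf_send hd.1).2] at this
    have hfz : FrozenAt e μ ν j L t d.1.2 d.1.1 :=
      ⟨d, r, m', rfl, rfl, hr, hd, by omega, by omega⟩
    have h3 := h.isMode_unique (hn.mode d.1.2) (.frozen hfz)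
    refine h.nodeAt_send hst hn hb ht hun (a := .active) (a' := .active) ?_
      (h.sender_active_succ hb ht (hn.mode _) hfree (hactt.mono (by omega)))
      (h.isMode_active_succ hlt ht ⟨_, hact, by omega⟩ (fun f => Or.inl fun hw => ?_) ?_)
    · rw [h1, h3]
      exact .thaw
    · exact h.not_active_of_frozen hfz (h.active_of_waiting hw)
    · intro d' r' m'' hr' hd' hb' heq
      have := h.matching.inj hb'.1 hd.1 heq
      subst this
      exact absurd hb'.2.2 (by have := hd.2.2; omega)
  by_cases hbwd : ∃ r m', e[r]? = some (.recv d m') ∧ μ r = b ∧ IsBwd e μ ν j r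
  · -- the sender becomes active through its receiver
    obtain ⟨r, m', hr, rfl, hd⟩ := hbwd
    have hact := h.activates_of_isBwd hr hd
    have hidle := isMode_idle (hn.mode d.1.1) hfree (h.not_activeAt hact ht.ge)
    have h2 : L (μ r) < L (ν r) := by
      have := h.lt_of_lt hd.2.2 (h.sameProc_sends hd.1)
      rwa [(h.nodeOf_send hd.1).1, (h.nodeOf_send hd.1).2] at this
    have hrec : ActiveAt e μ ν j L t d.1.2 := h.activeAt_receiver hr hd.2.1
      (Or.inr (Or.inr ⟨r, hd.1, rfl, (min_eq_right hd.2.2.le).symm⟩)) ht.le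
    have h3 : n.mode d.1.2 = .active := by
      refine h.isMode_unique (hn.mode d.1.2) (.active hrec ?_)
      rintro f ⟨d', r', m'', h4, h5, hr', h6, h7, h8⟩
      have hs : SameProc e r' r := (h5 ▸ isOn_of_recv hr').sameProc (isOn_of_recv hr)
      have := h.bwd_unique h6 hd hs h7.le h8 (by omega) (by omega)
      subst this
      omega
    refine h.nodeAt_send hst hn hb ht hun (a := .active) (a' := .waiting d.1.1) ?_
      (h.sender_active_succ hb ht (hn.mode _) hfree ⟨_, hact, by omega⟩)
      (.waiting ⟨d, r, m', rfl, rfl, hr, hd, by omega, by omega⟩)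
    rw [hidle, h3]
    exact .invite
  · -- no mode changes
    refine h.nodeAt_send hst hn hb ht hun (.plain hfree)
      (h.isMode_succ_of_send hlt ht (h.unaffected_of_ne hb d.2 fun ha => ?_) (hn.mode _))
      (h.isMode_succ_of_send hlt ht (h.unaffected_receiver hb fun r m' hr => ?_) (hn.mode _))
    · rcases h.activates_send hb ha with ⟨-, h1 | ⟨r, m', hr, h1, h2⟩⟩ | ⟨h1, -⟩
      · exact hbj h1
      · have hir : IsRecv e r := ⟨_, _, hr⟩
        rcases lt_or_ge (ν r) (μ r) with h3 | h3
        · rw [min_eq_left h3.le] at h2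
          exact hun r hir h2.symm
        · rw [min_eq_right h3] at h2
          have h4 : μ r < ν r := lt_of_le_of_ne h3 fun h5 => hun r hir (h5.symm.trans h2.symm)
          exact hbwd ⟨r, m', hr, h2.symm, hir, h1, h4⟩
      · exact d.2 h1
    · have hir : IsRecv e r := ⟨_, _, hr⟩
      refine ⟨fun h1 h2 => hbwd ⟨r, m', hr, h1, h2⟩, fun h1 => absurd h1 (hun r hir),
        fun h1 h2 => ?_⟩
      rcases lt_or_ge (ν r) (μ r) with h3 | h3
      · rw [max_eq_right h3.le] at h1
        exact hfwd ⟨r, m', hr, h1.symm, hir, h2, h3⟩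
      · rw [max_eq_left h3] at h1
        exact hun r hir h1.symm

/-- Every matched pair is a move of the search. -/
theorem exists_sync_move (h : Layout F e μ ν c m₀ j j₀ L) (hst : IsRun S e st) {n : SearchNode S}
    (hn : NodeAt e μ ν j j₀ L st t n) {b r : ℕ} {d : Channel P} {m' : M}
    (hr : e[r]? = some (.recv d m')) (hrb : ν r = b) (ht : L b = t) :
    ∃ n', Move F c m₀ n n' ∧ NodeAt e μ ν j j₀ L st (t + 1) n' := by
  obtain ⟨-, m, hb⟩ := h.sends hr
  rw [hrb] at hb
  have hir : IsRecv e r := ⟨_, _, hr⟩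
  have hlt := lt_length_of_getElem? hb
  have hfree := h.free_sender hb ht (hn.mode d.1.1)
  have hN : nodeOf e ν r = b := by rw [nodeOf_recv hir, hrb]
  have huniq : ∀ {r' d' m''}, e[r']? = some (.recv d' m'') → ν r' = b ∨ μ r' = b → r' = r := by
    intro r' d' m'' hr' h1
    rcases h1 with h1 | h1
    · exact h.honest.inj ⟨_, _, hr'⟩ hir (h1.trans hrb.symm)
    · exact (h.acyclic.eq_of_send_eq h.matching h.honest.toIsMatching hir ⟨_, _, hr'⟩
        (hrb.trans h1.symm)).symm
  have hbnd : μ r < ν r → L (μ r) < L (ν r) := by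
    intro h1
    have := h.lt_of_lt h1 (h.sameProc_sends hir)
    rwa [(h.nodeOf_send hir).1, (h.nodeOf_send hir).2] at this
  by_cases hbwd : IsBwd e μ ν j r
  · -- the receiver stops waiting
    have hbj : b ≠ j := by
      rintro rfl
      rcases h.start_cases with h1 | ⟨r', h1, h2⟩
      · exact h1 r hir hrb
      · have := h.honest.inj h1.1 hir (h2.trans hrb.symm)
        subst this
        have := hbwd.2.2
        have := h1.2.2
        omega
    have h1 := hbnd hbwd.2.2
    rw [hrb] at h1
    have hw : WaitingAt e μ ν j L t d.1.2 d.1.1 :=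
      ⟨d, r, m', rfl, rfl, hr, hbwd, by omega, by rw [hrb]; omega⟩
    have h2 := h.isMode_unique (hn.mode d.1.2) (.waiting hw)
    refine h.nodeAt_sync hst hn hr hrb ht (a := n.mode d.1.1) (a' := .active) ?_
      (h.isMode_succ_of_send hlt ht (h.unaffected_of_ne hb d.2 fun ha => ?_) (hn.mode _))
      (h.isMode_active_succ hlt ht ((h.active_of_waiting hw).mono (by omega))
        (fun f => Or.inr ⟨d, r, m', hr, rfl, hbwd, hrb⟩) ?_)
    · rw [h2]
      exact .release hfree
    · have := h.activates_unique ha (h.activates_of_isBwd hr hbwd)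
      rw [this] at h1
      omega
    · intro d' r' m'' hr' _ _ h4
      have := huniq hr' (Or.inr h4)
      subst this
      rw [h4] at h1
      omega
  have hfree' : (n.mode d.1.2).Free :=
    (h.free_or_bwd (isOn_of_recv hr) (by rw [hN]; exact ht) (hn.mode d.1.2)).resolve_right hbwd
  by_cases hfwd : IsFwd e μ ν j r
  · -- the receiver is frozen
    have hactr := activates_of_isFwd hr hfwd
    have h2 : L (ν r) < L (μ r) := by
      have := h.lt_of_lt hfwd.2.2 (h.sameProc_sends hir).symm
      rwa [(h.nodeOf_send hir).1, (h.nodeOf_send hir).2] at this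
    rw [hrb] at h2
    have hidle' := isMode_idle (hn.mode d.1.2) hfree' (h.not_activeAt hactr (by omega))
    have hfz : IsMode e μ ν j L (t + 1) d.1.2 (.frozen d.1.1) :=
      .frozen ⟨d, r, m', rfl, rfl, hr, hfwd, by rw [hrb]; omega, by omega⟩
    by_cases hbj : b = j
    · subst hbj
      obtain ⟨m1, h1⟩ := h.start
      have hdc : d = c := by
        rw [hb] at h1
        cases h1
        rfl
      have hact : Activates e μ ν b d.1.1 b :=
        ⟨b, isOn_of_send hb, h.isFirst_start, Or.inl ⟨rfl, rfl⟩⟩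
      have hidle := isMode_idle (hn.mode d.1.1) hfree (h.not_activeAt hact ht.ge)
      refine h.nodeAt_sync hst hn hr hrb ht ?_
        (h.sender_active_succ hb ht (hn.mode _) hfree ⟨b, hact, by omega⟩) hfz
      rw [hidle, hidle']
      exact .startFreeze hdc
    · refine h.nodeAt_sync hst hn hr hrb ht ?_
        (h.isMode_succ_of_send hlt ht (h.unaffected_of_ne hb d.2 fun ha => ?_) (hn.mode _)) hfz
      · rw [hidle']
        exact .freeze hfree
      · rcases h.activates_send hb ha with ⟨-, h1 | ⟨r', m'', hr', h1, h3⟩⟩ | ⟨h1, -⟩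
        · exact hbj h1
        · have : r' = r := by
            refine huniq hr' ?_
            rcases min_choice (ν r') (μ r') with h5 | h5
            · exact Or.inl (h5.symm.trans h3.symm)
            · exact Or.inr (h5.symm.trans h3.symm)
          subst this
          exact h.not_isFirst_send hir hfwd.2.1 h1
        · exact d.2 h1
  have hbj : b ≠ j := by
    rintro rfl
    rcases h.start_cases with h1 | ⟨r', h1, h2⟩
    · exact h1 r hir hrb
    · have := h.honest.inj h1.1 hir (h2.trans hrb.symm)
      subst this
      exact hfwd h1
  by_cases hsp : IsFirst e μ j r ∨ IsFirst e μ j (μ r)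
  · -- both are active afterwards
    have key : ActiveAt e μ ν j L (t + 1) d.1.1 ∧ ActiveAt e μ ν j L (t + 1) d.1.2 ∧
        (ActiveAt e μ ν j L t d.1.1 ∨ ActiveAt e μ ν j L t d.1.2) := by
      rcases hsp with h1 | h1
      · have h2 : μ r ≤ ν r := not_lt.1 fun h3 => hfwd ⟨hir, h1, h3⟩
        have h3 : ActAt e μ ν j r b := Or.inr (Or.inl ⟨hir, by rw [max_eq_left h2, hrb]⟩)
        have h4 := h.activeAt_sender hr h1 h3 ht.le
        exact ⟨h4.mono (by omega), ⟨b, ⟨r, isOn_of_recv hr, h1, h3⟩, by omega⟩, Or.inl h4⟩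
      · have h2 : ν r ≤ μ r := not_lt.1 fun h3 => hbwd ⟨hir, h1, h3⟩
        have h3 : ActAt e μ ν j (μ r) b :=
          Or.inr (Or.inr ⟨r, hir, rfl, by rw [min_eq_left h2, hrb]⟩)
        have h4 := h.activeAt_receiver hr h1 h3 ht.le
        obtain ⟨⟨m1, h5⟩, -⟩ := h.sends hr
        exact ⟨⟨b, ⟨μ r, isOn_of_send h5, h1, h3⟩, by omega⟩, h4.mono (by omega), Or.inr h4⟩
    obtain ⟨h1, h2, h3⟩ := key
    refine h.nodeAt_sync hst hn hr hrb ht (.spread hfree hfree' ?_)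
      (h.sender_active_succ hb ht (hn.mode _) hfree h1)
      (h.isMode_active_succ hlt ht h2
        (fun f => Or.inl (h.not_waiting_of_free (hn.mode _) hfree' f)) ?_)
    · rcases h3 with h3 | h3
      · exact Or.inl (isMode_active (hn.mode _) hfree h3)
      · exact Or.inr (isMode_active (hn.mode _) hfree' h3)
    · intro d' r' m'' hr' _ h4 h5
      have := huniq hr' (Or.inr h5)
      subst this
      exact hbwd h4
  · -- no mode changes
    push Not at hsp
    refine h.nodeAt_sync hst hn hr hrb ht (.plain hfree hfree')
      (h.isMode_succ_of_send hlt ht (h.unaffected_of_ne hb d.2 fun ha => ?_) (hn.mode _))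
      (h.isMode_succ_of_send hlt ht (h.unaffected_receiver hb fun r' m'' hr' => ?_) (hn.mode _))
    · rcases h.activates_send hb ha with ⟨-, h1 | ⟨r', m'', hr', h1, h3⟩⟩ | ⟨h1, -⟩
      · exact hbj h1
      · have : r' = r := by
          refine huniq hr' ?_
          rcases min_choice (ν r') (μ r') with h5 | h5
          · exact Or.inl (h5.symm.trans h3.symm)
          · exact Or.inr (h5.symm.trans h3.symm)
        subst this
        exact hsp.2 h1
      · exact d.2 h1
    · refine ⟨fun h1 => ?_, fun h1 => ?_, fun h1 => ?_⟩
      · have := huniq hr' (Or.inr h1)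
        subst this
        exact hbwd
      · have := huniq hr' (Or.inl h1)
        subst this
        exact ⟨hbwd, hfwd⟩
      · have : r' = r := by
          refine huniq hr' ?_
          rcases max_choice (ν r') (μ r') with h5 | h5
          · exact Or.inl (h5.symm.trans h1.symm)
          · exact Or.inr (h5.symm.trans h1.symm)
        subst this
        exact hsp.1

theorem exists_nodeAt (h : Layout F e μ ν c m₀ j j₀ L) (hst : IsRun S e st) (h0 : st 0 = S.init)
    (t : ℕ) : ∃ n, ReflTransGen (Move F c m₀) (SearchNode.init S) n ∧
      NodeAt e μ ν j j₀ L st t n := by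
  induction t with
  | zero => exact ⟨_, .refl, nodeAt_zero h0⟩
  | succ t ih =>
    obtain ⟨n, h1, h2⟩ := ih
    by_cases hb : ∃ b < e.length, L b = t ∧ ¬ IsRecv e b
    · suffices h3 : ∃ n', Move F c m₀ n n' ∧ NodeAt e μ ν j j₀ L st (t + 1) n' by
        obtain ⟨n', h3, h4⟩ := h3
        exact ⟨n', h1.tail h3, h4⟩
      obtain ⟨b, hb, ht, hnr⟩ := hb
      have hget : e[b]? = some (e[b]'hb) := by simp
      cases hact : e[b]'hb with
      | send d m =>
        rw [hact] at hget
        by_cases hr : ∃ r, IsRecv e r ∧ ν r = b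
        · obtain ⟨r, ⟨d', m', hr⟩, hrb⟩ := hr
          exact h.exists_sync_move hst h2 hr hrb ht
        · push Not at hr
          exact h.exists_send_move hst h2 hget ht hr
      | recv d m => exact absurd ⟨d, m, hact ▸ hget⟩ hnr
      | internal p x => exact h.nodeAt_internal hst h2 (hact ▸ hget) ht
    · exact ⟨n, h1, h.nodeAt_skip h2 fun b hb' hnr ht => hb ⟨b, hb', ht, hnr⟩⟩

end Layout

end ScheduleCases


/-! ### Every cyclic execution yields an accepting search -/

section Complete

variable {P M : Type} {F : Set Failure} {e : List (Act P M)} {μ ν L : ℕ → ℕ} {c : Channel P}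
  {m₀ : M} {j j₀ t : ℕ} {p : P} {S : FIFOSystem P M} {st : ℕ → ∀ p, Fin (S.numStates p)}

/-- The schedule numbers the mixed graph over `ν` whose additional edges out of `μ r` are for the
forward receives, and those into `μ r` for the backward ones. -/
theorem exists_schedule (hac : AlwaysAcyclic e) (hμ : IsMatching e μ) (hν : IsMatching e ν)
    (j : ℕ) : ∃ L : ℕ → ℕ, (∀ a b, a < e.length → b < e.length → L a = L b → a = b) ∧
      ∀ {i i' a b}, i < i' → SameProc e i i' →
        (a = nodeOf e ν i ∨ (IsFwd e μ ν j i ∧ a = μ i)) →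
        (b = nodeOf e ν i' ∨ (IsBwd e μ ν j i' ∧ b = μ i')) → L a < L b := by
  classical
  have hout : ∀ {i a Z}, i < e.length → OutNode e ν μ Z i a → a < e.length := by
    rintro i a Z hi (rfl | ⟨-, h1, rfl⟩)
    · exact (hν.nodeOf_le i).trans_lt hi
    · exact (hμ.lt h1).trans hi
  obtain ⟨L, h1, h2⟩ := exists_numbering (MixedEdge e ν μ
    ((Finset.range e.length).filter (IsFwd e μ ν j))
    ((Finset.range e.length).filter (IsBwd e μ ν j))) e.length
    (fun a b ⟨i, i', _, h2, h3, h4⟩ => ⟨hout h2.lt_left h3, hout h2.lt_right h4⟩)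
    (hac.mixedEdge hμ hν _ _ ν fun r => Or.inr rfl)
  refine ⟨L, h1, fun {i i' a b} h3 h4 h5 h6 => h2 a b ⟨i, i', h3, h4, ?_, ?_⟩⟩
  · rcases h5 with h5 | ⟨h5, h7⟩
    · exact Or.inl h5
    · exact Or.inr ⟨by simp [h4.lt_left, h5], h5.1, h7⟩
  · rcases h6 with h6 | ⟨h6, h7⟩
    · exact Or.inl h6
    · exact Or.inr ⟨by simp [h4.lt_right, h6], h6.1, h7⟩

/-- At a time beyond all numbers everything has been scheduled, so no waiting period is left, the
available message has been sent, and every process that has a hot position is active. -/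
theorem Layout.exists_accepting (h : Layout F e μ ν c m₀ j j₀ L) (hst : IsRun S e st)
    (h0 : st 0 = S.init) {i : ℕ} (hi : IsOn e i c.1.2) (hhot : IsHot e μ j i) {m' : M}
    {q' : Fin (S.numStates c.1.2)} (hok : MsgOk F m₀ m')
    (htr : (st e.length c.1.2, Act.recv c m', q') ∈ S.trans c.1.2) :
    ∃ n : SearchNode S, ReflTransGen (Move F c m₀) (SearchNode.init S) n ∧
      n.Accepting F c m₀ := by
  obtain ⟨T, hT⟩ : ∃ T, ∀ b < e.length, L b < T := by
    refine ⟨(Finset.range e.length).sup L + 1, fun b hb => Nat.lt_succ_of_le ?_⟩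
    exact Finset.le_sup (f := L) (Finset.mem_range.2 hb)
  obtain ⟨n, h1, h2⟩ := h.exists_nodeAt hst h0 T
  have hwait : ∀ p f, ¬ WaitingAt e μ ν j L T p f := by
    rintro p f ⟨d, r, m, -, -, -, h3, -, h4⟩
    have := hT (ν r) ((h.honest.lt h3.1).trans h3.1.lt)
    omega
  refine ⟨n, h1, h2.flag (hT _ h.start_lt), ?_, fun p f hp => ?_, m', q', hok, ?_⟩
  · obtain ⟨f, -, h3, h4⟩ := exists_isFirst hhot
    obtain ⟨b, hb⟩ := h.exists_actAt h4
    have hact : Activates e μ ν j c.1.2 b := ⟨f, (h3.isOn_iff).2 hi, h4, hb⟩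
    exact h.isMode_unique (h2.mode _)
      (.active ⟨b, hact, hT b (hact.lt h.matching h.honest.toIsMatching)⟩ (hwait _))
  · have h3 := h2.mode p
    rw [hp] at h3
    cases h3 with
    | waiting h4 => exact hwait _ _ h4
  · obtain ⟨x, h3, h4, h5⟩ := h2.state c.1.2
    rw [h4, hst.eq_of_forall h3 le_rfl fun i h6 _ h8 => ?_]
    · exact htr
    · have := (h5 i h8).1 (hT _ ((h.honest.toIsMatching.nodeOf_le i).trans_lt h8.lt))
      omega

theorem nodeEdge_update {r a b : ℕ} (hr : IsRecv e r) (h : NodeEdge e μ a b) (ha : a ≠ μ r)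
    (hb : b ≠ μ r) : NodeEdge e (Function.update μ r (ν r)) a b :=
  mixedEdge_empty.1 (mixedEdge_update hr (mixedEdge_empty.2 h) ha hb)

/-- The chosen send can be chosen such that the schedule exists. -/
theorem exists_start_cases (hac : AlwaysAcyclic e) (hμ : IsMatching e μ) (hν : IsMatching e ν)
    {m : M} (hj : e[j]? = some (.send c m)) (hun : ∀ r, IsRecv e r → μ r ≠ j) {i : ℕ}
    (hi : IsOn e i c.1.2) (hhot : IsHot e μ j i) :
    ∃ μ' j' i', IsMatching e μ' ∧ (∃ m, e[j']? = some (.send c m)) ∧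
      (∀ r, IsRecv e r → μ' r ≠ j') ∧
      ((∀ r, IsRecv e r → ν r ≠ j') ∨ ∃ r, IsFwd e μ' ν j' r ∧ ν r = j') ∧
      IsOn e i' c.1.2 ∧ IsHot e μ' j' i' := by
  by_cases hex : ∃ r, IsRecv e r ∧ ν r = j
  swap
  · push Not at hex
    exact ⟨μ, j, i, hμ, ⟨m, hj⟩, hun, Or.inl hex, hi, hhot⟩
  obtain ⟨r, hr, rfl⟩ := hex
  obtain ⟨d, m1, hrd⟩ := id hr
  obtain ⟨h1, m2, h2⟩ := hν.send hrd
  rw [hj] at h2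
  cases h2
  obtain ⟨h3, m3, h4⟩ := hμ.send hrd
  have hs := sameProc_of_send h4 hj
  rcases lt_or_gt_of_ne (hun r hr) with hlt | hlt
  -- Here `μ r` is an earlier send on `c`. Rematching `r` with the send `ν r` frees `μ r`, which
  -- becomes the chosen send and precedes the old one on its process. By
  -- `AlwaysAcyclic.eq_of_send_eq` it is unmatched in `ν` too.
  · have hedge : ∀ κ, NodeEdge e κ (μ r) (ν r) := fun κ =>
      ⟨μ r, ν r, hlt, hs, nodeOf_not_recv (hμ.not_recv hr), nodeOf_not_recv (hν.not_recv hr)⟩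
    have havoid : ∀ v, ReflTransGen (NodeEdge e μ) (ν r) v → v ≠ μ r := by
      rintro v hv rfl
      exact hac μ hμ ⟨_, TransGen.head' (hedge μ) hv⟩
    have hpath := reflTransGen_of_avoid' (X' := NodeEdge e (Function.update μ r (ν r))) havoid
      (fun _ _ h h1 h2 => nodeEdge_update hr h h1 h2) hhot.2
    have hir : i ≠ r := by
      rintro rfl
      exact havoid _ hhot.2 (nodeOf_recv hr)
    refine ⟨Function.update μ r (ν r), μ r, i, ?_, ⟨_, h4⟩, ?_, Or.inl ?_, hi, hhot.1, ?_⟩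
    · refine hac.mix hμ hν fun r' => ?_
      by_cases h5 : r' = r
      · subst h5
        exact Or.inr (Function.update_self _ _ _)
      · exact Or.inl (Function.update_of_ne h5 _ _)
    · intro r' hr' heq
      by_cases h5 : r' = r
      · subst h5
        rw [Function.update_self] at heq
        omega
      · rw [Function.update_of_ne h5] at heq
        exact h5 (hμ.inj hr' hr heq)
    · intro r' hr' heq
      have := hac.eq_of_send_eq hμ hν hr' hr heq
      subst this
      omega
    · rw [nodeOf_update hir]
      exact .head (hedge _) hpath
  -- Here the honest send of `r` is earlier than `μ r`. In the matching `ν` with `r` moved to `μ r`,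
  -- the send `ν r` is free and directly precedes the node of `r`, and `r` is an action of the
  -- receiver of `c`: the path is a single edge.
  · have hmix : IsMatching e (Function.update ν r (μ r)) := by
      refine hac.mix hμ hν fun r' => ?_
      by_cases h5 : r' = r
      · subst h5
        exact Or.inl (Function.update_self _ _ _)
      · exact Or.inr (Function.update_of_ne h5 _ _)
    have hN : nodeOf e (Function.update ν r (μ r)) r = μ r := by
      rw [nodeOf_recv hr, Function.update_self]
    have hhr : IsHot e (Function.update ν r (μ r)) (ν r) r := by
      refine ⟨hr.lt, .single ⟨ν r, μ r, hlt, hs.symm, nodeOf_not_recv (hν.not_recv hr), ?_⟩⟩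
      rw [hN]
      exact nodeOf_not_recv (hμ.not_recv hr)
    refine ⟨Function.update ν r (μ r), ν r, r, hmix, ⟨_, hj⟩, ?_,
      Or.inr ⟨r, ⟨hr, ⟨hhr, ?_⟩, ?_⟩, rfl⟩, isOn_of_recv hrd, hhr⟩
    · intro r' hr' heq
      by_cases h5 : r' = r
      · subst h5
        rw [Function.update_self] at heq
        omega
      · rw [Function.update_of_ne h5] at heq
        exact h5 (hν.inj hr' hr heq)
    -- A hot action before `r` would be reached from `ν r` without the node of `r`, hence also in
    -- `ν`, where `ν r` is the node of `r`: a cycle.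
    · intro i' hi' hs' hh
      have hedge : NodeEdge e (Function.update ν r (μ r))
          (nodeOf e (Function.update ν r (μ r)) i') (μ r) := ⟨i', r, hi', hs', rfl, hN⟩
      have havoid : ∀ v, ReflTransGen (NodeEdge e (Function.update ν r (μ r))) v
          (nodeOf e (Function.update ν r (μ r)) i') → v ≠ Function.update ν r (μ r) r := by
        rintro v hv rfl
        rw [Function.update_self] at hv
        exact hac _ hmix ⟨_, TransGen.tail' hv hedge⟩
      have hpath := reflTransGen_of_avoid (X' := NodeEdge e ν) havoid
        (fun _ _ h h1 h2 => by
          have := nodeEdge_update (ν := ν) hr h h1 h2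
          rwa [Function.update_idem, Function.update_eq_self] at this) hh.2
      rw [nodeOf_update hi'.ne] at hpath
      exact hac ν hν ⟨_, TransGen.tail' hpath ⟨i', r, hi', hs', rfl, nodeOf_recv hr⟩⟩
    · rw [Function.update_self]
      exact hlt

theorem isMatching_of_append {e' : List (Act P M)} (h : IsMatching (e ++ e') μ) :
    IsMatching e μ where
  send hr := by
    obtain ⟨h1, m, h2⟩ := h.send (getElem?_append_of_some hr)
    refine ⟨h1, m, ?_⟩
    rwa [List.getElem?_append_left (h1.trans (lt_length_of_getElem? hr))] at h2
  inj hr hr' := by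
    obtain ⟨c, m, hr⟩ := hr
    obtain ⟨c', m', hr'⟩ := hr'
    exact h.inj ⟨_, _, getElem?_append_of_some hr⟩ ⟨_, _, getElem?_append_of_some hr'⟩

theorem isHonest_of_append {e' : List (Act P M)} (h : IsHonest F (e ++ e') μ) :
    IsHonest F e μ where
  toIsMatching := isMatching_of_append h.toIsMatching
  msg hr := by
    obtain ⟨m, h1, h2⟩ := h.msg (getElem?_append_of_some hr)
    refine ⟨m, ?_, h2⟩
    have := (h.send (getElem?_append_of_some hr)).1
    rwa [List.getElem?_append_left (this.trans (lt_length_of_getElem? hr))] at h1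
  mono hF _ _ _ _ _ hlt hr hr' :=
    h.mono hF hlt (getElem?_append_of_some hr) (getElem?_append_of_some hr')

theorem sameProc_of_append {e' : List (Act P M)} {i i' : ℕ} (h : SameProc (e ++ e') i i')
    (hi : i < e.length) (hi' : i' < e.length) : SameProc e i i' := by
  obtain ⟨a, b, h1, h2, h3⟩ := h
  rw [List.getElem?_append_left hi] at h1
  rw [List.getElem?_append_left hi'] at h2
  exact ⟨a, b, h1, h2, h3⟩

/-- By induction the execution without its last action is always acyclic. A cycle therefore passes
through the last position, which only adds edges into its own node. So the last action is a receive,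
and what remains of the cycle is a path from its matched send to an earlier action of its process.
-/
theorem not_hasCycle_of_not_accepting
    (hno : ∀ (c : Channel P) (m₀ : M) (n : SearchNode S),
      ReflTransGen (Move F c m₀) (SearchNode.init S) n → ¬ n.Accepting F c m₀)
    (e : List (Act P M)) (he : IsExecutionOf (failureModel M F) S e) : AlwaysAcyclic e := by
  induction e using List.reverseRecOn with
  | nil =>
    rintro μ - ⟨a, ha⟩
    obtain ⟨b, ⟨i, i', -, h, -⟩, -⟩ := TransGen.head'_iff.1 ha
    have := h.lt_left
    simp at this
  | append_singleton e a ih =>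
    have hex : IsExecutionOf (failureModel M F) S e := by
      obtain ⟨γ, hγ⟩ := he
      obtain ⟨γ', h1, -⟩ := hγ.split
      exact ⟨γ', h1⟩
    have hac := ih hex
    rintro μ hμ' ⟨a₀, ha₀⟩
    have hμ := isMatching_of_append hμ'
    have hun : TransGen (fun x y => NodeEdge e μ x y ∨ (y = nodeOf (e ++ [a]) μ e.length ∧
        ∃ i, i < e.length ∧ SameProc (e ++ [a]) i e.length ∧ nodeOf e μ i = x)) a₀ a₀ := by
      refine TransGen.mono (fun x y hxy => ?_) _ _ ha₀
      obtain ⟨i, i', h1, h2, h3, h4⟩ := hxy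
      have h5 := h2.lt_right
      simp only [List.length_append, List.length_singleton] at h5
      have h6 : i < e.length := by omega
      rw [nodeOf_append (fun _ _ => rfl) h6] at h3
      rcases Nat.lt_succ_iff_lt_or_eq.1 h5 with h7 | rfl
      · rw [nodeOf_append (fun _ _ => rfl) h7] at h4
        exact Or.inl ⟨i, i', h1, sameProc_of_append h2 h6 h7, h3, h4⟩
      · exact Or.inr ⟨h4.symm, i, h6, h2, h3⟩
    rcases exists_cycle_or_path_of_union' hun with ⟨b, hb⟩ | ⟨b, ⟨i, hi, his, rfl⟩, hpath⟩
    · exact hac μ hμ ⟨b, hb⟩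
    have hlast : (e ++ [a])[e.length]? = some a := by simp
    by_cases hrec : IsRecv (e ++ [a]) e.length
    swap
    -- If the last position is its own node, no edge leaves it.
    · rw [nodeOf_not_recv hrec] at hpath
      rcases ReflTransGen.cases_head hpath with h1 | ⟨b, ⟨k, k', -, h1, h2, -⟩, -⟩
      · have := hμ.nodeOf_le i
        omega
      · have := hμ.nodeOf_le k
        have := h1.lt_left
        omega
    obtain ⟨c, m', hc⟩ := id hrec
    have hac' : a = .recv c m' := by
      rw [hlast] at hc
      exact Option.some.inj hc
    subst hac'
    rw [nodeOf_recv hrec] at hpath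
    obtain ⟨h1, mj, h2⟩ := hμ'.send hc
    rw [List.getElem?_append_left h1] at h2
    -- The last receive may have another send in the honest matching. That send, at `ν e.length`,
    -- supplies the message; the one in `μ` supplies the causality.
    obtain ⟨ν, hν'⟩ := exists_isHonest hμ' he
    have hν := isHonest_of_append hν'
    obtain ⟨h3, -⟩ := hν'.send hc
    obtain ⟨m₀, h4, hok⟩ := hν'.msg hc
    rw [List.getElem?_append_left h3] at h4
    have hfresh : ∀ {κ}, IsMatching (e ++ [.recv c m']) κ → ∀ r, IsRecv e r → κ r ≠ κ e.length := by
      intro κ hκ r hr heq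
      have h5 := hr.lt
      obtain ⟨d, m, hr⟩ := hr
      have := hκ.inj ⟨d, m, getElem?_append_of_some hr⟩ hrec heq
      omega
    have hion : IsOn e i c.1.2 := by
      obtain ⟨x, y, h5, h6, h7⟩ := his
      rw [List.getElem?_append_left hi] at h5
      rw [hlast] at h6
      cases h6
      exact ⟨x, h5, h7⟩
    obtain ⟨μ₁, j, i₁, g1, g2, g3, g4, g5, g6⟩ := exists_start_cases hac hμ hν.toIsMatching h2
      (hfresh hμ') hion ⟨hi, hpath⟩
    obtain ⟨L, g7, g8⟩ := exists_schedule hac g1 hν.toIsMatching j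
    obtain ⟨γ, hγ⟩ := he
    obtain ⟨st, s1, -, s3⟩ := hγ.exists_states
    have hst : IsRun S e st := fun k b hk => s3 k b (getElem?_append_of_some hk)
    have hL : Layout F e μ₁ ν c m₀ j (ν e.length) L :=
      { acyclic := hac
        matching := g1
        honest := hν
        start := g2
        unmatched := g3
        start_cases := g4
        avail := h4
        avail_unmatched := hfresh hν'.toIsMatching
        avail_fifo := fun hF r m hr =>
          hν'.mono hF (lt_length_of_getElem? hr) (getElem?_append_of_some hr) hc
        inj := g7
        edge := g8 }
    obtain ⟨n, n1, n2⟩ := hL.exists_accepting hst s1 g5 g6 hok (s3 _ _ hc).1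
    exact hno c m₀ n n1 n2

end Complete

/-- A system is `i`-RSC if and only if no search reaches an accepting node. -/
theorem isIRSC_iff_not_accepting {P M : Type} {F : Set Failure} (hF : F.Nonempty)
    (S : FIFOSystem P M) : IsIRSC (failureModel M F) S ↔
      ∀ (c : Channel P) (m₀ : M) (n : SearchNode S),
        ReflTransGen (Move F c m₀) (SearchNode.init S) n → ¬ n.Accepting F c m₀ := by
  rw [isIRSC_iff]
  constructor
  · intro h c m₀ n hn hacc
    obtain ⟨e, he, μ, hμ, hc⟩ := exists_hasCycle_of_accepting hF hn hacc
    exact h e he μ hμ hc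
  · exact fun h e he => not_hasCycle_of_not_accepting h e he


/-! ### Verifying programs of random access machines -/

namespace RAM

instance : Add Term := ⟨.add⟩
instance : Sub Term := ⟨.sub⟩
instance (n : ℕ) : OfNat Term n := ⟨.lit n⟩

@[simp] theorem Term.eval_add (s t : Term) (σ : Memory) : (s + t).eval σ = s.eval σ + t.eval σ := rfl
@[simp] theorem Term.eval_sub (s t : Term) (σ : Memory) : (s - t).eval σ = s.eval σ - t.eval σ := rfl
@[simp] theorem Term.eval_ofNat (n : ℕ) (σ : Memory) :
    (ofNat(n) : Term).eval σ = n := rfl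
@[simp] theorem Term.eval_lit (n : ℕ) (σ : Memory) : (Term.lit n).eval σ = n := rfl
@[simp] theorem Term.eval_reg (x : ℕ) (σ : Memory) : (Term.reg x).eval σ = σ.reg x := rfl
@[simp] theorem Term.eval_read (a : ℕ) (i : Term) (σ : Memory) :
    (Term.read a i).eval σ = σ.arr a (i.eval σ) := rfl

/-- The memory with register `x` set to `v`. -/
def Memory.setReg (σ : Memory) (x v : ℕ) : Memory := { σ with reg := Function.update σ.reg x v }

/-- The memory with cell `i` of array `a` set to `v`. -/
def Memory.setArr (σ : Memory) (a i v : ℕ) : Memory :=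
  { σ with arr := Function.update σ.arr a (Function.update (σ.arr a) i v) }

@[simp] theorem Memory.setReg_reg (σ : Memory) (x v y : ℕ) :
    (σ.setReg x v).reg y = if y = x then v else σ.reg y := by
  simp [Memory.setReg, Function.update_apply]

@[simp] theorem Memory.setReg_arr (σ : Memory) (x v : ℕ) : (σ.setReg x v).arr = σ.arr := rfl

@[simp] theorem Memory.setArr_reg (σ : Memory) (a i v : ℕ) : (σ.setArr a i v).reg = σ.reg := rfl

theorem Memory.setArr_arr (σ : Memory) (a i v b j : ℕ) :
    (σ.setArr a i v).arr b j = if b = a ∧ j = i then v else σ.arr b j := by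
  simp only [Memory.setArr, Function.update_apply]
  by_cases h : b = a
  · subst h
    simp [Function.update_apply]
  · simp [h]

@[simp] theorem Memory.setArr_arr_same (σ : Memory) (a i v j : ℕ) :
    (σ.setArr a i v).arr a j = if j = i then v else σ.arr a j := by
  simp [Memory.setArr_arr]

theorem Memory.setArr_arr_ne (σ : Memory) (a i v : ℕ) {b : ℕ} (h : b ≠ a) :
    (σ.setArr a i v).arr b = σ.arr b := by
  simp [Memory.setArr, h]

/-- Registers that a program may change. -/
def Prog.setsReg : Prog → ℕ → Bool
  | .skip, _ => false
  | .assign x _, y => x == y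
  | .write _ _ _, _ => false
  | .seq c d, y => c.setsReg y || d.setsReg y
  | .cond _ c d, y => c.setsReg y || d.setsReg y
  | .loop _ c, y => c.setsReg y

/-- Arrays that a program may change. -/
def Prog.setsArr : Prog → ℕ → Bool
  | .skip, _ => false
  | .assign _ _, _ => false
  | .write a _ _, b => a == b
  | .seq c d, y => c.setsArr y || d.setsArr y
  | .cond _ c d, y => c.setsArr y || d.setsArr y
  | .loop _ c, y => c.setsArr y

theorem Runs.reg_eq {c : Prog} {σ σ' : Memory} {t : ℕ} (h : Runs c σ t σ') {x : ℕ}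
    (hx : c.setsReg x = false) : σ'.reg x = σ.reg x := by
  induction h with
  | skip | write | loop_done => rfl
  | assign y t σ =>
    simp only [Prog.setsReg, beq_eq_false_iff_ne] at hx
    simp [Function.update_of_ne hx.symm]
  | seq _ _ ih₁ ih₂ =>
    simp only [Prog.setsReg, Bool.or_eq_false_iff] at hx
    rw [ih₂ hx.2, ih₁ hx.1]
  | cond_true _ _ ih =>
    simp only [Prog.setsReg, Bool.or_eq_false_iff] at hx
    exact ih hx.1
  | cond_false _ _ ih =>
    simp only [Prog.setsReg, Bool.or_eq_false_iff] at hx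
    exact ih hx.2
  | loop_step _ _ _ ih₁ ih₂ => rw [ih₂ hx, ih₁ hx]

theorem Runs.arr_eq {c : Prog} {σ σ' : Memory} {t : ℕ} (h : Runs c σ t σ') {a : ℕ}
    (ha : c.setsArr a = false) : σ'.arr a = σ.arr a := by
  induction h with
  | skip | assign | loop_done => rfl
  | write b i t σ =>
    simp only [Prog.setsArr, beq_eq_false_iff_ne] at ha
    simp [Function.update_of_ne ha.symm]
  | seq _ _ ih₁ ih₂ =>
    simp only [Prog.setsArr, Bool.or_eq_false_iff] at ha
    rw [ih₂ ha.2, ih₁ ha.1]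
  | cond_true _ _ ih =>
    simp only [Prog.setsArr, Bool.or_eq_false_iff] at ha
    exact ih ha.1
  | cond_false _ _ ih =>
    simp only [Prog.setsArr, Bool.or_eq_false_iff] at ha
    exact ih ha.2
  | loop_step _ _ _ ih₁ ih₂ => rw [ih₂ ha, ih₁ ha]

/-- `c` halts from `σ` within `T` steps in a memory that satisfies `Q`. -/
def Ends (c : Prog) (σ : Memory) (T : ℕ) (Q : Memory → Prop) : Prop :=
  ∃ t σ', Runs c σ t σ' ∧ t ≤ T ∧ Q σ'

section Ends

variable {c d : Prog} {σ : Memory} {T T' : ℕ} {Q Q' : Memory → Prop} {t : Term}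

/-- `σ'` differs from `σ` only where `c` may write. -/
structure Frame (c : Prog) (σ σ' : Memory) : Prop where
  reg : ∀ x, c.setsReg x = false → σ'.reg x = σ.reg x
  arr : ∀ a, c.setsArr a = false → σ'.arr a = σ.arr a

theorem Ends.mono (h : Ends c σ T Q) (hT : T ≤ T') (hQ : ∀ σ', Q σ' → Q' σ') :
    Ends c σ T' Q' := by
  obtain ⟨t, σ', h1, h2, h3⟩ := h
  exact ⟨t, σ', h1, h2.trans hT, hQ _ h3⟩

/-- Frame conditions come for free: whatever a program does not syntactically assign is unchanged,
and the new postcondition may use this. -/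
theorem Ends.imp (h : Ends c σ T Q) (hQ : ∀ σ', Frame c σ σ' → Q σ' → Q' σ') :
    Ends c σ T Q' := by
  obtain ⟨t, σ', h1, h2, h3⟩ := h
  exact ⟨t, σ', h1, h2, hQ _ ⟨fun _ => h1.reg_eq, fun _ => h1.arr_eq⟩ h3⟩

theorem Ends.seq (h : Ends c σ T fun σ' => Ends d σ' T' Q) : Ends (.seq c d) σ (T + T') Q := by
  obtain ⟨t, σ', h1, h2, t', σ'', h3, h4, h5⟩ := h
  exact ⟨_, σ'', .seq h1 h3, by omega, h5⟩

/-- The memory after a program without loops. -/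
def Prog.run : Prog → Memory → Memory
  | .skip, σ => σ
  | .assign x t, σ => σ.setReg x (t.eval σ)
  | .write a i t, σ => σ.setArr a (i.eval σ) (t.eval σ)
  | .seq c d, σ => d.run (c.run σ)
  | .cond t c d, σ => if t.eval σ = 0 then d.run σ else c.run σ
  | .loop _ _, σ => σ

/-- Programs without loops. -/
def Prog.flat : Prog → Bool
  | .skip => true
  | .assign _ _ => true
  | .write _ _ _ => true
  | .seq c d => c.flat && d.flat
  | .cond _ c d => c.flat && d.flat
  | .loop _ _ => false

/-- A bound for the number of steps of a program without loops. -/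
def Prog.cost : Prog → ℕ
  | .skip => 1
  | .assign _ t => t.cost + 1
  | .write _ i t => i.cost + t.cost + 1
  | .seq c d => c.cost + d.cost
  | .cond t c d => t.cost + 1 + (c.cost + d.cost)
  | .loop _ _ => 0

theorem Prog.exists_runs_of_flat (c : Prog) (hc : c.flat = true) (σ : Memory) :
    ∃ t, Runs c σ t (c.run σ) ∧ t ≤ c.cost := by
  induction c generalizing σ with
  | skip => exact ⟨_, .skip σ, le_rfl⟩
  | assign x t => exact ⟨_, .assign x t σ, le_rfl⟩
  | write a i t => exact ⟨_, .write a i t σ, le_rfl⟩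
  | seq c d ih₁ ih₂ =>
    simp only [Prog.flat, Bool.and_eq_true] at hc
    obtain ⟨t₁, h₁, h₁'⟩ := ih₁ hc.1 σ
    obtain ⟨t₂, h₂, h₂'⟩ := ih₂ hc.2 (c.run σ)
    exact ⟨_, .seq h₁ h₂, Nat.add_le_add h₁' h₂'⟩
  | cond t c d ih₁ ih₂ =>
    simp only [Prog.flat, Bool.and_eq_true] at hc
    by_cases ht : t.eval σ = 0
    · obtain ⟨t₂, h₂, h₂'⟩ := ih₂ hc.2 σ
      refine ⟨t.cost + 1 + t₂, ?_, ?_⟩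
      · simp only [Prog.run, if_pos ht]
        exact .cond_false ht h₂
      · simp only [Prog.cost]
        omega
    · obtain ⟨t₂, h₂, h₂'⟩ := ih₁ hc.1 σ
      refine ⟨t.cost + 1 + t₂, ?_, ?_⟩
      · simp only [Prog.run, if_neg ht]
        exact .cond_true ht h₂
      · simp only [Prog.cost]
        omega
  | loop t c => simp [Prog.flat] at hc

theorem Ends.of_flat (hc : c.flat = true) (hQ : Q (c.run σ)) : Ends c σ c.cost Q := by
  obtain ⟨t, h1, h2⟩ := c.exists_runs_of_flat hc σ
  exact ⟨t, _, h1, h2, hQ⟩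

theorem Ends.cond_of (h1 : t.eval σ ≠ 0 → Ends c σ T Q) (h2 : t.eval σ = 0 → Ends d σ T Q) :
    Ends (.cond t c d) σ (t.cost + 1 + T) Q := by
  by_cases ht : t.eval σ = 0
  · obtain ⟨k, σ', h3, h4, h5⟩ := h2 ht
    exact ⟨_, σ', .cond_false ht h3, by omega, h5⟩
  · obtain ⟨k, σ', h3, h4, h5⟩ := h1 ht
    exact ⟨_, σ', .cond_true ht h3, by omega, h5⟩

/-- Total correctness of loops, with a decreasing variant. -/
theorem Ends.while {I : Memory → Prop} (V : Memory → ℕ)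
    (hbody : ∀ σ, I σ → t.eval σ ≠ 0 → Ends c σ T fun σ' => I σ' ∧ V σ' < V σ) (h : I σ) :
    Ends (.loop t c) σ (V σ * (t.cost + 1 + T) + (t.cost + 1)) fun σ' => I σ' ∧ t.eval σ' = 0 := by
  induction hn : V σ using Nat.strong_induction_on generalizing σ with
  | _ n ih =>
    by_cases ht : t.eval σ = 0
    · exact ⟨_, σ, .loop_done ht, by omega, h, ht⟩
    · obtain ⟨k, σ', h1, h2, h3, h4⟩ := hbody σ h ht
      obtain ⟨l, σ'', h5, h6, h7⟩ := ih (V σ') (by omega) h3 rfl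
      refine ⟨_, σ'', .loop_step ht h1 h5, ?_, h7⟩
      have : (V σ' + 1) * (t.cost + 1 + T) ≤ n * (t.cost + 1 + T) :=
        Nat.mul_le_mul_right _ (by omega)
      rw [add_mul, one_mul] at this
      omega

/-- Run `c` with register `i` going from 0 to the value of register `x`. -/
def Prog.for (i x : ℕ) (c : Prog) : Prog :=
  .seq (.assign i 0) (.loop (.reg x - .reg i) (.seq c (.assign i (.reg i + 1))))

/-- A test costs 4 and an increment 4, whence `T + 8`; the initialisation costs 2 and the final test
4, whence 6. By `hI` the invariant must not depend on the counter register, and by `hx` it fixes the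
bound. -/
theorem Ends.for {I : ℕ → Memory → Prop} {i x H : ℕ}
    (hi : c.setsReg i = false)
    (hI : ∀ k σ v, I k σ → I k (σ.setReg i v)) (hx : ∀ k σ, k ≤ H → I k σ → σ.reg x = H)
    (hbody : ∀ k σ, k < H → I k σ → σ.reg i = k → Ends c σ T (I (k + 1))) (h : I 0 σ) :
    Ends (.for i x c) σ (H * (T + 8) + 6) (I H) := by
  have hcost : (Term.reg x - Term.reg i).cost = 3 := rfl
  have key := Ends.while (σ := σ.setReg i 0) (t := .reg x - .reg i) (T := T + 4)
    (c := .seq c (.assign i (.reg i + 1)))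
    (I := fun σ => I (σ.reg i) σ ∧ σ.reg i ≤ H) (fun σ => H - σ.reg i) ?_ ?_
  · obtain ⟨k, σ', h1, h2, ⟨h3, h4⟩, h5⟩ := key
    refine ⟨_, σ', .seq (.assign i 0 σ) h1, ?_, ?_⟩
    · have h6 : (0 : Term).cost = 1 := rfl
      simp only [hcost, Memory.setReg_reg, if_true, Nat.sub_zero] at h2
      rw [h6]
      have : 3 + 1 + (T + 4) = T + 8 := by ring
      rw [this] at h2
      omega
    · have h6 := hx _ _ h4 h3
      simp only [Term.eval_sub, Term.eval_reg, h6] at h5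
      have : σ'.reg i = H := by omega
      rwa [this] at h3
  · rintro σ ⟨h1, h2⟩ h3
    have h4 := hx _ _ h2 h1
    simp only [Term.eval_sub, Term.eval_reg, h4] at h3
    refine Ends.seq ((hbody _ σ (by omega) h1 rfl).imp fun σ' hf h5 => ?_)
    have h6 := hf.reg i hi
    refine ⟨_, _, .assign _ _ _, le_rfl, ?_⟩
    change (I ((σ'.setReg i _).reg i) (σ'.setReg i _) ∧ (σ'.setReg i _).reg i ≤ H) ∧
      H - (σ'.setReg i _).reg i < _
    simp only [Memory.setReg_reg, if_true, Term.eval_add, Term.eval_reg, Term.eval_ofNat, h6]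
    exact ⟨⟨hI _ _ _ h5, by omega⟩, by omega⟩
  · simp only [Memory.setReg_reg, if_true]
    exact ⟨hI _ _ _ h, Nat.zero_le _⟩

/-- A loop in which run `k` ensures `P k`, and ghost states only grow. -/
theorem Ends.forEach {G : Type} {le : G → G → Prop} (hrefl : ∀ g, le g g)
    (htrans : ∀ {g g' g''}, le g g' → le g' g'' → le g g'') {J : G → Memory → Prop}
    {P : ℕ → G → Prop} {i x H : ℕ} (hi : c.setsReg i = false)
    (hJ : ∀ g σ v, J g σ → J g (σ.setReg i v)) (hx : ∀ g σ, J g σ → σ.reg x = H)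
    (hP : ∀ k g g', le g g' → P k g → P k g')
    (hbody : ∀ k g σ, k < H → J g σ → σ.reg i = k →
      Ends c σ T fun σ' => ∃ g', le g g' ∧ J g' σ' ∧ P k g') {g : G} (h : J g σ) :
    Ends (.for i x c) σ (H * (T + 8) + 6) fun σ' => ∃ g', le g g' ∧ J g' σ' ∧ ∀ k < H, P k g' := by
  refine Ends.for (I := fun n σ' => ∃ g', le g g' ∧ J g' σ' ∧ ∀ k < n, P k g') hi ?_ ?_ ?_ ?_
  · rintro k σ v ⟨g', h1, h2, h3⟩
    exact ⟨g', h1, hJ _ _ _ h2, h3⟩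
  · rintro k σ - ⟨g', -, h2, -⟩
    exact hx _ _ h2
  · rintro k σ hk ⟨g', h1, h2, h3⟩ hik
    refine (hbody k g' σ hk h2 hik).imp fun σ' _ ⟨g'', h4, h5, h6⟩ =>
      ⟨g'', htrans h1 h4, h5, fun k' hk' => ?_⟩
    rcases Nat.lt_succ_iff_lt_or_eq.1 hk' with h7 | rfl
    · exact hP _ _ _ h4 (h3 _ h7)
    · exact h6
  · exact ⟨g, hrefl g, h, fun k hk => absurd hk (Nat.not_lt_zero k)⟩

end Ends

/-! ### Conditions -/

/-- Boolean combinations of comparisons. -/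
inductive BExp : Type where
  | eq (s t : Term)
  | lt (s t : Term)
  | and (a b : BExp)
  | or (a b : BExp)
  | not (a : BExp)

/-- The truth of a condition. -/
def BExp.Holds (σ : Memory) : BExp → Prop
  | .eq s t => s.eval σ = t.eval σ
  | .lt s t => s.eval σ < t.eval σ
  | .and a b => a.Holds σ ∧ b.Holds σ
  | .or a b => a.Holds σ ∨ b.Holds σ
  | .not a => ¬ a.Holds σ

/-- The expression with value 1 or 0 for a condition. -/
def BExp.term : BExp → Term
  | .eq s t => 1 - ((s - t) + (t - s))
  | .lt s t => 1 - (1 - (t - s))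
  | .and a b => 1 - ((1 - a.term) + (1 - b.term))
  | .or a b => 1 - (1 - (a.term + b.term))
  | .not a => 1 - a.term

open Classical in
theorem BExp.eval_term (b : BExp) (σ : Memory) :
    b.term.eval σ = if b.Holds σ then 1 else 0 := by
  induction b with
  | eq s t =>
    simp only [BExp.term, Term.eval_sub, Term.eval_add, Term.eval_ofNat]
    by_cases h : (BExp.eq s t).Holds σ
    · rw [if_pos h]
      have h' : s.eval σ = t.eval σ := h
      omega
    · rw [if_neg h]
      have h' : ¬ s.eval σ = t.eval σ := h
      omega
  | lt s t =>
    simp only [BExp.term, Term.eval_sub, Term.eval_ofNat]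
    by_cases h : (BExp.lt s t).Holds σ
    · rw [if_pos h]
      have h' : s.eval σ < t.eval σ := h
      omega
    · rw [if_neg h]
      have h' : ¬ s.eval σ < t.eval σ := h
      omega
  | and a b iha ihb =>
    simp only [BExp.term, BExp.Holds, Term.eval_sub, Term.eval_add, Term.eval_ofNat, iha, ihb]
    by_cases h1 : a.Holds σ <;> by_cases h2 : b.Holds σ <;> simp [h1, h2]
  | or a b iha ihb =>
    simp only [BExp.term, BExp.Holds, Term.eval_sub, Term.eval_add, Term.eval_ofNat, iha, ihb]
    by_cases h1 : a.Holds σ <;> by_cases h2 : b.Holds σ <;> simp [h1, h2]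
  | not a iha =>
    simp only [BExp.term, BExp.Holds, Term.eval_sub, Term.eval_ofNat, iha]
    by_cases h1 : a.Holds σ <;> simp [h1]

theorem BExp.eval_term_ne_zero (b : BExp) (σ : Memory) : b.term.eval σ ≠ 0 ↔ b.Holds σ := by
  classical
  rw [BExp.eval_term]
  by_cases h : b.Holds σ <;> simp [h]

theorem BExp.eval_term_eq_zero (b : BExp) (σ : Memory) : b.term.eval σ = 0 ↔ ¬ b.Holds σ := by
  rw [← BExp.eval_term_ne_zero, not_not]

end RAM


/-! ### Codes of search nodes -/

section Codes

variable {N : ℕ}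

/-- The number of a mode. -/
def Mode.code : Mode (Fin N) → ℕ
  | .idle => 0
  | .active => 1
  | .frozen f => 2 + f
  | .waiting f => 2 + N + f

theorem Mode.code_lt (a : Mode (Fin N)) : a.code < 2 * N + 2 := by
  cases a with
  | idle => simp [Mode.code]
  | active => simp [Mode.code]
  | frozen f => simp only [Mode.code]; omega
  | waiting f => simp only [Mode.code]; omega

theorem Mode.exists_code {k : ℕ} (hk : k < 2 * N + 2) : ∃ a : Mode (Fin N), a.code = k := by
  by_cases h0 : k = 0
  · exact ⟨.idle, h0.symm⟩
  by_cases h1 : k = 1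
  · exact ⟨.active, h1.symm⟩
  by_cases h2 : k < 2 + N
  · exact ⟨.frozen ⟨k - 2, by omega⟩, by simp only [Mode.code]; omega⟩
  · exact ⟨.waiting ⟨k - (2 + N), by omega⟩, by simp only [Mode.code]; omega⟩

@[simp] theorem Mode.code_eq_zero {a : Mode (Fin N)} : a.code = 0 ↔ a = .idle := by
  cases a <;> simp [Mode.code]

@[simp] theorem Mode.code_eq_one {a : Mode (Fin N)} : a.code = 1 ↔ a = .active := by
  cases a <;> simp [Mode.code] <;> omega

@[simp] theorem Mode.code_eq_frozen {a : Mode (Fin N)} {f : Fin N} :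
    a.code = 2 + f ↔ a = .frozen f := by
  cases a <;> simp [Mode.code, Fin.ext_iff] <;> omega

@[simp] theorem Mode.code_eq_waiting {a : Mode (Fin N)} {f : Fin N} :
    a.code = 2 + N + f ↔ a = .waiting f := by
  cases a <;> simp [Mode.code, Fin.ext_iff] <;> omega

@[simp] theorem Mode.code_lt_two {a : Mode (Fin N)} : a.code < 2 ↔ a.Free := by
  have : a.code < 2 ↔ a.code = 0 ∨ a.code = 1 := by omega
  rw [this, Mode.code_eq_zero, Mode.code_eq_one, Mode.Free]

theorem Mode.code_lt_waiting {a : Mode (Fin N)} : a.code < 2 + N ↔ ∀ f, a ≠ .waiting f := by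
  cases a with
  | waiting f => simp [Mode.code]
  | _ => simp [Mode.code] <;> omega

@[simp] theorem Mode.code_inj {a b : Mode (Fin N)} : a.code = b.code ↔ a = b := by
  cases b with
  | idle => exact Mode.code_eq_zero
  | active => exact Mode.code_eq_one
  | frozen f => exact Mode.code_eq_frozen
  | waiting f => exact Mode.code_eq_waiting

namespace RAM

/-- Condition for `SendModes`; `p` is the sender, register 1 holds the number of processes. -/
def sendModesExp (start : BExp) (p a b a' b' : Term) : BExp :=
  .or (.and (.lt a 2) (.and (.eq a' a) (.eq b' b)))
    (.or (.and start (.and (.eq a 0) (.and (.eq a' 1) (.eq b' b))))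
      (.or (.and (.eq a 1) (.and (.eq b (2 + p)) (.and (.eq a' 1) (.eq b' 1))))
        (.and (.eq a 0) (.and (.eq b 1) (.and (.eq a' 1) (.eq b' (2 + .reg 1 + p)))))))

theorem holds_sendModesExp {σ : Memory} {start : BExp} {p a b a' b' : Term}
    {c d : Channel (Fin N)} {α β α' β' : Mode (Fin N)} (hN : σ.reg 1 = N)
    (hs : start.Holds σ ↔ d = c) (hp : p.eval σ = d.1.1) (ha : a.eval σ = α.code)
    (hb : b.eval σ = β.code) (ha' : a'.eval σ = α'.code) (hb' : b'.eval σ = β'.code) :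
    (sendModesExp start p a b a' b').Holds σ ↔ SendModes c d α β α' β' := by
  simp only [sendModesExp, BExp.Holds, hs, hp, ha, hb, ha', hb', Term.eval_add, Term.eval_ofNat,
    Term.eval_reg, hN, Mode.code_eq_zero, Mode.code_eq_one, Mode.code_eq_frozen,
    Mode.code_eq_waiting, Mode.code_lt_two, Mode.code_inj, sendModes_iff]

/-- Condition for `SyncModes`. -/
def syncModesExp (start : BExp) (p a b a' b' : Term) : BExp :=
  .or (.and (.lt a 2) (.and (.lt b 2) (.and (.eq a' a) (.eq b' b))))
    (.or (.and (.lt a 2) (.and (.lt b 2) (.and (.or (.eq a 1) (.eq b 1))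
        (.and (.eq a' 1) (.eq b' 1)))))
      (.or (.and (.lt a 2) (.and (.eq b 0) (.and (.eq a' a) (.eq b' (2 + p)))))
        (.or (.and start (.and (.eq a 0) (.and (.eq b 0) (.and (.eq a' 1) (.eq b' (2 + p))))))
          (.and (.lt a 2) (.and (.eq b (2 + .reg 1 + p)) (.and (.eq a' a) (.eq b' 1)))))))

theorem holds_syncModesExp {σ : Memory} {start : BExp} {p a b a' b' : Term}
    {c d : Channel (Fin N)} {α β α' β' : Mode (Fin N)} (hN : σ.reg 1 = N)
    (hs : start.Holds σ ↔ d = c) (hp : p.eval σ = d.1.1) (ha : a.eval σ = α.code)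
    (hb : b.eval σ = β.code) (ha' : a'.eval σ = α'.code) (hb' : b'.eval σ = β'.code) :
    (syncModesExp start p a b a' b').Holds σ ↔ SyncModes c d α β α' β' := by
  simp only [syncModesExp, BExp.Holds, hs, hp, ha, hb, ha', hb', Term.eval_add, Term.eval_ofNat,
    Term.eval_reg, hN, Mode.code_eq_zero, Mode.code_eq_one, Mode.code_eq_frozen,
    Mode.code_eq_waiting, Mode.code_lt_two, Mode.code_inj, syncModes_iff]

end RAM

variable {s : ℕ} {S : FIFOSystem (Fin N) (Fin s)}

/-- A search node, with the channel and the message that the search is for. -/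
abbrev SearchKey (S : FIFOSystem (Fin N) (Fin s)) : Type :=
  Channel (Fin N) × Fin s × SearchNode S

/-- A word that describes a search node. -/
def digit (x : SearchKey S) (i : ℕ) : ℕ :=
  if h : i < N then x.2.2.state ⟨i, h⟩
  else if h : i - N < N then (x.2.2.mode ⟨i - N, h⟩).code
  else if i = 2 * N then x.2.2.flag.toNat
  else if i = 2 * N + 1 then x.1.1.1
  else if i = 2 * N + 2 then x.1.1.2
  else x.2.1

theorem digit_state (x : SearchKey S) (p : Fin N) : digit x p = x.2.2.state p := by
  simp [digit]

theorem digit_mode (x : SearchKey S) (p : Fin N) : digit x (N + p) = (x.2.2.mode p).code := by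
  simp [digit]

theorem digit_flag (x : SearchKey S) : digit x (2 * N) = x.2.2.flag.toNat := by
  rw [digit, dif_neg (by omega), dif_neg (by omega), if_pos rfl]

theorem digit_sender (x : SearchKey S) : digit x (2 * N + 1) = x.1.1.1 := by
  rw [digit, dif_neg (by omega), dif_neg (by omega), if_neg (by omega), if_pos rfl]

theorem digit_receiver (x : SearchKey S) : digit x (2 * N + 2) = x.1.1.2 := by
  rw [digit, dif_neg (by omega), dif_neg (by omega), if_neg (by omega), if_neg (by omega),
    if_pos rfl]

theorem digit_msg (x : SearchKey S) : digit x (2 * N + 3) = x.2.1 := by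
  rw [digit, dif_neg (by omega), dif_neg (by omega), if_neg (by omega), if_neg (by omega),
    if_neg (by omega)]

theorem forall_digit_iff {f g : ℕ → ℕ} : (∀ i < 2 * N + 4, f i = g i) ↔
    (∀ p : Fin N, f p = g p) ∧ (∀ p : Fin N, f (N + p) = g (N + p)) ∧ f (2 * N) = g (2 * N) ∧
      f (2 * N + 1) = g (2 * N + 1) ∧ f (2 * N + 2) = g (2 * N + 2) ∧
      f (2 * N + 3) = g (2 * N + 3) := by
  constructor
  · intro h
    exact ⟨fun p => h _ (by omega), fun p => h _ (by omega), h _ (by omega), h _ (by omega),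
      h _ (by omega), h _ (by omega)⟩
  · rintro ⟨h1, h2, h3, h4, h5, h6⟩ i hi
    by_cases i1 : i < N
    · exact h1 ⟨i, i1⟩
    by_cases i2 : i < 2 * N
    · have := h2 ⟨i - N, by omega⟩
      simpa [show N + (i - N) = i by omega] using this
    have : i = 2 * N ∨ i = 2 * N + 1 ∨ i = 2 * N + 2 ∨ i = 2 * N + 3 := by omega
    rcases this with rfl | rfl | rfl | rfl <;> assumption

theorem digit_injective {x y : SearchKey S} (h : ∀ i < 2 * N + 4, digit x i = digit y i) :
    x = y := by
  rw [forall_digit_iff] at h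
  simp only [digit_state, digit_mode, digit_flag, digit_sender, digit_receiver, digit_msg] at h
  obtain ⟨h1, h2, h3, h4, h5, h6⟩ := h
  obtain ⟨⟨⟨w, q⟩, hc⟩, m, ⟨st, md, fl⟩⟩ := x
  obtain ⟨⟨⟨w', q'⟩, hc'⟩, m', ⟨st', md', fl'⟩⟩ := y
  simp only [Mode.code_inj] at h1 h2 h3 h4 h5 h6
  have e1 : st = st' := funext fun p => Fin.ext (h1 p)
  have e2 : md = md' := funext h2
  have e3 : fl = fl' := by
    cases fl <;> cases fl' <;> simp at h3 <;> rfl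
  have e4 : w = w' := Fin.ext h4
  have e5 : q = q' := Fin.ext h5
  have e6 : m = m' := Fin.ext h6
  subst e1 e2 e3 e4 e5 e6
  rfl

/-- A number that exceeds all digits. -/
def FIFOSystem.base (S : FIFOSystem (Fin N) (Fin s)) : ℕ := (∑ p, S.numStates p) + 2 * N + s + 3

theorem digit_lt (x : SearchKey S) (i : ℕ) : digit x i < S.base := by
  unfold digit FIFOSystem.base
  split_ifs with h1 h2
  · have h3 := (x.2.2.state ⟨i, h1⟩).2
    have h4 := Finset.single_le_sum (f := S.numStates) (fun _ _ => Nat.zero_le _)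
      (Finset.mem_univ ⟨i, h1⟩)
    omega
  · have := (x.2.2.mode ⟨i - N, h2⟩).code_lt
    omega
  · have := x.2.2.flag.toNat_lt
    omega
  · omega
  · omega
  · omega

/-- Division by the highest power recovers the leading digit, because the lower digits sum to less
than that power. -/
theorem sum_pow_mul_inj {B : ℕ} {u v : ℕ → ℕ} (D : ℕ) (hu : ∀ i, u i < B) (hv : ∀ i, v i < B)
    (h : ∑ i ∈ Finset.range D, B ^ i * u i = ∑ i ∈ Finset.range D, B ^ i * v i) :
    ∀ i < D, u i = v i := by
  have hlt : ∀ (w : ℕ → ℕ) (D : ℕ), (∀ i, w i < B) →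
      ∑ i ∈ Finset.range D, B ^ i * w i < B ^ D := by
    intro w D hw
    induction D with
    | zero => simp
    | succ D ih =>
      rw [Finset.sum_range_succ, pow_succ]
      have h1 : B ^ D * (w D + 1) ≤ B ^ D * B := Nat.mul_le_mul_left _ (hw D)
      rw [mul_add, mul_one] at h1
      omega
  induction D with
  | zero => intro i hi; omega
  | succ D ih =>
    rw [Finset.sum_range_succ, Finset.sum_range_succ] at h
    have h1 := hlt u D hu
    have h2 := hlt v D hv
    have hpos : 0 < B ^ D := by omega
    have h3 : u D = v D := by
      have := congrArg (· / B ^ D) h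
      simpa [Nat.add_mul_div_left _ _ hpos, Nat.div_eq_of_lt h1, Nat.div_eq_of_lt h2] using this
    rw [h3] at h
    intro i hi
    rcases Nat.lt_succ_iff_lt_or_eq.1 hi with h4 | rfl
    · exact ih (by omega) i h4
    · exact h3

/-- The number of a search node. -/
def SearchKey.code (x : SearchKey S) : ℕ :=
  ∑ i ∈ Finset.range (2 * N + 4), S.base ^ i * digit x i

theorem SearchKey.code_injective {x y : SearchKey S} (h : SearchKey.code x = SearchKey.code y) :
    x = y :=
  digit_injective (sum_pow_mul_inj _ (digit_lt x) (digit_lt y) h)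

end Codes


/-! ### The search program -/

section Search

variable {N s : ℕ} {S : FIFOSystem (Fin N) (Fin s)} {nT : ℕ} {σ σ' : RAM.Memory}

/-- Entry `i` of the transition table describes the transition `τ` of process `p`. -/
structure TransAt (σ : RAM.Memory) (i : ℕ) (p : Fin N)
    (τ : Fin (S.numStates p) × Act (Fin N) (Fin s) × Fin (S.numStates p)) : Prop where
  owner : σ.arr 2 i = p
  src : σ.arr 0 (σ.arr 1 i) = τ.1
  act : ∀ l < 4, σ.arr 0 (σ.arr 1 i + (1 + l)) = τ.2.1.code.getD l 0
  tgt : σ.arr 0 (σ.arr 1 i + 5) = τ.2.2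

/-- The tables that the search program uses. -/
structure Tables (S : FIFOSystem (Fin N) (Fin s)) (nT : ℕ) (σ : RAM.Memory) : Prop where
  reg1 : σ.reg 1 = N
  reg2 : σ.reg 2 = s
  reg3 : σ.reg 3 = 2 * N + 4
  reg4 : σ.reg 4 = S.base
  reg5 : σ.reg 5 = nT
  reg6 : σ.reg 6 = 2 * N + 2
  reg7 : σ.reg 7 = 2 * N
  sound : ∀ i < nT, ∃ p, ∃ τ ∈ S.trans p, TransAt σ i p τ
  complete : ∀ p, ∀ τ ∈ S.trans p, ∃ i < nT, TransAt σ i p τ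
  init : ∀ p : Fin N, σ.arr 3 p = S.init p
  weight : ∀ i < 2 * N + 4, ∀ d < S.base, σ.arr 4 (i * S.base + d) = S.base ^ i * d

/-- Register 1 holds the number of processes, 2 that of messages, 3 the length of a row, 4 the base,
5 the number of transitions, 6 the number of modes and 7 the place of the flag in a row. Array 0 is
the input, 1 and 2 give address and owner of each transition, 3 the initial states, 4 the multiples
of the powers of the base. The search never writes to any of these. -/
theorem Tables.congr (h : Tables S nT σ) (hr : ∀ x, 1 ≤ x → x ≤ 7 → σ'.reg x = σ.reg x)
    (ha : ∀ a, a ≤ 4 → σ'.arr a = σ.arr a) : Tables S nT σ' := by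
  have ht : ∀ i p τ, TransAt (S := S) σ i p τ → TransAt (S := S) σ' i p τ := by
    rintro i p τ ⟨h1, h2, h3, h4⟩
    constructor <;> simpa only [ha 0 (by omega), ha 1 (by omega), ha 2 (by omega)]
  constructor
  · rw [hr 1 (by omega) (by omega), h.reg1]
  · rw [hr 2 (by omega) (by omega), h.reg2]
  · rw [hr 3 (by omega) (by omega), h.reg3]
  · rw [hr 4 (by omega) (by omega), h.reg4]
  · rw [hr 5 (by omega) (by omega), h.reg5]
  · rw [hr 6 (by omega) (by omega), h.reg6]
  · rw [hr 7 (by omega) (by omega), h.reg7]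
  · intro i hi
    obtain ⟨p, τ, h1, h2⟩ := h.sound i hi
    exact ⟨p, τ, h1, ht _ _ _ h2⟩
  · intro p τ hτ
    obtain ⟨i, hi, h1⟩ := h.complete p τ hτ
    exact ⟨i, hi, ht _ _ _ h1⟩
  · rw [ha 3 (by omega)]
    exact h.init
  · rw [ha 4 (by omega)]
    exact h.weight

/-- The queue of the search holds the nodes `ns`, and exactly these are marked. -/
structure Queue (ns : List (SearchKey S)) (σ : RAM.Memory) : Prop where
  row : ∀ k (hk : k < ns.length), ∀ i < 2 * N + 4,
    σ.arr 5 (k * (2 * N + 4) + i) = digit ns[k] i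
  fin : σ.reg 8 = ns.length * (2 * N + 4)
  mark : ∀ x : SearchKey S, σ.arr 6 (SearchKey.code x) ≠ 0 ↔ x ∈ ns
  nodup : ns.Nodup

/-- Array 5 holds the rows of the queue and array 6 the marks. Cells of array 5 from register 8 on
are free, and new rows are assembled there; therefore only those below it must be kept. -/
theorem Queue.congr {ns : List (SearchKey S)} (h : Queue ns σ) (hr : σ'.reg 8 = σ.reg 8)
    (h5 : ∀ i < σ.reg 8, σ'.arr 5 i = σ.arr 5 i) (h6 : σ'.arr 6 = σ.arr 6) : Queue ns σ' := by
  refine ⟨fun k hk i hi => ?_, hr.trans h.fin, by rw [h6]; exact h.mark, h.nodup⟩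
  rw [h5, h.row k hk i hi]
  rw [h.fin]
  have : (k + 1) * (2 * N + 4) ≤ ns.length * (2 * N + 4) := Nat.mul_le_mul_right _ hk
  rw [add_mul, one_mul] at this
  omega

namespace RAM

/-- Add the row after the end of the queue to the queue, if it is new. -/
def visit : Prog :=
  .seq (.seq (.assign 40 0) (.assign 41 0)) <|
  .seq (.for 42 3 (.seq
    (.assign 40 (.reg 40 + .read 4 (.reg 41 + .read 5 (.reg 8 + .reg 42))))
    (.assign 41 (.reg 41 + .reg 4)))) <|
  .cond (.read 6 (.reg 40)) .skip
    (.seq (.write 6 (.reg 40) 1) (.assign 8 (.reg 8 + .reg 3)))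

/-- A bound for the running time of a loop. -/
def loopTime (H T : ℕ) : ℕ := H * (T + 8) + 6

theorem Ends.flat_then {c d : Prog} {σ : Memory} {T : ℕ} {Q : Memory → Prop} (hc : c.flat = true)
    (h : Ends d (c.run σ) T Q) : Ends (.seq c d) σ (c.cost + T) Q :=
  Ends.seq (Ends.of_flat hc h)

/-- The machine cannot multiply, so the code of the row is summed up from tabulated multiples of
powers of the base, with register 41 running through the starts of the blocks of the table. As codes
are injective, marking `y` marks no other key. -/
theorem exists_visit_time : ∃ K, ∀ {N s : ℕ} {S : FIFOSystem (Fin N) (Fin s)} {nT : ℕ}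
    {σ : Memory} {ns : List (SearchKey S)} {y : SearchKey S}, Tables S nT σ → Queue ns σ →
    (∀ i < 2 * N + 4, σ.arr 5 (σ.reg 8 + i) = digit y i) →
    Ends visit σ (K * (2 * N + 4)) fun σ' => ∃ ns', ns <+: ns' ∧ y ∈ ns' ∧
      (∀ z ∈ ns', z ∈ ns ∨ z = y) ∧ Queue ns' σ' := by
  refine ⟨200, fun {N s S nT σ ns y} hT hQ hy => ?_⟩
  refine Ends.mono (T := 4 + ((2 * N + 4) * (14 + 8) + 6 + 20)) ?_ (by omega) fun σ' h => h
  refine Ends.flat_then rfl (Ends.seq ((Ends.for (H := 2 * N + 4)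
    (I := fun k σ' => σ'.reg 3 = 2 * N + 4 ∧ σ'.reg 4 = S.base ∧ σ'.reg 8 = σ.reg 8 ∧
      σ'.arr = σ.arr ∧ σ'.reg 41 = k * S.base ∧
      σ'.reg 40 = ∑ i ∈ Finset.range k, S.base ^ i * digit y i) rfl ?_ ?_ ?_ ?_).imp ?_))
  · rintro k σ v ⟨h1, h2, h3, h4, h5, h6⟩
    simp [h1, h2, h3, h4, h5, h6]
  · exact fun k σ _ h => h.1
  · rintro k σ₁ hk ⟨h1, h2, h3, h4, h5, h6⟩ h7
    refine (Ends.of_flat rfl ?_).mono (T := _) (le_refl 14) (fun _ h => h)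
    simp only [Prog.run, Memory.setReg_reg, Memory.setReg_arr, Term.eval_add, Term.eval_reg,
      Term.eval_read, h1, h2, h3, h4, h5, h6, h7]
    have h8 : σ.arr 5 (σ.reg 8 + k) = digit y k := hy k hk
    simp [h8, hT.weight k hk _ (digit_lt y k), Finset.sum_range_succ, add_mul]
  · simp [Prog.run, hT.reg3, hT.reg4]
  · rintro σ₁ - ⟨h1, h2, h3, h4, h5, h6⟩
    have h40 : σ₁.reg 40 = SearchKey.code y := h6
    refine Ends.mono (T := 2 + 1 + (4 + 4)) (Ends.cond_of (fun hne => ?_) fun heq => ?_) (by omega)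
      fun _ h => h
    · simp only [Term.eval_read, Term.eval_reg, h4, h40] at hne
      refine (Ends.of_flat rfl ?_).mono (T := _) (by decide) (fun _ h => h)
      refine ⟨ns, List.prefix_rfl, (hQ.mark y).1 hne, fun z hz => Or.inl hz, ?_⟩
      exact hQ.congr h3 (fun i _ => by rw [Prog.run, h4]) (by rw [Prog.run, h4])
    · simp only [Term.eval_read, Term.eval_reg, h4, h40] at heq
      have hny : y ∉ ns := fun h => (hQ.mark y).2 h heq
      refine (Ends.of_flat rfl ?_).mono (T := _) (by decide) (fun _ h => h)
      refine ⟨ns ++ [y], List.prefix_append _ _, by simp, fun z hz => by simpa using hz, ?_⟩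
      constructor
      · intro k hk i hi
        simp only [Prog.run, Memory.setReg_arr, Memory.setArr_arr, h4]
        simp only [Term.eval_reg, show ¬ (5 = 6) by decide, false_and, if_false]
        by_cases hk' : k < ns.length
        · rw [List.getElem_append_left hk']
          exact hQ.row k hk' i hi
        · have : k = ns.length := by simp at hk; omega
          subst this
          rw [← hQ.fin]
          simpa using hy i hi
      · simp [Prog.run, h1, h3, hQ.fin, add_mul]
      · intro x
        simp only [Prog.run, Memory.setReg_arr, Memory.setArr_arr_same, h4, Term.eval_reg, h40,
          Term.eval_ofNat]
        by_cases hx : x = y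
        · subst hx
          simp
        · rw [if_neg fun h => hx (SearchKey.code_injective h), hQ.mark]
          simp [hx]
      · exact List.nodup_append.2 ⟨hQ.nodup, by simp, by rintro z hz w hw rfl; simp at hw; exact hny (hw ▸ hz)⟩

end RAM

end Search


/-! ### Candidates for moves: expressions that test and perform them -/

section Candidates

variable {N s : ℕ} {S : FIFOSystem (Fin N) (Fin s)} {nT : ℕ} {σ σ' : RAM.Memory}
  {F : Set Failure}

/-- Moves of search keys. -/
def KeyMove (F : Set Failure) (x y : SearchKey S) : Prop :=
  y.1 = x.1 ∧ y.2.1 = x.2.1 ∧ Move F x.1 x.2.1 x.2.2 y.2.2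

namespace RAM

/-- Kind, sender, receiver and message of the first chosen transition, whose address is in
register 24; register 20 holds its index. -/
def kind₁ : Term := .read 0 (.reg 24 + 1)
def snd₁ : Term := .read 0 (.reg 24 + 2)
def rcv₁ : Term := .read 0 (.reg 24 + 3)
def msg₁ : Term := .read 0 (.reg 24 + 4)
/-- Kind, sender, receiver and message of the second chosen transition. -/
def kind₂ : Term := .read 0 (.reg 25 + 1)
def snd₂ : Term := .read 0 (.reg 25 + 2)
def rcv₂ : Term := .read 0 (.reg 25 + 3)
def msg₂ : Term := .read 0 (.reg 25 + 4)
/-- State and mode of a process in the current row. -/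
def stateOf (p : Term) : Term := .read 5 (.reg 9 + p)
def modeOf (p : Term) : Term := .read 5 (.reg 9 + (.reg 1 + p))

/-- The first transition is on the channel of the search. -/
def onChannel : BExp := .and (.eq snd₁ (.reg 10)) (.eq rcv₁ (.reg 11))

/-- Condition for `MsgOk`; `corr` is 1 if messages may be corrupted. -/
def msgExp (corr : ℕ) (m m' : Term) : BExp := .or (.eq (.lit corr) 1) (.eq m m')

/-- The first transition is a send, the second one a receive. -/
def isSync : BExp := .and (.eq kind₁ 0) (.eq kind₂ 1)

/-- The chosen transitions and the modes in registers 22 and 23 constitute a move. -/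
def moveExp (corr : ℕ) : BExp :=
  .and (.eq (.read 2 (.reg 20)) snd₁) <| .and (.eq (stateOf snd₁) (.read 0 (.reg 24))) <|
  .or (.and (.eq kind₁ 2) (.and (.lt (modeOf snd₁) 2)
    (.and (.eq (.reg 22) (modeOf snd₁)) (.eq (.reg 23) (modeOf rcv₁))))) <|
  .or (.and (.eq kind₁ 0) (.and (.not (.eq kind₂ 1))
    (sendModesExp onChannel snd₁ (modeOf snd₁) (modeOf rcv₁) (.reg 22) (.reg 23))))
  (.and isSync (.and (.eq snd₂ snd₁) (.and (.eq rcv₂ rcv₁) (.and (.eq (.read 2 (.reg 21)) rcv₁)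
    (.and (.eq (stateOf rcv₁) (.read 0 (.reg 25))) (.and (msgExp corr msg₁ msg₂)
      (syncModesExp onChannel snd₁ (modeOf snd₁) (modeOf rcv₁) (.reg 22) (.reg 23))))))))

/-- The new flag. -/
def flagExp (corr fifo : ℕ) : BExp :=
  .or (.and (.not isSync) (.or (.eq (.read 5 (.reg 9 + .reg 7)) 1)
    (.and (.eq kind₁ 0) (.and onChannel (msgExp corr msg₁ (.reg 12))))))
  (.and isSync (.and (.eq (.read 5 (.reg 9 + .reg 7)) 1)
    (.not (.and (.eq (.lit fifo) 1) onChannel))))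

open Classical in
/-- The row of the new node. -/
noncomputable def newRow (corr fifo : ℕ) (σ : Memory) (i : ℕ) : ℕ :=
  if i = σ.reg 7 then (flagExp corr fifo).term.eval σ
  else if i = σ.reg 1 + rcv₁.eval σ then σ.reg 23
  else if i = σ.reg 1 + snd₁.eval σ then σ.reg 22
  else if i = snd₁.eval σ then σ.arr 0 (σ.reg 24 + 5)
  else if isSync.Holds σ ∧ i = rcv₁.eval σ then σ.arr 0 (σ.reg 25 + 5)
  else σ.arr 5 (σ.reg 9 + i)

end RAM

open RAM

/-- The current row of the search is that of `x`. -/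
structure Head (x : SearchKey S) (σ : RAM.Memory) : Prop where
  sender : σ.reg 10 = x.1.1.1
  receiver : σ.reg 11 = x.1.1.2
  msg : σ.reg 12 = x.2.1
  row : ∀ i < 2 * N + 4, σ.arr 5 (σ.reg 9 + i) = digit x i

/-- The chosen transitions are `τ₁` and `τ₂`, and the chosen modes `α` and `β`. -/
structure Candidate (x : SearchKey S) (σ : RAM.Memory) (p₁ : Fin N)
    (τ₁ : Fin (S.numStates p₁) × Act (Fin N) (Fin s) × Fin (S.numStates p₁)) (p₂ : Fin N)
    (τ₂ : Fin (S.numStates p₂) × Act (Fin N) (Fin s) × Fin (S.numStates p₂))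
    (α β : Mode (Fin N)) : Prop where
  head : Head x σ
  reg1 : σ.reg 1 = N
  reg7 : σ.reg 7 = 2 * N
  reg24 : σ.reg 24 = σ.arr 1 (σ.reg 20)
  reg25 : σ.reg 25 = σ.arr 1 (σ.reg 21)
  trans₁ : TransAt σ (σ.reg 20) p₁ τ₁
  trans₂ : TransAt σ (σ.reg 21) p₂ τ₂
  reg22 : σ.reg 22 = α.code
  reg23 : σ.reg 23 = β.code

theorem TransAt.fields {i : ℕ} {p : Fin N}
    {τ : Fin (S.numStates p) × Act (Fin N) (Fin s) × Fin (S.numStates p)} (h : TransAt σ i p τ) :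
    σ.arr 0 (σ.arr 1 i + 1) = τ.2.1.code.getD 0 0 ∧ σ.arr 0 (σ.arr 1 i + 2) = τ.2.1.code.getD 1 0 ∧
      σ.arr 0 (σ.arr 1 i + 3) = τ.2.1.code.getD 2 0 ∧ σ.arr 0 (σ.arr 1 i + 4) = τ.2.1.code.getD 3 0 :=
  ⟨h.act 0 (by omega), h.act 1 (by omega), h.act 2 (by omega), h.act 3 (by omega)⟩

namespace Candidate

variable {x y : SearchKey S} {p₁ p₂ : Fin N}
  {τ₁ : Fin (S.numStates p₁) × Act (Fin N) (Fin s) × Fin (S.numStates p₁)}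
  {τ₂ : Fin (S.numStates p₂) × Act (Fin N) (Fin s) × Fin (S.numStates p₂)}
  {α β : Mode (Fin N)} {corr fifo : ℕ}

theorem eval₁ (h : Candidate x σ p₁ τ₁ p₂ τ₂ α β) :
    kind₁.eval σ = τ₁.2.1.code.getD 0 0 ∧ snd₁.eval σ = τ₁.2.1.code.getD 1 0 ∧
      rcv₁.eval σ = τ₁.2.1.code.getD 2 0 ∧ msg₁.eval σ = τ₁.2.1.code.getD 3 0 := by
  have := h.trans₁.fields
  rwa [← h.reg24] at this

theorem eval₂ (h : Candidate x σ p₁ τ₁ p₂ τ₂ α β) :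
    kind₂.eval σ = τ₂.2.1.code.getD 0 0 ∧ snd₂.eval σ = τ₂.2.1.code.getD 1 0 ∧
      rcv₂.eval σ = τ₂.2.1.code.getD 2 0 ∧ msg₂.eval σ = τ₂.2.1.code.getD 3 0 := by
  have := h.trans₂.fields
  rwa [← h.reg25] at this

theorem eval_stateOf (h : Candidate x σ p₁ τ₁ p₂ τ₂ α β) {t : Term} {p : Fin N}
    (ht : t.eval σ = p) : (stateOf t).eval σ = x.2.2.state p := by
  simp only [stateOf, Term.eval_read, Term.eval_add, Term.eval_reg, ht]
  rw [h.head.row _ (by omega), digit_state]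

theorem eval_modeOf (h : Candidate x σ p₁ τ₁ p₂ τ₂ α β) {t : Term} {p : Fin N}
    (ht : t.eval σ = p) : (modeOf t).eval σ = (x.2.2.mode p).code := by
  simp only [modeOf, Term.eval_read, Term.eval_add, Term.eval_reg, ht, h.reg1]
  rw [h.head.row _ (by omega), digit_mode]

theorem eval_flag (h : Candidate x σ p₁ τ₁ p₂ τ₂ α β) :
    (Term.read 5 (.reg 9 + .reg 7)).eval σ = x.2.2.flag.toNat := by
  simp only [Term.eval_read, Term.eval_add, Term.eval_reg, h.reg7]
  rw [h.head.row _ (by omega), digit_flag]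

theorem holds_onChannel (h : Candidate x σ p₁ τ₁ p₂ τ₂ α β) {d : Channel (Fin N)} {m : Fin s}
    (hτ : τ₁.2.1 = .send d m) : onChannel.Holds σ ↔ d = x.1 := by
  obtain ⟨-, h1, h2, -⟩ := h.eval₁
  rw [hτ] at h1 h2
  simp only [onChannel, BExp.Holds, h1, h2, Term.eval_reg, h.head.sender, h.head.receiver, Act.code]
  simp [Subtype.ext_iff, Prod.ext_iff, Fin.ext_iff]

/-- The new row is that of `y`, if `y` results from the changes. -/
theorem newRow_eq (h : Candidate x σ p₁ τ₁ p₂ τ₂ α β) {p r : Fin N} (hp : snd₁.eval σ = p)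
    (hr : rcv₁.eval σ = r) (h1 : y.1 = x.1) (h2 : y.2.1 = x.2.1)
    (hstate : (τ₁.2.2 : ℕ) = y.2.2.state p)
    (hsync : isSync.Holds σ → p ≠ r ∧ (τ₂.2.2 : ℕ) = y.2.2.state r)
    (hother : ∀ z, z ≠ p → (isSync.Holds σ → z ≠ r) → y.2.2.state z = x.2.2.state z)
    (hα : y.2.2.mode p = α) (hβ : y.2.2.mode r = β)
    (hmode : ∀ z, z ≠ p → z ≠ r → y.2.2.mode z = x.2.2.mode z)
    (hflag : y.2.2.flag = true ↔ (flagExp corr fifo).Holds σ) :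
    ∀ i < 2 * N + 4, newRow corr fifo σ i = digit y i := by
  have ht1 : σ.arr 0 (σ.reg 24 + 5) = τ₁.2.2 := by rw [h.reg24]; exact h.trans₁.tgt
  have ht2 : σ.arr 0 (σ.reg 25 + 5) = τ₂.2.2 := by rw [h.reg25]; exact h.trans₂.tgt
  have hrow := h.head.row
  rw [forall_digit_iff]
  simp only [newRow, h.reg1, h.reg7, hp, hr, ht1, ht2]
  refine ⟨fun z => ?_, fun z => ?_, ?_, ?_, ?_, ?_⟩
  · rw [if_neg (by omega), if_neg (by omega), if_neg (by omega), digit_state]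
    by_cases hz : z = p
    · subst hz
      rw [if_pos rfl, hstate]
    · rw [if_neg (by omega)]
      by_cases hs : isSync.Holds σ
      · by_cases hz' : z = r
        · subst hz'
          rw [if_pos ⟨hs, hr.symm⟩, (hsync hs).2]
        · rw [if_neg (by omega), hother z hz fun _ => hz', hrow _ (by omega), digit_state]
      · rw [if_neg (by tauto), hother z hz fun h => absurd h hs, hrow _ (by omega), digit_state]
  · rw [if_neg (by omega), digit_mode]
    by_cases hz : z = r
    · subst hz
      rw [if_pos rfl, hβ, h.reg23]
    · rw [if_neg (by omega)]
      by_cases hz' : z = p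
      · subst hz'
        rw [if_pos rfl, hα, h.reg22]
      · rw [if_neg (by omega), if_neg (by omega), if_neg (by omega), hmode z hz' hz,
          hrow _ (by omega), digit_mode]
  · rw [if_pos trivial, digit_flag]
    by_cases hf : (flagExp corr fifo).Holds σ
    · rw [BExp.eval_term, if_pos hf, hflag.2 hf]
      rfl
    · rw [(BExp.eval_term_eq_zero _ _).2 hf, Bool.eq_false_iff.2 fun h => hf (hflag.1 h)]
      rfl
  · rw [if_neg (by omega), if_neg (by omega), if_neg (by omega), if_neg (by omega),
      if_neg (by omega), hrow _ (by omega), digit_sender, digit_sender, h1]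
  · rw [if_neg (by omega), if_neg (by omega), if_neg (by omega), if_neg (by omega),
      if_neg (by omega), hrow _ (by omega), digit_receiver, digit_receiver, h1]
  · rw [if_neg (by omega), if_neg (by omega), if_neg (by omega), if_neg (by omega),
      if_neg (by omega), hrow _ (by omega), digit_msg, digit_msg, h2]

end Candidate

end Candidates


/-! ### Candidates that pass the test are exactly the moves -/

section CandidateMoves

variable {N s : ℕ} {S : FIFOSystem (Fin N) (Fin s)} {nT : ℕ} {σ σ₀ : RAM.Memory}
  {F : Set Failure} {x y : SearchKey S} {p₁ p₂ : Fin N}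
  {τ₁ : Fin (S.numStates p₁) × Act (Fin N) (Fin s) × Fin (S.numStates p₁)}
  {τ₂ : Fin (S.numStates p₂) × Act (Fin N) (Fin s) × Fin (S.numStates p₂)}
  {α β : Mode (Fin N)} {corr fifo : ℕ}

open RAM

theorem holds_msgExp (hcorr : corr = 1 ↔ Failure.corruption ∈ F) {t t' : Term} {m m' : Fin s}
    (ht : t.eval σ = m) (ht' : t'.eval σ = m') : (msgExp corr t t').Holds σ ↔ MsgOk F m m' := by
  simp only [msgExp, BExp.Holds, ht, ht', Term.eval_lit, Term.eval_ofNat, hcorr, MsgOk, Fin.ext_iff]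

namespace Candidate

/-- The values of the expressions, if the first transition is a send of its sender. -/
theorem holds_of_send (h : Candidate x σ p₁ τ₁ p₂ τ₂ α β)
    (hcorr : corr = 1 ↔ Failure.corruption ∈ F) (hfifo : fifo = 1 ↔ IsFifo F)
    {d : Channel (Fin N)} {m : Fin s} (hτ : τ₁.2.1 = .send d m) :
    (isSync.Holds σ ↔ ∃ d' m', τ₂.2.1 = .recv d' m') ∧
    ((flagExp corr fifo).Holds σ ↔
      (¬ isSync.Holds σ ∧ (x.2.2.flag = true ∨ (d = x.1 ∧ MsgOk F m x.2.1))) ∨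
      (isSync.Holds σ ∧ x.2.2.flag = true ∧ ¬ (IsFifo F ∧ d = x.1))) ∧
    ((moveExp corr).Holds σ ↔ p₁ = d.1.1 ∧ (x.2.2.state d.1.1 : ℕ) = τ₁.1 ∧
      ((¬ isSync.Holds σ ∧ SendModes x.1 d (x.2.2.mode d.1.1) (x.2.2.mode d.1.2) α β) ∨
      ∃ m', τ₂.2.1 = .recv d m' ∧ p₂ = d.1.2 ∧ (x.2.2.state d.1.2 : ℕ) = τ₂.1 ∧ MsgOk F m m' ∧
        SyncModes x.1 d (x.2.2.mode d.1.1) (x.2.2.mode d.1.2) α β)) := by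
  obtain ⟨k1, s1, r1, m1⟩ := h.eval₁
  obtain ⟨k2, s2, r2, m2⟩ := h.eval₂
  have hchan := h.holds_onChannel hτ
  rw [hτ] at k1 s1 r1 m1
  simp only [Act.code, List.getD_cons_zero, List.getD_cons_succ] at k1 s1 r1 m1
  have hsync : isSync.Holds σ ↔ ∃ d' m', τ₂.2.1 = .recv d' m' := by
    simp only [isSync, BExp.Holds, k1, k2, Term.eval_ofNat, true_and]
    cases hτ₂ : τ₂.2.1 <;> simp [Act.code]
  have hk2 : kind₂.eval σ = 1 ↔ isSync.Holds σ := by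
    simp [isSync, BExp.Holds, k1]
  have hfl : (Term.read 5 (.reg 9 + .reg 7)).eval σ = 1 ↔ x.2.2.flag = true := by
    rw [h.eval_flag]
    cases x.2.2.flag <;> simp
  have hmsg := holds_msgExp (F := F) hcorr m1 (t' := .reg 12) (h.head.msg)
  refine ⟨hsync, ?_, ?_⟩
  · simp only [flagExp, BExp.Holds, hfl, k1, hchan, hmsg, Term.eval_ofNat, Term.eval_lit, hfifo,
      true_and]
  · have h1 := holds_sendModesExp h.reg1 hchan s1 (h.eval_modeOf s1) (h.eval_modeOf r1)
      (a' := .reg 22) (b' := .reg 23) h.reg22 h.reg23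
    have h2 := holds_syncModesExp h.reg1 hchan s1 (h.eval_modeOf s1) (h.eval_modeOf r1)
      (a' := .reg 22) (b' := .reg 23) h.reg22 h.reg23
    have h3 : σ.arr 0 (σ.reg 24) = τ₁.1 := by rw [h.reg24]; exact h.trans₁.src
    have h4 : σ.arr 0 (σ.reg 25) = τ₂.1 := by rw [h.reg25]; exact h.trans₂.src
    have h5 : (Term.read 2 (.reg 20)).eval σ = p₁ := h.trans₁.owner
    have h6 : (Term.read 2 (.reg 21)).eval σ = p₂ := h.trans₂.owner
    simp only [moveExp, BExp.Holds, h1, h2, h5, h6, h.eval_stateOf s1, h.eval_stateOf r1]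
    simp only [k1, s1, r1, s2, r2, Term.eval_ofNat, Term.eval_read, Term.eval_reg, h3, h4,
      show ¬ ((0 : ℕ) = 2) by decide, false_and, false_or, true_and, Fin.ext_iff]
    simp only [hk2]
    refine and_congr_right fun _ => and_congr_right fun _ => or_congr_right ?_
    rw [hsync]
    constructor
    · rintro ⟨⟨d', m', hτ₂⟩, h7, h8, h9, h10, h11, h12⟩
      rw [hτ₂] at h7 h8 m2
      simp only [Act.code, List.getD_cons_zero, List.getD_cons_succ] at h7 h8 m2
      have : d' = d := Subtype.ext (Prod.ext (Fin.ext h7) (Fin.ext h8))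
      subst this
      exact ⟨m', hτ₂, h9, h10, (holds_msgExp hcorr m1 m2).1 h11, h12⟩
    · rintro ⟨m', hτ₂, h9, h10, h11, h12⟩
      rw [hτ₂] at m2 ⊢
      simp only [Act.code, List.getD_cons_zero, List.getD_cons_succ] at m2 ⊢
      exact ⟨⟨_, _, rfl⟩, trivial, trivial, h9, h10, (holds_msgExp hcorr m1 m2).2 h11, h12⟩

/-- The code of an internal action has 0 in the place of a receiver. So register 23 has to repeat
the mode of process 0, and writing it back is harmless; process 0 exists because `p` does. -/
theorem holds_of_internal (h : Candidate x σ p₁ τ₁ p₂ τ₂ α β) {p : Fin N} {z : ℕ}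
    (hτ : τ₁.2.1 = .internal p z) :
    ¬ isSync.Holds σ ∧ ((flagExp corr fifo).Holds σ ↔ x.2.2.flag = true) ∧
    ((moveExp corr).Holds σ ↔ p₁ = p ∧ (x.2.2.state p : ℕ) = τ₁.1 ∧ (x.2.2.mode p).Free ∧
      α = x.2.2.mode p ∧ β = x.2.2.mode ⟨0, p.pos⟩) := by
  obtain ⟨k1, s1, r1, m1⟩ := h.eval₁
  rw [hτ] at k1 s1 r1 m1
  simp only [Act.code, List.getD_cons_zero, List.getD_cons_succ] at k1 s1 r1 m1
  have r1' : rcv₁.eval σ = (⟨0, p.pos⟩ : Fin N) := r1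
  have hsync : ¬ isSync.Holds σ := by
    simp [isSync, BExp.Holds, k1]
  have hfl : (Term.read 5 (.reg 9 + .reg 7)).eval σ = 1 ↔ x.2.2.flag = true := by
    rw [h.eval_flag]
    cases x.2.2.flag <;> simp
  have h3 : σ.arr 0 (σ.reg 24) = τ₁.1 := by rw [h.reg24]; exact h.trans₁.src
  have h5 : (Term.read 2 (.reg 20)).eval σ = p₁ := h.trans₁.owner
  refine ⟨hsync, ?_, ?_⟩
  · simp only [flagExp, BExp.Holds, hfl, k1, hsync, Term.eval_ofNat]
    simp
  · simp only [moveExp, BExp.Holds, h5, s1, h.eval_stateOf s1, h.eval_modeOf s1,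
      h.eval_modeOf r1', k1, Term.eval_ofNat, Term.eval_read, Term.eval_reg, h3, h.reg22, h.reg23,
      hsync, Mode.code_inj, Mode.code_lt_two, Fin.ext_iff]
    simp

theorem not_holds_of_recv (h : Candidate x σ p₁ τ₁ p₂ τ₂ α β) {d : Channel (Fin N)} {m : Fin s}
    (hτ : τ₁.2.1 = .recv d m) : ¬ (moveExp corr).Holds σ := by
  obtain ⟨k1, -⟩ := h.eval₁
  rw [hτ] at k1
  simp only [Act.code, List.getD_cons_zero] at k1
  simp [moveExp, BExp.Holds, k1, isSync]

/-- Every accepted candidate is a move. -/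
theorem sound (h : Candidate x σ p₁ τ₁ p₂ τ₂ α β)
    (hcorr : corr = 1 ↔ Failure.corruption ∈ F) (hfifo : fifo = 1 ↔ IsFifo F)
    (hτ₁ : τ₁ ∈ S.trans p₁) (hτ₂ : τ₂ ∈ S.trans p₂) (hm : (moveExp corr).Holds σ) :
    ∃ y, KeyMove F x y ∧ ∀ i < 2 * N + 4, newRow corr fifo σ i = digit y i := by
  classical
  obtain ⟨c, m₀, n⟩ := x
  obtain ⟨q₁, a₁, q₁'⟩ := τ₁
  cases a₁ with
  | recv d m => exact absurd hm (h.not_holds_of_recv rfl)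
  | internal p z =>
    obtain ⟨h1, h2, h3⟩ := h.holds_of_internal (corr := corr) (fifo := fifo) rfl
    obtain ⟨rfl, h4, h5, h6, h7⟩ := h3.1 hm
    simp only at h4 h5 h6 h7
    have hq : n.state p₁ = q₁ := Fin.ext h4
    obtain ⟨-, s1, r1, -⟩ := h.eval₁
    simp only [Act.code, List.getD_cons_zero, List.getD_cons_succ] at s1 r1
    refine ⟨⟨c, m₀, ⟨Function.update n.state p₁ q₁', n.mode, n.flag⟩⟩,
      ⟨rfl, rfl, .internal p₁ z ?_ (fun r hr => Function.update_of_ne hr _ _) h5 rfl rfl⟩,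
      h.newRow_eq (p := p₁) (r := ⟨0, p₁.pos⟩) s1 r1 rfl rfl ?_ (fun hs => absurd hs h1) ?_ h6.symm
        h7.symm (fun _ _ _ => rfl) h2.symm⟩
    · simpa [hq] using hτ₁
    · simp
    · exact fun z hz _ => Function.update_of_ne hz _ _
  | send d m =>
    obtain ⟨h1, h2, h3⟩ := h.holds_of_send hcorr hfifo rfl
    obtain ⟨rfl, h4, h5⟩ := h3.1 hm
    simp only at h2 h4 h5
    have hq : n.state d.1.1 = q₁ := Fin.ext h4
    obtain ⟨-, s1, r1, -⟩ := h.eval₁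
    simp only [Act.code, List.getD_cons_zero, List.getD_cons_succ] at s1 r1
    rcases h5 with ⟨h5, h6⟩ | ⟨m', h5, rfl, h6, h7, h8⟩
    · refine ⟨⟨c, m₀, ⟨Function.update n.state d.1.1 q₁',
        Function.update (Function.update n.mode d.1.1 α) d.1.2 β,
        decide (n.flag = true ∨ (d = c ∧ MsgOk F m m₀))⟩⟩,
        ⟨rfl, rfl, .send d m ?_ (fun r hr => Function.update_of_ne hr _ _) ?_ ?_ ?_⟩,
        h.newRow_eq (p := d.1.1) (r := d.1.2) s1 r1 rfl rfl ?_ (fun hs => absurd hs h5) ?_ ?_ ?_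
          ?_ ?_⟩
      · simpa [hq] using hτ₁
      · simpa [Function.update_of_ne d.2] using h6
      · intro r hr hr'
        simp [Function.update_of_ne hr, Function.update_of_ne hr']
      · simp
      · simp
      · exact fun z hz _ => Function.update_of_ne hz _ _
      · simp [Function.update_of_ne d.2]
      · simp
      · intro r hr hr'
        simp [Function.update_of_ne hr, Function.update_of_ne hr']
      · simp [h2, h5]
    · have hs : isSync.Holds σ := h1.2 ⟨_, _, h5⟩
      obtain ⟨q₂, a₂, q₂'⟩ := τ₂
      simp only at h5 h6
      subst h5
      have hq' : n.state d.1.2 = q₂ := Fin.ext h6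
      refine ⟨⟨c, m₀, ⟨Function.update (Function.update n.state d.1.1 q₁') d.1.2 q₂',
        Function.update (Function.update n.mode d.1.1 α) d.1.2 β,
        decide (n.flag = true ∧ ¬ (IsFifo F ∧ d = c))⟩⟩,
        ⟨rfl, rfl, .sync d m m' h7 ?_ ?_ ?_ ?_ ?_ ?_⟩,
        h.newRow_eq (p := d.1.1) (r := d.1.2) s1 r1 rfl rfl ?_ (fun _ => ⟨d.2, ?_⟩) ?_ ?_ ?_
          ?_ ?_⟩
      · simpa [hq, Function.update_of_ne d.2] using hτ₁
      · simpa [hq'] using hτ₂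
      · intro r hr hr'
        simp [Function.update_of_ne hr, Function.update_of_ne hr']
      · simpa [Function.update_of_ne d.2] using h8
      · intro r hr hr'
        simp [Function.update_of_ne hr, Function.update_of_ne hr']
      · simp only [decide_eq_true_eq]
      · simp [Function.update_of_ne d.2]
      · simp
      · intro z hz hz'
        simp [Function.update_of_ne hz, Function.update_of_ne (hz' hs)]
      · simp [Function.update_of_ne d.2]
      · simp
      · intro r hr hr'
        simp [Function.update_of_ne hr, Function.update_of_ne hr']
      · rw [h2]
        simp only [hs, decide_eq_true_eq, not_true, false_and, false_or, true_and]

end Candidate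

/-- For the chosen transitions with indices `i₁` and `i₂` and modes with codes `a` and `b`, the
program adds the key `y`. -/
def Target (corr fifo nT : ℕ) (σ₀ : Memory) (x : SearchKey S) (i₁ i₂ a b : ℕ) (y : SearchKey S) :
    Prop :=
  ∀ σ : Memory, (∀ k ≤ 2, σ.arr k = σ₀.arr k) → Tables S nT σ → Head x σ → σ.reg 20 = i₁ →
    σ.reg 21 = i₂ → σ.reg 22 = a → σ.reg 23 = b → σ.reg 24 = σ.arr 1 i₁ → σ.reg 25 = σ.arr 1 i₂ →
    (moveExp corr).Holds σ ∧ ∀ i < 2 * N + 4, newRow corr fifo σ i = digit y i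

theorem TransAt.congr {i : ℕ} (h : TransAt σ₀ i p₁ τ₁) (ha : ∀ k ≤ 2, σ.arr k = σ₀.arr k) :
    TransAt σ i p₁ τ₁ := by
  obtain ⟨h1, h2, h3, h4⟩ := h
  constructor <;> simpa only [ha 0 (by omega), ha 1 (by omega), ha 2 (by omega)]

/-- Every move arises from a candidate. -/
theorem KeyMove.exists_target (hT : Tables S nT σ₀)
    (hcorr : corr = 1 ↔ Failure.corruption ∈ F) (hfifo : fifo = 1 ↔ IsFifo F)
    (hxy : KeyMove F x y) : ∃ i₁ < nT, ∃ i₂ < nT, ∃ a < 2 * N + 2, ∃ b < 2 * N + 2,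
      Target corr fifo nT σ₀ x i₁ i₂ a b y := by
  obtain ⟨hc, hm, hmove⟩ := hxy
  have hcand : ∀ {i₁ i₂ p₁ τ₁ p₂ τ₂} {α β : Mode (Fin N)} {σ : Memory},
      TransAt (S := S) σ₀ i₁ p₁ τ₁ →
      TransAt (S := S) σ₀ i₂ p₂ τ₂ → (∀ k ≤ 2, σ.arr k = σ₀.arr k) → Tables S nT σ → Head x σ →
      σ.reg 20 = i₁ → σ.reg 21 = i₂ → σ.reg 22 = α.code → σ.reg 23 = β.code →
      σ.reg 24 = σ.arr 1 i₁ → σ.reg 25 = σ.arr 1 i₂ → Candidate x σ p₁ τ₁ p₂ τ₂ α β := by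
    intro i₁ i₂ p₁ τ₁ p₂ τ₂ α β σ g1 g2 h1 h2 h3 h4 h5 h6 h7 h8 h9
    exact ⟨h3, h2.reg1, h2.reg7, by rw [h8, h4], by rw [h9, h5], by rw [h4]; exact g1.congr h1,
      by rw [h5]; exact g2.congr h1, h6, h7⟩
  cases hmove with
  | internal p z ht hst hfree hmd hfl =>
    obtain ⟨i, hi, hi'⟩ := hT.complete _ _ ht
    refine ⟨i, hi, i, hi, _, (x.2.2.mode p).code_lt, _, (x.2.2.mode ⟨0, p.pos⟩).code_lt, ?_⟩
    intro σ h1 h2 h3 h4 h5 h6 h7 h8 h9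
    have h := hcand hi' hi' h1 h2 h3 h4 h5 h6 h7 h8 h9
    obtain ⟨g1, g2, g3⟩ := h.holds_of_internal (corr := corr) (fifo := fifo) rfl
    obtain ⟨-, s1, r1, -⟩ := h.eval₁
    simp only [Act.code, List.getD_cons_zero, List.getD_cons_succ] at s1 r1
    refine ⟨g3.2 ⟨rfl, rfl, hfree, rfl, rfl⟩, h.newRow_eq (p := p) (r := ⟨0, p.pos⟩) s1 r1 hc hm rfl
      (fun hs => absurd hs g1) (fun z hz _ => hst z hz) (by rw [hmd]) (by rw [hmd])
      (fun z _ _ => by rw [hmd]) ?_⟩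
    rw [g2, hfl]
  | send d m ht hst hmds hmd hfl =>
    obtain ⟨i, hi, hi'⟩ := hT.complete _ _ ht
    -- The test tells an unmatched send from a handshake by whether the second transition is a
    -- receive. The send itself serves as a second transition that is none.
    refine ⟨i, hi, i, hi, _, (y.2.2.mode d.1.1).code_lt, _, (y.2.2.mode d.1.2).code_lt, ?_⟩
    intro σ h1 h2 h3 h4 h5 h6 h7 h8 h9
    have h := hcand hi' hi' h1 h2 h3 h4 h5 h6 h7 h8 h9
    obtain ⟨g1, g2, g3⟩ := h.holds_of_send hcorr hfifo rfl
    have g4 : ¬ isSync.Holds σ := by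
      rw [g1]
      rintro ⟨d', m', h⟩
      cases h
    obtain ⟨-, s1, r1, -⟩ := h.eval₁
    simp only [Act.code, List.getD_cons_zero, List.getD_cons_succ] at s1 r1
    refine ⟨g3.2 ⟨rfl, rfl, Or.inl ⟨g4, hmds⟩⟩, h.newRow_eq s1 r1 hc hm rfl
      (fun hs => absurd hs g4) (fun z hz _ => hst z hz) rfl rfl hmd ?_⟩
    rw [g2, hfl]
    simp [g4]
  | sync d m m' hok ht ht' hst hmds hmd hfl =>
    obtain ⟨i, hi, hi'⟩ := hT.complete _ _ ht
    obtain ⟨k, hk, hk'⟩ := hT.complete _ _ ht'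
    refine ⟨i, hi, k, hk, _, (y.2.2.mode d.1.1).code_lt, _, (y.2.2.mode d.1.2).code_lt, ?_⟩
    intro σ h1 h2 h3 h4 h5 h6 h7 h8 h9
    have h := hcand hi' hk' h1 h2 h3 h4 h5 h6 h7 h8 h9
    obtain ⟨g1, g2, g3⟩ := h.holds_of_send hcorr hfifo rfl
    have g4 : isSync.Holds σ := g1.2 ⟨_, _, rfl⟩
    obtain ⟨-, s1, r1, -⟩ := h.eval₁
    simp only [Act.code, List.getD_cons_zero, List.getD_cons_succ] at s1 r1
    refine ⟨g3.2 ⟨rfl, rfl, Or.inr ⟨m', rfl, rfl, rfl, hok, hmds⟩⟩, h.newRow_eq s1 r1 hc hm rfl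
      (fun _ => ⟨d.2, rfl⟩) (fun z hz hz' => hst z hz (hz' g4)) rfl rfl hmd ?_⟩
    rw [g2, hfl]
    simp only [g4, not_true, false_and, false_or, true_and]

end CandidateMoves


/-! ### Expanding a node of the search -/

namespace RAM

/-- Copy the current row after the end of the queue. -/
def copyRow : Prog := .for 43 3 (.write 5 (.reg 8 + .reg 43) (.read 5 (.reg 9 + .reg 43)))

/-- Turn the copied row into that of the new node. -/
def editRow : Prog :=
  .seq (.cond isSync.term (.write 5 (.reg 8 + rcv₁) (.read 0 (.reg 25 + 5))) .skip) <|
  .seq (.write 5 (.reg 8 + snd₁) (.read 0 (.reg 24 + 5))) <|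
  .seq (.write 5 (.reg 8 + (.reg 1 + snd₁)) (.reg 22)) <|
  .seq (.write 5 (.reg 8 + (.reg 1 + rcv₁)) (.reg 23)) <|
  .write 5 (.reg 8 + .reg 7) (.reg 44)

/-- Fetch the chosen transitions. -/
def fetch (corr fifo : ℕ) : Prog :=
  .seq (.assign 24 (.read 1 (.reg 20))) <| .seq (.assign 25 (.read 1 (.reg 21))) <|
    .assign 44 (flagExp corr fifo).term

/-- Perform the chosen move, if there is one. -/
def tryMove (corr fifo : ℕ) : Prog :=
  .seq (fetch corr fifo)
    (.cond (moveExp corr).term (.seq copyRow (.seq editRow visit)) .skip)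

/-- Perform all moves from the current row. -/
def expand (corr fifo : ℕ) : Prog :=
  .for 20 5 (.for 21 5 (.for 22 6 (.for 23 6 (tryMove corr fifo))))

end RAM

section Expand

open RAM

variable {N s : ℕ} {S : FIFOSystem (Fin N) (Fin s)} {nT h : ℕ} {σ σ' σ₀ : RAM.Memory}
  {F : Set Failure} {x y : SearchKey S} {ns ns' : List (SearchKey S)} {corr fifo : ℕ}

/-- The search treats node `x`, which has index `h` in the queue `ns`. -/
structure SearchAt (nT : ℕ) (σ₀ : RAM.Memory) (x : SearchKey S) (h : ℕ) (ns : List (SearchKey S))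
    (σ : RAM.Memory) : Prop where
  tables : Tables S nT σ
  queue : Queue ns σ
  reg9 : σ.reg 9 = h * (2 * N + 4)
  current : ns[h]? = some x
  sender : σ.reg 10 = x.1.1.1
  receiver : σ.reg 11 = x.1.1.2
  msg : σ.reg 12 = x.2.1
  input : ∀ k ≤ 2, σ.arr k = σ₀.arr k

theorem SearchAt.head (hs : SearchAt nT σ₀ x h ns σ) : Head x σ := by
  obtain ⟨h1, h2⟩ := List.getElem?_eq_some_iff.1 hs.current
  refine ⟨hs.sender, hs.receiver, hs.msg, fun i hi => ?_⟩
  rw [hs.reg9, hs.queue.row h h1 i hi, h2]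

theorem SearchAt.le (hs : SearchAt nT σ₀ x h ns σ) : σ.reg 9 + (2 * N + 4) ≤ σ.reg 8 := by
  obtain ⟨h1, -⟩ := List.getElem?_eq_some_iff.1 hs.current
  rw [hs.reg9, hs.queue.fin]
  have : (h + 1) * (2 * N + 4) ≤ ns.length * (2 * N + 4) := Nat.mul_le_mul_right _ h1
  rwa [add_mul, one_mul] at this

theorem SearchAt.setReg (hs : SearchAt nT σ₀ x h ns σ) {i v : ℕ} (hi : 12 < i) :
    SearchAt nT σ₀ x h ns (σ.setReg i v) := by
  have hr : ∀ k ≤ 12, (σ.setReg i v).reg k = σ.reg k := by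
    intro k hk
    rw [Memory.setReg_reg, if_neg (by omega)]
  refine ⟨hs.tables.congr (fun k _ hk => hr k (by omega)) fun _ _ => rfl,
    hs.queue.congr (hr 8 (by omega)) (fun _ _ => rfl) rfl, ?_, hs.current, ?_, ?_, ?_, hs.input⟩
  · rw [hr 9 (by omega), hs.reg9]
  · rw [hr 10 (by omega), hs.sender]
  · rw [hr 11 (by omega), hs.receiver]
  · rw [hr 12 (by omega), hs.msg]

/-- Registers 0 and 8, the result and the end of the queue, are exempt: they are what the search
changes. -/
theorem SearchAt.congr (hs : SearchAt nT σ₀ x h ns σ) (hr : ∀ k ≤ 12, k ≠ 8 → k ≠ 0 → σ'.reg k = σ.reg k)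
    (ha : ∀ k ≤ 4, σ'.arr k = σ.arr k) (hpre : ns <+: ns') (hq : Queue ns' σ') :
    SearchAt nT σ₀ x h ns' σ' := by
  refine ⟨hs.tables.congr (fun k _ hk => hr k (by omega) (by omega) (by omega)) ha,
    hq, ?_, ?_, ?_, ?_, ?_, ?_⟩
  · rw [hr 9 (by omega) (by omega) (by omega), hs.reg9]
  · obtain ⟨l, rfl⟩ := hpre
    exact getElem?_append_of_some hs.current
  · rw [hr 10 (by omega) (by omega) (by omega), hs.sender]
  · rw [hr 11 (by omega) (by omega) (by omega), hs.receiver]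
  · rw [hr 12 (by omega) (by omega) (by omega), hs.msg]
  · intro k hk
    rw [ha k (by omega), hs.input k hk]

/-- The queue grows by moves from `x`. -/
def Grows (F : Set Failure) (x : SearchKey S) (ns ns' : List (SearchKey S)) : Prop :=
  ns <+: ns' ∧ ∀ z ∈ ns', z ∈ ns ∨ KeyMove F x z

theorem Grows.refl (ns : List (SearchKey S)) : Grows F x ns ns :=
  ⟨List.prefix_rfl, fun _ hz => Or.inl hz⟩

theorem Grows.trans {ns'' : List (SearchKey S)} (h1 : Grows F x ns ns') (h2 : Grows F x ns' ns'') :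
    Grows F x ns ns'' := by
  refine ⟨h1.1.trans h2.1, fun z hz => ?_⟩
  rcases h2.2 z hz with h3 | h3
  · exact h1.2 z h3
  · exact Or.inr h3

theorem ends_copyRow {σ : RAM.Memory} (h3 : σ.reg 3 = 2 * N + 4)
    (hle : σ.reg 9 + (2 * N + 4) ≤ σ.reg 8) :
    Ends copyRow σ (loopTime (2 * N + 4) 8) fun σ' =>
      (∀ i < 2 * N + 4, σ'.arr 5 (σ.reg 8 + i) = σ.arr 5 (σ.reg 9 + i)) ∧
      ∀ i < σ.reg 8, σ'.arr 5 i = σ.arr 5 i := by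
  refine (Ends.for (H := 2 * N + 4) (I := fun k σ' => σ'.reg 3 = 2 * N + 4 ∧
    σ'.reg 8 = σ.reg 8 ∧ σ'.reg 9 = σ.reg 9 ∧
    (∀ i < k, σ'.arr 5 (σ.reg 8 + i) = σ.arr 5 (σ.reg 9 + i)) ∧
    ∀ i < σ.reg 8, σ'.arr 5 i = σ.arr 5 i) rfl ?_ ?_ ?_ ?_).mono le_rfl fun σ' h => h.2.2.2
  · rintro k σ' v ⟨g1, g2, g3, g4, g5⟩
    exact ⟨by simpa using g1, by simpa using g2, by simpa using g3, g4, g5⟩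
  · exact fun k σ' _ g => g.1
  · rintro k σ' hk ⟨g1, g2, g3, g4, g5⟩ g6
    refine (Ends.of_flat rfl ?_).mono (T := _) (le_refl _) (fun _ h => h)
    simp only [Prog.run, Memory.setArr_reg, Memory.setArr_arr_same, Term.eval_add, Term.eval_reg,
      Term.eval_read, g1, g2, g3, g6]
    refine ⟨trivial, trivial, trivial, fun i hi => ?_, fun i hi => ?_⟩
    · rcases Nat.lt_succ_iff_lt_or_eq.1 hi with h | rfl
      · rw [if_neg (by omega), g4 i h]
      -- The cell that is read lies below the end of the queue, hence has not been overwritten.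
      · rw [if_pos rfl, g5 _ (by omega)]
    · rw [if_neg (by omega), g5 i hi]
  · exact ⟨h3, rfl, rfl, fun i hi => absurd hi (Nat.not_lt_zero i), fun i _ => rfl⟩

theorem eval_congr_of_arr (t : Term) (ht : t = snd₁ ∨ t = rcv₁ ∨ t = isSync.term)
    (hr : σ'.reg 24 = σ.reg 24 ∧ σ'.reg 25 = σ.reg 25) (ha : σ'.arr 0 = σ.arr 0) :
    t.eval σ' = t.eval σ := by
  rcases ht with rfl | rfl | rfl <;>
    simp [snd₁, rcv₁, isSync, BExp.term, kind₁, kind₂, hr.1, hr.2, ha]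

/-- The cases of `newRow` are the writes of `editRow` from last to first, so coinciding addresses
are resolved in the same way. -/
theorem editRow_spec (hσ : σ.reg 44 = (flagExp corr fifo).term.eval σ)
    (hr : ∀ k, k ≠ 43 → σ'.reg k = σ.reg k) (ha : σ'.arr 0 = σ.arr 0)
    (hrow : ∀ i < 2 * N + 4, σ'.arr 5 (σ.reg 8 + i) = σ.arr 5 (σ.reg 9 + i)) :
    (∀ i < 2 * N + 4, (editRow.run σ').arr 5 (σ.reg 8 + i) = newRow corr fifo σ i) ∧
    ∀ i < σ.reg 8, (editRow.run σ').arr 5 i = σ'.arr 5 i := by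
  classical
  have hcond : isSync.term.eval σ' = if isSync.Holds σ then 1 else 0 := by
    rw [← BExp.eval_term]
    exact eval_congr_of_arr _ (Or.inr (Or.inr rfl)) ⟨hr _ (by omega), hr _ (by omega)⟩ ha
  by_cases hs : isSync.Holds σ
  · rw [if_pos hs] at hcond
    simp only [editRow, Prog.run, hcond, one_ne_zero, if_false, Memory.setArr_arr_same,
      Memory.setArr_reg, Term.eval_add, Term.eval_reg, Term.eval_read, snd₁, rcv₁, newRow, hs,
      true_and, Memory.setArr_arr_ne _ _ _ _ (show (0 : ℕ) ≠ 5 by decide), ha, Term.eval_ofNat,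
      hr 1 (by omega), hr 7 (by omega), hr 8 (by omega), hr 22 (by omega), hr 23 (by omega),
      hr 24 (by omega), hr 25 (by omega), hr 44 (by omega), Nat.add_left_cancel_iff, hσ]
    refine ⟨fun i hi => ?_, fun i hi => ?_⟩
    · rw [hrow i hi]
    · rw [if_neg (by omega), if_neg (by omega), if_neg (by omega), if_neg (by omega),
        if_neg (by omega)]
  · rw [if_neg hs] at hcond
    simp only [editRow, Prog.run, hcond, if_true, Memory.setArr_arr_same,
      Memory.setArr_reg, Term.eval_add, Term.eval_reg, Term.eval_read, snd₁, rcv₁, newRow, hs,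
      false_and, if_false, Memory.setArr_arr_ne _ _ _ _ (show (0 : ℕ) ≠ 5 by decide), ha,
      Term.eval_ofNat,
      hr 1 (by omega), hr 7 (by omega), hr 8 (by omega), hr 22 (by omega), hr 23 (by omega),
      hr 24 (by omega), hr 44 (by omega), Nat.add_left_cancel_iff, hσ]
    refine ⟨fun i hi => ?_, fun i hi => ?_⟩
    · rw [hrow i hi]
    · rw [if_neg (by omega), if_neg (by omega), if_neg (by omega), if_neg (by omega)]

end Expand


/-! ### Correctness and time of the expansion -/

section ExpandSpec

open RAM

variable {N s : ℕ} {S : FIFOSystem (Fin N) (Fin s)} {nT h : ℕ} {σ σ' σ₀ : RAM.Memory}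
  {F : Set Failure} {x y : SearchKey S} {ns ns' : List (SearchKey S)} {corr fifo : ℕ}

/-- A product form, in which the bounds of nested loops multiply. -/
theorem loopTime_le {H T : ℕ} (hT : 1 ≤ T) : loopTime H T ≤ 15 * ((H + 1) * T) := by
  unfold loopTime
  nlinarith [Nat.mul_le_mul_left H hT]

theorem RAM.Ends.mono_left {c : Prog} {T T' : ℕ} {Q : Memory → Prop} (h : Ends c σ T Q)
    (hT : T ≤ T') : Ends c σ T' Q := h.mono hT fun _ h => h

theorem visit_setsReg : ∀ k ≤ 12, k ≠ 8 → visit.setsReg k = false := by decide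

theorem visit_setsArr : ∀ k ≤ 4, visit.setsArr k = false := by decide

/-- A candidate that passes the test is a move to some `y`, so only successors of `x` enter the
queue. Conversely, any target of this candidate has the same row as `y` and hence equals `y`. -/
theorem exists_tryMove_time (hcorr : corr = 1 ↔ Failure.corruption ∈ F)
    (hfifo : fifo = 1 ↔ IsFifo F) : ∃ K, 1 ≤ K ∧ ∀ {N s : ℕ} {S : FIFOSystem (Fin N) (Fin s)}
    {nT h : ℕ} {σ σ₀ : Memory} {x : SearchKey S} {ns : List (SearchKey S)} {i₁ i₂ a b : ℕ},
    SearchAt nT σ₀ x h ns σ → i₁ < nT → i₂ < nT → a < 2 * N + 2 → b < 2 * N + 2 →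
    σ.reg 20 = i₁ → σ.reg 21 = i₂ → σ.reg 22 = a → σ.reg 23 = b →
    Ends (tryMove corr fifo) σ (K * (2 * N + 4)) fun σ' => ∃ ns', Grows F x ns ns' ∧
      SearchAt nT σ₀ x h ns' σ' ∧ ∀ y, Target corr fifo nT σ₀ x i₁ i₂ a b y → y ∈ ns' := by
  obtain ⟨Kv, hKv⟩ := exists_visit_time
  refine ⟨(fetch corr fifo).cost + ((moveExp corr).term.cost + 1 + 300 + editRow.cost + Kv), by omega, ?_⟩
  intro N s S nT h σ σ₀ x ns i₁ i₂ a b hs hi₁ hi₂ ha hb h20 h21 h22 h23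
  have hflat : (fetch corr fifo).flat = true := rfl
  refine Ends.mono_left (T := (fetch corr fifo).cost + ((moveExp corr).term.cost + 1 +
    (loopTime (2 * N + 4) 8 + (editRow.cost + Kv * (2 * N + 4))))) (Ends.flat_then hflat ?_) ?_
  swap
  · have : loopTime (2 * N + 4) 8 ≤ 300 * (2 * N + 4) := by
      unfold loopTime
      omega
    have h4 : 1 ≤ 2 * N + 4 := by omega
    have e1 := Nat.mul_le_mul_left (fetch corr fifo).cost h4
    have e2 := Nat.mul_le_mul_left ((moveExp corr).term.cost + 1) h4
    have e3 := Nat.mul_le_mul_left editRow.cost h4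
    simp only [add_mul] at *
    omega
  set σ₁ := (fetch corr fifo).run σ with hσ₁
  have harr : σ₁.arr = σ.arr := rfl
  have hreg : ∀ k, k ≠ 24 → k ≠ 25 → k ≠ 44 → σ₁.reg k = σ.reg k := by
    intro k h1 h2 h3
    simp [hσ₁, fetch, Prog.run, h1, h2, h3]
  have h24 : σ₁.reg 24 = σ₁.arr 1 i₁ := by
    simp [hσ₁, fetch, Prog.run, h20]
  have h25 : σ₁.reg 25 = σ₁.arr 1 i₂ := by
    simp [hσ₁, fetch, Prog.run, h21]
  have hs₁ : SearchAt nT σ₀ x h ns σ₁ :=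
    ((hs.setReg (by omega)).setReg (by omega)).setReg (by omega)
  have h44 : σ₁.reg 44 = (flagExp corr fifo).term.eval σ₁ := by
    simp only [hσ₁, fetch, Prog.run, Memory.setReg_reg, if_true]
    simp [flagExp, BExp.term, isSync, kind₁, kind₂, onChannel, msgExp, snd₁, rcv₁, msg₁]
  have e20 : σ₁.reg 20 = i₁ := by rw [hreg 20 (by omega) (by omega) (by omega), h20]
  have e21 : σ₁.reg 21 = i₂ := by rw [hreg 21 (by omega) (by omega) (by omega), h21]
  have e22 : σ₁.reg 22 = a := by rw [hreg 22 (by omega) (by omega) (by omega), h22]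
  have e23 : σ₁.reg 23 = b := by rw [hreg 23 (by omega) (by omega) (by omega), h23]
  refine Ends.cond_of (fun hm => ?_) (fun hm => ?_)
  swap
  · rw [BExp.eval_term_eq_zero] at hm
    refine (Ends.of_flat rfl ?_).mono_left (T := 1) (by unfold loopTime; omega)
    refine ⟨ns, .refl ns, hs₁, fun y hy => ?_⟩
    exact absurd (hy σ₁ hs₁.input hs₁.tables hs₁.head e20 e21 e22 e23 h24 h25).1 hm
  rw [BExp.eval_term_ne_zero] at hm
  obtain ⟨p₁, τ₁, m₁, t₁⟩ := hs₁.tables.sound i₁ hi₁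
  obtain ⟨p₂, τ₂, m₂, t₂⟩ := hs₁.tables.sound i₂ hi₂
  obtain ⟨α, rfl⟩ := Mode.exists_code ha
  obtain ⟨β, rfl⟩ := Mode.exists_code hb
  have hcand : Candidate x σ₁ p₁ τ₁ p₂ τ₂ α β :=
    ⟨hs₁.head, hs₁.tables.reg1, hs₁.tables.reg7, by rw [h24, e20], by rw [h25, e21],
      by rw [e20]; exact t₁, by rw [e21]; exact t₂, e22, e23⟩
  obtain ⟨y, hy, hrow⟩ := hcand.sound hcorr hfifo m₁ m₂ hm
  refine Ends.seq ((ends_copyRow hs₁.tables.reg3 hs₁.le).imp fun σ₂ hf₂ ⟨g1, g2⟩ => ?_)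
  refine Ends.flat_then rfl ?_
  have r2 : ∀ k, k ≠ 43 → σ₂.reg k = σ₁.reg k := by
    intro k hk
    refine hf₂.reg k ?_
    simp [copyRow, Prog.for, Prog.setsReg, Ne.symm hk]
  have a2 : ∀ k, k ≠ 5 → σ₂.arr k = σ₁.arr k := by
    intro k hk
    refine hf₂.arr k ?_
    simp [copyRow, Prog.for, Prog.setsArr, Ne.symm hk]
  obtain ⟨g3, g4⟩ := editRow_spec (σ := σ₁) (σ' := σ₂) h44 r2 (a2 0 (by omega)) g1
  set σ₃ := editRow.run σ₂ with hσ₃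
  have r3 : σ₃.reg = σ₂.reg := by
    simp only [hσ₃, editRow, Prog.run, Memory.setArr_reg]
    split_ifs <;> rfl
  have a3 : ∀ k, k ≠ 5 → σ₃.arr k = σ₂.arr k := by
    intro k hk
    simp only [hσ₃, editRow, Prog.run]
    rw [Memory.setArr_arr_ne _ _ _ _ hk, Memory.setArr_arr_ne _ _ _ _ hk,
      Memory.setArr_arr_ne _ _ _ _ hk, Memory.setArr_arr_ne _ _ _ _ hk]
    split_ifs
    · rfl
    · rw [Memory.setArr_arr_ne _ _ _ _ hk]
  have hr3 : ∀ k, k ≠ 43 → σ₃.reg k = σ₁.reg k := by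
    intro k hk
    rw [r3, r2 k hk]
  have ha3 : ∀ k, k ≠ 5 → σ₃.arr k = σ₁.arr k := by
    intro k hk
    rw [a3 k hk, a2 k hk]
  have hq3 : Queue ns σ₃ := hs₁.queue.congr (hr3 8 (by omega))
    (fun i hi => (g4 i hi).trans (g2 i hi)) (ha3 6 (by omega))
  have hs3 : SearchAt nT σ₀ x h ns σ₃ := hs₁.congr (fun k _ _ _ => hr3 k (by omega))
    (fun k _ => ha3 k (by omega)) List.prefix_rfl hq3
  refine (hKv hs3.tables hq3 (y := y) fun i hi => ?_).imp fun σ₄ hf₄ ⟨ns', n1, n2, n3, n4⟩ => ?_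
  · rw [hr3 8 (by omega), g3 i hi, hrow i hi]
  · refine ⟨ns', ⟨n1, fun z hz => ?_⟩, ?_, fun y' hy' => ?_⟩
    · rcases n3 z hz with h1 | rfl
      · exact Or.inl h1
      · exact Or.inr hy
    · refine hs3.congr (fun k h1 h2 _ => hf₄.reg k ?_) (fun k h1 => hf₄.arr k ?_) n1 n4
      · exact visit_setsReg k h1 h2
      · exact visit_setsArr k h1
    · have h1 := (hy' σ₁ hs₁.input hs₁.tables hs₁.head e20 e21 e22 e23 h24 h25).2
      have : y' = y := digit_injective fun i hi => by rw [← h1 i hi, hrow i hi]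
      subst this
      exact n2

theorem Target.mem_mono {i₁ i₂ a b : ℕ} {g g' : List (SearchKey S)} (hg : Grows F x g g')
    (h : ∀ y, Target corr fifo nT σ₀ x i₁ i₂ a b y → y ∈ g) :
    ∀ y, Target corr fifo nT σ₀ x i₁ i₂ a b y → y ∈ g' := fun y hy => hg.1.subset (h y hy)

/-- The ghost state of the four nested loops is the queue, which only grows; so what one candidate
has added is still there at the end, and every move arises from some candidate. The two loops over
transitions and the two over modes, with a body linear in the length of a row, give the time. -/
theorem exists_expand_time (hcorr : corr = 1 ↔ Failure.corruption ∈ F)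
    (hfifo : fifo = 1 ↔ IsFifo F) : ∃ K, 1 ≤ K ∧ ∀ {N s : ℕ} {S : FIFOSystem (Fin N) (Fin s)}
    {nT h : ℕ} {σ σ₀ : Memory} {x : SearchKey S} {ns : List (SearchKey S)},
    SearchAt nT σ₀ x h ns σ → Tables S nT σ₀ →
    Ends (expand corr fifo) σ (K * ((nT + 1) ^ 2 * (2 * N + 4) ^ 3)) fun σ' => ∃ ns',
      Grows F x ns ns' ∧ SearchAt nT σ₀ x h ns' σ' ∧ ∀ y, KeyMove F x y → y ∈ ns' := by
  obtain ⟨K, hK1, hK⟩ := exists_tryMove_time hcorr hfifo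
  refine ⟨15 ^ 4 * K, by omega, fun {N s S nT h σ σ₀ x ns} hs hT => ?_⟩
  have key := Ends.forEach (c := .for 21 5 (.for 22 6 (.for 23 6 (tryMove corr fifo))))
    (T := loopTime nT (loopTime (2 * N + 2) (loopTime (2 * N + 2) (K * (2 * N + 4)))))
    (H := nT) (i := 20) (x := 5) (le := Grows F x) Grows.refl Grows.trans
    (J := fun g σ => SearchAt nT σ₀ x h g σ)
    (P := fun i₁ g => ∀ i₂ < nT, ∀ a < 2 * N + 2, ∀ b < 2 * N + 2, ∀ y,
      Target corr fifo nT σ₀ x i₁ i₂ a b y → y ∈ g) rfl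
    (fun g σ v hg => hg.setReg (by omega)) (fun g σ hg => hg.tables.reg5)
    (fun i₁ g g' hg hP i₂ hi₂ a ha b hb => Target.mem_mono hg (hP i₂ hi₂ a ha b hb)) ?_ hs
  · refine (key.mono ?_ fun σ' ⟨g', h1, h2, h3⟩ => ⟨g', h1, h2, fun y hy => ?_⟩)
    · have e1 : 1 ≤ K * (2 * N + 4) := Nat.mul_pos hK1 (by omega)
      have e2 : loopTime (2 * N + 2) (K * (2 * N + 4)) ≤ 15 * ((2 * N + 4) * (K * (2 * N + 4))) :=
        (loopTime_le e1).trans (Nat.mul_le_mul_left _ (Nat.mul_le_mul_right _ (by omega)))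
      have e3 : loopTime (2 * N + 2) (loopTime (2 * N + 2) (K * (2 * N + 4))) ≤
          15 * ((2 * N + 4) * (15 * ((2 * N + 4) * (K * (2 * N + 4))))) :=
        (loopTime_le (by unfold loopTime; omega)).trans
          (Nat.mul_le_mul_left _ (Nat.mul_le_mul (by omega) e2))
      have e4 := (loopTime_le (H := nT) (T := loopTime (2 * N + 2) (loopTime (2 * N + 2)
        (K * (2 * N + 4)))) (by unfold loopTime; omega)).trans
          (Nat.mul_le_mul_left _ (Nat.mul_le_mul_left _ e3))
      have e5 := (loopTime_le (H := nT) (T := loopTime nT (loopTime (2 * N + 2)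
        (loopTime (2 * N + 2) (K * (2 * N + 4))))) (by rw [loopTime]; omega)).trans
          (Nat.mul_le_mul_left _ (Nat.mul_le_mul_left _ e4))
      refine le_trans e5 (le_of_eq ?_)
      ring
    · obtain ⟨i₁, hi₁, i₂, hi₂, a, ha, b, hb, hy'⟩ := hy.exists_target hT hcorr hfifo
      exact h3 i₁ hi₁ i₂ hi₂ a ha b hb y hy'
  · intro i₁ g σ hi₁ hg h20
    refine (Ends.forEach (c := .for 22 6 (.for 23 6 (tryMove corr fifo))) (H := nT) (i := 21) (x := 5)
      (le := Grows F x) Grows.refl Grows.trans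
      (J := fun g σ => SearchAt nT σ₀ x h g σ ∧ σ.reg 20 = i₁)
      (P := fun i₂ g => ∀ a < 2 * N + 2, ∀ b < 2 * N + 2, ∀ y,
        Target corr fifo nT σ₀ x i₁ i₂ a b y → y ∈ g) rfl
      (fun g σ v hg => ⟨hg.1.setReg (by omega), by simpa using hg.2⟩)
      (fun g σ hg => hg.1.tables.reg5)
      (fun i₂ g g' hg hP a ha b hb => Target.mem_mono hg (hP a ha b hb)) ?_ ⟨hg, h20⟩).mono le_rfl
      fun σ' ⟨g', h1, h2, h3⟩ => ⟨g', h1, h2.1, h3⟩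
    rintro i₂ g σ hi₂ ⟨hg, h20⟩ h21
    refine (Ends.forEach (c := .for 23 6 (tryMove corr fifo)) (H := 2 * N + 2) (i := 22) (x := 6)
      (le := Grows F x) Grows.refl Grows.trans
      (J := fun g σ => SearchAt nT σ₀ x h g σ ∧ σ.reg 20 = i₁ ∧ σ.reg 21 = i₂)
      (P := fun a g => ∀ b < 2 * N + 2, ∀ y,
        Target corr fifo nT σ₀ x i₁ i₂ a b y → y ∈ g) rfl
      (fun g σ v hg => ⟨hg.1.setReg (by omega), by simpa using hg.2⟩)
      (fun g σ hg => hg.1.tables.reg6)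
      (fun a g g' hg hP b hb => Target.mem_mono hg (hP b hb)) ?_ ⟨hg, h20, h21⟩).imp
      fun σ' hf ⟨g', h1, h2, h3⟩ => ⟨g', h1, ⟨h2.1, h2.2.1⟩, h3⟩
    rintro a g σ ha ⟨hg, h20, h21⟩ h22
    refine (Ends.forEach (c := tryMove corr fifo) (H := 2 * N + 2) (i := 23) (x := 6)
      (le := Grows F x) Grows.refl Grows.trans
      (J := fun g σ => SearchAt nT σ₀ x h g σ ∧ σ.reg 20 = i₁ ∧ σ.reg 21 = i₂ ∧ σ.reg 22 = a)
      (P := fun b g => ∀ y, Target corr fifo nT σ₀ x i₁ i₂ a b y → y ∈ g) rfl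
      (fun g σ v hg => ⟨hg.1.setReg (by omega), by simpa using hg.2⟩)
      (fun g σ hg => hg.1.tables.reg6)
      (fun b g g' hg hP => Target.mem_mono hg hP) ?_ ⟨hg, h20, h21, h22⟩).imp
      fun σ' hf ⟨g', h1, h2, h3⟩ => ⟨g', h1, ⟨h2.1, h2.2.1, h2.2.2.1⟩, h3⟩
    rintro b g σ hb ⟨hg, h20, h21, h22⟩ h23
    refine (hK hg hi₁ hi₂ ha hb h20 h21 h22 h23).imp fun σ' hf ⟨g', h1, h2, h3⟩ => ?_
    refine ⟨g', h1, ⟨h2, ?_, ?_, ?_⟩, h3⟩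
    · rw [hf.reg 20 rfl, h20]
    · rw [hf.reg 21 rfl, h21]
    · rw [hf.reg 22 rfl, h22]

end ExpandSpec


/-! ### Initial nodes and the search loop -/

namespace RAM

/-- Write the row of an initial node after the end of the queue. -/
def initRow : Prog :=
  .seq (.for 43 1 (.seq (.write 5 (.reg 8 + .reg 43) (.read 3 (.reg 43)))
    (.write 5 (.reg 8 + (.reg 1 + .reg 43)) 0))) <|
  .seq (.write 5 (.reg 8 + .reg 7) 0) <|
  .seq (.write 5 (.reg 8 + (.reg 7 + 1)) (.reg 10)) <|
  .seq (.write 5 (.reg 8 + (.reg 7 + 2)) (.reg 11)) <|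
  .write 5 (.reg 8 + (.reg 7 + 3)) (.reg 12)

/-- Put all initial nodes into the queue. -/
def initQueue : Prog :=
  .for 10 1 (.for 11 1 (.cond (BExp.not (.eq (.reg 10) (.reg 11))).term
    (.for 12 2 (.seq initRow visit)) .skip))

/-- The current row and the transition with index in register 20 are accepting. -/
def acceptExp (corr : ℕ) : BExp :=
  .and (.eq (.reg 13) 1) <| .and (.eq (.read 5 (.reg 9 + .reg 7)) 1) <|
  .and (.eq (modeOf (.reg 11)) 1) <| .and (.eq kind₁ 1) <|
  .and (.eq (.read 2 (.reg 20)) rcv₁) <| .and onChannel <|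
  .and (.eq (stateOf (.reg 11)) (.read 0 (.reg 24))) (msgExp corr (.reg 12) msg₁)

/-- Read the channel and the message of the current row. -/
def loadRow : Prog :=
  .seq (.assign 10 (.read 5 (.reg 9 + (.reg 7 + 1)))) <|
  .seq (.assign 11 (.read 5 (.reg 9 + (.reg 7 + 2)))) <|
  .seq (.assign 12 (.read 5 (.reg 9 + (.reg 7 + 3)))) <| .assign 13 1

/-- Set register 13 to 0 if some process is waiting. -/
def checkWaiting : Prog :=
  .for 43 1 (.cond (BExp.lt (modeOf (.reg 43)) (2 + .reg 1)).term .skip (.assign 13 0))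

/-- Set the result to 0 if the current row is accepting. -/
def checkAccepting (corr : ℕ) : Prog :=
  .for 20 5 (.seq (.assign 24 (.read 1 (.reg 20))) (.cond (acceptExp corr).term (.assign 0 0) .skip))

/-- The search loop. -/
def searchLoop (corr fifo : ℕ) : Prog :=
  .loop (.reg 8 - .reg 9) (.seq loadRow (.seq checkWaiting (.seq (checkAccepting corr)
    (.seq (expand corr fifo) (.assign 9 (.reg 9 + .reg 3))))))

end RAM

section SearchLoop

open RAM

variable {N s : ℕ} {S : FIFOSystem (Fin N) (Fin s)} {nT h : ℕ} {σ σ' σ₀ : RAM.Memory}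
  {F : Set Failure} {x y : SearchKey S} {ns ns' : List (SearchKey S)} {corr fifo : ℕ}

/-- The initial nodes. -/
def IsInitKey (z : SearchKey S) : Prop := z.2.2 = SearchNode.init S

theorem ends_initRow {σ : RAM.Memory} (hT : Tables S nT σ) {c : Channel (Fin N)} {m : Fin s}
    (h10 : σ.reg 10 = c.1.1) (h11 : σ.reg 11 = c.1.2) (h12 : σ.reg 12 = m) :
    Ends initRow σ (200 * (N + 1)) fun σ' =>
      (∀ i < 2 * N + 4, σ'.arr 5 (σ.reg 8 + i) = digit (S := S) (c, m, SearchNode.init S) i) ∧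
      ∀ i < σ.reg 8, σ'.arr 5 i = σ.arr 5 i := by
  refine Ends.mono_left (T := loopTime N 20 + 50) ?_ (by unfold loopTime; omega)
  refine Ends.seq ((Ends.for (H := N) (T := 20) (I := fun k σ' =>
    (∀ z, z ≠ 43 → σ'.reg z = σ.reg z) ∧ σ'.arr 3 = σ.arr 3 ∧
    (∀ i < k, σ'.arr 5 (σ.reg 8 + i) = σ.arr 3 i) ∧
    (∀ i < k, σ'.arr 5 (σ.reg 8 + (N + i)) = 0) ∧
    ∀ i < σ.reg 8, σ'.arr 5 i = σ.arr 5 i) rfl ?_ ?_ ?_ ?_).imp ?_)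
  · rintro k σ' v ⟨g1, g2, g3, g4, g5⟩
    refine ⟨fun z hz => ?_, g2, g3, g4, g5⟩
    rw [Memory.setReg_reg, if_neg hz, g1 z hz]
  · rintro k σ' _ g
    rw [g.1 1 (by omega), hT.reg1]
  · rintro k σ' hk ⟨g1, g2, g3, g4, g5⟩ g6
    refine (Ends.of_flat rfl ?_).mono_left (T := _) (by decide)
    simp only [Prog.run, Memory.setArr_reg, Memory.setArr_arr_same, Term.eval_add, Term.eval_reg,
      Term.eval_read, g1 8 (by omega), g1 1 (by omega), hT.reg1, g6, Term.eval_ofNat,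
      Memory.setArr_arr_ne _ _ _ _ (show (3 : ℕ) ≠ 5 by decide), g2, Nat.add_left_cancel_iff]
    refine ⟨g1, trivial, fun i hi => ?_, fun i hi => ?_, fun i hi => ?_⟩
    · rw [if_neg (by omega)]
      rcases Nat.lt_succ_iff_lt_or_eq.1 hi with h | rfl
      · rw [if_neg (by omega), g3 i h]
      · rw [if_pos rfl]
    · rcases Nat.lt_succ_iff_lt_or_eq.1 hi with h | rfl
      · rw [if_neg (by omega), if_neg (by omega), g4 i h]
      · rw [if_pos rfl]
    · rw [if_neg (by omega), if_neg (by omega), g5 i hi]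
  · exact ⟨fun _ _ => rfl, rfl, fun i hi => absurd hi (Nat.not_lt_zero i),
      fun i hi => absurd hi (Nat.not_lt_zero i), fun _ _ => rfl⟩
  · rintro σ' - ⟨g1, g2, g3, g4, g5⟩
    refine (Ends.of_flat rfl ?_).mono_left (T := _) (by decide)
    simp only [Prog.run, Memory.setArr_reg, Memory.setArr_arr_same, Term.eval_add, Term.eval_reg,
      g1 8 (by omega), g1 7 (by omega), g1 10 (by omega), g1 11 (by omega), g1 12 (by omega),
      hT.reg7, Term.eval_ofNat, h10, h11, h12, Nat.add_left_cancel_iff]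
    constructor
    · rw [forall_digit_iff (f := fun i => if i = 2 * N + 3 then (m : ℕ) else
        if i = 2 * N + 2 then (c.1.2 : ℕ) else if i = 2 * N + 1 then (c.1.1 : ℕ) else
        if i = 2 * N then 0 else σ'.arr 5 (σ.reg 8 + i))]
      refine ⟨fun p => ?_, fun p => ?_, ?_, ?_, ?_, ?_⟩
      · rw [if_neg (by omega), if_neg (by omega), if_neg (by omega), if_neg (by omega),
          g3 _ p.2, digit_state, hT.init p]
        rfl
      · rw [if_neg (by omega), if_neg (by omega), if_neg (by omega), if_neg (by omega),
          g4 _ p.2, digit_mode]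
        rfl
      · rw [if_neg (by omega), if_neg (by omega), if_neg (by omega), if_pos rfl, digit_flag]
        rfl
      · rw [if_neg (by omega), if_neg (by omega), if_pos rfl, digit_sender]
      · rw [if_neg (by omega), if_pos rfl, digit_receiver]
      · rw [if_pos rfl, digit_msg]
    · intro i hi
      rw [if_neg (by omega), if_neg (by omega), if_neg (by omega), if_neg (by omega), g5 i hi]

/-- Growth of the queue by initial nodes. -/
def GrowsInit (ns ns' : List (SearchKey S)) : Prop :=
  ns <+: ns' ∧ ∀ z ∈ ns', z ∈ ns ∨ IsInitKey z

theorem GrowsInit.refl (ns : List (SearchKey S)) : GrowsInit ns ns :=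
  ⟨List.prefix_rfl, fun _ hz => Or.inl hz⟩

theorem GrowsInit.trans {ns'' : List (SearchKey S)} (h1 : GrowsInit ns ns')
    (h2 : GrowsInit ns' ns'') : GrowsInit ns ns'' := by
  refine ⟨h1.1.trans h2.1, fun z hz => ?_⟩
  rcases h2.2 z hz with h3 | h3
  · exact h1.2 z h3
  · exact Or.inr h3

theorem tables_queue_setReg {i v : ℕ} (hi : 8 < i) (h : Tables S nT σ ∧ Queue ns σ) :
    Tables S nT (σ.setReg i v) ∧ Queue ns (σ.setReg i v) :=
  ⟨h.1.congr (fun k _ hk => by rw [Memory.setReg_reg, if_neg (by omega)]) fun _ _ => rfl,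
    h.2.congr (by rw [Memory.setReg_reg, if_neg (by omega)]) (fun _ _ => rfl) rfl⟩

theorem initRow_sets : (∀ k, k ≠ 43 → initRow.setsReg k = false) ∧
    ∀ k, k ≠ 5 → initRow.setsArr k = false := by
  constructor <;> intro k hk <;>
    simp [initRow, Prog.for, Prog.setsReg, Prog.setsArr, Ne.symm hk]

/-- There is one initial node for each channel and message. Enumerating pairs of processes and
messages, with linear time for each row, gives the bound. -/
theorem exists_initQueue_time : ∃ K, ∀ {N s : ℕ} {S : FIFOSystem (Fin N) (Fin s)} {nT : ℕ}
    {σ : Memory}, Tables S nT σ → Queue ([] : List (SearchKey S)) σ →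
    Ends initQueue σ (K * ((N + 1) ^ 3 * (s + 1))) fun σ' => ∃ ns : List (SearchKey S),
      Queue ns σ' ∧ ∀ z, z ∈ ns ↔ IsInitKey z := by
  obtain ⟨Kv, hKv⟩ := exists_visit_time
  refine ⟨15 ^ 3 * (200 + 4 * Kv) + 15 ^ 3, fun {N s S nT σ} hT hQ => ?_⟩
  have key := Ends.forEach (G := List (SearchKey S)) (σ := σ) (g := [])
    (c := .for 11 1 (.cond (BExp.not (.eq (.reg 10) (.reg 11))).term
      (.for 12 2 (.seq initRow visit)) .skip))
    (T := loopTime N ((BExp.not (.eq (.reg 10) (.reg 11))).term.cost + 1 +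
      loopTime s (200 * (N + 1) + Kv * (2 * N + 4)))) (H := N) (i := 10) (x := 1)
    (le := GrowsInit) GrowsInit.refl GrowsInit.trans
    (J := fun g σ => Tables S nT σ ∧ Queue g σ)
    (P := fun w g => ∀ q < N, ∀ z : SearchKey S, IsInitKey z → (z.1.1.1 : ℕ) = w →
      (z.1.1.2 : ℕ) = q → z ∈ g) rfl
    (fun g σ v hg => tables_queue_setReg (by omega) hg) (fun g σ hg => hg.1.reg1)
    (fun w g g' hg hP q hq z h1 h2 h3 => hg.1.subset (hP q hq z h1 h2 h3)) ?_ ⟨hT, hQ⟩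
  · refine key.mono ?_ fun σ' ⟨g', h1, h2, h3⟩ => ⟨g', h2.2, fun z => ⟨fun hz => ?_, fun hz => ?_⟩⟩
    · have hc : (BExp.not (.eq (.reg 10) (.reg 11))).term.cost = 11 := rfl
      rw [hc]
      set X := 200 * (N + 1) + Kv * (2 * N + 4) with hX
      have e0 : X ≤ (200 + 4 * Kv) * (N + 1) := by rw [hX]; nlinarith
      have e1 : loopTime s X ≤ 15 * ((s + 1) * X) := loopTime_le (by omega)
      have e2 : 11 + 1 + loopTime s X ≤ 15 * ((s + 1) * (X + 1)) := by
        have : 15 * ((s + 1) * (X + 1)) = 15 * ((s + 1) * X) + 15 * (s + 1) := by ring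
        omega
      have e3 : loopTime N (11 + 1 + loopTime s X) ≤ 15 * ((N + 1) * (15 * ((s + 1) * (X + 1)))) :=
        (loopTime_le (by omega)).trans (Nat.mul_le_mul_left _ (Nat.mul_le_mul_left _ e2))
      have e4 : loopTime N (loopTime N (11 + 1 + loopTime s X)) ≤
          15 * ((N + 1) * (15 * ((N + 1) * (15 * ((s + 1) * (X + 1)))))) :=
        (loopTime_le (by rw [loopTime]; omega)).trans
          (Nat.mul_le_mul_left _ (Nat.mul_le_mul_left _ e3))
      refine le_trans e4 ?_
      have e5 : X + 1 ≤ (200 + 4 * Kv + 1) * (N + 1) := by nlinarith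
      calc 15 * ((N + 1) * (15 * ((N + 1) * (15 * ((s + 1) * (X + 1))))))
          ≤ 15 * ((N + 1) * (15 * ((N + 1) * (15 * ((s + 1) * ((200 + 4 * Kv + 1) * (N + 1))))))) := by
            gcongr
        _ = (15 ^ 3 * (200 + 4 * Kv) + 15 ^ 3) * ((N + 1) ^ 3 * (s + 1)) := by ring
    · exact (h1.2 z hz).resolve_left (by simp)
    · exact h3 _ z.1.1.1.2 _ z.1.1.2.2 z hz rfl rfl
  · rintro w g σ hw hg h10
    refine (Ends.forEach (c := .cond (BExp.not (.eq (.reg 10) (.reg 11))).term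
      (.for 12 2 (.seq initRow visit)) .skip) (H := N) (i := 11) (x := 1)
      (le := GrowsInit) GrowsInit.refl GrowsInit.trans
      (J := fun g σ => (Tables S nT σ ∧ Queue g σ) ∧ σ.reg 10 = w)
      (P := fun q g => ∀ z : SearchKey S, IsInitKey z → (z.1.1.1 : ℕ) = w →
        (z.1.1.2 : ℕ) = q → z ∈ g) rfl
      (fun g σ v hg => ⟨tables_queue_setReg (by omega) hg.1, by simpa using hg.2⟩)
      (fun g σ hg => hg.1.1.reg1)
      (fun w g g' hg hP z h1 h2 h3 => hg.1.subset (hP z h1 h2 h3)) ?_ ⟨hg, h10⟩).mono le_rfl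
      fun σ' ⟨g', h1, h2, h3⟩ => ⟨g', h1, h2.1, h3⟩
    rintro q g σ hq ⟨hg, h10⟩ h11
    refine Ends.cond_of (fun hne => ?_) (fun heq => ?_)
    · rw [BExp.eval_term_ne_zero] at hne
      have hwq : w ≠ q := by
        simpa [BExp.Holds, h10, h11] using hne
      refine (Ends.forEach (c := .seq initRow visit) (H := s) (i := 12) (x := 2)
        (le := GrowsInit) GrowsInit.refl GrowsInit.trans
        (J := fun g σ => (Tables S nT σ ∧ Queue g σ) ∧ σ.reg 10 = w ∧ σ.reg 11 = q)
        (P := fun m g => ∀ z : SearchKey S, IsInitKey z → (z.1.1.1 : ℕ) = w →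
          (z.1.1.2 : ℕ) = q → (z.2.1 : ℕ) = m → z ∈ g) rfl
        (fun g σ v hg => ⟨tables_queue_setReg (by omega) hg.1, by simpa using hg.2⟩)
        (fun g σ hg => hg.1.1.reg2)
        (fun w g g' hg hP z h1 h2 h3 h4 => hg.1.subset (hP z h1 h2 h3 h4)) ?_ ⟨hg, h10, h11⟩).mono
        le_rfl fun σ' ⟨g', h1, h2, h3⟩ => ⟨g', h1, ⟨h2.1, h2.2.1⟩, fun z g1 g2 g3 =>
          h3 _ z.2.1.2 z g1 g2 g3 rfl⟩
      rintro m g σ hm ⟨hg, h10, h11⟩ h12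
      refine Ends.seq ((ends_initRow hg.1 (c := ⟨(⟨w, hw⟩, ⟨q, hq⟩), by simpa using hwq⟩)
        (m := ⟨m, hm⟩) h10 h11 h12).imp fun σ₁ hf₁ ⟨g1, g2⟩ => ?_)
      have hr : ∀ k, k ≠ 43 → σ₁.reg k = σ.reg k := fun k hk => hf₁.reg k (initRow_sets.1 k hk)
      have ha : ∀ k, k ≠ 5 → σ₁.arr k = σ.arr k := fun k hk => hf₁.arr k (initRow_sets.2 k hk)
      have hT₁ : Tables S nT σ₁ := hg.1.congr (fun k _ _ => hr k (by omega)) fun k _ => ha k (by omega)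
      have hQ₁ : Queue g σ₁ := hg.2.congr (hr 8 (by omega)) g2 (ha 6 (by omega))
      refine (hKv hT₁ hQ₁ (y := (⟨(⟨w, hw⟩, ⟨q, hq⟩), by simpa using hwq⟩, ⟨m, hm⟩,
        SearchNode.init S)) (by rw [hr 8 (by omega)]; exact g1)).imp
        fun σ₂ hf₂ ⟨ns', n1, n2, n3, n4⟩ => ⟨ns', ⟨n1, fun z hz => ?_⟩, ⟨⟨?_, n4⟩, ?_, ?_⟩, ?_⟩
      · rcases n3 z hz with h1 | rfl
        · exact Or.inl h1
        · exact Or.inr rfl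
      · exact hT₁.congr (fun k _ hk => hf₂.reg k (visit_setsReg k (by omega) (by omega)))
          fun k hk => hf₂.arr k (visit_setsArr k hk)
      · rw [hf₂.reg 10 rfl, hr 10 (by omega), h10]
      · rw [hf₂.reg 11 rfl, hr 11 (by omega), h11]
      · rintro ⟨⟨⟨w', q'⟩, hc⟩, m', n⟩ hz hw' hq' hm'
        simp only [IsInitKey] at hz hw' hq' hm'
        subst hz
        have : (⟨(w', q'), hc⟩ : Channel (Fin N)) = ⟨(⟨w, hw⟩, ⟨q, hq⟩), by simpa using hwq⟩ :=
          Subtype.ext (Prod.ext (Fin.ext hw') (Fin.ext hq'))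
        have h5 : m' = ⟨m, hm⟩ := Fin.ext hm'
        rw [this, h5]
        exact n2
    · rw [BExp.eval_term_eq_zero] at heq
      have hwq : w = q := by
        simpa [BExp.Holds, h10, h11] using heq
      refine (Ends.of_flat rfl ?_).mono_left (T := 1) (by unfold loopTime; omega)
      refine ⟨g, .refl g, ⟨hg, h10⟩, fun z _ h1 h2 => ?_⟩
      exact absurd (Fin.ext (h1.trans (hwq.trans h2.symm))) z.1.2

end SearchLoop


/-! ### Testing whether a node is accepting -/

section SearchSpec

open RAM

variable {N s : ℕ} {S : FIFOSystem (Fin N) (Fin s)} {nT h : ℕ} {σ σ' σ₀ : RAM.Memory}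
  {F : Set Failure} {x y : SearchKey S} {ns ns' : List (SearchKey S)} {corr fifo : ℕ}

/-- The transition `τ` of process `p` shows that `x` is accepting. -/
def AcceptedBy (F : Set Failure) (x : SearchKey S) (p : Fin N)
    (τ : Fin (S.numStates p) × Act (Fin N) (Fin s) × Fin (S.numStates p)) : Prop :=
  x.2.2.flag = true ∧ x.2.2.mode x.1.1.2 = .active ∧ (∀ p f, x.2.2.mode p ≠ .waiting f) ∧
    p = x.1.1.2 ∧ (τ.1 : ℕ) = x.2.2.state x.1.1.2 ∧ ∃ m', τ.2.1 = .recv x.1 m' ∧ MsgOk F x.2.1 m'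

theorem accepting_iff : x.2.2.Accepting F x.1 x.2.1 ↔ ∃ p, ∃ τ ∈ S.trans p, AcceptedBy F x p τ := by
  constructor
  · rintro ⟨h1, h2, h3, m', q', h4, h5⟩
    exact ⟨_, _, h5, h1, h2, h3, rfl, rfl, m', rfl, h4⟩
  · rintro ⟨p, ⟨q, a, q'⟩, hτ, h1, h2, h3, rfl, h4, m', h5, h6⟩
    obtain rfl : q = x.2.2.state x.1.1.2 := Fin.ext h4
    simp only at h5
    subst h5
    exact ⟨h1, h2, h3, m', q', h6, hτ⟩

theorem holds_acceptExp (hs : SearchAt nT σ₀ x h ns σ) (hcorr : corr = 1 ↔ Failure.corruption ∈ F)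
    (h13 : σ.reg 13 = 1 ↔ ∀ p f, x.2.2.mode p ≠ .waiting f) (h24 : σ.reg 24 = σ.arr 1 (σ.reg 20))
    {p : Fin N} {τ : Fin (S.numStates p) × Act (Fin N) (Fin s) × Fin (S.numStates p)}
    (hτ : TransAt σ (σ.reg 20) p τ) : (acceptExp corr).Holds σ ↔ AcceptedBy F x p τ := by
  obtain ⟨k1, s1, r1, m1⟩ := hτ.fields
  rw [← h24] at k1 s1 r1 m1
  have hrow := hs.head.row
  have hfl : σ.arr 5 (σ.reg 9 + σ.reg 7) = 1 ↔ x.2.2.flag = true := by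
    rw [hs.tables.reg7, hrow _ (by omega), digit_flag]
    cases x.2.2.flag <;> simp
  have hmode : σ.arr 5 (σ.reg 9 + (σ.reg 1 + x.1.1.2)) = 1 ↔ x.2.2.mode x.1.1.2 = .active := by
    rw [hs.tables.reg1, hrow _ (by omega), digit_mode, Mode.code_eq_one]
  have hstate : σ.arr 5 (σ.reg 9 + x.1.1.2) = x.2.2.state x.1.1.2 := by
    rw [hrow _ (by omega), digit_state]
  have hsrc : σ.arr 0 (σ.reg 24) = τ.1 := by rw [h24]; exact hτ.src
  have hown : σ.arr 2 (σ.reg 20) = p := hτ.owner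
  unfold AcceptedBy
  cases ha : τ.2.1 with
  | send c m =>
    rw [ha] at k1
    simp [acceptExp, BExp.Holds, kind₁, k1, Act.code]
  | internal p z =>
    rw [ha] at k1
    simp [acceptExp, BExp.Holds, kind₁, k1, Act.code]
  | recv c m =>
    rw [ha] at k1 s1 r1 m1
    simp only [Act.code, List.getD_cons_zero, List.getD_cons_succ] at k1 s1 r1 m1
    have hmsg := holds_msgExp (σ := σ) (t := .reg 12) (t' := msg₁) hcorr hs.msg m1
    simp only [acceptExp, onChannel, stateOf, modeOf, BExp.Holds, hmsg, Term.eval_read, Term.eval_add,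
      Term.eval_reg, Term.eval_ofNat, kind₁, snd₁, rcv₁, k1, s1, r1, hfl, hmode, hstate, hsrc, hown,
      h13, hs.sender, hs.receiver, true_and]
    constructor
    · rintro ⟨h1, h2, h3, h4, ⟨h5, h6⟩, h7, h8⟩
      have : c = x.1 := Subtype.ext (Prod.ext (Fin.ext h5) (Fin.ext h6))
      subst this
      exact ⟨h2, h3, h1, Fin.ext h4, h7.symm, m, rfl, h8⟩
    · rintro ⟨h1, h2, h3, h4, h5, m', h6, h7⟩
      cases h6
      exact ⟨h3, h1, h2, congrArg Fin.val h4, ⟨rfl, rfl⟩, h5.symm, h7⟩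

theorem ends_loadRow (hT : Tables S nT σ) (hQ : Queue ns σ) (h9 : σ.reg 9 = h * (2 * N + 4))
    (hx : ns[h]? = some x) (hin : ∀ k ≤ 2, σ.arr k = σ₀.arr k) :
    Ends loadRow σ 30 fun σ' => SearchAt nT σ₀ x h ns σ' ∧ σ'.reg 13 = 1 ∧ σ'.reg 0 = σ.reg 0 := by
  refine (Ends.of_flat rfl ?_).mono_left (T := _) (by decide)
  obtain ⟨h1, h2⟩ := List.getElem?_eq_some_iff.1 hx
  have hrow : ∀ i < 2 * N + 4, σ.arr 5 (h * (2 * N + 4) + i) = digit x i := fun i hi => by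
    rw [hQ.row h h1 i hi, h2]
  simp only [loadRow, Prog.run]
  refine ⟨⟨hT.congr (fun k _ hk => ?_) fun _ _ => rfl, hQ.congr ?_ (fun _ _ => rfl) rfl, ?_, hx,
    ?_, ?_, ?_, hin⟩, ?_, ?_⟩
  · simp [show k ≠ 10 by omega, show k ≠ 11 by omega, show k ≠ 12 by omega, show k ≠ 13 by omega]
  · simp
  · simpa using h9
  · simp [h9, hT.reg7, hrow _ (show 2 * N + 1 < 2 * N + 4 by omega), digit_sender]
  · simp [h9, hT.reg7, hrow _ (show 2 * N + 2 < 2 * N + 4 by omega), digit_receiver]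
  · simp [h9, hT.reg7, hrow _ (show 2 * N + 3 < 2 * N + 4 by omega), digit_msg]
  · simp
  · simp

theorem ends_checkWaiting (hs : SearchAt nT σ₀ x h ns σ) (h13 : σ.reg 13 = 1) :
    Ends checkWaiting σ (loopTime N 30) fun σ' => SearchAt nT σ₀ x h ns σ' ∧
      (σ'.reg 13 = 1 ↔ ∀ p f, x.2.2.mode p ≠ .waiting f) ∧ σ'.reg 0 = σ.reg 0 := by
  refine (Ends.for (H := N) (T := 30) (I := fun k σ' => SearchAt nT σ₀ x h ns σ' ∧
      (σ'.reg 13 = 1 ↔ ∀ p : Fin N, (p : ℕ) < k → ∀ f, x.2.2.mode p ≠ .waiting f) ∧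
      σ'.reg 0 = σ.reg 0) rfl ?_ ?_ ?_ ?_).mono le_rfl fun σ' ⟨h1, h2, h3⟩ => ⟨h1, ?_, h3⟩
  · rintro k σ' v ⟨h1, h2, h3⟩
    exact ⟨h1.setReg (by omega), by simpa using h2, by simpa using h3⟩
  · exact fun k σ' _ h => h.1.tables.reg1
  · rintro k σ₁ hk ⟨h1, h2, h3⟩ h43
    have hc : (BExp.lt (modeOf (.reg 43)) (2 + .reg 1)).Holds σ₁ ↔
        ∀ f, x.2.2.mode ⟨k, hk⟩ ≠ .waiting f := by
      simp only [BExp.Holds, modeOf, Term.eval_read, Term.eval_add, Term.eval_reg, Term.eval_ofNat,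
        h1.tables.reg1, h43]
      rw [h1.head.row _ (by omega), ← Mode.code_lt_waiting]
      exact iff_of_eq (congrArg (· < 2 + N) (digit_mode x ⟨k, hk⟩))
    have hsplit : (∀ p : Fin N, (p : ℕ) < k + 1 → ∀ f, x.2.2.mode p ≠ .waiting f) ↔
        (∀ p : Fin N, (p : ℕ) < k → ∀ f, x.2.2.mode p ≠ .waiting f) ∧
        ∀ f, x.2.2.mode ⟨k, hk⟩ ≠ .waiting f := by
      constructor
      · exact fun h => ⟨fun p hp => h p (by omega), h _ (Nat.lt_succ_self k)⟩
      · rintro ⟨g1, g2⟩ p hp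
        rcases Nat.lt_succ_iff_lt_or_eq.1 hp with g3 | g3
        · exact g1 p g3
        · obtain rfl : p = ⟨k, hk⟩ := Fin.ext g3
          exact g2
    refine (Ends.cond_of (T := 2) (fun hne => ?_) fun heq => ?_).mono_left (by decide)
    · rw [BExp.eval_term_ne_zero, hc] at hne
      refine (Ends.of_flat rfl ?_).mono_left (T := _) (by decide)
      exact ⟨h1, h2.trans (hsplit.trans (and_iff_left hne)).symm, h3⟩
    · rw [BExp.eval_term_eq_zero, hc] at heq
      refine (Ends.of_flat rfl ?_).mono_left (T := _) (by decide)
      refine ⟨h1.setReg (by omega), ?_, by simpa [Prog.run] using h3⟩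
      rw [hsplit]
      simp [Prog.run, heq]
  · exact ⟨hs, by simp [h13], rfl⟩
  · rw [h2]
    exact ⟨fun g p f => g p p.2 f, fun g p _ => g p⟩

theorem SearchAt.setReg_zero (hs : SearchAt nT σ₀ x h ns σ) {v : ℕ} :
    SearchAt nT σ₀ x h ns (σ.setReg 0 v) :=
  hs.congr (fun k _ _ hk => by rw [Memory.setReg_reg, if_neg hk]) (fun _ _ => rfl) List.prefix_rfl
    (hs.queue.congr (by simp) (fun _ _ => rfl) rfl)

/-- Register 0 can only change from 1 to 0, so running through the table of transitions forms the
disjunction over all of them. -/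
theorem ends_checkAccepting (hs : SearchAt nT σ₀ x h ns σ) (hT : Tables S nT σ₀)
    (hcorr : corr = 1 ↔ Failure.corruption ∈ F)
    (h13 : σ.reg 13 = 1 ↔ ∀ p f, x.2.2.mode p ≠ .waiting f) (h0 : σ.reg 0 ≤ 1) :
    Ends (checkAccepting corr) σ (loopTime nT ((acceptExp corr).term.cost + 6)) fun σ' =>
      SearchAt nT σ₀ x h ns σ' ∧ σ'.reg 0 ≤ 1 ∧
      (σ'.reg 0 = 0 ↔ σ.reg 0 = 0 ∨ x.2.2.Accepting F x.1 x.2.1) := by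
  refine (Ends.for (H := nT) (I := fun k σ' => SearchAt nT σ₀ x h ns σ' ∧
      (σ'.reg 13 = 1 ↔ ∀ p f, x.2.2.mode p ≠ .waiting f) ∧ σ'.reg 0 ≤ 1 ∧
      (σ'.reg 0 = 0 ↔ σ.reg 0 = 0 ∨ ∃ i < k, ∃ p, ∃ τ ∈ S.trans p, TransAt σ₀ i p τ ∧
        AcceptedBy F x p τ)) rfl ?_ ?_ ?_ ?_).mono le_rfl fun σ' ⟨h1, h2, h3, h4⟩ => ⟨h1, h3, ?_⟩
  · rintro k σ' v ⟨h1, h2, h3⟩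
    exact ⟨h1.setReg (by omega), by simpa using h2, by simpa using h3⟩
  · exact fun k σ' _ h => h.1.tables.reg5
  · rintro k σ₁ hk ⟨h1, h2, h3, h4⟩ h20
    refine Ends.mono_left (T := 3 + ((acceptExp corr).term.cost + 1 + 2)) ?_ (by omega)
    refine Ends.flat_then (c := .assign 24 (.read 1 (.reg 20))) rfl ?_
    set σ₂ := Prog.run (.assign 24 (.read 1 (.reg 20))) σ₁ with hσ₂
    have g1 : SearchAt nT σ₀ x h ns σ₂ := h1.setReg (by omega)
    have r24 : σ₂.reg 24 = σ₂.arr 1 (σ₂.reg 20) := by simp [hσ₂, Prog.run]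
    have r20 : σ₂.reg 20 = k := by simp [hσ₂, Prog.run, h20]
    have r13 : σ₂.reg 13 = σ₁.reg 13 := by simp [hσ₂, Prog.run]
    have r0 : σ₂.reg 0 = σ₁.reg 0 := by simp [hσ₂, Prog.run]
    rw [← r13] at h2
    rw [← r0] at h3 h4
    have hc : (acceptExp corr).Holds σ₂ ↔ ∃ p, ∃ τ ∈ S.trans p, TransAt σ₀ k p τ ∧
        AcceptedBy F x p τ := by
      constructor
      · intro hh
        obtain ⟨p, τ, hτ, ht⟩ := hT.sound k hk
        refine ⟨p, τ, hτ, ht, ?_⟩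
        rwa [← holds_acceptExp g1 hcorr h2 r24]
        rw [r20]
        exact ht.congr g1.input
      · rintro ⟨p, τ, hτ, ht, hacc⟩
        rwa [holds_acceptExp g1 hcorr h2 r24]
        rw [r20]
        exact ht.congr g1.input
    have hsplit : (∃ i < k + 1, ∃ p, ∃ τ ∈ S.trans p, TransAt σ₀ i p τ ∧ AcceptedBy F x p τ) ↔
        (∃ i < k, ∃ p, ∃ τ ∈ S.trans p, TransAt σ₀ i p τ ∧ AcceptedBy F x p τ) ∨
        (acceptExp corr).Holds σ₂ := by
      rw [hc]
      constructor
      · rintro ⟨i, hi, g⟩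
        rcases Nat.lt_succ_iff_lt_or_eq.1 hi with g3 | rfl
        · exact Or.inl ⟨i, g3, g⟩
        · exact Or.inr g
      · rintro (⟨i, hi, g⟩ | g)
        · exact ⟨i, by omega, g⟩
        · exact ⟨k, by omega, g⟩
    refine (Ends.cond_of (T := 2) (fun hne => ?_) fun heq => ?_)
    · rw [BExp.eval_term_ne_zero] at hne
      refine (Ends.of_flat rfl ?_).mono_left (T := _) (by decide)
      refine ⟨g1.setReg_zero, by simpa [Prog.run] using h2, by simp [Prog.run], ?_⟩
      rw [hsplit]
      simp [Prog.run, hne]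
    · rw [BExp.eval_term_eq_zero] at heq
      refine (Ends.of_flat rfl ?_).mono_left (T := _) (by decide)
      refine ⟨g1, h2, h3, ?_⟩
      rw [hsplit, or_iff_left heq]
      exact h4
  · exact ⟨hs, h13, h0, by simp⟩
  · rw [h4, accepting_iff]
    refine or_congr_right ⟨fun ⟨i, _, p, τ, g1, _, g2⟩ => ⟨p, τ, g1, g2⟩, fun ⟨p, τ, g1, g2⟩ => ?_⟩
    obtain ⟨i, hi, g3⟩ := hT.complete p τ g1
    exact ⟨i, hi, p, τ, g1, g3, g2⟩

end SearchSpec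


/-! ### The search decides the question -/

section SearchLoopSpec

open RAM

variable {N s : ℕ} {S : FIFOSystem (Fin N) (Fin s)} {nT h : ℕ} {σ σ' σ₀ : RAM.Memory}
  {F : Set Failure} {x y : SearchKey S} {ns ns' : List (SearchKey S)} {corr fifo : ℕ}

/-- The node of the key is reachable in the search for its channel and message. -/
def SearchKey.Reached (F : Set Failure) (x : SearchKey S) : Prop :=
  ReflTransGen (Move F x.1 x.2.1) (SearchNode.init S) x.2.2

theorem SearchKey.Reached.move (hx : SearchKey.Reached F x) (h : KeyMove F x y) :
    SearchKey.Reached F y := by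
  obtain ⟨c, m, n⟩ := x
  obtain ⟨c', m', n'⟩ := y
  obtain ⟨h1, h2, h3⟩ := h
  simp only at h1 h2
  subst h1 h2
  exact ReflTransGen.tail hx h3

/-- A bound for the number of search keys. -/
def FIFOSystem.numKeys (S : FIFOSystem (Fin N) (Fin s)) : ℕ :=
  Fintype.card (Channel (Fin N)) * (s * ((∏ p, S.numStates p) * ((2 * N + 2) ^ N * 2)))

/-- The factors count channels, messages, global states, mode vectors and values of the flag. -/
theorem length_le_numKeys (h : ns.Nodup) : ns.length ≤ S.numKeys := by
  classical
  let f : SearchKey S → Channel (Fin N) × Fin s × (∀ p, Fin (S.numStates p)) ×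
      (Fin N → Fin (2 * N + 2)) × Bool := fun x =>
    (x.1, x.2.1, x.2.2.state, fun p => ⟨(x.2.2.mode p).code, Mode.code_lt _⟩, x.2.2.flag)
  have hf : Function.Injective f := by
    rintro ⟨c, m, ⟨st, md, fl⟩⟩ ⟨c', m', ⟨st', md', fl'⟩⟩ he
    simp only [f, Prod.mk.injEq] at he
    obtain ⟨rfl, rfl, rfl, h4, rfl⟩ := he
    obtain rfl : md = md' := funext fun p => by
      have := congrFun h4 p
      simpa using this
    rfl
  have h1 := (h.map hf).length_le_card
  simpa [FIFOSystem.numKeys] using h1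

/-- The invariant of the search: `ns` is the queue, and the first `h` nodes are done. -/
structure SearchInv (F : Set Failure) (nT : ℕ) (σ₀ : RAM.Memory) (ns : List (SearchKey S)) (h : ℕ)
    (σ : RAM.Memory) : Prop where
  tables : Tables S nT σ
  queue : Queue ns σ
  reg9 : σ.reg 9 = h * (2 * N + 4)
  input : ∀ k ≤ 2, σ.arr k = σ₀.arr k
  le : h ≤ ns.length
  reached : ∀ z ∈ ns, SearchKey.Reached F z
  start : ∀ z : SearchKey S, IsInitKey z → z ∈ ns
  closed : ∀ k < h, ∀ z, ns[k]? = some z → ∀ z', KeyMove F z z' → z' ∈ ns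
  result : σ.reg 0 ≤ 1
  found : σ.reg 0 = 0 ↔ ∃ k < h, ∃ z, ns[k]? = some z ∧ z.2.2.Accepting F z.1 z.2.1

theorem expand_setsReg (corr fifo : ℕ) : (expand corr fifo).setsReg 0 = false := rfl

/-- The body of the search loop. -/
theorem exists_searchBody_time (hcorr : corr = 1 ↔ Failure.corruption ∈ F)
    (hfifo : fifo = 1 ↔ IsFifo F) : ∃ K, 1 ≤ K ∧ ∀ {N s : ℕ} {S : FIFOSystem (Fin N) (Fin s)}
    {nT h : ℕ} {σ σ₀ : Memory} {ns : List (SearchKey S)},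
    SearchInv F nT σ₀ ns h σ → Tables S nT σ₀ → h < ns.length →
    Ends (.seq loadRow (.seq checkWaiting (.seq (checkAccepting corr)
      (.seq (expand corr fifo) (.assign 9 (.reg 9 + .reg 3)))))) σ
      (K * ((nT + 1) ^ 2 * (2 * N + 4) ^ 3)) fun σ' =>
      ∃ ns' : List (SearchKey S), SearchInv F nT σ₀ ns' (h + 1) σ' := by
  obtain ⟨K, hK1, hK⟩ := exists_expand_time hcorr hfifo
  set C := (acceptExp corr).term.cost + 6 with hC
  refine ⟨K + 30 + 15 * 30 + 15 * C + 10, by omega, fun {N s S nT h σ σ₀ ns} hI hT hh => ?_⟩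
  refine Ends.mono_left (T := 30 + (loopTime N 30 + (loopTime nT C +
    (K * ((nT + 1) ^ 2 * (2 * N + 4) ^ 3) + 4)))) ?_ ?_
  swap
  · have e1 : loopTime N 30 ≤ 15 * ((N + 1) * 30) := loopTime_le (by omega)
    have e2 : loopTime nT C ≤ 15 * ((nT + 1) * C) := loopTime_le (by omega)
    set A := (nT + 1) ^ 2 * (2 * N + 4) ^ 3 with hA
    have a1 : nT + 1 ≤ A := by
      rw [hA]
      calc nT + 1 ≤ (nT + 1) ^ 2 := Nat.le_self_pow (by omega) _
        _ ≤ _ := Nat.le_mul_of_pos_right _ (by positivity)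
    have a2 : N + 1 ≤ A := by
      rw [hA]
      calc N + 1 ≤ 2 * N + 4 := by omega
        _ ≤ (2 * N + 4) ^ 3 := Nat.le_self_pow (by omega) _
        _ ≤ _ := Nat.le_mul_of_pos_left _ (by positivity)
    have a3 : (nT + 1) * C ≤ A * C := Nat.mul_le_mul_right _ a1
    have e3 : (K + 30 + 15 * 30 + 15 * C + 10) * A = K * A + 490 * A + 15 * (A * C) := by ring
    rw [e3]
    omega
  obtain ⟨x, hx'⟩ : ∃ x, ns[h]? = some x := ⟨_, List.getElem?_eq_getElem hh⟩
  refine Ends.seq ((ends_loadRow hI.tables hI.queue hI.reg9 hx' hI.input).imp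
    fun σ₁ _ ⟨a1, a2, a3⟩ => ?_)
  refine Ends.seq ((ends_checkWaiting a1 a2).imp fun σ₂ _ ⟨b1, b2, b3⟩ => ?_)
  rw [a3] at b3
  refine Ends.seq ((ends_checkAccepting b1 hT hcorr b2 (by rw [b3]; exact hI.result)).imp
    fun σ₃ _ ⟨c1, c2, c3⟩ => ?_)
  rw [b3, hI.found] at c3
  refine Ends.seq ((hK c1 hT).imp fun σ₄ hf ⟨ns', d1, d2, d3⟩ => ?_)
  refine (Ends.of_flat rfl ?_).mono_left (T := _) (by decide)
  have r0 : σ₄.reg 0 = σ₃.reg 0 := hf.reg 0 (expand_setsReg corr fifo)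
  have hget : ∀ k z, k < h + 1 → (ns'[k]? = some z ↔ ns[k]? = some z) := by
    intro k z hk
    obtain ⟨l, rfl⟩ := d1.1
    rw [List.getElem?_append_left (by omega)]
  have hlen := d1.1.length_le
  refine ⟨ns', ?_, ?_, ?_, d2.input, by omega, ?_, ?_, ?_, ?_, ?_⟩
  · exact d2.tables.congr (fun k _ hk => by simp [Prog.run, show k ≠ 9 by omega]) fun _ _ => rfl
  · exact d2.queue.congr (by simp [Prog.run]) (fun _ _ => rfl) rfl
  · simp [Prog.run, d2.reg9, d2.tables.reg3, add_mul]
  · intro z hz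
    rcases d1.2 z hz with h1 | h1
    · exact hI.reached z h1
    · exact (hI.reached x (List.mem_of_getElem? hx')).move h1
  · exact fun z hz => d1.1.subset (hI.start z hz)
  · intro k hk z hz z' hz'
    rw [hget k z hk] at hz
    rcases Nat.lt_succ_iff_lt_or_eq.1 hk with h1 | rfl
    · exact d1.1.subset (hI.closed k h1 z hz z' hz')
    · rw [hx'] at hz
      obtain rfl := Option.some.inj hz
      exact d3 z' hz'
  · simpa [Prog.run, r0] using c2
  · simp only [Prog.run, Memory.setReg_reg, show ¬ ((0 : ℕ) = 9) by decide, if_false, r0, c3]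
    constructor
    · rintro (⟨k, hk, z, hz, hz'⟩ | hacc)
      · exact ⟨k, by omega, z, (hget k z (by omega)).2 hz, hz'⟩
      · exact ⟨h, by omega, x, (hget h x (by omega)).2 hx', hacc⟩
    · rintro ⟨k, hk, z, hz, hz'⟩
      rw [hget k z hk] at hz
      rcases Nat.lt_succ_iff_lt_or_eq.1 hk with h1 | rfl
      · exact Or.inl ⟨k, h1, z, hz, hz'⟩
      · rw [hx'] at hz
        obtain rfl := Option.some.inj hz
        exact Or.inr hz'

/-- The search loop decides the question. -/
theorem exists_searchLoop_time (hF : F.Nonempty) (hcorr : corr = 1 ↔ Failure.corruption ∈ F)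
    (hfifo : fifo = 1 ↔ IsFifo F) : ∃ K, ∀ {N s : ℕ} {S : FIFOSystem (Fin N) (Fin s)}
    {nT : ℕ} {σ σ₀ : Memory} {ns : List (SearchKey S)},
    SearchInv F nT σ₀ ns 0 σ → Tables S nT σ₀ →
    Ends (searchLoop corr fifo) σ (K * ((S.numKeys + 1) * ((nT + 1) ^ 2 * (2 * N + 4) ^ 3)))
      fun σ' => (IsIRSC (failureModel (Fin s) F) S → σ'.reg 0 = 1) ∧
        (¬ IsIRSC (failureModel (Fin s) F) S → σ'.reg 0 = 0) := by
  obtain ⟨K, hK1, hK⟩ := exists_searchBody_time hcorr hfifo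
  refine ⟨K + 4, fun {N s S nT σ σ₀ ns} hI hT => ?_⟩
  -- The variant counts the keys not yet treated: register 9 divided by the length of a row is the
  -- index of the head, and a queue without duplicates has at most `numKeys` rows.
  have key := Ends.while (σ := σ) (t := .reg 8 - .reg 9) (I := fun σ => ∃ ns h,
    SearchInv (S := S) F nT σ₀ ns h σ) (fun σ => S.numKeys - σ.reg 9 / (2 * N + 4))
    (T := K * ((nT + 1) ^ 2 * (2 * N + 4) ^ 3))
    (c := .seq loadRow (.seq checkWaiting (.seq (checkAccepting corr)
      (.seq (expand corr fifo) (.assign 9 (.reg 9 + .reg 3)))))) ?_ ⟨ns, 0, hI⟩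
  · refine key.mono ?_ fun σ' ⟨⟨ns', h, hI'⟩, hend⟩ => ?_
    · have hc : (Term.reg 8 - Term.reg 9).cost = 3 := rfl
      rw [hc]
      have h1 : 1 ≤ (nT + 1) ^ 2 * (2 * N + 4) ^ 3 := Nat.pos_of_ne_zero (by positivity)
      generalize (nT + 1) ^ 2 * (2 * N + 4) ^ 3 = A at *
      have h2 : S.numKeys - σ.reg 9 / (2 * N + 4) ≤ S.numKeys := Nat.sub_le _ _
      generalize S.numKeys = B at *
      generalize σ.reg 9 / (2 * N + 4) = D at *
      calc (B - D) * (3 + 1 + K * A) + (3 + 1) ≤ B * (3 + 1 + K * A) + (3 + 1) := by gcongr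
        _ ≤ B * (4 * A + K * A) + 4 * A := by
          have := Nat.mul_le_mul_left B (show 3 + 1 + K * A ≤ 4 * A + K * A by omega)
          omega
        _ ≤ (K + 4) * ((B + 1) * A) := by nlinarith [Nat.zero_le (K * A)]
    · have hlen : h = ns'.length := by
        simp only [Term.eval_sub, Term.eval_reg, hI'.reg9, hI'.queue.fin] at hend
        have h1 : ns'.length * (2 * N + 4) ≤ h * (2 * N + 4) := Nat.le_of_sub_eq_zero hend
        exact le_antisymm hI'.le (Nat.le_of_mul_le_mul_right h1 (by omega))
      -- When the head has met the end, every node of the queue has been expanded. So the queue is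
      -- closed under moves and contains all reachable nodes.
      have hall : ∀ c m n, ReflTransGen (Move F c m) (SearchNode.init S) n → (c, m, n) ∈ ns' := by
        intro c m n hn
        induction hn with
        | refl => exact hI'.start _ rfl
        | @tail n₁ n₂ _ hmove ih =>
          obtain ⟨k, hk, hz⟩ := List.getElem_of_mem ih
          exact hI'.closed k (by omega) (c, m, n₁) (by rw [List.getElem?_eq_getElem hk, hz])
            (c, m, n₂) ⟨rfl, rfl, hmove⟩
      have hres : σ'.reg 0 = 0 ↔ ¬ IsIRSC (failureModel (Fin s) F) S := by
        rw [hI'.found, isIRSC_iff_not_accepting hF]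
        constructor
        · rintro ⟨k, _, z, hz, hacc⟩ hno
          exact hno _ _ _ (hI'.reached z (List.mem_of_getElem? hz)) hacc
        · intro hno
          push Not at hno
          obtain ⟨c, m, n, hn, hacc⟩ := hno
          obtain ⟨k, hk, hz⟩ := List.getElem_of_mem (hall c m n hn)
          exact ⟨k, by omega, (c, m, n), by rw [List.getElem?_eq_getElem hk, hz], hacc⟩
      have h1 := hI'.result
      refine ⟨fun hyes => ?_, hres.2⟩
      have : σ'.reg 0 ≠ 0 := fun h0 => hres.1 h0 hyes
      omega
  · rintro σ₁ ⟨ns₁, h, hI₁⟩ hne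
    have hlt : h < ns₁.length := by
      simp only [Term.eval_sub, Term.eval_reg, hI₁.reg9, hI₁.queue.fin] at hne
      by_contra hcon
      exact hne (Nat.sub_eq_zero_of_le (Nat.mul_le_mul_right _ (by omega)))
    refine (hK hI₁ hT hlt).imp fun σ₂ _ ⟨ns₂, hI₂⟩ => ⟨⟨ns₂, h + 1, hI₂⟩, ?_⟩
    rw [hI₁.reg9, hI₂.reg9, Nat.mul_div_cancel _ (by omega), Nat.mul_div_cancel _ (by omega)]
    have := length_le_numKeys hI₁.queue.nodup
    omega

end SearchLoopSpec


/-! ### Reading the input -/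

section PartialSums

variable {N : ℕ}

/-- The sum of the first `k` values of `f`. -/
def takeSum (f : Fin N → ℕ) (k : ℕ) : ℕ := (((List.finRange N).take k).map f).sum

@[simp] theorem takeSum_zero (f : Fin N → ℕ) : takeSum f 0 = 0 := by simp [takeSum]

theorem takeSum_succ (f : Fin N → ℕ) (p : Fin N) : takeSum f (p + 1) = takeSum f p + f p := by
  have h : (p : ℕ) < (List.finRange N).length := by simp
  rw [takeSum, List.take_add_one, List.getElem?_eq_getElem h]
  simp [takeSum]

theorem takeSum_self (f : Fin N → ℕ) : takeSum f N = ∑ p, f p := by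
  rw [takeSum, List.take_of_length_le (by simp), Fin.sum_univ_def]

/-- An index of the common table of transitions determines an automaton and an index in its own
list. -/
theorem exists_of_lt_takeSum {f : Fin N → ℕ} {k j : ℕ} (hk : k ≤ N) (hj : j < takeSum f k) :
    ∃ p : Fin N, (p : ℕ) < k ∧ ∃ i < f p, j = takeSum f p + i := by
  induction k with
  | zero => simp at hj
  | succ k ih =>
    have h := takeSum_succ f ⟨k, hk⟩
    simp only at h
    by_cases hlt : j < takeSum f k
    · obtain ⟨p, h1, h2⟩ := ih (by omega) hlt
      exact ⟨p, by omega, h2⟩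
    · exact ⟨⟨k, hk⟩, Nat.lt_succ_self k, j - takeSum f k, by omega, by simp only; omega⟩

theorem takeSum_add_le {f : Fin N → ℕ} {k : ℕ} {p : Fin N} (hp : (p : ℕ) < k) (hk : k ≤ N) :
    takeSum f p + f p ≤ takeSum f k := by
  induction k with
  | zero => omega
  | succ k ih =>
    have h := takeSum_succ f ⟨k, hk⟩
    simp only at h
    rcases Nat.lt_succ_iff_lt_or_eq.1 hp with h1 | h1
    · have := ih h1 (by omega)
      omega
    · obtain rfl : p = ⟨k, hk⟩ := Fin.ext h1
      exact h.ge

/-- Addresses in a concatenation of blocks: the lengths of the preceding blocks, plus the place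
inside the block. -/
theorem List.getD_flatMap {α : Type} (f : α → List ℕ) (l : List α) {k i : ℕ} {a : α}
    (hk : l[k]? = some a) (hi : i < (f a).length) :
    (l.flatMap f).getD (((l.take k).map fun b => (f b).length).sum + i) 0 = (f a).getD i 0 := by
  induction l generalizing k with
  | nil => simp at hk
  | cons b l ih =>
    cases k with
    | zero =>
      simp only [List.getElem?_cons_zero, Option.some.injEq] at hk
      subst hk
      simp only [List.take_zero, List.map_nil, List.sum_nil, Nat.zero_add, List.flatMap_cons]
      rw [List.getD_append _ _ _ _ hi]
    | succ k =>
      simp only [List.getElem?_cons_succ] at hk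
      simp only [List.take_succ_cons, List.map_cons, List.sum_cons, List.flatMap_cons]
      rw [List.getD_append_right _ _ _ _ (by omega), ← ih hk]
      congr 1
      omega

end PartialSums

section Layout

variable {N s : ℕ} {S : FIFOSystem (Fin N) (Fin s)} {w : List ℕ}
  {L : ∀ p, List (Fin (S.numStates p) × Act (Fin N) (Fin s) × Fin (S.numStates p))}

theorem Act.length_code (a : Act (Fin N) (Fin s)) : a.code.length = 4 := by
  cases a <;> rfl

theorem length_automatonCode {k : ℕ} (q₀ : Fin k)
    (l : List (Fin k × Act (Fin N) (Fin s) × Fin k)) :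
    (automatonCode q₀ l).length = 3 + 6 * l.length := by
  simp [automatonCode, List.length_flatMap, Act.length_code]
  omega

/-- Where the code of automaton `k` starts in the input. -/
def inputOffset (L : ∀ p, List (Fin (S.numStates p) × Act (Fin N) (Fin s) × Fin (S.numStates p)))
    (k : ℕ) : ℕ := 2 + takeSum (fun p => 3 + 6 * (L p).length) k

theorem input_automaton (hw : w = [N, s] ++ (List.finRange N).flatMap fun p =>
    automatonCode (S.init p) (L p)) (p : Fin N) {i : ℕ} (hi : i < 3 + 6 * (L p).length) :
    w.getD (inputOffset L p + i) 0 = (automatonCode (S.init p) (L p)).getD i 0 := by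
  have h1 := List.getD_flatMap (fun p => automatonCode (S.init p) (L p)) (List.finRange N)
    (k := p) (i := i) (a := p) (by simp) (by rw [length_automatonCode]; exact hi)
  rw [hw, List.getD_append_right _ _ _ _ (by simp [inputOffset]; omega), ← h1]
  congr 1
  simp only [inputOffset, takeSum, length_automatonCode, List.length_cons, List.length_nil]
  omega

theorem input_transition (hw : w = [N, s] ++ (List.finRange N).flatMap fun p =>
    automatonCode (S.init p) (L p)) (p : Fin N) {i : ℕ} {τ} (hi : (L p)[i]? = some τ) {l : ℕ}
    (hl : l < 6) : w.getD (inputOffset L p + 3 + 6 * i + l) 0 =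
      ((τ.1 : ℕ) :: (τ.2.1.code ++ [(τ.2.2 : ℕ)])).getD l 0 := by
  have hlt : i < (L p).length := (List.getElem?_eq_some_iff.1 hi).1
  have h1 := List.getD_flatMap (fun t : Fin (S.numStates p) × Act (Fin N) (Fin s) ×
    Fin (S.numStates p) => (t.1 : ℕ) :: (t.2.1.code ++ [(t.2.2 : ℕ)])) (L p) (k := i) (i := l)
    (a := τ) hi (by simp [Act.length_code]; omega)
  have h2 : (((L p).take i).map fun t => ((t.1 : ℕ) :: (t.2.1.code ++ [(t.2.2 : ℕ)])).length).sum =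
      6 * i := by
    simp [Act.length_code, Nat.min_eq_left hlt.le]
    omega
  rw [h2] at h1
  have h3 := input_automaton hw p (i := 3 + (6 * i + l)) (by omega)
  rw [← h1, show inputOffset L p + 3 + 6 * i + l = inputOffset L p + (3 + (6 * i + l)) by omega, h3,
    automatonCode, List.getD_append_right _ _ _ _ (by simp)]
  congr 1
  simp

theorem transAt_of_input (hw : w = [N, s] ++ (List.finRange N).flatMap fun p =>
    automatonCode (S.init p) (L p)) {σ : RAM.Memory} (h0 : σ.arr 0 = fun i => w.getD i 0)
    {p : Fin N} {i j : ℕ} {τ} (hi : (L p)[i]? = some τ) (h1 : σ.arr 1 j = inputOffset L p + 3 + 6 * i)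
    (h2 : σ.arr 2 j = p) : TransAt σ j p τ := by
  have h := fun l (hl : l < 6) => input_transition hw p hi hl
  refine ⟨h2, ?_, fun l hl => ?_, ?_⟩
  · rw [h0, h1]
    exact h 0 (by omega)
  · rw [h0, h1]
    refine (h (1 + l) (by omega)).trans ?_
    rw [Nat.add_comm 1 l, List.getD_cons_succ,
      List.getD_append _ _ _ _ (by rw [Act.length_code]; exact hl)]
  · rw [h0, h1]
    refine (h 5 (by omega)).trans ?_
    rw [List.getD_cons_succ, List.getD_append_right _ _ _ _ (by rw [Act.length_code]),
      Act.length_code]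
    rfl

end Layout


namespace RAM

/-- Enter the transitions of one automaton into the table. -/
def readTransitions : Prog :=
  .for 33 32 (.seq (.write 1 (.reg 5) (.reg 30)) (.seq (.write 2 (.reg 5) (.reg 31))
    (.seq (.assign 5 (.reg 5 + 1)) (.assign 30 (.reg 30 + 6)))))

/-- Read one automaton. -/
def readAutomaton : Prog :=
  .seq (.seq (.assign 34 (.reg 34 + .read 0 (.reg 30)))
    (.seq (.write 3 (.reg 31) (.read 0 (.reg 30 + 1)))
      (.seq (.assign 32 (.read 0 (.reg 30 + 2))) (.assign 30 (.reg 30 + 3))))) readTransitions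

/-- Read the input. -/
def readInput : Prog :=
  .seq (.seq (.assign 1 (.read 0 0)) (.seq (.assign 2 (.read 0 1)) (.assign 30 2)))
    (.for 31 1 readAutomaton)

/-- Compute the constants. -/
def setConstants : Prog :=
  .seq (.assign 7 (.reg 1 + .reg 1)) <| .seq (.assign 6 (.reg 7 + 2)) <|
  .seq (.assign 3 (.reg 7 + 4)) <| .assign 4 (.reg 34 + (.reg 7 + (.reg 2 + 3)))

/-- Compute the multiples of the powers of the base. -/
def setWeights : Prog :=
  .seq (.seq (.assign 35 1) (.assign 37 0)) <|
  .for 38 3 (.seq (.assign 36 0) (.seq (.for 39 4 (.seq (.write 4 (.reg 37) (.reg 36))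
    (.seq (.assign 36 (.reg 36 + .reg 35)) (.assign 37 (.reg 37 + 1))))) (.assign 35 (.reg 36))))

end RAM

section ReadInput

open RAM

variable {N s : ℕ} {S : FIFOSystem (Fin N) (Fin s)} {w : List ℕ} {σ σ' : RAM.Memory}
  {L : ∀ p, List (Fin (S.numStates p) × Act (Fin N) (Fin s) × Fin (S.numStates p))}

theorem ends_readTransitions : Ends readTransitions σ (loopTime (σ.reg 32) 20) fun σ' =>
    σ'.reg 5 = σ.reg 5 + σ.reg 32 ∧ σ'.reg 30 = σ.reg 30 + 6 * σ.reg 32 ∧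
    (∀ i < σ.reg 32, σ'.arr 1 (σ.reg 5 + i) = σ.reg 30 + 6 * i ∧
      σ'.arr 2 (σ.reg 5 + i) = σ.reg 31) ∧
    ∀ j < σ.reg 5, σ'.arr 1 j = σ.arr 1 j ∧ σ'.arr 2 j = σ.arr 2 j := by
  refine (Ends.for (H := σ.reg 32) (T := 20) (I := fun k σ' => σ'.reg 32 = σ.reg 32 ∧
    σ'.reg 31 = σ.reg 31 ∧ σ'.reg 5 = σ.reg 5 + k ∧ σ'.reg 30 = σ.reg 30 + 6 * k ∧
    (∀ i < k, σ'.arr 1 (σ.reg 5 + i) = σ.reg 30 + 6 * i ∧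
      σ'.arr 2 (σ.reg 5 + i) = σ.reg 31) ∧
    ∀ j < σ.reg 5, σ'.arr 1 j = σ.arr 1 j ∧ σ'.arr 2 j = σ.arr 2 j) rfl ?_ ?_ ?_ ?_).mono le_rfl
    fun σ' h => h.2.2
  · rintro k σ' v ⟨h1, h2, h3, h4, h5⟩
    exact ⟨by simpa using h1, by simpa using h2, by simpa using h3, by simpa using h4, h5⟩
  · exact fun k σ' _ h => h.1
  · rintro k σ₁ hk ⟨h1, h2, h3, h4, h5, h6⟩ -
    refine (Ends.of_flat rfl ?_).mono_left (T := _) (by decide)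
    have a1 : ∀ j, (Prog.run (.seq (.write 1 (.reg 5) (.reg 30)) (.seq (.write 2 (.reg 5) (.reg 31))
        (.seq (.assign 5 (.reg 5 + 1)) (.assign 30 (.reg 30 + 6))))) σ₁).arr 1 j =
        if j = σ₁.reg 5 then σ₁.reg 30 else σ₁.arr 1 j := by
      intro j
      simp [Prog.run, Memory.setArr_arr]
    have a2 : ∀ j, (Prog.run (.seq (.write 1 (.reg 5) (.reg 30)) (.seq (.write 2 (.reg 5) (.reg 31))
        (.seq (.assign 5 (.reg 5 + 1)) (.assign 30 (.reg 30 + 6))))) σ₁).arr 2 j =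
        if j = σ₁.reg 5 then σ₁.reg 31 else σ₁.arr 2 j := by
      intro j
      simp [Prog.run, Memory.setArr_arr]
    simp only [a1, a2]
    refine ⟨by simpa [Prog.run] using h1, by simpa [Prog.run] using h2, ?_, ?_, fun i hi => ?_,
      fun j hj => ?_⟩
    · simp [Prog.run, h3, Nat.add_assoc]
    · simp [Prog.run, h4]
      omega
    · rcases Nat.lt_succ_iff_lt_or_eq.1 hi with h | rfl
      · rw [if_neg (by omega), if_neg (by omega)]
        exact h5 i h
      · rw [if_pos h3.symm, if_pos h3.symm]
        exact ⟨h4, h2⟩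
    · rw [if_neg (by omega), if_neg (by omega)]
      exact h6 j hj
  · exact ⟨rfl, rfl, rfl, rfl, fun i hi => absurd hi (Nat.not_lt_zero i), fun j _ => ⟨rfl, rfl⟩⟩

/-- The first `k` automata have been read. -/
structure ReadInv (w : List ℕ)
    (L : ∀ p, List (Fin (S.numStates p) × Act (Fin N) (Fin s) × Fin (S.numStates p))) (k : ℕ)
    (σ : RAM.Memory) : Prop where
  reg1 : σ.reg 1 = N
  reg2 : σ.reg 2 = s
  reg5 : σ.reg 5 = takeSum (fun p => (L p).length) k
  reg30 : σ.reg 30 = inputOffset L k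
  reg34 : σ.reg 34 = takeSum S.numStates k
  input : σ.arr 0 = fun i => w.getD i 0
  init : ∀ p : Fin N, (p : ℕ) < k → σ.arr 3 p = S.init p
  table : ∀ p : Fin N, (p : ℕ) < k → ∀ i < (L p).length,
    σ.arr 1 (takeSum (fun p => (L p).length) p + i) = inputOffset L p + 3 + 6 * i ∧
    σ.arr 2 (takeSum (fun p => (L p).length) p + i) = p

/-- The code of an automaton has three leading cells, with the number of states, the initial state
and the number of transitions, followed by six cells for each transition. -/
theorem ends_readAutomaton (hw : w = [N, s] ++ (List.finRange N).flatMap fun p =>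
    automatonCode (S.init p) (L p)) {p : Fin N} (h : ReadInv w L p σ) (h31 : σ.reg 31 = p) :
    Ends readAutomaton σ (20 + loopTime (L p).length 20) fun σ' => ReadInv w L (p + 1) σ' := by
  have hin := fun i (hi : i < 3 + 6 * (L p).length) => input_automaton hw p hi
  have v0 : w.getD (inputOffset L p) 0 = S.numStates p := hin 0 (by omega)
  have v1 : w.getD (inputOffset L p + 1) 0 = S.init p := hin 1 (by omega)
  have v2 : w.getD (inputOffset L p + 2) 0 = (L p).length := hin 2 (by omega)
  refine (Ends.flat_then (c := .seq (.assign 34 (.reg 34 + .read 0 (.reg 30)))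
    (.seq (.write 3 (.reg 31) (.read 0 (.reg 30 + 1)))
      (.seq (.assign 32 (.read 0 (.reg 30 + 2))) (.assign 30 (.reg 30 + 3)))))
    (T := loopTime (L p).length 20) rfl ?_).mono_left (Nat.add_le_add_right (show _ ≤ 20 by decide) _)
  set σ₁ := Prog.run (.seq (.assign 34 (.reg 34 + .read 0 (.reg 30)))
    (.seq (.write 3 (.reg 31) (.read 0 (.reg 30 + 1)))
      (.seq (.assign 32 (.read 0 (.reg 30 + 2))) (.assign 30 (.reg 30 + 3))))) σ with hσ₁
  have hr : ∀ k, k ≠ 34 → k ≠ 32 → k ≠ 30 → σ₁.reg k = σ.reg k := by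
    intro k h1 h2 h3
    simp [hσ₁, Prog.run, h1, h2, h3]
  have ha : ∀ k, k ≠ 3 → σ₁.arr k = σ.arr k := by
    intro k hk
    simp [hσ₁, Prog.run, Memory.setArr_arr_ne _ _ _ _ hk]
  have r34 : σ₁.reg 34 = takeSum S.numStates (p + 1) := by
    simp [hσ₁, Prog.run, h.reg34, h.input, h.reg30, takeSum_succ]
    simpa using v0
  have r32 : σ₁.reg 32 = (L p).length := by
    simp [hσ₁, Prog.run, h.input, h.reg30, Memory.setArr_arr]
    simpa using v2
  have r30 : σ₁.reg 30 = inputOffset L p + 3 := by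
    simp [hσ₁, Prog.run, h.reg30]
  have a3 : ∀ j, σ₁.arr 3 j = if j = p then (S.init p : ℕ) else σ.arr 3 j := by
    intro j
    rw [← v1]
    simp [hσ₁, Prog.run, h31, h.input, h.reg30]
  have r5 : σ₁.reg 5 = takeSum (fun p => (L p).length) p := by
    rw [hr 5 (by omega) (by omega) (by omega), h.reg5]
  have key := ends_readTransitions (σ := σ₁)
  rw [r32, r5, r30, hr 31 (by omega) (by omega) (by omega), h31] at key
  refine key.imp fun σ₂ hf ⟨g1, g2, g3, g4⟩ => ⟨?_, ?_, ?_, ?_, ?_, ?_, fun q hq => ?_,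
    fun q hq i hi => ?_⟩
  · rw [hf.reg 1 rfl, hr 1 (by omega) (by omega) (by omega), h.reg1]
  · rw [hf.reg 2 rfl, hr 2 (by omega) (by omega) (by omega), h.reg2]
  · rw [g1, takeSum_succ]
  · rw [g2, inputOffset, inputOffset, takeSum_succ]
    omega
  · rw [hf.reg 34 rfl, r34]
  · rw [hf.arr 0 rfl, ha 0 (by omega), h.input]
  · rw [hf.arr 3 rfl, a3]
    rcases Nat.lt_succ_iff_lt_or_eq.1 hq with h1 | h1
    · rw [if_neg (by omega), h.init q h1]
    · obtain rfl := Fin.ext h1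
      rw [if_pos rfl]
  · rcases Nat.lt_succ_iff_lt_or_eq.1 hq with h1 | h1
    · have h2 := takeSum_add_le (f := fun p => (L p).length) h1 p.2.le
      have h3 := g4 (takeSum (fun p => (L p).length) q + i) (by omega)
      rw [h3.1, h3.2, ha 1 (by omega), ha 2 (by omega)]
      exact h.table q h1 i hi
    · obtain rfl := Fin.ext h1
      exact g3 i hi

theorem ends_readInput (hw : w = [N, s] ++ (List.finRange N).flatMap fun p =>
    automatonCode (S.init p) (L p)) {nT : ℕ} (hnT : nT = ∑ p, (L p).length) :
    Ends readInput (start w) (15 + loopTime N (20 + loopTime nT 20)) fun σ => ReadInv w L N σ := by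
  refine (Ends.flat_then (c := .seq (.assign 1 (.read 0 0)) (.seq (.assign 2 (.read 0 1))
    (.assign 30 2))) (T := loopTime N (20 + loopTime nT 20)) rfl ?_).mono_left
    (Nat.add_le_add_right (show _ ≤ 15 by decide) _)
  refine Ends.for (H := N) (I := fun k σ => ReadInv w L k σ) rfl ?_ (fun k σ _ h => h.reg1) ?_ ?_
  · rintro k σ v ⟨h1, h2, h3, h4, h5, h6, h7, h8⟩
    exact ⟨by simpa using h1, by simpa using h2, by simpa using h3, by simpa using h4,
      by simpa using h5, h6, h7, h8⟩
  · intro k σ hk h h31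
    refine (ends_readAutomaton hw (p := ⟨k, hk⟩) h h31).mono_left ?_
    have h1 : (L ⟨k, hk⟩).length ≤ nT := by
      rw [hnT]
      exact Finset.single_le_sum (f := fun p => (L p).length) (fun _ _ => Nat.zero_le _)
        (Finset.mem_univ _)
    unfold loopTime
    gcongr
  · have harr : (start w).arr 0 = fun i => w.getD i 0 := by
      funext i
      simp [start]
    refine ⟨?_, ?_, ?_, ?_, ?_, harr, fun p hp => absurd hp (Nat.not_lt_zero _),
      fun p hp => absurd hp (Nat.not_lt_zero _)⟩
    · simp [Prog.run, start, hw]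
    · simp [Prog.run, start, hw]
    · simp [Prog.run, start]
    · simp [Prog.run, inputOffset]
    · simp [Prog.run, start]

/-- Multiples of a power of the base arise by repeated addition; after a full block the running sum
is the next power. -/
theorem ends_setWeights {D B : ℕ} (h3 : σ.reg 3 = D) (h4 : σ.reg 4 = B) :
    Ends setWeights σ (4 + loopTime D (loopTime B 20 + 10)) fun σ' =>
      ∀ i < D, ∀ d < B, σ'.arr 4 (i * B + d) = B ^ i * d := by
  refine Ends.flat_then (c := .seq (.assign 35 1) (.assign 37 0)) rfl ?_
  refine (Ends.for (H := D) (T := loopTime B 20 + 10) (I := fun k σ' => σ'.reg 3 = D ∧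
    σ'.reg 4 = B ∧ σ'.reg 35 = B ^ k ∧ σ'.reg 37 = k * B ∧
    ∀ i < k, ∀ d < B, σ'.arr 4 (i * B + d) = B ^ i * d) rfl ?_ (fun k σ' _ h => h.1) ?_ ?_).mono
    le_rfl fun σ' h => h.2.2.2.2
  · rintro k σ' v ⟨g1, g2, g3, g4, g5⟩
    exact ⟨by simpa using g1, by simpa using g2, by simpa using g3, by simpa using g4, g5⟩
  · rintro k σ₁ hk ⟨g1, g2, g3, g4, g5⟩ -
    refine Ends.mono_left (T := 2 + (loopTime B 20 + 2)) ?_ (by omega)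
    refine Ends.flat_then (c := .assign 36 0) rfl ?_
    refine Ends.seq ((Ends.for (H := B) (T := 20) (I := fun e σ' => σ'.reg 3 = D ∧
      σ'.reg 4 = B ∧ σ'.reg 35 = B ^ k ∧ σ'.reg 36 = B ^ k * e ∧ σ'.reg 37 = k * B + e ∧
      (∀ i < k, ∀ d < B, σ'.arr 4 (i * B + d) = B ^ i * d) ∧
      ∀ d < e, σ'.arr 4 (k * B + d) = B ^ k * d) rfl ?_ (fun k σ' _ h => h.2.1) ?_ ?_).imp ?_)
    · rintro e σ' v ⟨a1, a2, a3, a4, a5, a6, a7⟩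
      exact ⟨by simpa using a1, by simpa using a2, by simpa using a3, by simpa using a4,
        by simpa using a5, a6, a7⟩
    · rintro e σ₂ he ⟨a1, a2, a3, a4, a5, a6, a7⟩ -
      refine (Ends.of_flat rfl ?_).mono_left (T := _) (by decide)
      refine ⟨by simpa [Prog.run] using a1, by simpa [Prog.run] using a2,
        by simpa [Prog.run] using a3, ?_, ?_, fun i hi d hd => ?_, fun d hd => ?_⟩
      · simp [Prog.run, a3, a4, mul_add]
      · simp [Prog.run, a5, Nat.add_assoc]
      · have h1 : (i + 1) * B ≤ k * B := Nat.mul_le_mul_right _ hi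
        rw [add_mul, one_mul] at h1
        simp only [Prog.run, Memory.setReg_arr, Memory.setArr_arr_same, Term.eval_reg]
        rw [if_neg (by omega), a6 i hi d hd]
      · simp only [Prog.run, Memory.setReg_arr, Memory.setArr_arr_same, Term.eval_reg, a4, a5]
        rcases Nat.lt_succ_iff_lt_or_eq.1 hd with h | rfl
        · rw [if_neg (by omega), a7 d h]
        · rw [if_pos rfl]
    · refine ⟨by simpa [Prog.run] using g1, by simpa [Prog.run] using g2,
        by simpa [Prog.run] using g3, by simp [Prog.run], by simpa [Prog.run] using g4, g5,
        fun d hd => absurd hd (Nat.not_lt_zero d)⟩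
    · rintro σ₂ - ⟨a1, a2, a3, a4, a5, a6, a7⟩
      refine (Ends.of_flat rfl ?_).mono_left (T := _) (by decide)
      refine ⟨by simpa [Prog.run] using a1, by simpa [Prog.run] using a2, ?_, ?_,
        fun i hi d hd => ?_⟩
      · simp [Prog.run, a4, pow_succ]
      · simp [Prog.run, a5, add_mul]
      · rcases Nat.lt_succ_iff_lt_or_eq.1 hi with h | rfl
        · exact a6 i h d hd
        · exact a7 d hd
  · exact ⟨by simpa [Prog.run] using h3, by simpa [Prog.run] using h4, by simp [Prog.run],
      by simp [Prog.run], fun i hi => absurd hi (Nat.not_lt_zero i)⟩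

end ReadInput


/-! ### The whole program -/

namespace RAM

/-- Read the input and compute the tables. -/
def prepare : Prog :=
  .seq readInput (.seq setConstants (.seq setWeights (.assign 0 1)))

/-- The decision procedure. -/
def decideIRSC (corr fifo : ℕ) : Prog :=
  .seq prepare (.seq initQueue (searchLoop corr fifo))

end RAM

section Decide

open RAM

variable {N s : ℕ} {S : FIFOSystem (Fin N) (Fin s)} {w : List ℕ} {σ σ' : RAM.Memory}
  {L : ∀ p, List (Fin (S.numStates p) × Act (Fin N) (Fin s) × Fin (S.numStates p))}

/-- The number of transitions. -/
def FIFOSystem.numTrans {P M : Type} [Fintype P] (S : FIFOSystem P M) : ℕ := ∑ p, (S.trans p).card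

theorem sum_length_eq_numTrans (hL : ∀ p, (L p).Nodup ∧ ∀ t, t ∈ L p ↔ t ∈ S.trans p) :
    S.numTrans = ∑ p, (L p).length := by
  classical
  refine Finset.sum_congr rfl fun p _ => ?_
  rw [← List.toFinset_card_of_nodup (hL p).1]
  congr 1
  ext t
  rw [List.mem_toFinset, (hL p).2]

/-- A bound for the time to compute the tables. -/
def prepareTime (N nT B : ℕ) : ℕ :=
  (15 + loopTime N (20 + loopTime nT 20)) + (30 + (4 + loopTime (2 * N + 4) (loopTime B 20 + 10) + 2))

theorem ends_prepare (h : S.IsEncodedBy w) :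
    Ends prepare (start w) (prepareTime N S.numTrans S.base) fun σ =>
      Tables S S.numTrans σ ∧ Queue ([] : List (SearchKey S)) σ ∧ σ.reg 0 = 1 ∧ σ.reg 9 = 0 := by
  obtain ⟨L, hL, hw⟩ := h
  have hnT := sum_length_eq_numTrans hL
  have key : Ends prepare (start w) (prepareTime N S.numTrans S.base) fun σ =>
      Tables S S.numTrans σ ∧ σ.reg 0 = 1 := by
    refine Ends.seq ((ends_readInput hw hnT).imp fun σ₁ _ h₁ => ?_)
    have hc : setConstants.cost ≤ 30 := by decide
    refine (Ends.flat_then (c := setConstants) (T := 4 + loopTime (2 * N + 4)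
      (loopTime S.base 20 + 10) + 2) rfl ?_).mono_left (Nat.add_le_add_right hc _)
    set σ₂ := setConstants.run σ₁ with hσ₂
    have e1 : σ₂.reg 1 = N := by simp [hσ₂, setConstants, Prog.run, h₁.reg1]
    have e2 : σ₂.reg 2 = s := by simp [hσ₂, setConstants, Prog.run, h₁.reg2]
    have e3 : σ₂.reg 3 = 2 * N + 4 := by simp [hσ₂, setConstants, Prog.run, h₁.reg1, two_mul]
    have e4 : σ₂.reg 4 = S.base := by
      simp [hσ₂, setConstants, Prog.run, h₁.reg1, h₁.reg2, h₁.reg34, takeSum_self, FIFOSystem.base]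
      omega
    have e5 : σ₂.reg 5 = S.numTrans := by
      rw [hnT, ← takeSum_self, ← h₁.reg5]
      simp [hσ₂, setConstants, Prog.run]
    have e6 : σ₂.reg 6 = 2 * N + 2 := by simp [hσ₂, setConstants, Prog.run, h₁.reg1, two_mul]
    have e7 : σ₂.reg 7 = 2 * N := by simp [hσ₂, setConstants, Prog.run, h₁.reg1, two_mul]
    have ea : σ₂.arr = σ₁.arr := rfl
    refine Ends.seq ((ends_setWeights e3 e4).imp fun σ₃ hf hwt => ?_)
    refine (Ends.of_flat rfl ?_).mono_left (T := _) (by decide)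
    set σ₄ := Prog.run (.assign 0 1) σ₃ with hσ₄
    have hr : ∀ k, k ≠ 0 → setWeights.setsReg k = false → σ₄.reg k = σ₂.reg k := by
      intro k hk hk'
      rw [← hf.reg k hk']
      simp [hσ₄, Prog.run, hk]
    have ha : ∀ k, setWeights.setsArr k = false → σ₄.arr k = σ₁.arr k := by
      intro k hk
      rw [← ea, ← hf.arr k hk]
      rfl
    have htrans : ∀ p : Fin N, ∀ i, (hi : i < (L p).length) →
        TransAt σ₄ (takeSum (fun p => (L p).length) p + i) p ((L p)[i]) := by
      intro p i hi
      obtain ⟨h1, h2⟩ := h₁.table p p.2 i hi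
      refine transAt_of_input hw ((ha 0 rfl).trans h₁.input) (List.getElem?_eq_getElem hi) ?_ ?_
      · rw [ha 1 rfl, h1]
      · rw [ha 2 rfl, h2]
    refine ⟨⟨?_, ?_, ?_, ?_, ?_, ?_, ?_, fun j hj => ?_, fun p τ hτ => ?_, fun p => ?_,
      hwt⟩, by simp [hσ₄, Prog.run]⟩
    · rw [hr 1 (by omega) rfl, e1]
    · rw [hr 2 (by omega) rfl, e2]
    · rw [hr 3 (by omega) rfl, e3]
    · rw [hr 4 (by omega) rfl, e4]
    · rw [hr 5 (by omega) rfl, e5]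
    · rw [hr 6 (by omega) rfl, e6]
    · rw [hr 7 (by omega) rfl, e7]
    · rw [hnT, ← takeSum_self] at hj
      obtain ⟨p, -, i, hi, rfl⟩ := exists_of_lt_takeSum le_rfl hj
      exact ⟨p, _, ((hL p).2 _).1 (List.getElem_mem hi), htrans p i hi⟩
    · obtain ⟨i, hi, rfl⟩ := List.getElem_of_mem (((hL p).2 τ).2 hτ)
      refine ⟨_, ?_, htrans p i hi⟩
      have := takeSum_add_le (f := fun p => (L p).length) p.2 le_rfl
      rw [takeSum_self, ← hnT] at this
      omega
    · rw [ha 3 rfl, h₁.init p p.2]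
  -- The preparation does not touch array 6 nor registers 8 and 9. They still hold the zeros of the
  -- start memory, which represent the empty queue.
  refine key.imp fun σ hf ⟨h1, h2⟩ => ⟨h1, ⟨fun k hk => absurd hk (Nat.not_lt_zero k), ?_, ?_,
    List.nodup_nil⟩, h2, ?_⟩
  · rw [hf.reg 8 rfl]
    simp [start]
  · rw [hf.arr 6 rfl]
    simp [start]
  · rw [hf.reg 9 rfl]
    simp [start]

theorem initQueue_setsReg : ∀ k ≤ 9, k ≠ 8 → initQueue.setsReg k = false := by decide

theorem initQueue_setsArr : ∀ k ≤ 4, initQueue.setsArr k = false := by decide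

theorem exists_decide_time {F : Set Failure} (hF : F.Nonempty) {corr fifo : ℕ}
    (hcorr : corr = 1 ↔ Failure.corruption ∈ F) (hfifo : fifo = 1 ↔ IsFifo F) :
    ∃ K, ∀ {N s : ℕ} {S : FIFOSystem (Fin N) (Fin s)} {w : List ℕ}, S.IsEncodedBy w →
    Ends (decideIRSC corr fifo) (start w) (prepareTime N S.numTrans S.base +
      (K * ((N + 1) ^ 3 * (s + 1)) +
      K * ((S.numKeys + 1) * ((S.numTrans + 1) ^ 2 * (2 * N + 4) ^ 3))))
      fun σ' => (IsIRSC (failureModel (Fin s) F) S → σ'.reg 0 = 1) ∧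
        (¬ IsIRSC (failureModel (Fin s) F) S → σ'.reg 0 = 0) := by
  obtain ⟨K₁, hK₁⟩ := exists_initQueue_time
  obtain ⟨K₂, hK₂⟩ := exists_searchLoop_time hF hcorr hfifo
  refine ⟨K₁ + K₂, fun {N s S w} hw => ?_⟩
  refine Ends.mono_left ?_ (Nat.add_le_add_left (Nat.add_le_add
    (Nat.mul_le_mul_right _ (Nat.le_add_right K₁ K₂))
    (Nat.mul_le_mul_right _ (Nat.le_add_left K₂ K₁))) _)
  refine Ends.seq ((ends_prepare hw).imp fun σ₁ _ ⟨a1, a2, a3, a4⟩ => ?_)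
  refine Ends.seq ((hK₁ a1 a2).imp fun σ₂ hf ⟨ns, b1, b2⟩ => ?_)
  have hT : Tables S S.numTrans σ₂ := a1.congr
    (fun k _ hk => hf.reg k (initQueue_setsReg k (by omega) (by omega)))
    fun k hk => hf.arr k (initQueue_setsArr k hk)
  have r0 : σ₂.reg 0 = 1 := by rw [hf.reg 0 (initQueue_setsReg 0 (by omega) (by omega)), a3]
  refine hK₂ (σ₀ := σ₂) (ns := ns) ⟨hT, b1, ?_, fun _ _ => rfl, Nat.zero_le _, fun z hz => ?_,
    fun z hz => (b2 z).2 hz, fun k hk => absurd hk (Nat.not_lt_zero k), r0.le, ?_⟩ hT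
  · rw [hf.reg 9 (initQueue_setsReg 9 (by omega) (by omega)), a4, Nat.zero_mul]
  · have : z.2.2 = SearchNode.init S := (b2 z).1 hz
    rw [SearchKey.Reached, this]
  · simp [r0]

end Decide


/-! ### The running time -/

section RunningTime

open RAM

variable {N s : ℕ} {S : FIFOSystem (Fin N) (Fin s)}

theorem card_channel (N : ℕ) : Fintype.card (Channel (Fin N)) = N * (N - 1) := by
  classical
  have h : Fintype.card (Channel (Fin N)) = (Finset.univ : Finset (Fin N)).offDiag.card := by
    rw [Fintype.card_subtype]
    congr 1
    ext x
    simp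
  rw [h, Finset.offDiag_card, Finset.card_fin, Nat.mul_sub, mul_one]

/-- This is the source of the factor `2 ^ |C|`: from `N = 5` on, `2 * N + 2 ≤ 2 ^ (N - 1)`. The
smaller cases are computed; the factor 9 is attained at `N = 2`, where 36 = 9 · 4. -/
theorem pow_modes_le (hN : 2 ≤ N) : (2 * N + 2) ^ N ≤ 9 * 2 ^ (N * (N - 1)) := by
  by_cases h5 : 5 ≤ N
  · have h : ∀ m, 4 ≤ m → 2 * (m + 1) + 2 ≤ 2 ^ m := by
      intro m hm
      induction m, hm using Nat.le_induction with
      | base => norm_num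
      | succ m hm ih =>
        rw [pow_succ]
        omega
    have h1 := h (N - 1) (by omega)
    rw [show N - 1 + 1 = N by omega] at h1
    calc (2 * N + 2) ^ N ≤ (2 ^ (N - 1)) ^ N := Nat.pow_le_pow_left h1 N
      _ = 2 ^ (N * (N - 1)) := by rw [← pow_mul, mul_comm]
      _ ≤ _ := by omega
  · interval_cases N <;> norm_num

theorem numStates_add_numTrans (S : FIFOSystem (Fin N) (Fin s)) :
    S.size = (∑ p, S.numStates p) + S.numTrans := by
  rw [FIFOSystem.size, Finset.sum_add_distrib, FIFOSystem.numTrans]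

/-- Every automaton has an initial state, hence at least one state. So the size is at least the
number of processes. -/
theorem le_sum_numStates (S : FIFOSystem (Fin N) (Fin s)) : N ≤ ∑ p, S.numStates p := by
  have h := Finset.card_nsmul_le_sum Finset.univ S.numStates 1 fun p _ => (S.init p).pos
  simpa using h

theorem prod_numStates_le (S : FIFOSystem (Fin N) (Fin s)) : ∏ p, S.numStates p ≤ S.size ^ N := by
  have h := Finset.prod_le_pow_card Finset.univ S.numStates S.size fun p _ => by
    rw [numStates_add_numTrans]
    exact (Finset.single_le_sum (f := S.numStates) (fun _ _ => Nat.zero_le _)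
      (Finset.mem_univ p)).trans (Nat.le_add_right _ _)
  simpa using h

/-- Reading takes at most the order of N·n steps and the table of weights that of N·B; the base B is
linear in n + N + |Σ|. -/
theorem prepareTime_le {n c : ℕ} (hNc : N ≤ c) (hc : 2 ≤ c) (hn : 1 ≤ n) (hs : 1 ≤ s) {nT B : ℕ}
    (hnT : nT + 1 ≤ n) (hB : B ≤ n + 2 * N + s + 3) :
    prepareTime N nT B ≤ 1000000 * (n * c ^ 2 * s) := by
  have e1 : 20 + loopTime nT 20 ≤ 320 * n := by
    have : loopTime nT 20 ≤ 15 * ((nT + 1) * 20) := loopTime_le (by omega)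
    omega
  have e2 : loopTime N (20 + loopTime nT 20) ≤ 15 * (2 * c * (320 * n)) :=
    (loopTime_le (by omega)).trans (by gcongr; omega)
  have hcn : 1 ≤ n * c := Nat.mul_pos hn (by omega)
  have hB' : B + 1 ≤ 9 * (n * c * s) := by
    have f1 : n ≤ n * c * s := by
      rw [mul_assoc]
      exact Nat.le_mul_of_pos_right _ (Nat.mul_pos (by omega) hs)
    have f2 : c ≤ n * c * s := by
      calc c ≤ n * c := Nat.le_mul_of_pos_left _ hn
        _ ≤ _ := Nat.le_mul_of_pos_right _ hs
    have f3 : s ≤ n * c * s := Nat.le_mul_of_pos_left _ hcn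
    omega
  have e3 : loopTime B 20 + 10 ≤ 310 * (9 * (n * c * s)) := by
    have : loopTime B 20 ≤ 15 * ((B + 1) * 20) := loopTime_le (by omega)
    omega
  have e4 : loopTime (2 * N + 4) (loopTime B 20 + 10) ≤ 15 * (5 * c * (310 * (9 * (n * c * s)))) :=
    (loopTime_le (by omega)).trans (by gcongr; omega)
  have g1 : 15 * (2 * c * (320 * n)) ≤ 9600 * (n * c ^ 2 * s) := by
    have : n * c ≤ n * c ^ 2 * s := by
      calc n * c ≤ n * c * (c * s) := Nat.le_mul_of_pos_right _ (Nat.mul_pos (by omega) hs)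
        _ = _ := by ring
    calc 15 * (2 * c * (320 * n)) = 9600 * (n * c) := by ring
      _ ≤ _ := Nat.mul_le_mul_left _ this
  have g2 : 15 * (5 * c * (310 * (9 * (n * c * s)))) = 209250 * (n * c ^ 2 * s) := by ring
  have g3 : 1 ≤ n * c ^ 2 * s := Nat.pos_of_ne_zero (by positivity)
  unfold prepareTime
  omega

/-- For `N ≥ 2` the number c of channels satisfies N ≤ c, which absorbs the powers of N. There are
O(c·s·n^N·2^c) keys and O(n²·c³) steps for each, that is n^(N+2)·c⁴·2^c·s in total; the remaining
factors c and s of the stated bound are slack, which also covers the preparation. -/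
theorem exists_time_bound (K : ℕ) : ∃ K', ∀ {N s : ℕ} (S : FIFOSystem (Fin N) (Fin s)), 2 ≤ N →
    1 ≤ s → prepareTime N S.numTrans S.base + (K * ((N + 1) ^ 3 * (s + 1)) +
      K * ((S.numKeys + 1) * ((S.numTrans + 1) ^ 2 * (2 * N + 4) ^ 3))) ≤
    K' * (S.size ^ (N + 2) * Fintype.card (Channel (Fin N)) ^ 5 *
            2 ^ Fintype.card (Channel (Fin N)) * s ^ 2) := by
  refine ⟨1000000 + (K * 16 + K * (19 * 64)), fun {N s} S hN hs => ?_⟩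
  have hcard := card_channel N
  have hk : S.numKeys ≤ Fintype.card (Channel (Fin N)) * (s * (S.size ^ N *
      (9 * 2 ^ Fintype.card (Channel (Fin N)) * 2))) := by
    unfold FIFOSystem.numKeys
    have h1 := prod_numStates_le S
    have h2 := pow_modes_le hN
    rw [← hcard] at h2
    gcongr
  have hsize := numStates_add_numTrans S
  have hle := le_sum_numStates S
  have hNc : N ≤ Fintype.card (Channel (Fin N)) := by
    rw [hcard]
    exact Nat.le_mul_of_pos_right _ (by omega)
  have hB : S.base ≤ S.size + 2 * N + s + 3 := by
    unfold FIFOSystem.base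
    omega
  generalize Fintype.card (Channel (Fin N)) = c at *
  generalize S.size = n at *
  have hn : 1 ≤ n := by omega
  have h1 := prepareTime_le hNc (by omega) hn hs (nT := S.numTrans) (by omega) hB
  have hnT : S.numTrans + 1 ≤ n := by omega
  generalize S.numTrans = nT at *
  generalize S.base = B at *
  generalize S.numKeys = Q at *
  have hc : 1 ≤ c := by omega
  have ht : 1 ≤ 2 ^ c := Nat.one_le_two_pow
  generalize 2 ^ c = t at *
  have hnN : 1 ≤ n ^ N := Nat.one_le_pow _ _ hn
  rw [pow_add]
  generalize n ^ N = m at *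
  have z1 : n * c ^ 2 * s ≤ m * n ^ 2 * c ^ 5 * t * s ^ 2 := by
    calc n * c ^ 2 * s = 1 * n ^ 1 * c ^ 2 * 1 * s ^ 1 := by ring
      _ ≤ m * n ^ 2 * c ^ 5 * t * s ^ 2 := by gcongr <;> omega
  have z2 : (N + 1) ^ 3 * (s + 1) ≤ 16 * (m * n ^ 2 * c ^ 5 * t * s ^ 2) := by
    calc (N + 1) ^ 3 * (s + 1) ≤ (2 * c) ^ 3 * (2 * s) := by gcongr <;> omega
      _ = 16 * (1 * 1 ^ 2 * c ^ 3 * 1 * s ^ 1) := by ring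
      _ ≤ 16 * (m * n ^ 2 * c ^ 5 * t * s ^ 2) := by gcongr <;> omega
  have hQ : Q + 1 ≤ 19 * (c * s * m * t) := by
    have h3 : 1 ≤ c * s * m * t := Nat.pos_of_ne_zero (by positivity)
    have h4 : c * (s * (m * (9 * t * 2))) = 18 * (c * s * m * t) := by ring
    omega
  have z3 : (Q + 1) * ((nT + 1) ^ 2 * (2 * N + 4) ^ 3) ≤
      (19 * 64) * (m * n ^ 2 * c ^ 5 * t * s ^ 2) := by
    calc (Q + 1) * ((nT + 1) ^ 2 * (2 * N + 4) ^ 3)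
        ≤ (19 * (c * s * m * t)) * (n ^ 2 * (4 * c) ^ 3) := by gcongr; omega
      _ = (19 * 64) * (m * n ^ 2 * c ^ 4 * t * s ^ 1) := by ring
      _ ≤ (19 * 64) * (m * n ^ 2 * c ^ 5 * t * s ^ 2) := by gcongr <;> omega
  have z4 := Nat.mul_le_mul_left K z2
  have z5 := Nat.mul_le_mul_left K z3
  have z6 : (1000000 + (K * 16 + K * (19 * 64))) * (m * n ^ 2 * c ^ 5 * t * s ^ 2) =
      1000000 * (m * n ^ 2 * c ^ 5 * t * s ^ 2) + (K * (16 * (m * n ^ 2 * c ^ 5 * t * s ^ 2)) +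
        K * (19 * 64 * (m * n ^ 2 * c ^ 5 * t * s ^ 2))) := by ring
  rw [z6]
  exact Nat.add_le_add (h1.trans (Nat.mul_le_mul_left _ z1)) (Nat.add_le_add z4 z5)

end RunningTime

theorem theorem1 (F : Set Failure) (hF : F.Nonempty) :
    ∃ (c : RAM.Prog) (K : ℕ), ∀ (N s : ℕ) (S : FIFOSystem (Fin N) (Fin s)) (w : List ℕ),
      S.IsEncodedBy w →
      ∃ (t : ℕ) (σ : RAM.Memory), RAM.Runs c (RAM.start w) t σ ∧
        (IsIRSC (failureModel (Fin s) F) S → σ.reg 0 = 1) ∧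
        (¬ IsIRSC (failureModel (Fin s) F) S → σ.reg 0 = 0) ∧
        (2 ≤ N → 1 ≤ s →
          t ≤ K * (S.size ^ (N + 2) * Fintype.card (Channel (Fin N)) ^ 5 *
            2 ^ Fintype.card (Channel (Fin N)) * s ^ 2)) := by
  classical
  have hcorr : (if Failure.corruption ∈ F then 1 else 0) = 1 ↔ Failure.corruption ∈ F := by simp
  have hfifo : (if IsFifo F then 1 else 0) = 1 ↔ IsFifo F := by simp
  obtain ⟨K, hK⟩ := exists_decide_time hF hcorr hfifo
  obtain ⟨K', hK'⟩ := exists_time_bound K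
  -- The two facts about `F` that the program needs are built into it as constants; it depends on
  -- nothing else.
  refine ⟨RAM.decideIRSC (if Failure.corruption ∈ F then 1 else 0) (if IsFifo F then 1 else 0), K', fun N s S w hw => ?_⟩
  obtain ⟨t, σ, h1, h2, h3, h4⟩ := hK hw
  exact ⟨t, σ, h1, h3, h4, fun hN hs => h2.trans (hK' S hN hs)⟩
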